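/- Let $Y$ be a closed connected oriented smooth $3$-manifold, $\xi_0$ a (positive, oriented) contact structure on $Y$, and let $\mathcal C(Y,\xi_0)$ be the space, with the $C^\infty$ topology, of contact structures on $Y$ isotopic to $\xi_0$. Let $p\in Y$, fix a positive framing $T_pY\cong\mathbb R^3$, and use it to identify the Grassmannian of oriented planes in $T_pY$ with the unit sphere $S^2\subset\mathbb R^3$ (a plane corresponds to its positive unit normal vector). Let $\mathrm{ev}_p:\mathcal C(Y,\xi_0)\to S^2$, $\xi\mapsto\xi(p)$, be the evaluation map, and let $[S^2]^*\in H^2(S^2;\mathbb Z)$ be the unique class with $\langle [S^2]^*,[S^2]\rangle=1$, where $S^2$ is oriented as the boundary of the unit ball. Let $\boldsymbol\xi_p\to\mathcal C(Y,\xi_0)$ be the oriented plane bundle with fibre $\xi(p)\subset T_pY$ over $\xi$, i.e. the tautological contact-plane bundle restricted over $p$. A positive framing of $T_pY$ exhibits $\boldsymbol\xi_p$ as the pull-back of the tautological plane bundle over the Grassmannian of oriented planes in $\mathbb R^3$, which, regarded as a complex line bundle, has a square root, unique up to isomorphism. Let $\overline\mu(1)\in H^2(\mathcal C(Y,\xi_0);\mathbb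 Z)$ be the Euler class of the pulled-back square root of $\boldsymbol\xi_p$; it is the canonical half of the Euler class, i.e. $2\overline\mu(1)=e(\boldsymbol\xi_p)$. This class is well defined, and $$\overline\mu(1)=(\mathrm{ev}_p)^*[S^2]^* .$$ Hence the $U$-action is the geometric one: let $R$ be a commutative ring, $n\ge 0$, $T\in H_{n+2}(\mathcal C(Y,\xi_0);R)$ and $q\in S^2$, and let $\iota:F=\mathrm{ev}_p^{-1}(q)\to\mathcal C(Y,\xi_0)$ be the inclusion of the fibre. Call $\beta\in H_n(F;R)$ the intersection of $T$ with $F$ if there are a positively oriented geodesic triangle $D\subset S^2$ with $q$ in its interior and a continuous map $\Theta:D\times F\to\mathcal C(Y,\xi_0)$ with $\mathrm{ev}_p\Theta(x,f)=x$ and $\Theta(q,f)=f$, such that $T$ and $\Theta_*([D,\partial D]\times\beta)$ have the same image in $H_{n+2}(\mathcal C(Y,\xi_0),\mathcal C(Y,\xi_0)\setminus F;R)$ (this is the map $U_p$ of the Wang sequence of $\mathrm{ev}_p$). Then there is exactly one such $\beta$, and $$U\cdot T:=\overline\mu(1)\cap T=\iota_*\beta .$$ -/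

import Mathlib

open scoped Manifold ContDiff Bundle

/-! ## Subquotients of modules -/

/-- The subquotient `Z / (B ∩ Z)` of a module ("cycles modulo boundaries"). -/
abbrev SubQuot {R : Type*} [Ring R] {M : Type*} [AddCommGroup M] [Module R M]
    (Z B : Submodule R M) :=
  Z ⧸ B.submoduleOf Z

namespace SubQuot

variable {R : Type*} [Ring R] {M : Type*} [AddCommGroup M] [Module R M]
  {R' : Type*} [Ring R'] {N : Type*} [AddCommGroup N] [Module R' N]

/-- The class of an element of `Z`. -/
def mk {Z : Submodule R M} (B : Submodule R M) (z : Z) : SubQuot Z B :=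
  Submodule.Quotient.mk z

theorem mk_eq_mk {Z B : Submodule R M} {z z' : Z} :
    mk B z = mk B z' ↔ (z : M) - z' ∈ B := by
  refine (Submodule.Quotient.eq _).trans ?_
  rfl

/-- The map of subquotients induced by a linear map. -/
def map {M' : Type*} [AddCommGroup M'] [Module R M'] {Z B : Submodule R M}
    {Z' B' : Submodule R M'} (f : M →ₗ[R] M') (hZ : ∀ z ∈ Z, f z ∈ Z') (hB : ∀ b ∈ B, f b ∈ B') :
    SubQuot Z B →ₗ[R] SubQuot Z' B' :=
  Submodule.mapQ _ _ (f.restrict hZ) fun z hz => hB z.1 hz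

/-- Functions of two variables on subquotients. -/
def lift₂ {Z B : Submodule R M} {W D : Submodule R' N} {A : Type*} (f : Z → W → A)
    (h₁ : ∀ (z z' : Z) (w : W), (z : M) - z' ∈ B → f z w = f z' w)
    (h₂ : ∀ (z : Z) (w w' : W), (w : N) - w' ∈ D → f z w = f z w') :
    SubQuot Z B → SubQuot W D → A := fun x y =>
  Quotient.liftOn₂' x y f fun z w z' w' hz hw =>
    (h₁ z z' w (mk_eq_mk.1 (Quotient.sound' hz))).trans
      (h₂ z' w w' (mk_eq_mk.1 (Quotient.sound' hw)))

end SubQuot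

/-! ## Singular homology and cohomology -/

/-- The standard topological `n`-simplex. -/
abbrev Simp (n : ℕ) : Type := stdSimplex ℝ (Fin (n + 1))

/-- Singular `n`-simplices of `X`. -/
abbrev SingSimplex (n : ℕ) (X : Type*) [TopologicalSpace X] := C(Simp n, X)

/-- The affine map of standard simplices given by a map of vertices. -/
noncomputable def simpMap {m n : ℕ} (f : Fin (m + 1) → Fin (n + 1)) : C(Simp m, Simp n) :=
  ⟨stdSimplex.map f, stdSimplex.continuous_map f⟩

theorem simpMap_comp {l m n : ℕ} (f : Fin (m + 1) → Fin (n + 1)) (g : Fin (l + 1) → Fin (m + 1)) :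
    (simpMap f).comp (simpMap g) = simpMap (f ∘ g) := by
  ext x : 1
  exact stdSimplex.map_comp_apply g f x

/-- The `i`-th face of a singular simplex. -/
noncomputable def face {X : Type*} [TopologicalSpace X] {n : ℕ} (i : Fin (n + 2))
    (σ : SingSimplex (n + 1) X) : SingSimplex n X :=
  σ.comp (simpMap i.succAbove)

/-- Singular `n`-chains of `X` with coefficients in `R`. -/
abbrev Chains (R : Type*) [CommRing R] (n : ℕ) (X : Type*) [TopologicalSpace X] :=
  SingSimplex n X →₀ R

/-- The alternating sum of the faces of a singular simplex. -/
noncomputable def bdrySimplex (R : Type*) [CommRing R] {n : ℕ} {X : Type*} [TopologicalSpace X]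
    (σ : SingSimplex (n + 1) X) : Chains R n X :=
  ∑ i : Fin (n + 2), (-1 : R) ^ (i : ℕ) • Finsupp.single (face i σ) (1 : R)

/-- The singular boundary operator `∂ : C_{n+1}(X; R) → C_n(X; R)`. -/
noncomputable def bdrySucc (R : Type*) [CommRing R] (X : Type*) [TopologicalSpace X] (n : ℕ) :
    Chains R (n + 1) X →ₗ[R] Chains R n X :=
  Finsupp.linearCombination R (bdrySimplex R (n := n) (X := X))

/-- The singular boundary operator `∂ : C_n(X; R) → C_{n-1}(X; R)`; it is zero for `n = 0`. -/
noncomputable def bdry (R : Type*) [CommRing R] (X : Type*) [TopologicalSpace X] :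
    (n : ℕ) → Chains R n X →ₗ[R] Chains R (n - 1) X
  | 0 => 0
  | n + 1 => bdrySucc R X n

/-- Singular cycles. -/
noncomputable def cycles (R : Type*) [CommRing R] (n : ℕ) (X : Type*) [TopologicalSpace X] :
    Submodule R (Chains R n X) :=
  LinearMap.ker (bdry R X n)

/-- Singular boundaries. -/
noncomputable def boundaries (R : Type*) [CommRing R] (n : ℕ) (X : Type*) [TopologicalSpace X] :
    Submodule R (Chains R n X) :=
  LinearMap.range (bdry R X (n + 1))

/-- Singular homology `H_n(X; R)`. -/
abbrev Homology (R : Type*) [CommRing R] (n : ℕ) (X : Type*) [TopologicalSpace X] :=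
  SubQuot (cycles R n X) (boundaries R n X)

/-- The homology class of a cycle. -/
noncomputable def homClass {R : Type*} [CommRing R] {n : ℕ} {X : Type*} [TopologicalSpace X]
    (c : cycles R n X) : Homology R n X :=
  SubQuot.mk _ c

/-- Integral singular `n`-cochains of `X`. -/
abbrev Cochains (n : ℕ) (X : Type*) [TopologicalSpace X] := SingSimplex n X → ℤ

/-- The singular coboundary operator, `(δφ)(σ) = φ(∂σ)`. -/
noncomputable def cobdry (n : ℕ) (X : Type*) [TopologicalSpace X] :
    Cochains n X →ₗ[ℤ] Cochains (n + 1) X where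
  toFun φ σ := ∑ i : Fin (n + 2), (-1 : ℤ) ^ (i : ℕ) * φ (face i σ)
  map_add' φ ψ := by ext; simp [mul_add, Finset.sum_add_distrib]
  map_smul' a φ := by ext; simp [Finset.mul_sum, mul_left_comm]

/-- Integral singular cocycles. -/
noncomputable def cocycles (n : ℕ) (X : Type*) [TopologicalSpace X] : Submodule ℤ (Cochains n X) :=
  LinearMap.ker (cobdry n X)

/-- Integral singular coboundaries. -/
noncomputable def coboundaries : (n : ℕ) → (X : Type*) → [TopologicalSpace X] →
    Submodule ℤ (Cochains n X)
  | 0, _, _ => ⊥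
  | n + 1, X, _ => LinearMap.range (cobdry n X)

/-- Integral singular cohomology `H^n(X; ℤ)`. -/
abbrev Cohomology (n : ℕ) (X : Type*) [TopologicalSpace X] :=
  SubQuot (cocycles n X) (coboundaries n X)

/-- The cohomology class of a cocycle. -/
noncomputable def cohClass {n : ℕ} {X : Type*} [TopologicalSpace X] (c : cocycles n X) :
    Cohomology n X :=
  SubQuot.mk _ c

section Functoriality

variable {X Z : Type*} [TopologicalSpace X] [TopologicalSpace Z]

/-- The map induced on chains by a continuous map. -/
noncomputable def chainMap (R : Type*) [CommRing R] (n : ℕ) (f : C(X, Z)) :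
    Chains R n X →ₗ[R] Chains R n Z :=
  Finsupp.lmapDomain R R (fun σ : SingSimplex n X => f.comp σ)

theorem bdry_chainMap (R : Type*) [CommRing R] (n : ℕ) (f : C(X, Z)) (c : Chains R n X) :
    bdry R Z n (chainMap R n f c) = chainMap R (n - 1) f (bdry R X n c) := by
  cases n with
  | zero => simp [bdry]
  | succ n =>
    refine LinearMap.congr_fun (f := (bdry R Z (n + 1)).comp (chainMap R (n + 1) f))
      (g := (chainMap R n f).comp (bdry R X (n + 1))) ?_ c
    ext1 σ
    ext1
    simp [bdry, bdrySucc, chainMap, bdrySimplex, face, ContinuousMap.comp_assoc, Finsupp.mapDomain_single]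

/-- The map `f_* : H_n(X; R) → H_n(Z; R)` induced by a continuous map `f`. -/
noncomputable def homologyMap (R : Type*) [CommRing R] (n : ℕ) (f : C(X, Z)) :
    Homology R n X →ₗ[R] Homology R n Z :=
  SubQuot.map (chainMap R n f)
    (by
      intro c hc
      have h0 : bdry R X n c = 0 := hc
      change bdry R Z n _ = 0
      rw [bdry_chainMap, h0, map_zero])
    (by
      rintro _ ⟨d, rfl⟩
      exact ⟨chainMap R (n + 1) f d, bdry_chainMap R (n + 1) f d⟩)

/-- The map induced on cochains by a continuous map. -/
def cochainMap (n : ℕ) (f : C(X, Z)) : Cochains n Z →ₗ[ℤ] Cochains n X where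
  toFun φ σ := φ (f.comp σ)
  map_add' _ _ := rfl
  map_smul' _ _ := rfl

theorem cobdry_cochainMap (n : ℕ) (f : C(X, Z)) (φ : Cochains n Z) :
    cobdry n X (cochainMap n f φ) = cochainMap (n + 1) f (cobdry n Z φ) := rfl

/-- The map `f^* : H^n(Z; ℤ) → H^n(X; ℤ)` induced by a continuous map `f`. -/
noncomputable def cohomologyMap (n : ℕ) (f : C(X, Z)) : Cohomology n Z →ₗ[ℤ] Cohomology n X :=
  SubQuot.map (cochainMap n f)
    (by
      intro φ hφ
      have h0 : cobdry n Z φ = 0 := hφ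
      change cobdry n X (cochainMap n f φ) = 0
      rw [cobdry_cochainMap, h0, map_zero])
    (by
      intro φ h
      cases n with
      | zero =>
        have h0 : φ = 0 := h
        subst h0
        exact Submodule.zero_mem _
      | succ n =>
        obtain ⟨ψ, rfl⟩ := h
        exact ⟨cochainMap n f ψ, cobdry_cochainMap n f ψ⟩)

end Functoriality

section Pairings

variable {X : Type*} [TopologicalSpace X]

/-- Evaluation of an integral cochain on an integral chain. -/
noncomputable def evalChain (n : ℕ) (φ : Cochains n X) : Chains ℤ n X →ₗ[ℤ] ℤ :=
  Finsupp.linearCombination ℤ φ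

theorem evalChain_sub (n : ℕ) (φ ψ : Cochains n X) (c : Chains ℤ n X) :
    evalChain n (φ - ψ) c = evalChain n φ c - evalChain n ψ c := by
  simp [evalChain, Finsupp.linearCombination_apply, mul_sub, Finsupp.sum_sub]

theorem evalChain_cobdry (n : ℕ) (φ : Cochains n X) (c : Chains ℤ (n + 1) X) :
    evalChain (n + 1) (cobdry n X φ) c = evalChain n φ (bdry ℤ X (n + 1) c) := by
  refine LinearMap.congr_fun (f := evalChain (n + 1) (cobdry n X φ))
      (g := (evalChain n φ).comp (bdry ℤ X (n + 1))) ?_ c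
  ext1 σ
  ext1
  simp [bdry, bdrySucc, evalChain, bdrySimplex, cobdry]

/-- The Kronecker pairing `H^n(X; ℤ) × H_n(X; ℤ) → ℤ`. -/
noncomputable def kronecker (n : ℕ) : Cohomology n X → Homology ℤ n X → ℤ :=
  SubQuot.lift₂ (fun z c => evalChain n z.1 c.1)
    (by
      intro z z' c h
      rw [← sub_eq_zero, ← evalChain_sub]
      cases n with
      | zero =>
        have h0 : z.1 - z'.1 = 0 := h
        simp [h0, evalChain]
      | succ n =>
        obtain ⟨ψ, hψ⟩ := h
        have hc : bdry ℤ X (n + 1) c.1 = 0 := c.2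
        rw [← hψ, evalChain_cobdry, hc, map_zero])
    (by
      rintro z c c' ⟨d, hd⟩
      have h0 : cobdry n X z.1 = 0 := z.2
      rw [← sub_eq_zero, ← map_sub, ← hd, ← evalChain_cobdry, h0]
      simp [evalChain])

/-- The front `p`-face (vertices `0, …, p`) of a singular `n`-simplex. -/
noncomputable def front {n : ℕ} (p : ℕ) (h : p ≤ n) (σ : SingSimplex n X) : SingSimplex p X :=
  σ.comp (simpMap fun k => ⟨k, by omega⟩)

/-- The back `m`-face (vertices `p, …, n`) of a singular `n`-simplex, where `n = m + p`. -/
noncomputable def back {n : ℕ} (p m : ℕ) (h : n = m + p) (σ : SingSimplex n X) :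
    SingSimplex m X :=
  σ.comp (simpMap fun k => ⟨k + p, by omega⟩)

/-- The cap product of an integral `p`-cochain with a chain:
`φ ∩ σ = φ(front face of σ) · (back face of σ)`. -/
noncomputable def capChain (R : Type*) [CommRing R] {n : ℕ} (p m : ℕ) (h : n = m + p)
    (φ : Cochains p X) : Chains R n X →ₗ[R] Chains R m X :=
  Finsupp.linearCombination R fun σ : SingSimplex n X =>
    Finsupp.single (back p m h σ) ((φ (front p (by omega) σ) : ℤ) : R)

theorem capChain_sub (R : Type*) [CommRing R] {n : ℕ} (p m : ℕ) (h : n = m + p)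
    (φ ψ : Cochains p X) (c : Chains R n X) :
    capChain R p m h (φ - ψ) c = capChain R p m h φ c - capChain R p m h ψ c := by
  simp [capChain, Finsupp.linearCombination_apply, Finsupp.single_sub, smul_sub, Finsupp.sum_sub]

theorem comp_simpMap_comp {l m n : ℕ} (σ : SingSimplex n X) (f : Fin (m + 1) → Fin (n + 1))
    (g : Fin (l + 1) → Fin (m + 1)) :
    (σ.comp (simpMap f)).comp (simpMap g) = σ.comp (simpMap (f ∘ g)) := by
  rw [ContinuousMap.comp_assoc, simpMap_comp]

theorem comp_simpMap_congr {m n : ℕ} (σ : SingSimplex n X) {f g : Fin (m + 1) → Fin (n + 1)}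
    (h : ∀ k, (f k : ℕ) = g k) : σ.comp (simpMap f) = σ.comp (simpMap g) := by
  rw [funext fun k => Fin.ext (h k)]

theorem val_succAbove {n : ℕ} (i : Fin (n + 1)) (k : Fin n) :
    (i.succAbove k : ℕ) = if (k : ℕ) < i then (k : ℕ) else k + 1 := by
  unfold Fin.succAbove
  simp only [Fin.lt_def, Fin.val_castSucc]
  split_ifs <;> simp

theorem front_face_low {n p : ℕ} (h : p + 1 ≤ n + 1) (σ : SingSimplex (n + 1) X)
    (i : Fin (n + 2)) (j : Fin (p + 2)) (hij : (i : ℕ) = j) :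
    front p (Nat.le_of_succ_le_succ h) (face i σ) = face j (front (p + 1) h σ) := by
  unfold front face
  rw [comp_simpMap_comp, comp_simpMap_comp]
  exact comp_simpMap_congr σ fun k => by simp [val_succAbove, hij]

theorem back_face_low {n p m : ℕ} (h : n = m + p) (σ : SingSimplex (n + 1) X)
    (i : Fin (n + 2)) (hi : (i : ℕ) ≤ p) :
    back p m h (face i σ) = back (p + 1) m (by omega) σ := by
  unfold back face
  rw [comp_simpMap_comp]
  refine comp_simpMap_congr σ fun k => ?_
  simp only [Function.comp, val_succAbove]
  split_ifs <;> omega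

theorem front_face_high {n p : ℕ} (h : p ≤ n) (σ : SingSimplex (n + 1) X)
    (i : Fin (n + 2)) (hi : p < (i : ℕ)) :
    front p h (face i σ) = front p (by omega) σ := by
  unfold front face
  rw [comp_simpMap_comp]
  refine comp_simpMap_congr σ fun k => ?_
  simp only [Function.comp, val_succAbove]
  split_ifs <;> omega

theorem back_face_high {n p m : ℕ} (h : n = m + p) (σ : SingSimplex (n + 1) X)
    (i : Fin (n + 2)) (j : Fin (m + 2)) (hij : (i : ℕ) = j + p) :
    back p m h (face i σ) = face j (back p (m + 1) (by omega) σ) := by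
  unfold back face
  rw [comp_simpMap_comp, comp_simpMap_comp]
  refine comp_simpMap_congr σ fun k => ?_
  simp only [Function.comp, val_succAbove]
  split_ifs <;> omega

theorem face_last_front {n p : ℕ} (h : p + 1 ≤ n) (σ : SingSimplex n X) :
    face (Fin.last (p + 1)) (front (p + 1) h σ) = front p (by omega) σ := by
  unfold front face
  rw [comp_simpMap_comp]
  refine comp_simpMap_congr σ fun k => ?_
  simp only [Function.comp, val_succAbove, Fin.val_last]
  split_ifs <;> omega

theorem face_zero_back {n p m : ℕ} (h : n = m + 1 + p) (σ : SingSimplex n X) :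
    face 0 (back p (m + 1) h σ) = back (p + 1) m (by omega) σ := by
  unfold back face
  rw [comp_simpMap_comp]
  refine comp_simpMap_congr σ fun k => ?_
  simp only [Function.comp, val_succAbove, Fin.val_zero, Nat.not_lt_zero, if_false]
  omega

theorem capChain_bdry_one (R : Type*) [CommRing R] (m : ℕ) (φ : Cochains 1 X)
    (c : Chains R (m + 2) X) :
    capChain R 1 m rfl φ (bdrySucc R X (m + 1) c) =
      capChain R 2 m rfl (cobdry 1 X φ) c -
        bdrySucc R X m (capChain R 1 (m + 1) rfl φ c) := by
  refine LinearMap.congr_fun (f := (capChain R 1 m rfl φ).comp (bdrySucc R X (m + 1)))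
      (g := capChain R 2 m rfl (cobdry 1 X φ) -
        (bdrySucc R X m).comp (capChain R 1 (m + 1) rfl φ)) ?_ c
  ext1 σ
  ext1
  have e0 : front 1 (by omega) (face 0 σ) = face 0 (front 2 (by omega) σ) :=
    front_face_low (p := 1) (by omega) σ 0 0 rfl
  have e1 : front 1 (by omega) (face 1 σ) = face 1 (front 2 (by omega) σ) :=
    front_face_low (p := 1) (by omega) σ 1 1 rfl
  have eh := fun j : Fin (m + 1) => front_face_high (p := 1) (by omega) σ j.succ.succ (by simp)
  have bh := fun j : Fin (m + 1) => back_face_high (p := 1) (m := m) rfl σ j.succ.succ j.succ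
    (by simp)
  have el : face 2 (front 2 (by omega) σ) = front 1 (by omega) σ :=
    face_last_front (p := 1) (by omega) σ
  have bz : face 0 (back 1 (m + 1) rfl σ) = back 2 m rfl σ :=
    face_zero_back (p := 1) (m := m) rfl σ
  have b0 : back 1 m rfl (face 0 σ) = back 2 m rfl σ :=
    back_face_low (p := 1) (m := m) rfl σ 0 (by simp)
  have b1 : back 1 m rfl (face 1 σ) = back 2 m rfl σ :=
    back_face_low (p := 1) (m := m) rfl σ 1 (by simp)
  simp only [capChain, bdrySucc, bdrySimplex, cobdry, LinearMap.comp_apply, LinearMap.sub_apply,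
    Finsupp.lsingle_apply, Finsupp.linearCombination_single, map_sum, map_smul, one_smul,
    LinearMap.coe_mk, AddHom.coe_mk]
  rw [Fin.sum_univ_succ, Fin.sum_univ_succ, Fin.sum_univ_three, Finset.smul_sum]
  conv_rhs => rw [Fin.sum_univ_succ]
  simp only [Fin.succ_zero_eq_one, eh, bh, e0, e1, b0, b1, bz, el, Finsupp.smul_single,
    smul_eq_mul, Fin.val_succ, Fin.val_zero, Fin.val_one, Fin.val_two, pow_succ, pow_zero, one_mul,
    mul_one, neg_mul, mul_neg, neg_neg, Int.cast_add, Int.cast_neg, Finsupp.single_add,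
    Finsupp.single_neg, Finset.sum_neg_distrib, smul_neg]
  simp only [mul_comm]
  abel

theorem capChain_bdry_two (R : Type*) [CommRing R] (m : ℕ) (φ : Cochains 2 X)
    (c : Chains R (m + 3) X) :
    capChain R 2 m rfl φ (bdrySucc R X (m + 2) c) =
      capChain R 3 m rfl (cobdry 2 X φ) c +
        bdrySucc R X m (capChain R 2 (m + 1) rfl φ c) := by
  refine LinearMap.congr_fun (f := (capChain R 2 m rfl φ).comp (bdrySucc R X (m + 2)))
      (g := capChain R 3 m rfl (cobdry 2 X φ) +
        (bdrySucc R X m).comp (capChain R 2 (m + 1) rfl φ)) ?_ c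
  ext1 σ
  ext1
  have e0 : front 2 (by omega) (face 0 σ) = face 0 (front 3 (by omega) σ) :=
    front_face_low (p := 2) (by omega) σ 0 0 rfl
  have e1 : front 2 (by omega) (face 1 σ) = face 1 (front 3 (by omega) σ) :=
    front_face_low (p := 2) (by omega) σ 1 1 rfl
  have e2 : front 2 (by omega) (face (Fin.succ 1) σ) = face 2 (front 3 (by omega) σ) :=
    front_face_low (p := 2) (by omega) σ (Fin.succ 1) 2 (by simp)
  have eh := fun j : Fin (m + 1) =>
    front_face_high (p := 2) (by omega) σ j.succ.succ.succ (by simp)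
  have bh := fun j : Fin (m + 1) =>
    back_face_high (p := 2) (m := m) rfl σ j.succ.succ.succ j.succ (by simp)
  have el : face 3 (front 3 (by omega) σ) = front 2 (by omega) σ :=
    face_last_front (p := 2) (by omega) σ
  have bz : face 0 (back 2 (m + 1) rfl σ) = back 3 m rfl σ :=
    face_zero_back (p := 2) (m := m) rfl σ
  have b0 : back 2 m rfl (face 0 σ) = back 3 m rfl σ :=
    back_face_low (p := 2) (m := m) rfl σ 0 (by simp)
  have b1 : back 2 m rfl (face 1 σ) = back 3 m rfl σ :=
    back_face_low (p := 2) (m := m) rfl σ 1 (by simp)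
  have b2 : back 2 m rfl (face (Fin.succ 1) σ) = back 3 m rfl σ :=
    back_face_low (p := 2) (m := m) rfl σ (Fin.succ 1) (by rw [Fin.val_succ, Fin.val_one])
  simp only [capChain, bdrySucc, bdrySimplex, cobdry, LinearMap.comp_apply, LinearMap.add_apply,
    Finsupp.lsingle_apply, Finsupp.linearCombination_single, map_sum, map_smul, one_smul,
    LinearMap.coe_mk, AddHom.coe_mk]
  rw [Fin.sum_univ_succ, Fin.sum_univ_succ, Fin.sum_univ_succ, Fin.sum_univ_four, Finset.smul_sum]
  conv_rhs => rw [Fin.sum_univ_succ]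
  simp only [Fin.succ_zero_eq_one, eh, bh, e0, e1, e2, b0, b1, b2, bz, el, Finsupp.smul_single,
    smul_eq_mul, Fin.val_succ, Fin.val_zero, Fin.val_one, Fin.val_two, pow_succ, pow_zero, one_mul,
    mul_one, neg_mul, mul_neg, neg_neg, Int.cast_add, Int.cast_neg, Finsupp.single_add,
    Finsupp.single_neg, Finset.sum_neg_distrib, smul_neg]
  have e3 : ((3 : Fin 4) : ℕ) = 3 := rfl
  simp only [e3, pow_succ, pow_zero, one_mul, mul_one, neg_mul, mul_neg, neg_neg,
    Int.cast_neg, Finsupp.single_neg]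
  simp only [mul_comm]
  abel

theorem capChain_mem_cycles (R : Type*) [CommRing R] (m : ℕ) (z : cocycles 2 X)
    (c : cycles R (m + 2) X) : capChain R 2 m rfl z.1 c.1 ∈ cycles R m X := by
  cases m with
  | zero => exact LinearMap.zero_apply _
  | succ m =>
    have hz : cobdry 2 X z.1 = 0 := z.2
    have hc : bdrySucc R X (m + 2) c.1 = 0 := c.2
    have h := capChain_bdry_two R m z.1 c.1
    have h0 : capChain R 3 m rfl (0 : Cochains 3 X) c.1 = 0 := by
      simp [capChain, Finsupp.linearCombination_apply]
    rw [hz, hc, map_zero, h0, zero_add] at h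
    exact h.symm

/-- The cap product `H^2(X; ℤ) × H_{m+2}(X; R) → H_m(X; R)`. -/
noncomputable def cap (R : Type*) [CommRing R] (m : ℕ) :
    Cohomology 2 X → Homology R (m + 2) X → Homology R m X :=
  SubQuot.lift₂
    (fun z c => homClass ⟨capChain R 2 m rfl z.1 c.1, capChain_mem_cycles R m z c⟩)
    (by
      rintro z z' c ⟨ψ, hψ⟩
      refine SubQuot.mk_eq_mk.2 ⟨capChain R 1 (m + 1) rfl ψ c.1, ?_⟩
      have hc : bdrySucc R X (m + 1) c.1 = 0 := c.2
      have h := capChain_bdry_one R m ψ c.1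
      rw [hc, map_zero, hψ, capChain_sub] at h
      exact (sub_eq_zero.1 h.symm).symm)
    (by
      rintro z c c' ⟨d, hd⟩
      refine SubQuot.mk_eq_mk.2 ⟨capChain R 2 (m + 1) rfl z.1 d, ?_⟩
      have hz : cobdry 2 X z.1 = 0 := z.2
      have h := capChain_bdry_two R m z.1 d
      have h0 : capChain R 3 m rfl (0 : Cochains 3 X) d = 0 := by
        simp [capChain, Finsupp.linearCombination_apply]
      have hd' : bdrySucc R X (m + 2) d = c.1 - c'.1 := hd
      rw [hz, h0, zero_add, hd', map_sub] at h
      exact h.symm)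

end Pairings

/-! ## The oriented 2-sphere -/

/-- Euclidean 3-space. -/
abbrev E3 : Type := EuclideanSpace ℝ (Fin 3)

/-- The unit sphere of Euclidean 3-space. -/
abbrev S2 : Type := Metric.sphere (0 : E3) 1

/-- The cross product of Euclidean 3-space. -/
noncomputable def cross (u v : E3) : E3 :=
  WithLp.toLp 2 ![u 1 * v 2 - u 2 * v 1, u 2 * v 0 - u 0 * v 2, u 0 * v 1 - u 1 * v 0]

/-- The triple product (determinant) of three vectors of Euclidean 3-space. -/
noncomputable def triple (u v w : E3) : ℝ := inner ℝ u (cross v w)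

/-- The unit vector in the direction of a nonzero vector. -/
noncomputable def unitVector (x : E3) (hx : x ≠ 0) : S2 :=
  ⟨‖x‖⁻¹ • x, by
    rw [mem_sphere_zero_iff_norm, norm_smul, norm_inv, norm_norm,
      inv_mul_cancel₀ (norm_ne_zero_iff.2 hx)]⟩

theorem continuous_unitVector {T : Type*} [TopologicalSpace T] {f : T → E3} (hf : Continuous f)
    (h0 : ∀ t, f t ≠ 0) : Continuous fun t => unitVector (f t) (h0 t) := by
  refine Continuous.subtype_mk ?_ _
  exact (hf.norm.inv₀ fun t => norm_ne_zero_iff.2 (h0 t)).smul hf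

/-- The affine simplex in Euclidean space with vertices `v` misses the origin. -/
def AvoidsZero {n : ℕ} (v : Fin (n + 1) → E3) : Prop :=
  ∀ t : Simp n, ∑ i, t i • v i ≠ 0

/-- The singular simplex of the sphere obtained by radially projecting the affine simplex with
vertices `v`. -/
noncomputable def sphSimplex {n : ℕ} (v : Fin (n + 1) → E3) (hv : AvoidsZero v) :
    SingSimplex n S2 :=
  ⟨fun t => unitVector (∑ i, t i • v i) (hv t), continuous_unitVector
    (continuous_finsetSum _ fun i _ =>
      (((continuous_apply i).comp continuous_subtype_val).smul continuous_const)) hv⟩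

theorem sum_simpMap {m n : ℕ} (v : Fin (n + 1) → E3) (f : Fin (m + 1) → Fin (n + 1)) (t : Simp m) :
    ∑ i, (simpMap f t) i • v i = ∑ j, t j • v (f j) := by
  have h : ∀ i, (simpMap f t) i = ∑ j with f j = i, t j := fun i => by
    change stdSimplex.map f t i = _
    rw [stdSimplex.map_coe]
    simp [FunOnFinite.linearMap_apply_apply]
  simp only [h, Finset.sum_smul]
  rw [← Finset.sum_fiberwise (s := Finset.univ) (g := f)]
  refine Finset.sum_congr rfl fun i _ => Finset.sum_congr rfl fun j hj => ?_
  rw [(Finset.mem_filter.1 hj).2]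

theorem AvoidsZero.comp {m n : ℕ} {v : Fin (n + 1) → E3} (hv : AvoidsZero v)
    (f : Fin (m + 1) → Fin (n + 1)) : AvoidsZero (v ∘ f) := fun t => by
  have h := hv (simpMap f t)
  rwa [sum_simpMap] at h

theorem face_sphSimplex {n : ℕ} {v : Fin (n + 2) → E3} (hv : AvoidsZero v) (i : Fin (n + 2)) :
    face i (sphSimplex v hv) = sphSimplex (v ∘ i.succAbove) (hv.comp _) := by
  ext t : 2
  simp [face, sphSimplex, unitVector, sum_simpMap]

/-- The vertices `-(e₁ + e₂ + e₃), e₁, e₂, e₃` of a positively oriented tetrahedron around the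
origin. -/
noncomputable def tetra : Fin 4 → E3 :=
  ![WithLp.toLp 2 ![-1, -1, -1], WithLp.toLp 2 ![1, 0, 0], WithLp.toLp 2 ![0, 1, 0],
    WithLp.toLp 2 ![0, 0, 1]]

theorem tetra_face_avoidsZero (i : Fin 4) : AvoidsZero (tetra ∘ i.succAbove) := by
  intro t h
  have h0 := congrArg (fun x : E3 => x 0) h
  have h1 := congrArg (fun x : E3 => x 1) h
  have h2 := congrArg (fun x : E3 => x 2) h
  have hs := stdSimplex.sum_eq_one t
  rw [Fin.sum_univ_three] at hs
  fin_cases i <;>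
  · simp [Fin.sum_univ_three, tetra, Fin.succAbove, Fin.lt_def] at h0 h1 h2
    linarith

/-- The boundary of the tetrahedron, projected radially to the sphere. -/
noncomputable def sphereChain : Chains ℤ 2 S2 :=
  ∑ i : Fin 4, (-1 : ℤ) ^ (i : ℕ) •
    Finsupp.single (sphSimplex (tetra ∘ i.succAbove) (tetra_face_avoidsZero i)) (1 : ℤ)

theorem sphereChain_mem_cycles : sphereChain ∈ cycles ℤ 2 S2 := by
  classical
  change bdrySucc ℤ S2 1 sphereChain = 0
  let G : (Fin 2 → Fin 4) → Chains ℤ 1 S2 := fun f =>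
    if h : AvoidsZero (n := 1) (tetra ∘ f) then
      Finsupp.single (sphSimplex (n := 1) (tetra ∘ f) h) (1 : ℤ) else 0
  have hG : ∀ (i : Fin 4) (j : Fin 3),
      Finsupp.single (face j (sphSimplex (tetra ∘ i.succAbove) (tetra_face_avoidsZero i))) (1 : ℤ) =
        G (i.succAbove ∘ j.succAbove) := by
    intro i j
    have hij : AvoidsZero (n := 1) (tetra ∘ (i.succAbove ∘ j.succAbove)) :=
      (tetra_face_avoidsZero i).comp (m := 1) j.succAbove
    simp only [G, dif_pos hij, face_sphSimplex]
    rfl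
  have h00 : ((0 : Fin 4).succAbove ∘ (0 : Fin 3).succAbove) = ![2, 3] := by
    decide
  have h01 : ((0 : Fin 4).succAbove ∘ (1 : Fin 3).succAbove) = ![1, 3] := by
    decide
  have h02 : ((0 : Fin 4).succAbove ∘ (2 : Fin 3).succAbove) = ![1, 2] := by
    decide
  have h10 : ((1 : Fin 4).succAbove ∘ (0 : Fin 3).succAbove) = ![2, 3] := by
    decide
  have h11 : ((1 : Fin 4).succAbove ∘ (1 : Fin 3).succAbove) = ![0, 3] := by
    decide
  have h12 : ((1 : Fin 4).succAbove ∘ (2 : Fin 3).succAbove) = ![0, 2] := by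
    decide
  have h20 : ((2 : Fin 4).succAbove ∘ (0 : Fin 3).succAbove) = ![1, 3] := by
    decide
  have h21 : ((2 : Fin 4).succAbove ∘ (1 : Fin 3).succAbove) = ![0, 3] := by
    decide
  have h22 : ((2 : Fin 4).succAbove ∘ (2 : Fin 3).succAbove) = ![0, 1] := by
    decide
  have h30 : ((3 : Fin 4).succAbove ∘ (0 : Fin 3).succAbove) = ![1, 2] := by
    decide
  have h31 : ((3 : Fin 4).succAbove ∘ (1 : Fin 3).succAbove) = ![0, 2] := by
    decide
  have h32 : ((3 : Fin 4).succAbove ∘ (2 : Fin 3).succAbove) = ![0, 1] := by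
    decide
  have hb : ∀ i : Fin 4,
      bdrySimplex ℤ (sphSimplex (tetra ∘ i.succAbove) (tetra_face_avoidsZero i)) =
        G (i.succAbove ∘ (0 : Fin 3).succAbove) - G (i.succAbove ∘ (1 : Fin 3).succAbove) +
          G (i.succAbove ∘ (2 : Fin 3).succAbove) := by
    intro i
    refine (Fin.sum_univ_three _).trans ?_
    rw [hG, hG, hG]
    simp [sub_eq_add_neg]
  rw [sphereChain, map_sum, Fin.sum_univ_four]
  simp only [bdrySucc, map_smul, Finsupp.linearCombination_single, hb]
  simp only [h00, h01, h02, h10, h11, h12, h20, h21, h22, h30, h31, h32]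
  have e3 : ((3 : Fin 4) : ℕ) = 3 := rfl
  simp only [Fin.val_zero, Fin.val_one, Fin.val_two, e3, pow_succ, pow_zero, one_smul,
    mul_neg, mul_one, neg_neg, neg_smul]
  abel

/-- The fundamental class `[S²] ∈ H_2(S²; ℤ)` of the sphere, oriented as the boundary of the
unit ball. -/
noncomputable def sphereClass : Homology ℤ 2 S2 := homClass ⟨sphereChain, sphereChain_mem_cycles⟩

/-! ## The Euler class of an oriented plane bundle -/

/-- `e ∈ H^2(X; ℤ)` is the Euler class of the oriented real plane bundle `E` over `X`, described as
the primary obstruction to a nowhere vanishing section. Here `Pos x v w` says that `(v, w)` is a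
positively oriented basis of the fibre `E x`. One chooses nowhere vanishing sections `s₀` over all
singular `0`-simplices (points) and `s₁` over all singular `1`-simplices, extending `s₀` over the
endpoints. The obstruction cocycle `c` assigns to a singular `2`-simplex `σ` the winding number
around `∂Δ²` of `s₁`, measured in a positively oriented frame `(f₁, f₂)` of `σ^*E`: with
`s₁ = Re(exp θᵢ) f₁ + Im(exp θᵢ) f₂` on the `i`-th face, this is the total change of `θ / 2πi` around
`∂Δ²`. -/
def IsEulerClass {X : Type*} [TopologicalSpace X] (F : Type*) (E : X → Type*)
    [∀ x, AddCommGroup (E x)] [∀ x, Module ℝ (E x)] [TopologicalSpace (Bundle.TotalSpace F E)]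
    (Pos : ∀ x, E x → E x → Prop) (e : Cohomology 2 X) : Prop :=
  ∃ (c : cocycles 2 X) (s₀ : ∀ x, E x) (s₁ : ∀ (γ : SingSimplex 1 X) (r : Simp 1), E (γ r)),
    cohClass c = e ∧
    (∀ x, s₀ x ≠ 0) ∧
    (∀ γ r, s₁ γ r ≠ 0) ∧
    (∀ γ, Continuous fun r => Bundle.TotalSpace.mk' F (γ r) (s₁ γ r)) ∧
    (∀ γ i, s₁ γ (stdSimplex.vertex i) = s₀ (γ (stdSimplex.vertex i))) ∧
    ∀ σ : SingSimplex 2 X, ∃ (f₁ f₂ : ∀ t : Simp 2, E (σ t)) (θ : Fin 3 → C(Simp 1, ℂ)),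
      (Continuous fun t => Bundle.TotalSpace.mk' F (σ t) (f₁ t)) ∧
      (Continuous fun t => Bundle.TotalSpace.mk' F (σ t) (f₂ t)) ∧
      (∀ t, Pos (σ t) (f₁ t) (f₂ t)) ∧
      (∀ (i : Fin 3) (r : Simp 1), s₁ (face i σ) r =
        (Complex.exp (θ i r)).re • f₁ (simpMap i.succAbove r) +
          (Complex.exp (θ i r)).im • f₂ (simpMap i.succAbove r)) ∧
      2 * Real.pi * Complex.I * (c.1 σ : ℂ) =
        ∑ i : Fin 3, (-1 : ℂ) ^ (i : ℕ) *
          (θ i (stdSimplex.vertex 1) - θ i (stdSimplex.vertex 0))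

/-- The complex orientation of a complex line: `(v, w)` is positive if `w = z v` with `v ≠ 0` and
`Im z > 0`. -/
def complexPos {L : Type*} [AddCommGroup L] [Module ℂ L] (v w : L) : Prop :=
  v ≠ 0 ∧ ∃ z : ℂ, 0 < z.im ∧ w = z • v

/-! ## The tautological plane bundle over the oriented Grassmannian

The Grassmannian of oriented planes in `ℝ³` is identified with `S²`: the unit vector `q` corresponds
to the plane `q^⊥`, oriented so that `(q, v, w)` is a positive basis of `ℝ³` for every positive basis
`(v, w)` of `q^⊥`. With the rotation `v ↦ q × v` as multiplication by `i`, the tautological plane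
bundle with fibre `q^⊥` over `q` is a complex line bundle. -/

/-- A square root of the tautological plane bundle: a complex line bundle `N` over the Grassmannian
with an isomorphism of complex line bundles from `N ⊗ N` to the tautological plane bundle. The
isomorphism is given by the quadratic map `sq v`, the image of `v ⊗ v`. -/
structure TautSquareRoot where
  /-- The fibres of `N`. -/
  N : S2 → Type
  [addCommGroup : ∀ q, AddCommGroup (N q)]
  [module : ∀ q, Module ℂ (N q)]
  [topFibre : ∀ q, TopologicalSpace (N q)]
  [topTotal : TopologicalSpace (Bundle.TotalSpace ℂ N)]
  [fiberBundle : FiberBundle ℂ N]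
  [vectorBundle : VectorBundle ℂ ℂ N]
  /-- The map `v ↦ v ⊗ v` into the tautological plane bundle. -/
  sq : ∀ q, N q → E3
  sq_mem : ∀ (q : S2) v, inner ℝ (q : E3) (sq q v) = 0
  sq_smul : ∀ (q : S2) (z : ℂ) v, sq q (z • v) = (z ^ 2).re • sq q v + (z ^ 2).im • cross q (sq q v)
  sq_ne_zero : ∀ q v, v ≠ 0 → sq q v ≠ 0
  continuous_sq : Continuous fun x : Bundle.TotalSpace ℂ N => sq x.proj x.snd

attribute [instance] TautSquareRoot.addCommGroup TautSquareRoot.module TautSquareRoot.topFibre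
  TautSquareRoot.topTotal TautSquareRoot.fiberBundle TautSquareRoot.vectorBundle

/-- `e` is the Euler class of the complex line bundle `g^*N`. -/
def IsEulerClassPullback {X : Type*} [TopologicalSpace X] (g : C(X, S2)) (A : TautSquareRoot)
    (e : Cohomology 2 X) : Prop :=
  @IsEulerClass X _ ℂ (g *ᵖ A.N) (fun x => A.addCommGroup (g x))
    (fun x => inferInstanceAs (Module ℝ (A.N (g x)))) _ (fun x => complexPos (L := A.N (g x))) e

/-! ## Intersection with a fibre -/

section FibreIntersection

variable {X : Type*} [TopologicalSpace X]

/-- First coordinates of the vertices of the `(n + 2)`-simplex of `Δ² × Δⁿ` labelled by `i ≤ j`,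
whose vertices are `(0,0), …, (0,i), (1,i), …, (1,j), (2,j), …, (2,n)`. -/
def prodVertex₁ {n : ℕ} (i j : Fin (n + 1)) (k : Fin (n + 2 + 1)) : Fin 3 :=
  if (k : ℕ) ≤ i then 0 else if (k : ℕ) ≤ j + 1 then 1 else 2

/-- Second coordinates of the vertices of the `(n + 2)`-simplex of `Δ² × Δⁿ` labelled by
`i ≤ j`. -/
def prodVertex₂ {n : ℕ} (i j : Fin (n + 1)) (k : Fin (n + 2 + 1)) : Fin (n + 1) :=
  if _ : (k : ℕ) ≤ i then ⟨k, by omega⟩ else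
    if _ : (k : ℕ) ≤ j + 1 then ⟨k - 1, by omega⟩ else ⟨k - 2, by omega⟩

/-- The image of the product chain `Δ² × b` (the Eilenberg–Zilber shuffle product of the identity
of `Δ²` with the chain `b`) under a continuous map `Θ : Δ² × F → X`. -/
noncomputable def triangleTimes (R : Type*) [CommRing R] (n : ℕ) {F : Type*} [TopologicalSpace F]
    (Θ : C(Simp 2 × F, X)) : Chains R n F →ₗ[R] Chains R (n + 2) X :=
  Finsupp.linearCombination R fun τ : SingSimplex n F =>
    ∑ i : Fin (n + 1), ∑ j : Fin (n + 1) with i ≤ j, (-1 : R) ^ (i + j : ℕ) •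
      Finsupp.single (Θ.comp
        ((simpMap (prodVertex₁ i j)).prodMk (τ.comp (simpMap (prodVertex₂ i j))))) (1 : R)

/-- Chains of `X` that lie in the subset `A`. -/
noncomputable def chainsIn (R : Type*) [CommRing R] (n : ℕ) (A : Set X) :
    Submodule R (Chains R n X) :=
  Finsupp.supported R R {σ : SingSimplex n X | Set.range σ ⊆ A}

/-- The fibre of `g` over `q`. -/
abbrev Fibre (g : C(X, S2)) (q : S2) := {x : X // g x = q}

/-- The inclusion of a fibre. -/
def fibreIncl (g : C(X, S2)) (q : S2) : C(Fibre g q, X) := ⟨Subtype.val, continuous_subtype_val⟩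

/-- `β ∈ H_n(F; R)` is the intersection of `T ∈ H_{n+2}(X; R)` with the fibre `F` of `g` over `q`,
i.e. the image of `T` under the map `H_{n+2}(X) → H_n(F)` of the Wang sequence. Let `D ⊂ S²` be a
positively oriented geodesic triangle containing `q = D(w)` in its interior, and `Θ : D × F → X` a
map covering the inclusion of `D` and restricting to the inclusion of `F` over `q`. The condition is
that `T` and `Θ_*([D, ∂D] × β)` agree in `H_{n+2}(X, X ∖ F; R)`. -/
def IsFibreIntersection {R : Type*} [CommRing R] {n : ℕ} (g : C(X, S2)) (q : S2)
    (T : Homology R (n + 2) X) (β : Homology R n (Fibre g q)) : Prop :=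
  ∃ (v : Fin 3 → E3) (hv : AvoidsZero v) (w : Simp 2) (Θ : C(Simp 2 × Fibre g q, X))
    (t : cycles R (n + 2) X) (b : cycles R n (Fibre g q)),
    0 < triple (v 0) (v 1) (v 2) ∧
    (∀ i, 0 < w i) ∧ sphSimplex v hv w = q ∧
    (∀ r x, g (Θ (r, x)) = sphSimplex v hv r) ∧
    (∀ x, Θ (w, x) = x.1) ∧
    homClass t = T ∧ homClass b = β ∧
    t.1 - triangleTimes R n Θ b.1 ∈
      boundaries R (n + 2) X ⊔ chainsIn R (n + 2) {x | g x ≠ q}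

end FibreIntersection

/-! ## Contact structures -/

section Contact

variable (Y : Type*) [TopologicalSpace Y] [ChartedSpace E3 Y]

/-- The preferred charts of the smooth 3-manifold `Y` form an oriented atlas. Then `Y` is oriented by
its atlas, and the orientation of the tangent space at `y`, identified with `ℝ³` through the
preferred chart at `y`, is the standard one. -/
def IsOrientedAtlas [IsManifold (𝓡 3) ∞ Y] : Prop :=
  ∀ x y z : Y, z ∈ (chartAt E3 x).source → z ∈ (chartAt E3 y).source →
    0 < (tangentCoordChange (𝓡 3) x y z).det

variable {Y}

/-- The expression of a 1-form in the preferred chart at `x`. -/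
noncomputable def localForm (α : ∀ y : Y, TangentSpace (𝓡 3) y →L[ℝ] ℝ) (x : Y) (z : E3) :
    E3 →L[ℝ] ℝ :=
  (α ((extChartAt (𝓡 3) x).symm z)).comp
    (mfderiv 𝓘(ℝ, E3) (𝓡 3) (extChartAt (𝓡 3) x).symm z)

/-- The exterior derivative of a 1-form on `ℝ³`. -/
noncomputable def extDer (a : E3 → E3 →L[ℝ] ℝ) (z u v : E3) : ℝ :=
  fderiv ℝ a z u v - fderiv ℝ a z v u

/-- The coefficient of `a ∧ da` with respect to the standard volume form of `ℝ³`. -/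
noncomputable def wedgeDer (a : E3 → E3 →L[ℝ] ℝ) (z : E3) : ℝ :=
  let e := EuclideanSpace.basisFun (Fin 3) ℝ
  a z (e 0) * extDer a z (e 1) (e 2) + a z (e 1) * extDer a z (e 2) (e 0) +
    a z (e 2) * extDer a z (e 0) (e 1)

variable (Y)

/-- A (positive) contact form on the 3-manifold `Y`, oriented by its atlas. -/
structure ContactForm where
  /-- The underlying 1-form. -/
  form : ∀ y : Y, TangentSpace (𝓡 3) y →L[ℝ] ℝ
  smooth : ∀ x, ContDiffOn ℝ ∞ (localForm form x) (extChartAt (𝓡 3) x).target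
  contact : ∀ x, ∀ z ∈ (extChartAt (𝓡 3) x).target, 0 < wedgeDer (localForm form x) z

/-- The `C^∞` topology: uniform convergence on compact sets of all derivatives in all charts. -/
noncomputable instance : TopologicalSpace (ContactForm Y) :=
  ⨅ (x : Y) (k : ℕ), TopologicalSpace.induced
    (fun α => UniformOnFun.ofFun {K : Set E3 | IsCompact K ∧ K ⊆ (extChartAt (𝓡 3) x).target}
      (iteratedFDeriv ℝ k (localForm α.form x))) inferInstance

/-- Two contact forms have the same oriented kernel. -/
instance contactSetoid : Setoid (ContactForm Y) where
  r α β := ∀ y, ∃ c : ℝ, 0 < c ∧ β.form y = c • α.form y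
  iseqv :=
    { refl := fun α y => ⟨1, one_pos, (one_smul ℝ _).symm⟩
      symm := fun {α β} h y => by
        obtain ⟨c, hc, h⟩ := h y
        exact ⟨c⁻¹, inv_pos.2 hc, by rw [h, smul_smul, inv_mul_cancel₀ hc.ne', one_smul]⟩
      trans := fun {α β γ} h h' y => by
        obtain ⟨c, hc, h⟩ := h y
        obtain ⟨d, hd, h'⟩ := h' y
        exact ⟨d * c, mul_pos hd hc, by rw [h', h, smul_smul]⟩ }

/-- The space of (positive, oriented) contact structures on `Y`. The oriented plane field `ξ` is
recorded by the contact forms that have `ξ` as oriented kernel; these form one class of contact forms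
up to multiplication by positive functions. The topology is the quotient topology, which is the
`C^∞` topology of oriented plane fields. -/
abbrev ContactStructure := Quotient (contactSetoid Y)

variable {Y}

theorem localForm_self [IsManifold (𝓡 3) ∞ Y] (α : ∀ y : Y, TangentSpace (𝓡 3) y →L[ℝ] ℝ)
    (x : Y) (u : E3) : localForm α x (extChartAt (𝓡 3) x x) u = α x u := by
  have h := mfderivWithin_range_extChartAt_symm (I := 𝓡 3) (x := x)
  rw [ModelWithCorners.Boundaryless.range_eq_univ, mfderivWithin_univ] at h
  have hx : (extChartAt (𝓡 3) x).symm (extChartAt (𝓡 3) x x) = x := extChartAt_to_inv x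
  have hu : mfderiv 𝓘(ℝ, E3) (𝓡 3) (extChartAt (𝓡 3) x).symm (extChartAt (𝓡 3) x x) u = u :=
    DFunLike.congr_fun h u
  change α _ (mfderiv 𝓘(ℝ, E3) (𝓡 3) (extChartAt (𝓡 3) x).symm (extChartAt (𝓡 3) x x) u) = _
  have key : ∀ y, y = x → (α y : E3 →L[ℝ] ℝ) u = (α x : E3 →L[ℝ] ℝ) u := by
    rintro y rfl; rfl
  exact (congrArg (α _) hu).trans (key _ hx)

theorem ContactForm.form_ne_zero [IsManifold (𝓡 3) ∞ Y] (α : ContactForm Y) (p : Y) :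
    α.form p ≠ 0 := by
  intro h
  have h1 := α.contact p _ (mem_extChartAt_target p)
  have h2 : ∀ u, localForm α.form p (extChartAt (𝓡 3) p p) u = 0 := fun u => by
    rw [localForm_self, h]; rfl
  simp only [wedgeDer, h2, zero_mul, add_zero, lt_irrefl] at h1

theorem continuous_form [IsManifold (𝓡 3) ∞ Y] (p : Y) :
    Continuous fun α : ContactForm Y => (α.form p : E3 →L[ℝ] ℝ) := by
  have h1 : Continuous fun α : ContactForm Y =>
      UniformOnFun.ofFun {K : Set E3 | IsCompact K ∧ K ⊆ (extChartAt (𝓡 3) p).target}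
        (iteratedFDeriv ℝ 0 (localForm α.form p)) :=
    continuous_iInf_dom (i := p) (continuous_iInf_dom (i := 0) continuous_induced_dom)
  have h2 : Continuous fun α : ContactForm Y =>
      iteratedFDeriv ℝ 0 (localForm α.form p) (extChartAt (𝓡 3) p p) := by
    refine (UniformOnFun.uniformContinuous_eval_of_mem (β := E3 [×0]→L[ℝ] (E3 →L[ℝ] ℝ))
      (𝔖 := {K : Set E3 | IsCompact K ∧ K ⊆ (extChartAt (𝓡 3) p).target}) (s := {extChartAt (𝓡 3) p p})
      (x := extChartAt (𝓡 3) p p) rfl ?_).continuous.comp h1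
    exact ⟨isCompact_singleton, Set.singleton_subset_iff.2 (mem_extChartAt_target p)⟩
  have h3 : Continuous fun α : ContactForm Y =>
      iteratedFDeriv ℝ 0 (localForm α.form p) (extChartAt (𝓡 3) p p) (fun _ => 0) :=
    (ContinuousMultilinearMap.apply ℝ (fun _ : Fin 0 => E3) (E3 →L[ℝ] ℝ)
      (fun _ => 0)).continuous.comp h2
  refine h3.congr fun α => ?_
  rw [iteratedFDeriv_zero_apply]
  ext u
  exact localForm_self α.form p u

/-- A framing `τ : T_pY ≅ ℝ³` is positive if it preserves orientations. -/
def IsPositiveFraming {p : Y} (τ : TangentSpace (𝓡 3) p ≃L[ℝ] E3) : Prop :=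
  ∀ u v w : E3, 0 < triple u v w →
    0 < triple (τ (u : TangentSpace (𝓡 3) p)) (τ (v : TangentSpace (𝓡 3) p))
      (τ (w : TangentSpace (𝓡 3) p))

/-- The vector of `ℝ³` that represents, in the framing `τ`, a covector at `p`. -/
noncomputable def covectorDual {p : Y} (τ : TangentSpace (𝓡 3) p ≃L[ℝ] E3)
    (a : TangentSpace (𝓡 3) p →L[ℝ] ℝ) : E3 :=
  (InnerProductSpace.toDual ℝ E3).symm (a.comp (τ.symm : E3 →L[ℝ] TangentSpace (𝓡 3) p))

theorem covectorDual_ne_zero {p : Y} (τ : TangentSpace (𝓡 3) p ≃L[ℝ] E3)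
    {a : TangentSpace (𝓡 3) p →L[ℝ] ℝ} (ha : a ≠ 0) : covectorDual τ a ≠ 0 := by
  intro h
  apply ha
  have h' := (LinearIsometryEquiv.map_eq_zero_iff _).1 h
  ext u
  have := congrArg (fun f : E3 →L[ℝ] ℝ => f (τ u)) h'
  simpa using this

variable [IsManifold (𝓡 3) ∞ Y]

/-- The evaluation map `ξ ↦ ξ(p)` from contact structures to the Grassmannian of oriented planes of
`T_pY ≅ ℝ³`, which is identified with `S²`: the value is the positive unit normal vector of the
oriented plane `τ(ξ(p))`. -/
noncomputable def evalAt (p : Y) (τ : TangentSpace (𝓡 3) p ≃L[ℝ] E3) :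
    C(ContactStructure Y, S2) where
  toFun := Quotient.lift
    (fun α => unitVector (covectorDual τ (α.form p)) (covectorDual_ne_zero τ (α.form_ne_zero p)))
    (by
      intro α β h
      obtain ⟨c, hc, h⟩ := h p
      have h2 : covectorDual τ (β.form p) = c • covectorDual τ (α.form p) := by
        rw [h, covectorDual, ContinuousLinearMap.smul_comp, map_smulₛₗ]
        rfl
      apply Subtype.ext
      simp only [unitVector, h2, norm_smul, Real.norm_eq_abs, abs_of_pos hc, mul_inv, smul_smul]
      congr 1
      field_simp)
  continuous_toFun := by
    refine Continuous.quotient_lift (continuous_unitVector ?_ _) _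
    have h : Continuous fun a : E3 →L[ℝ] ℝ => covectorDual τ (a : TangentSpace (𝓡 3) p →L[ℝ] ℝ) :=
      (InnerProductSpace.toDual ℝ E3).symm.continuous.comp
        (continuous_id.clm_comp continuous_const)
    exact h.comp (continuous_form p)

/-- `ξ` is isotopic to `ξ₀`: there is a smooth isotopy `φ_t` of `Y` with `φ_0 = id` and
`(φ_1)_* ξ₀ = ξ` as oriented plane fields, i.e. `φ_1^*α` is a positive multiple of `α₀` for contact
forms `α₀` of `ξ₀` and `α` of `ξ`. -/
def IsIsotopic (ξ₀ ξ : ContactStructure Y) : Prop :=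
  ∃ φ : ℝ → Y ≃ₘ⟮𝓡 3, 𝓡 3⟯ Y,
    ContMDiff (𝓘(ℝ, ℝ).prod (𝓡 3)) (𝓡 3) ∞ (fun x : ℝ × Y => φ x.1 x.2) ∧
    (∀ y, φ 0 y = y) ∧
    ∃ α₀ α : ContactForm Y, ⟦α₀⟧ = ξ₀ ∧ ⟦α⟧ = ξ ∧
      ∀ y, ∃ c : ℝ, 0 < c ∧
        (α.form (φ 1 y)).comp (mfderiv (𝓡 3) (𝓡 3) (φ 1) y) = c • α₀.form y

/-- The space `𝒞(Y, ξ₀)` of contact structures on `Y` isotopic to `ξ₀`. -/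
abbrev IsotopyClass (ξ₀ : ContactStructure Y) := {ξ : ContactStructure Y // IsIsotopic ξ₀ ξ}

/-- The evaluation map `ev_p : 𝒞(Y, ξ₀) → S²`. -/
noncomputable def ev (ξ₀ : ContactStructure Y) (p : Y) (τ : TangentSpace (𝓡 3) p ≃L[ℝ] E3) :
    C(IsotopyClass ξ₀, S2) :=
  (evalAt p τ).comp ⟨Subtype.val, continuous_subtype_val⟩

/-- The plane `ξ(p) ⊂ T_pY`. -/
noncomputable def contactPlane (p : Y) :
    ContactStructure Y → Submodule ℝ (TangentSpace (𝓡 3) p) :=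
  Quotient.lift (fun α => LinearMap.ker (α.form p).toLinearMap) (by
    intro α β h
    obtain ⟨c, hc, h⟩ := h p
    ext v
    simp [h, hc.ne'])

/-- The fibres of the tautological contact-plane bundle restricted over `p`, a plane bundle over
`𝒞(Y, ξ₀)` whose fibre over `ξ` is `ξ(p)`. -/
abbrev TautPlane (ξ₀ : ContactStructure Y) (p : Y) (ξ : IsotopyClass ξ₀) : Type :=
  contactPlane p ξ.1

/-- The total space of the tautological plane bundle, as a subspace of `𝒞(Y, ξ₀) × T_pY`. -/
noncomputable instance (ξ₀ : ContactStructure Y) (p : Y) :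
    TopologicalSpace (Bundle.TotalSpace E3 (TautPlane ξ₀ p)) :=
  TopologicalSpace.induced
    (fun x => ((x.proj, (x.snd : TangentSpace (𝓡 3) p)) :
      IsotopyClass ξ₀ × TangentSpace (𝓡 3) p)) inferInstance

/-- The orientation of `ξ(p)` as the oriented kernel of a contact form `α`: `(v, w)` is a positive
basis of `ξ(p)` if `(n, v, w)` is a positive basis of `T_pY` for `n` with `α(n) > 0`. -/
def planePos (ξ₀ : ContactStructure Y) (p : Y) (ξ : IsotopyClass ξ₀) (v w : TautPlane ξ₀ p ξ) :
    Prop :=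
  ∃ α : ContactForm Y, ⟦α⟧ = ξ.1 ∧ ∃ n : TangentSpace (𝓡 3) p, 0 < α.form p n ∧
    0 < triple (n : E3) (v.1 : E3) (w.1 : E3)

/-- `μ ∈ H^2(𝒞(Y, ξ₀); ℤ)` is the class `μ̄(1)`: half the Euler class of the tautological
contact-plane bundle restricted over `p`, namely the Euler class of the canonical square root of this
bundle. A positive framing of `T_pY` exhibits the bundle as the pull-back by `ev_p` of the
tautological plane bundle over the oriented Grassmannian of `ℝ³`, and the canonical square root is
the pull-back of the square root of the latter. -/
def IsMuBarOne (ξ₀ : ContactStructure Y) (p : Y) (μ : Cohomology 2 (IsotopyClass ξ₀)) : Prop :=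
  IsEulerClass E3 (TautPlane ξ₀ p) (planePos ξ₀ p) (μ + μ) ∧
    ∃ τ : TangentSpace (𝓡 3) p ≃L[ℝ] E3, IsPositiveFraming τ ∧
      ∃ N : TautSquareRoot, IsEulerClassPullback (ev ξ₀ p τ) N μ

end Contact

/-!
# The evaluation map of contact structures at a point

Let `C` be the space of contact structures isotopic to `ξ₀` and `ev : C → S²` the evaluation at `p`.

The evaluation map is a locally trivial fibration. A rotation of `ℝ³`, damped to the identity outside
a small ball around `p`, is a diffeomorphism of `Y` isotopic to the identity, so it acts on `C`, and
`ev` is equivariant for the rotation. In Cayley coordinates the rotation that moves `q` to `x` along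
the great circle depends continuously on `x ≠ -q`. This trivializes `ev` over the sphere without `-q`
(`nonempty_trivialization`); that the action is continuous for the smooth topology is the chain rule
for derivatives depending on parameters (`ContDerivs`, `TwistData.continuous_pull`).

Everything about the intersection with a fibre holds for any map `g : X → S²` with such
trivializations (`fibreIntersection_eq_cap`). Subdivision splits a cycle into a part over the
punctured sphere and a part off the fibre; in the product of the punctured sphere with the fibre a
relative Künneth theorem (`exists_triangleTimes`) makes the first part a triangle times a cycle `β`.
Conversely, a class of the sphere is represented by a cocycle that vanishes on the simplices that do
not meet `q` (`exists_vanishesOff`), and the cap product with its pull-back takes a triangle times `β`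
to a multiple of `β` (`capChain_triangleTimes`), the multiple being the value of the class on the
fundamental class (`apply_sphSimplex_eq`). This recovers `β`: it is unique, and it is the cap product.
Applied to the identity of the sphere, the same argument shows that a class in `H²(S²)` is determined
by its value on the fundamental class (`eq_of_kronecker_eq`).

The Euler class of a line bundle is computed by obstruction cochains: nonvanishing sections over the
points and along the paths, and their winding numbers around the 2-simplices, measured by a section
over the simplex. They exist (`exists_isEulerCochain`), are natural, and differ by coboundaries
(`IsEulerCochain.sub_mem_coboundaries`). Squaring a section of a square root of the tautological plane
bundle doubles winding numbers, so twice the Euler class of the square root is that of the plane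
bundle (`IsEulerCochain.isEulerClass_tautPlane`), and the two polar tangent fields on the sphere, whose
ratio winds twice around the pole, show that its Euler number is one
(`IsEulerCochain.evalChain_sphereChain`). A square root exists: its transition function between the
complements of the poles is a square root of that ratio (`polarSquareRoot`). Hence the Euler class of
the pulled-back square root is the pull-back of the dual class of the sphere.

Another positive framing changes `ev` by a linear map of positive determinant, whose map of the sphere
is homotopic to the identity (`sphereMap_homotopic_id`, `ev_homotopic`); so `μ̄(1)` does not depend on
the framing or on the square root (`IsMuBarOne.eq_cohomologyMap`).
-/

/-! ### Formal chains of vertex lists -/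

/-- Formal `R`-linear combinations of lists of vertices. A list of length `k + 1` stands for an
ordered `k`-simplex; all degrees are kept in one module, and the empty list is allowed, so that the
boundary operator is the augmented one. -/
abbrev ListChain (R : Type*) [CommRing R] (V : Type*) := List V →₀ R

namespace ListChain

variable {R : Type*} [CommRing R] {V W K : Type*}

/-- Prepend the vertex `v` to every list: the cone operator with apex `v`. -/
noncomputable def cons (v : V) : ListChain R V →ₗ[R] ListChain R V :=
  Finsupp.lmapDomain R R (List.cons v)

/-- Apply a map of vertices. -/
noncomputable def map (f : V → W) : ListChain R V →ₗ[R] ListChain R W :=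
  Finsupp.lmapDomain R R (List.map f)

variable (R) in
/-- The augmented boundary of a list, by recursion: `∂(v :: l) = l - v :: ∂l`. -/
noncomputable def bdryList : List V → ListChain R V
  | [] => 0
  | v :: l => Finsupp.single l 1 - cons v (bdryList l)

/-- The augmented boundary operator on list chains. -/
noncomputable def bdry : ListChain R V →ₗ[R] ListChain R V :=
  Finsupp.linearCombination R (bdryList R)

@[simp] theorem cons_single (v : V) (l : List V) (a : R) :
    cons v (Finsupp.single l a) = Finsupp.single (v :: l) a := by
  simp [cons, Finsupp.mapDomain_single]

@[simp] theorem map_single (f : V → W) (l : List V) (a : R) :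
    map f (Finsupp.single l a) = Finsupp.single (l.map f) a := by
  simp [map, Finsupp.mapDomain_single]

@[simp] theorem bdry_single (l : List V) : bdry (Finsupp.single l (1 : R)) = bdryList R l := by
  simp [bdry]

theorem linearMap_ext {M : Type*} [AddCommGroup M] [Module R M] {f g : ListChain R V →ₗ[R] M}
    (h : ∀ l, f (Finsupp.single l 1) = g (Finsupp.single l 1)) (c : ListChain R V) :
    f c = g c := by
  refine LinearMap.congr_fun ?_ c
  ext1 l
  ext1
  exact h l

theorem bdry_cons (v : V) (c : ListChain R V) : bdry (cons v c) = c - cons v (bdry c) := by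
  refine linearMap_ext (f := bdry.comp (cons v)) (g := LinearMap.id - (cons v).comp bdry) ?_ c
  intro l
  simp [bdryList]

theorem map_cons (f : V → W) (v : V) (c : ListChain R V) :
    map f (cons v c) = cons (f v) (map f c) := by
  refine linearMap_ext (f := (map f).comp (cons v)) (g := (cons (f v)).comp (map f)) ?_ c
  intro l
  simp

theorem map_bdryList (f : V → W) (l : List V) : map f (bdryList R l) = bdryList R (l.map f) := by
  induction l with
  | nil => simp [bdryList]
  | cons v l ih => simp [bdryList, map_cons, ih]

theorem bdry_bdryList (l : List V) : bdry (bdryList R l) = 0 := by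
  induction l with
  | nil => simp [bdryList]
  | cons v l ih => simp [bdryList, bdry_cons, ih]

theorem bdry_bdry (c : ListChain R V) : bdry (bdry c) = 0 := by
  refine linearMap_ext (f := bdry.comp bdry) (g := 0) ?_ c
  intro l
  simp [bdry_bdryList]

theorem bdryList_ofFn {n : ℕ} (w : Fin (n + 1) → V) :
    bdryList R (List.ofFn w) =
      ∑ i : Fin (n + 1), (-1 : R) ^ (i : ℕ) •
        Finsupp.single (List.ofFn (w ∘ i.succAbove)) (1 : R) := by
  induction n with
  | zero => simp [bdryList]
  | succ n ih =>
    rw [List.ofFn_succ, bdryList, ih, map_sum, sub_eq_add_neg, ← Finset.sum_neg_distrib]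
    refine Eq.trans ?_ (Fin.sum_univ_succ (n := n + 1) _).symm
    congr 1
    · simp [Function.comp_def]
    · refine Finset.sum_congr rfl fun i _ => ?_
      rw [map_smul, cons_single, ← neg_smul, Fin.val_succ, pow_succ, mul_neg_one, List.ofFn_succ]
      simp [Function.comp_def]

/-! ### Products of a list with an edge and with a triangle -/

variable (R) in
/-- The product of the edge `[a, b]` with a simplex, as a list chain: the signed sum of the lattice
paths that switch once from column `a` to column `b`. -/
noncomputable def edgeList (a b : K) : List W → ListChain R (K × W)
  | [] => 0
  | t :: s => cons (a, t) (Finsupp.single ((t :: s).map (Prod.mk b)) 1 - edgeList a b s)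

variable (R) in
/-- The product of the triangle `[a, b, c]` with a simplex, as a list chain: the signed sum of the
lattice paths that switch from column `a` to `b` and then from `b` to `c`. -/
noncomputable def triList (a b c : K) : List W → ListChain R (K × W)
  | [] => 0
  | t :: s => cons (a, t) (edgeList R b c (t :: s) + triList a b c s)

/-- The linear extension of `edgeList`. -/
noncomputable def edge (a b : K) : ListChain R W →ₗ[R] ListChain R (K × W) :=
  Finsupp.linearCombination R (edgeList R a b)

/-- The linear extension of `triList`. -/
noncomputable def tri (a b c : K) : ListChain R W →ₗ[R] ListChain R (K × W) :=
  Finsupp.linearCombination R (triList R a b c)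

@[simp] theorem edge_single (a b : K) (l : List W) :
    edge a b (Finsupp.single l (1 : R)) = edgeList R a b l := by
  simp [edge]

@[simp] theorem tri_single (a b c : K) (l : List W) :
    tri a b c (Finsupp.single l (1 : R)) = triList R a b c l := by
  simp [tri]

theorem edge_cons (a b : K) (t : W) (d : ListChain R W) :
    edge a b (cons t d) = cons (a, t) (map (Prod.mk b) (cons t d) - edge a b d) := by
  refine linearMap_ext (f := (edge a b).comp (cons t))
    (g := (cons (a, t)).comp ((map (Prod.mk b)).comp (cons t) - edge a b)) ?_ d
  intro l
  simp [edgeList]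

theorem tri_cons (a b c : K) (t : W) (d : ListChain R W) :
    tri a b c (cons t d) = cons (a, t) (edge b c (cons t d) + tri a b c d) := by
  refine linearMap_ext (f := (tri a b c).comp (cons t))
    (g := (cons (a, t)).comp ((edge b c).comp (cons t) + tri a b c)) ?_ d
  intro l
  simp [triList]

theorem bdry_edgeList (a b : K) (l : List W) :
    bdry (edgeList R a b l) =
      Finsupp.single (l.map (Prod.mk b)) 1 - Finsupp.single (l.map (Prod.mk a)) 1 -
        edge a b (bdryList R l) := by
  induction l with
  | nil => simp [edgeList, bdryList]
  | cons t s ih =>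
    rw [edgeList, bdry_cons, map_sub (bdry (R := R) (V := K × W)), ih, bdry_single, ← map_bdryList, bdryList]
    simp only [map_sub, edge_cons, edge_single, map_single, List.map_cons, cons_single]
    abel

theorem bdry_triList (a b c : K) (l : List W) :
    bdry (triList R a b c l) =
      edgeList R b c l - edgeList R a c l + edgeList R a b l + tri a b c (bdryList R l) := by
  induction l with
  | nil => simp [edgeList, triList, bdryList]
  | cons t s ih =>
    have h1 : edgeList R a c (t :: s) =
      cons (a, t) (Finsupp.single ((t :: s).map (Prod.mk c)) 1 - edgeList R a c s) := rfl
    have h2 : edgeList R a b (t :: s) =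
      cons (a, t) (Finsupp.single ((t :: s).map (Prod.mk b)) 1 - edgeList R a b s) := rfl
    rw [triList, bdry_cons, map_add, ih, bdry_edgeList, h1, h2, bdryList]
    simp only [map_sub, map_add, tri_cons, edge_single, tri_single]
    abel

theorem map_edgeList {W' : Type*} (a b : K) (f : W → W') (l : List W) :
    map (Prod.map id f) (edgeList R a b l) = edgeList R a b (l.map f) := by
  induction l with
  | nil => simp [edgeList]
  | cons t s ih =>
    simp [edgeList, map_cons, ih, Function.comp_def]

theorem map_triList {W' : Type*} (a b c : K) (f : W → W') (l : List W) :
    map (Prod.map id f) (triList R a b c l) = triList R a b c (l.map f) := by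
  induction l with
  | nil => simp [triList]
  | cons t s ih =>
    simp [triList, map_cons, ih, map_edgeList]

theorem edgeList_eq_sum (a b : K) (l : List W) :
    edgeList R a b l = ∑ j : Fin l.length, (-1 : R) ^ (j : ℕ) •
      Finsupp.single ((l.take (j + 1)).map (Prod.mk a) ++ (l.drop j).map (Prod.mk b)) 1 := by
  induction l with
  | nil => simp [edgeList]
  | cons t s ih =>
    rw [edgeList, ih]
    refine Eq.trans ?_ (Fin.sum_univ_succ (n := s.length) _).symm
    simp [pow_succ, map_sum, sub_eq_add_neg]

/-- The lattice paths from the bottom to the top of the product of the triangle with a simplex are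
given by the two positions `i ≤ j` at which they climb. -/
theorem triList_eq_sum (a b c : K) (l : List W) :
    triList R a b c l = ∑ i : Fin l.length, ∑ j : Fin l.length,
      if i ≤ j then (-1 : R) ^ (i + j : ℕ) •
        Finsupp.single ((l.take (i + 1)).map (Prod.mk a) ++
          (((l.drop i).take (j - i + 1)).map (Prod.mk b) ++ (l.drop j).map (Prod.mk c))) 1
      else 0 := by
  induction l with
  | nil => simp [triList]
  | cons t s ih =>
    rw [triList, ih, edgeList_eq_sum]
    refine Eq.trans ?_ (Fin.sum_univ_succ (n := s.length) _).symm
    rw [map_add]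
    congr 1
    · simp
    · rw [map_sum]
      refine Finset.sum_congr rfl fun i _ => ?_
      refine Eq.trans ?_ (Fin.sum_univ_succ (n := s.length) _).symm
      rw [map_sum, if_neg (by simp), zero_add]
      refine Finset.sum_congr rfl fun j _ => ?_
      by_cases h : i ≤ j
      · rw [if_pos h, if_pos (Fin.succ_le_succ_iff.2 h)]
        have e : (-1 : R) ^ ((i.succ : ℕ) + (j.succ : ℕ)) = (-1) ^ (i + j : ℕ) := by
          rw [Fin.val_succ, Fin.val_succ,
            show (i : ℕ) + 1 + (j + 1) = i + j + 2 by omega, pow_add]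
          simp
        rw [e]
        simp
      · rw [if_neg h, if_neg (by rwa [Fin.succ_le_succ_iff]), map_zero]

/-! ### Realization of list chains by singular chains -/

section Realize

variable {X : Type*} [TopologicalSpace X]

/-- A realization of lists of vertices by singular simplices, compatible with faces. -/
structure Realization (V : Type*) (X : Type*) [TopologicalSpace X] where
  /-- The singular simplex with given vertices. -/
  simplex : ∀ {k : ℕ}, (Fin (k + 1) → V) → SingSimplex k X
  face_simplex : ∀ {k : ℕ} (w : Fin (k + 2) → V) (i : Fin (k + 2)),
    face i (simplex w) = simplex (w ∘ i.succAbove)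

/-- The degree-`k` part of the chain map given by a realization: lists of length other than `k + 1`
are sent to zero. -/
noncomputable def realize (ρ : Realization V X) (k : ℕ) : ListChain R V →ₗ[R] Chains R k X :=
  Finsupp.linearCombination R fun l =>
    if h : l.length = k + 1 then
      Finsupp.single (ρ.simplex fun i : Fin (k + 1) => l.get (Fin.cast h.symm i)) (1 : R)
    else 0

theorem realize_single_ofFn (ρ : Realization V X) {k : ℕ} (w : Fin (k + 1) → V) (a : R) :
    realize ρ k (Finsupp.single (List.ofFn w) a) = Finsupp.single (ρ.simplex w) a := by
  have : (fun i : Fin (k + 1) => (List.ofFn w).get (Fin.cast (List.length_ofFn).symm i)) = w :=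
    funext fun i => List.get_ofFn w _
  rw [realize, Finsupp.linearCombination_single, dif_pos List.length_ofFn, this,
    Finsupp.smul_single, smul_eq_mul, mul_one]

theorem realize_single_of_length_ne (ρ : Realization V X) {k : ℕ} {l : List V}
    (h : l.length ≠ k + 1) (a : R) : realize ρ k (Finsupp.single l a) = 0 := by
  simp [realize, h]

theorem exists_ofFn {l : List V} {n : ℕ} (h : l.length = n) : ∃ w : Fin n → V, l = List.ofFn w := by
  subst h
  exact ⟨l.get, (List.ofFn_get l).symm⟩

theorem realize_bdryList_eq_zero (ρ : Realization V X) {k : ℕ} {l : List V}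
    (h : l.length ≠ k + 2) : realize ρ k (bdryList R l) = 0 := by
  obtain ⟨w, hw⟩ := exists_ofFn (l := l) rfl
  cases hl : l.length with
  | zero =>
    rw [List.length_eq_zero_iff.1 hl, bdryList, map_zero]
  | succ n =>
    obtain ⟨w, rfl⟩ := exists_ofFn hl
    rw [bdryList_ofFn, map_sum]
    refine Finset.sum_eq_zero fun i _ => ?_
    rw [map_smul, realize_single_of_length_ne, smul_zero]
    simp at h ⊢
    omega

theorem bdrySucc_realize (ρ : Realization V X) (k : ℕ) (c : ListChain R V) :
    bdrySucc R X k (realize ρ (k + 1) c) = realize ρ k (bdry c) := by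
  refine linearMap_ext (f := (bdrySucc R X k).comp (realize ρ (k + 1)))
    (g := (realize ρ k).comp bdry) ?_ c
  intro l
  simp only [LinearMap.comp_apply, bdry_single]
  by_cases h : l.length = k + 2
  · obtain ⟨w, rfl⟩ := exists_ofFn h
    rw [realize_single_ofFn, bdryList_ofFn, map_sum, bdrySucc, Finsupp.linearCombination_single,
      one_smul, bdrySimplex]
    refine Finset.sum_congr rfl fun i _ => ?_
    rw [map_smul, realize_single_ofFn, ρ.face_simplex]
  · rw [realize_single_of_length_ne ρ h, realize_bdryList_eq_zero ρ h, map_zero]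

end Realize

end ListChain

/-! ### Products with the triangle and homotopy invariance -/

section Product

variable {R : Type*} [CommRing R] {X F : Type*} [TopologicalSpace X] [TopologicalSpace F]

open ListChain

/-- Lists of pairs (vertex of the triangle, vertex of a singular simplex `τ` of `F`), realized in `X`
through a map `Θ : Δ² × F → X`. -/
noncomputable def prodRealization (Θ : C(Simp 2 × F, X)) {n : ℕ} (τ : SingSimplex n F) :
    Realization (Fin 3 × Fin (n + 1)) X where
  simplex w := Θ.comp ((simpMap (Prod.fst ∘ w)).prodMk (τ.comp (simpMap (Prod.snd ∘ w))))
  face_simplex w i := by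
    simp only [face, ContinuousMap.comp_assoc]
    congr 1
    rw [← Function.comp_assoc, ← Function.comp_assoc, ← simpMap_comp, ← simpMap_comp]
    rfl

theorem realize_map_face (Θ : C(Simp 2 × F, X)) {n k : ℕ} (τ : SingSimplex (n + 1) F)
    (i : Fin (n + 2)) (c : ListChain R (Fin 3 × Fin (n + 1))) :
    realize (prodRealization Θ τ) k (map (Prod.map id i.succAbove) c) =
      realize (prodRealization Θ (face i τ)) k c := by
  refine linearMap_ext (f := (realize (prodRealization Θ τ) k).comp (map (Prod.map id i.succAbove)))
    (g := realize (prodRealization Θ (face i τ)) k) ?_ c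
  intro l
  rw [LinearMap.comp_apply, map_single]
  by_cases h : l.length = k + 1
  · obtain ⟨w, rfl⟩ := exists_ofFn h
    rw [List.map_ofFn, realize_single_ofFn, realize_single_ofFn]
    congr 1
    simp only [prodRealization, face, ContinuousMap.comp_assoc]
    congr 1
    rw [simpMap_comp]
    rfl
  · rw [realize_single_of_length_ne _ h, realize_single_of_length_ne _ (by simpa using h)]

/-- The list of all vertices of the `n`-simplex. -/
abbrev allVertices (n : ℕ) : List (Fin (n + 1)) := List.ofFn id

theorem bdryList_allVertices (n : ℕ) : bdryList R (allVertices (n + 1)) =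
    ∑ i : Fin (n + 2), (-1 : R) ^ (i : ℕ) •
      Finsupp.single ((allVertices n).map i.succAbove) (1 : R) := by
  rw [bdryList_ofFn]
  refine Finset.sum_congr rfl fun i _ => ?_
  rw [List.map_ofFn]
  rfl

/-- The product of the edge `[a, b]` of the triangle with a chain of `F`, mapped to `X`. -/
noncomputable def edgeTimes (R : Type*) [CommRing R] (n : ℕ) (Θ : C(Simp 2 × F, X)) (a b : Fin 3) :
    Chains R n F →ₗ[R] Chains R (n + 1) X :=
  Finsupp.linearCombination R fun τ =>
    realize (prodRealization Θ τ) (n + 1) (edgeList R a b (allVertices n))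

/-- The slice `f ↦ Θ(r, f)` of a map `Θ : Δ² × F → X`. -/
def slice (Θ : C(Simp 2 × F, X)) (r : Simp 2) : C(F, X) :=
  Θ.comp ((ContinuousMap.const F r).prodMk (ContinuousMap.id F))

@[simp] theorem slice_apply (Θ : C(Simp 2 × F, X)) (r : Simp 2) (f : F) :
    slice Θ r f = Θ (r, f) := rfl

theorem simpMap_const_apply {m n : ℕ} (a : Fin (n + 1)) (r : Simp m) :
    simpMap (fun _ => a) r = stdSimplex.vertex a := by
  have h : (fun _ : Fin (m + 1) => a) = (fun _ : Fin 1 => a) ∘ (fun _ => 0) := rfl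
  rw [h, ← simpMap_comp, ContinuousMap.comp_apply,
    show simpMap (n := 0) (fun _ => 0) r = stdSimplex.vertex (0 : Fin 1) from Subsingleton.elim _ _]
  exact stdSimplex.map_vertex _ _

theorem simpMap_id (n : ℕ) : simpMap (id : Fin (n + 1) → Fin (n + 1)) = ContinuousMap.id _ := by
  ext x : 1
  exact stdSimplex.map_id_apply x

theorem realize_column (Θ : C(Simp 2 × F, X)) {n : ℕ} (τ : SingSimplex n F) (a : Fin 3) :
    realize (prodRealization Θ τ) n
        (Finsupp.single ((allVertices n).map (Prod.mk a)) (1 : R)) =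
      chainMap R n (slice Θ (stdSimplex.vertex a)) (Finsupp.single τ 1) := by
  rw [List.map_ofFn, realize_single_ofFn, chainMap, Finsupp.lmapDomain_apply,
    Finsupp.mapDomain_single]
  congr 1
  ext x : 1
  change Θ (simpMap (fun _ => a) x, τ (simpMap id x)) = Θ (stdSimplex.vertex a, τ x)
  rw [simpMap_const_apply, simpMap_id]
  rfl

theorem realize_edge_bdryList (Θ : C(Simp 2 × F, X)) {n : ℕ} (a b : Fin 3)
    (τ : SingSimplex (n + 1) F) :
    realize (prodRealization Θ τ) (n + 1) (edge a b (bdryList R (allVertices (n + 1)))) =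
      edgeTimes R n Θ a b (bdrySimplex R τ) := by
  rw [bdryList_allVertices, bdrySimplex, map_sum, map_sum, map_sum]
  refine Finset.sum_congr rfl fun i _ => ?_
  rw [map_smul, map_smul, map_smul, edge_single, ← map_edgeList, realize_map_face, edgeTimes,
    Finsupp.linearCombination_single, one_smul]

theorem bdry_edgeTimes_succ (n : ℕ) (Θ : C(Simp 2 × F, X)) (a b : Fin 3)
    (c : Chains R (n + 1) F) :
    bdrySucc R X (n + 1) (edgeTimes R (n + 1) Θ a b c) =
      chainMap R (n + 1) (slice Θ (stdSimplex.vertex b)) c -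
        chainMap R (n + 1) (slice Θ (stdSimplex.vertex a)) c -
        edgeTimes R n Θ a b (bdrySucc R F n c) := by
  refine LinearMap.congr_fun (f := (bdrySucc R X (n + 1)).comp (edgeTimes R (n + 1) Θ a b))
    (g := chainMap R (n + 1) (slice Θ (stdSimplex.vertex b)) -
        chainMap R (n + 1) (slice Θ (stdSimplex.vertex a)) -
        (edgeTimes R n Θ a b).comp (bdrySucc R F n)) ?_ c
  ext1 τ
  ext1
  simp only [LinearMap.comp_apply, LinearMap.sub_apply, Finsupp.lsingle_apply]
  rw [← realize_column, ← realize_column, bdrySucc, bdrySucc, Finsupp.linearCombination_single,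
    one_smul, ← realize_edge_bdryList, edgeTimes, Finsupp.linearCombination_single, one_smul]
  refine (bdrySucc_realize _ _ _).trans ?_
  rw [bdry_edgeList, map_sub, map_sub]

theorem bdry_edgeTimes_zero (Θ : C(Simp 2 × F, X)) (a b : Fin 3) (c : Chains R 0 F) :
    bdrySucc R X 0 (edgeTimes R 0 Θ a b c) =
      chainMap R 0 (slice Θ (stdSimplex.vertex b)) c -
        chainMap R 0 (slice Θ (stdSimplex.vertex a)) c := by
  refine LinearMap.congr_fun (f := (bdrySucc R X 0).comp (edgeTimes R 0 Θ a b))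
    (g := chainMap R 0 (slice Θ (stdSimplex.vertex b)) -
        chainMap R 0 (slice Θ (stdSimplex.vertex a))) ?_ c
  ext1 τ
  ext1
  simp only [LinearMap.comp_apply, LinearMap.sub_apply, Finsupp.lsingle_apply]
  rw [← realize_column, ← realize_column, edgeTimes, Finsupp.linearCombination_single, one_smul]
  refine (bdrySucc_realize _ _ _).trans ?_
  rw [bdry_edgeList, map_sub, map_sub]
  simp [bdryList, edge, edgeList]

/-- For a cycle `c`, the boundary of `[a, b] × c` is the difference of the two end slices. -/
theorem bdry_edgeTimes_of_cycle (n : ℕ) (Θ : C(Simp 2 × F, X)) (a b : Fin 3) {c : Chains R n F}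
    (hc : bdry R F n c = 0) :
    bdrySucc R X n (edgeTimes R n Θ a b c) =
      chainMap R n (slice Θ (stdSimplex.vertex b)) c -
        chainMap R n (slice Θ (stdSimplex.vertex a)) c := by
  cases n with
  | zero => exact bdry_edgeTimes_zero Θ a b c
  | succ n =>
    have h : bdrySucc R F n c = 0 := hc
    rw [bdry_edgeTimes_succ, h, map_zero, sub_zero]

/-- The definition of the product as a sum over pairs `i ≤ j` agrees with the recursive one. -/
theorem triangleTimes_single (n : ℕ) (Θ : C(Simp 2 × F, X)) (τ : SingSimplex n F) :
    triangleTimes R n Θ (Finsupp.single τ 1) =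
      realize (prodRealization Θ τ) (n + 2) (triList R 0 1 2 (allVertices n)) := by
  have hlen : (allVertices n).length = n + 1 := List.length_ofFn
  have key : ∀ i j : Fin (n + 1), i ≤ j →
      ((allVertices n).take (i + 1)).map (Prod.mk (0 : Fin 3)) ++
        ((((allVertices n).drop i).take (j - i + 1)).map (Prod.mk 1) ++
          ((allVertices n).drop j).map (Prod.mk 2)) =
      List.ofFn fun k => (prodVertex₁ i j k, prodVertex₂ i j k) := by
    intro i j hij
    have hij' : (i : ℕ) ≤ j := hij
    apply List.ext_getElem
    · simp
      omega
    · intro k h1 h2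
      have hk : k < n + 3 := by rwa [List.length_ofFn] at h2
      rw [List.getElem_append]
      simp only [List.getElem_append (l₁ := List.map (Prod.mk (1 : Fin 3)) _)]
      simp only [List.length_map, List.length_take, List.length_drop, List.getElem_map,
        List.getElem_take, List.getElem_drop, List.getElem_ofFn, hlen, id_eq, prodVertex₁,
        prodVertex₂]
      split_ifs <;> first | (exfalso; omega) | (simp; try omega)
  rw [triangleTimes, Finsupp.linearCombination_single, one_smul, triList_eq_sum, map_sum]
  have e : ∀ (f : ℕ → ℕ → Chains R (n + 2) X) (m : ℕ), m = n + 1 →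
      ∑ i : Fin m, ∑ j : Fin m, f i j = ∑ i : Fin (n + 1), ∑ j : Fin (n + 1), f i j := by
    rintro f m rfl
    rfl
  simp only [map_sum, apply_ite (realize (prodRealization Θ τ) (n + 2)), map_zero, map_smul]
  simp only [Fin.le_def]
  refine Eq.trans ?_ (e (fun i j => if i ≤ j then (-1 : R) ^ (i + j : ℕ) •
    realize (prodRealization Θ τ) (n + 2) (Finsupp.single
      (((allVertices n).take (i + 1)).map (Prod.mk (0 : Fin 3)) ++
        ((((allVertices n).drop i).take (j - i + 1)).map (Prod.mk 1) ++
          ((allVertices n).drop j).map (Prod.mk 2))) 1) else 0) _ hlen).symm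
  refine Finset.sum_congr rfl fun i _ => ?_
  rw [Finset.sum_filter]
  refine Finset.sum_congr rfl fun j _ => ?_
  by_cases h : (i : ℕ) ≤ j
  · rw [if_pos h, if_pos h, key i j h]
    congr 1
    exact (realize_single_ofFn (k := n + 2) (prodRealization Θ τ)
      (fun k => (prodVertex₁ i j k, prodVertex₂ i j k)) (1 : R)).symm
  · rw [if_neg h, if_neg h]

/-- For a cycle `c`, the boundary of `Δ² × c` is `∂Δ² × c`. -/
theorem bdry_triangleTimes_of_cycle (n : ℕ) (Θ : C(Simp 2 × F, X)) {c : Chains R n F}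
    (hc : bdry R F n c = 0) :
    bdrySucc R X (n + 1) (triangleTimes R n Θ c) =
      edgeTimes R n Θ 1 2 c - edgeTimes R n Θ 0 2 c + edgeTimes R n Θ 0 1 c := by
  have h1 : ∀ τ : SingSimplex n F, bdrySucc R X (n + 1) (triangleTimes R n Θ (Finsupp.single τ 1)) =
      edgeTimes R n Θ 1 2 (Finsupp.single τ 1) - edgeTimes R n Θ 0 2 (Finsupp.single τ 1) +
        edgeTimes R n Θ 0 1 (Finsupp.single τ 1) +
        realize (prodRealization Θ τ) (n + 1) (tri 0 1 2 (bdryList R (allVertices n))) := by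
    intro τ
    rw [triangleTimes_single]
    refine (bdrySucc_realize _ _ _).trans ?_
    rw [bdry_triList]
    simp [edgeTimes]
  cases n with
  | zero =>
    refine LinearMap.congr_fun (f := (bdrySucc R X 1).comp (triangleTimes R 0 Θ))
      (g := edgeTimes R 0 Θ 1 2 - edgeTimes R 0 Θ 0 2 + edgeTimes R 0 Θ 0 1) ?_ c
    ext1 τ
    ext1
    refine (h1 τ).trans ?_
    have : tri (0 : Fin 3) 1 2 (bdryList R (allVertices 0)) = 0 := by
      simp [bdryList, tri, triList]
    rw [this, map_zero, add_zero]
    rfl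
  | succ n =>
    have h : bdrySucc R F n c = 0 := hc
    have h2 : bdrySucc R X (n + 2) (triangleTimes R (n + 1) Θ c) =
        edgeTimes R (n + 1) Θ 1 2 c - edgeTimes R (n + 1) Θ 0 2 c + edgeTimes R (n + 1) Θ 0 1 c +
          triangleTimes R n Θ (bdrySucc R F n c) := by
      refine LinearMap.congr_fun (f := (bdrySucc R X (n + 2)).comp (triangleTimes R (n + 1) Θ))
        (g := edgeTimes R (n + 1) Θ 1 2 - edgeTimes R (n + 1) Θ 0 2 + edgeTimes R (n + 1) Θ 0 1 +
          (triangleTimes R n Θ).comp (bdrySucc R F n)) ?_ c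
      ext1 τ
      ext1
      refine (h1 τ).trans ?_
      simp only [LinearMap.comp_apply, LinearMap.sub_apply, LinearMap.add_apply,
        Finsupp.lsingle_apply]
      congr 1
      rw [bdryList_allVertices, bdrySucc, Finsupp.linearCombination_single, one_smul, bdrySimplex,
        map_sum, map_sum, map_sum]
      refine Finset.sum_congr rfl fun i _ => ?_
      rw [map_smul, map_smul, map_smul, tri_single, ← map_triList, realize_map_face,
        triangleTimes_single]
    rw [h2, h, map_zero, add_zero]

end Product

/-! ### Homotopy invariance -/

section Homotopy

variable {R : Type*} [CommRing R] {X F : Type*} [TopologicalSpace X] [TopologicalSpace F]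

theorem chainMap_comp_apply {Z : Type*} [TopologicalSpace Z] (n : ℕ) (f : C(F, X)) (g : C(X, Z))
    (c : Chains R n F) : chainMap R n (g.comp f) c = chainMap R n g (chainMap R n f c) := by
  refine LinearMap.congr_fun (f := chainMap R n (g.comp f))
    (g := (chainMap R n g).comp (chainMap R n f)) ?_ c
  ext1 σ
  ext1
  simp [chainMap, Finsupp.mapDomain_single, ContinuousMap.comp_assoc]

theorem chainMap_single (n : ℕ) (f : C(F, X)) (σ : SingSimplex n F) (a : R) :
    chainMap R n f (Finsupp.single σ a) = Finsupp.single (f.comp σ) a := by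
  simp [chainMap, Finsupp.mapDomain_single]

theorem chainMap_id (n : ℕ) (c : Chains R n X) : chainMap R n (ContinuousMap.id X) c = c := by
  refine LinearMap.congr_fun (f := chainMap R n (ContinuousMap.id X))
    (g := LinearMap.id) ?_ c
  ext1 σ
  ext1
  simp [chainMap_single]

theorem bdrySucc_chainMap (n : ℕ) (f : C(F, X)) (c : Chains R (n + 1) F) :
    bdrySucc R X n (chainMap R (n + 1) f c) = chainMap R n f (bdrySucc R F n c) :=
  bdry_chainMap R (n + 1) f c

/-- A homotopy, parametrized by the triangle through its coordinate `t₁`. -/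
noncomputable def homotopyTriangle {f g : C(F, X)} (H : f.Homotopy g) : C(Simp 2 × F, X) :=
  H.toContinuousMap.comp
    (ContinuousMap.prodMap ⟨fun t : Simp 2 => ⟨t 1, stdSimplex.zero_le t 1, stdSimplex.le_one t 1⟩,
      Continuous.subtype_mk ((continuous_apply 1).comp continuous_subtype_val) _⟩
      (ContinuousMap.id F))

theorem slice_homotopyTriangle_zero {f g : C(F, X)} (H : f.Homotopy g) :
    slice (homotopyTriangle H) (stdSimplex.vertex 0) = f := by
  ext x
  refine Eq.trans ?_ (H.apply_zero x)
  change H (_, x) = _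
  congr 2

theorem slice_homotopyTriangle_one {f g : C(F, X)} (H : f.Homotopy g) :
    slice (homotopyTriangle H) (stdSimplex.vertex 1) = g := by
  ext x
  refine Eq.trans ?_ (H.apply_one x)
  change H (_, x) = _
  congr 2

/-- Homotopic maps send a cycle to homologous cycles. -/
theorem chainMap_sub_mem_boundaries {f g : C(F, X)} (h : f.Homotopic g) (n : ℕ) {c : Chains R n F}
    (hc : bdry R F n c = 0) : chainMap R n g c - chainMap R n f c ∈ boundaries R n X := by
  obtain ⟨H⟩ := h
  refine ⟨edgeTimes R n (homotopyTriangle H) 0 1 c, ?_⟩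
  refine (bdry_edgeTimes_of_cycle n (homotopyTriangle H) 0 1 hc).trans ?_
  rw [slice_homotopyTriangle_zero, slice_homotopyTriangle_one]

theorem evalChain_cochainMap (n : ℕ) (f : C(F, X)) (φ : Cochains n X) (c : Chains ℤ n F) :
    evalChain n (cochainMap n f φ) c = evalChain n φ (chainMap ℤ n f c) := by
  refine LinearMap.congr_fun (f := evalChain n (cochainMap n f φ))
    (g := (evalChain n φ).comp (chainMap ℤ n f)) ?_ c
  ext1 σ
  ext1
  simp [evalChain, chainMap_single, cochainMap]

theorem evalChain_single (n : ℕ) (φ : Cochains n X) (σ : SingSimplex n X) :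
    evalChain n φ (Finsupp.single σ 1) = φ σ := by
  simp [evalChain]

/-- Homotopic maps pull a cocycle back to cohomologous cocycles. -/
theorem cochainMap_sub_mem_coboundaries {f g : C(F, X)} (h : f.Homotopic g) (n : ℕ)
    {φ : Cochains (n + 1) X} (hφ : φ ∈ cocycles (n + 1) X) :
    cochainMap (n + 1) g φ - cochainMap (n + 1) f φ ∈ coboundaries (n + 1) F := by
  obtain ⟨H⟩ := h
  have h0 : cobdry (n + 1) X φ = 0 := hφ
  refine ⟨fun γ => evalChain (n + 1) φ
    (edgeTimes ℤ n (homotopyTriangle H) 0 1 (Finsupp.single γ 1)), ?_⟩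
  have h1 : ∀ c : Chains ℤ n F, evalChain n (fun γ => evalChain (n + 1) φ
      (edgeTimes ℤ n (homotopyTriangle H) 0 1 (Finsupp.single γ 1))) c =
      evalChain (n + 1) φ (edgeTimes ℤ n (homotopyTriangle H) 0 1 c) := by
    intro c
    refine LinearMap.congr_fun (f := evalChain n _)
      (g := (evalChain (n + 1) φ).comp (edgeTimes ℤ n (homotopyTriangle H) 0 1)) ?_ c
    ext1 σ
    ext1
    exact evalChain_single _ _ _
  ext σ
  rw [← evalChain_single (n + 1) (cobdry n F _), evalChain_cobdry, h1]
  have h2 := bdry_edgeTimes_succ (R := ℤ) n (homotopyTriangle H) 0 1 (Finsupp.single σ 1)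
  have h3 := congrArg (evalChain (n + 1) φ) h2
  have h4 := evalChain_cobdry (n + 1) φ
    (edgeTimes ℤ (n + 1) (homotopyTriangle H) 0 1 (Finsupp.single σ 1))
  rw [h0] at h4
  have h5 : evalChain (n + 1) φ (bdrySucc ℤ X (n + 1)
    (edgeTimes ℤ (n + 1) (homotopyTriangle H) 0 1 (Finsupp.single σ 1))) = 0 :=
    h4.symm.trans (by simp [evalChain])
  rw [h5, map_sub, map_sub, slice_homotopyTriangle_zero, slice_homotopyTriangle_one,
    ← evalChain_cochainMap, ← evalChain_cochainMap, evalChain_single, evalChain_single] at h3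
  change evalChain (n + 1) φ (edgeTimes ℤ n (homotopyTriangle H) 0 1
    (bdrySucc ℤ F n (Finsupp.single σ 1))) = _
  rw [Pi.sub_apply]
  linarith

theorem cohomologyMap_eq_of_homotopic {f g : C(F, X)} (h : f.Homotopic g) (n : ℕ) :
    cohomologyMap (n + 1) f = cohomologyMap (n + 1) g := by
  refine LinearMap.ext fun x => ?_
  obtain ⟨φ, rfl⟩ := Submodule.Quotient.mk_surjective _ x
  exact (SubQuot.mk_eq_mk.2 (cochainMap_sub_mem_coboundaries h n φ.2)).symm

/-- A contractible space has no second cohomology. -/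
theorem mem_coboundaries_of_contractible {x₀ : X}
    (h : (ContinuousMap.const X x₀).Homotopic (ContinuousMap.id X)) {φ : Cochains 2 X}
    (hφ : φ ∈ cocycles 2 X) : φ ∈ coboundaries 2 X := by
  have h1 := cochainMap_sub_mem_coboundaries h 1 hφ
  have h2 : cochainMap 2 (ContinuousMap.const X x₀) φ ∈ coboundaries 2 X := by
    refine ⟨fun _ => φ (ContinuousMap.const _ x₀), ?_⟩
    ext σ
    simp [cobdry, Fin.sum_univ_three, cochainMap]
  have h3 := Submodule.add_mem _ h1 h2
  rw [sub_add_cancel] at h3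
  exact h3

end Homotopy

/-! ### Barycentric subdivision -/

section Subdivision

open ListChain

theorem sum_smul_simpMap {M : Type*} [AddCommGroup M] [Module ℝ M] {m n : ℕ}
    (v : Fin (n + 1) → M) (f : Fin (m + 1) → Fin (n + 1)) (t : Simp m) :
    ∑ i, (simpMap f t) i • v i = ∑ j, t j • v (f j) := by
  have h : ∀ i, (simpMap f t) i = ∑ j with f j = i, t j := fun i => by
    change stdSimplex.map f t i = _
    rw [stdSimplex.map_coe]
    simp [FunOnFinite.linearMap_apply_apply]
  simp only [h, Finset.sum_smul]
  rw [← Finset.sum_fiberwise (s := Finset.univ) (g := f)]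
  refine Finset.sum_congr rfl fun i _ => Finset.sum_congr rfl fun j hj => ?_
  rw [(Finset.mem_filter.1 hj).2]

/-- The affine simplex in the standard `n`-simplex with given vertices. -/
noncomputable def affSimplex {n k : ℕ} (w : Fin (k + 1) → Simp n) : SingSimplex k (Simp n) where
  toFun t := ⟨∑ i, t i • (w i : Fin (n + 1) → ℝ),
    (convex_stdSimplex ℝ _).sum_mem (fun i _ => stdSimplex.zero_le t i) (stdSimplex.sum_eq_one t)
      fun i _ => (w i).2⟩
  continuous_toFun := Continuous.subtype_mk (continuous_finsetSum _ fun i _ =>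
    ((continuous_apply i).comp continuous_subtype_val).smul continuous_const) _

theorem affSimplex_val {n k : ℕ} (w : Fin (k + 1) → Simp n) (t : Simp k) :
    (affSimplex w t : Fin (n + 1) → ℝ) = ∑ i, t i • (w i : Fin (n + 1) → ℝ) := rfl

theorem affSimplex_vertex {n k : ℕ} (w : Fin (k + 1) → Simp n) (i : Fin (k + 1)) :
    affSimplex w (stdSimplex.vertex i) = w i := by
  apply stdSimplex.ext
  rw [affSimplex_val]
  simp only [stdSimplex.vertex_coe]
  simp [Pi.single_apply]

/-- Affine simplices realize lists of points of the standard simplex. -/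
noncomputable def affRealization (n : ℕ) : Realization (Simp n) (Simp n) where
  simplex w := affSimplex w
  face_simplex w i := by
    ext1 t
    apply stdSimplex.ext
    exact sum_smul_simpMap (fun i => (w i : Fin _ → ℝ)) i.succAbove t

/-- A map of standard simplices is affine if it is the restriction of a linear map. -/
def IsAffineMap {m n : ℕ} (f : Simp m → Simp n) : Prop :=
  ∃ L : (Fin (m + 1) → ℝ) →ₗ[ℝ] (Fin (n + 1) → ℝ), ∀ x : Simp m, (f x : Fin (n + 1) → ℝ) = L x

theorem isAffineMap_affSimplex {n k : ℕ} (w : Fin (k + 1) → Simp n) :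
    IsAffineMap (affSimplex w) :=
  ⟨∑ i, (LinearMap.proj i : (Fin (k + 1) → ℝ) →ₗ[ℝ] ℝ).smulRight (w i : Fin (n + 1) → ℝ), fun x => by
    rw [affSimplex_val]
    simp⟩

theorem simpMap_eq_affSimplex {m n : ℕ} (f : Fin (m + 1) → Fin (n + 1)) :
    simpMap f = affSimplex fun i => stdSimplex.vertex (f i) := by
  ext1 t
  apply stdSimplex.ext
  rw [affSimplex_val]
  have h := sum_smul_simpMap
    (fun i => (stdSimplex.vertex (S := ℝ) i : Fin (n + 1) → ℝ)) f t
  rw [← h]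
  ext j
  simp only [stdSimplex.vertex_coe]
  simp [Pi.single_apply]

theorem IsAffineMap.comp_affSimplex {m n k : ℕ} {f : C(Simp m, Simp n)} (hf : IsAffineMap f)
    (w : Fin (k + 1) → Simp m) : f.comp (affSimplex w) = affSimplex (f ∘ w) := by
  obtain ⟨L, hL⟩ := hf
  ext1 t
  apply stdSimplex.ext
  rw [affSimplex_val, ContinuousMap.comp_apply, hL, affSimplex_val, map_sum]
  refine Finset.sum_congr rfl fun i _ => ?_
  rw [map_smul, ← hL]
  rfl

theorem realize_map_affine (R : Type*) [CommRing R] {m n : ℕ} {f : C(Simp m, Simp n)}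
    (hf : IsAffineMap f) (k : ℕ) (c : ListChain R (Simp m)) :
    realize (affRealization n) k (map f c) = chainMap R k f (realize (affRealization m) k c) := by
  refine linearMap_ext (f := (realize (affRealization n) k).comp (map f))
    (g := (chainMap R k f).comp (realize (affRealization m) k)) ?_ c
  intro l
  simp only [LinearMap.comp_apply, map_single]
  by_cases h : l.length = k + 1
  · obtain ⟨w, rfl⟩ := exists_ofFn h
    rw [List.map_ofFn, realize_single_ofFn, realize_single_ofFn, chainMap_single]
    congr 1
    exact (hf.comp_affSimplex w).symm
  · rw [realize_single_of_length_ne _ h, realize_single_of_length_ne _ (by simpa using h),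
      map_zero]

/-- The barycenter of a nonempty list of points of the standard simplex (a vertex for the empty
list). -/
noncomputable def bary {n : ℕ} (l : List (Simp n)) : Simp n :=
  if h : l = [] then stdSimplex.vertex 0 else
    ⟨∑ i : Fin l.length, (l.length : ℝ)⁻¹ • (l.get i : Fin (n + 1) → ℝ), by
      have hl : (l.length : ℝ) ≠ 0 := by simpa using h
      refine (convex_stdSimplex ℝ _).sum_mem (fun i _ => by positivity) ?_ fun i _ => (l.get i).2
      simp [mul_inv_cancel₀ hl]⟩

theorem bary_val {n : ℕ} {l : List (Simp n)} (h : l ≠ []) : (bary l : Fin (n + 1) → ℝ) =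
    ∑ i : Fin l.length, (l.length : ℝ)⁻¹ • (l.get i : Fin (n + 1) → ℝ) := by
  rw [bary, dif_neg h]
  rfl

theorem IsAffineMap.map_bary {m n : ℕ} {f : Simp m → Simp n} (hf : IsAffineMap f)
    {l : List (Simp m)} (h : l ≠ []) : f (bary l) = bary (l.map f) := by
  obtain ⟨L, hL⟩ := hf
  apply stdSimplex.ext
  obtain ⟨w, hw⟩ := exists_ofFn (l := l) rfl
  rw [hL, bary_val h, bary_val (by simpa using h), map_sum]
  refine Fintype.sum_equiv (finCongr (List.length_map f).symm) _ _ fun i => ?_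
  rw [map_smul, ← hL]
  simp

variable (R : Type*) [CommRing R]

/-- Barycentric subdivision of list chains in degree `k`. -/
noncomputable def sdList (n : ℕ) : ℕ → ListChain R (Simp n) →ₗ[R] ListChain R (Simp n)
  | 0 => LinearMap.id
  | k + 1 => Finsupp.linearCombination R fun l => cons (bary l) (sdList n k (bdryList R l))

/-- The chain homotopy from the identity to barycentric subdivision, on list chains. -/
noncomputable def sdHomotopyList (n : ℕ) : ℕ → ListChain R (Simp n) →ₗ[R] ListChain R (Simp n)
  | 0 => 0
  | k + 1 => Finsupp.linearCombination R fun l =>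
      cons (bary l) (Finsupp.single l 1 - sdHomotopyList n k (bdryList R l))

variable {R}

theorem sdList_succ_single (n k : ℕ) (l : List (Simp n)) :
    sdList R n (k + 1) (Finsupp.single l 1) = cons (bary l) (sdList R n k (bdryList R l)) := by
  simp [sdList]

theorem sdHomotopyList_succ_single (n k : ℕ) (l : List (Simp n)) :
    sdHomotopyList R n (k + 1) (Finsupp.single l 1) =
      cons (bary l) (Finsupp.single l 1 - sdHomotopyList R n k (bdryList R l)) := by
  simp [sdHomotopyList]

theorem bdry_sdList (n k : ℕ) (c : ListChain R (Simp n)) :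
    bdry (sdList R n (k + 1) c) = sdList R n k (bdry c) := by
  induction k generalizing c with
  | zero =>
    refine linearMap_ext (f := bdry.comp (sdList R n 1)) (g := (sdList R n 0).comp bdry) ?_ c
    intro l
    simp [sdList, bdry_cons, bdry_bdryList]
  | succ k ih =>
    refine linearMap_ext (f := bdry.comp (sdList R n (k + 2)))
      (g := (sdList R n (k + 1)).comp bdry) ?_ c
    intro l
    rw [LinearMap.comp_apply, LinearMap.comp_apply, sdList_succ_single, bdry_cons, ih,
      bdry_bdryList, map_zero, map_zero, sub_zero, bdry_single]

theorem bdry_sdHomotopyList (n k : ℕ) (c : ListChain R (Simp n)) :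
    bdry (sdHomotopyList R n (k + 1) c) =
      c - sdHomotopyList R n k (bdry c) - sdList R n (k + 1) c := by
  induction k generalizing c with
  | zero =>
    refine linearMap_ext (f := bdry.comp (sdHomotopyList R n 1))
      (g := LinearMap.id - (sdHomotopyList R n 0).comp bdry - sdList R n 1) ?_ c
    intro l
    simp [sdList, sdHomotopyList, bdryList]
  | succ k ih =>
    refine linearMap_ext (f := bdry.comp (sdHomotopyList R n (k + 2)))
      (g := LinearMap.id - (sdHomotopyList R n (k + 1)).comp bdry - sdList R n (k + 2)) ?_ c
    intro l
    simp only [LinearMap.sub_apply, LinearMap.comp_apply, LinearMap.id_apply]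
    rw [sdHomotopyList_succ_single, bdry_cons, map_sub (ListChain.bdry (R := R) (V := Simp n)), ih, sdList_succ_single,
      bdry_bdryList, map_zero, bdry_single]
    simp only [map_sub, map_zero]
    abel

theorem map_sdList {m n : ℕ} {f : Simp m → Simp n} (hf : IsAffineMap f) (k : ℕ)
    (c : ListChain R (Simp m)) : map f (sdList R m k c) = sdList R n k (map f c) := by
  induction k generalizing c with
  | zero => rfl
  | succ k ih =>
    refine linearMap_ext (f := (map f).comp (sdList R m (k + 1)))
      (g := (sdList R n (k + 1)).comp (map f)) ?_ c
    intro l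
    rw [LinearMap.comp_apply, LinearMap.comp_apply, map_single, sdList_succ_single,
      sdList_succ_single, map_cons, ih, map_bdryList]
    by_cases h : l = []
    · subst h
      simp [bdryList]
    · rw [hf.map_bary h]

theorem bdryList_eq_sum_of_length {V : Type*} {l : List V} {k : ℕ} (h : l.length = k + 2) :
    ∃ w : Fin (k + 2) → List V, (∀ i, (w i).length = k + 1) ∧ (∀ i, ∀ x ∈ w i, x ∈ l) ∧
      bdryList R l = ∑ i : Fin (k + 2), (-1 : R) ^ (i : ℕ) • Finsupp.single (w i) (1 : R) := by
  obtain ⟨v, rfl⟩ := exists_ofFn h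
  refine ⟨fun i => List.ofFn (v ∘ i.succAbove), fun i => List.length_ofFn, ?_, bdryList_ofFn v⟩
  intro i x hx
  rw [List.mem_ofFn] at hx ⊢
  obtain ⟨j, rfl⟩ := hx
  exact ⟨_, rfl⟩

theorem map_sdHomotopyList {m n : ℕ} {f : Simp m → Simp n} (hf : IsAffineMap f) (k : ℕ)
    {l : List (Simp m)} (h : l.length = k + 1) :
    map f (sdHomotopyList R m k (Finsupp.single l 1)) =
      sdHomotopyList R n k (Finsupp.single (l.map f) 1) := by
  induction k generalizing l with
  | zero => simp [sdHomotopyList]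
  | succ k ih =>
    have h0 : l ≠ [] := by
      rintro rfl
      simp at h
    obtain ⟨w, hw, -, hb⟩ := bdryList_eq_sum_of_length (R := R) h
    rw [sdHomotopyList_succ_single, sdHomotopyList_succ_single, map_cons, hf.map_bary h0, map_sub,
      map_single, ← map_bdryList, hb]
    simp only [map_sum, map_smul, ih (hw _), map_single]

/-- Subdivision does not leave the closed balls around the simplex, and multiplies the mesh of a
`k`-simplex by at most `k / (k + 1)`. -/
theorem sdList_mem_supported (n k : ℕ) {l : List (Simp n)} (hl : l.length = k + 1) :
    sdList R n k (Finsupp.single l 1) ∈ Finsupp.supported R R {l' : List (Simp n) |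
      l'.length = k + 1 ∧
      (∀ (z : Simp n) (r : ℝ), (∀ y ∈ l, dist y z ≤ r) → ∀ x ∈ l', dist x z ≤ r) ∧
      ∀ d : ℝ, (∀ x ∈ l, ∀ y ∈ l, dist x y ≤ d) →
        ∀ x ∈ l', ∀ y ∈ l', dist x y ≤ (k : ℝ) / (k + 1) * d} := by
  induction k generalizing l with
  | zero =>
    obtain ⟨w, rfl⟩ := exists_ofFn hl
    refine Finsupp.single_mem_supported _ _ ⟨hl, fun z r h => h, fun d hd x hx y hy => ?_⟩
    simp only [List.ofFn_succ, List.ofFn_zero, List.mem_singleton] at hx hy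
    simp [hx, hy]
  | succ k ih =>
    have h0 : l ≠ [] := by
      rintro rfl
      simp at hl
    have hlen : (l.length : ℝ) = k + 2 := by
      rw [hl]
      push_cast
      ring
    obtain ⟨w, hw, hmem, hb⟩ := bdryList_eq_sum_of_length (R := R) hl
    have hbary : ∀ z : Simp n, dist (bary l) z ≤ ∑ i : Fin l.length, (l.length : ℝ)⁻¹ *
        dist (l.get i) z := by
      intro z
      have e : (bary l : Fin (n + 1) → ℝ) - z =
          ∑ i : Fin l.length, (l.length : ℝ)⁻¹ • ((l.get i : Fin (n + 1) → ℝ) - z) := by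
        rw [bary_val h0]
        simp only [smul_sub, Finset.sum_sub_distrib]
        congr 1
        have : (k : ℝ) + 2 ≠ 0 := by positivity
        rw [Finset.sum_const, Finset.card_univ, Fintype.card_fin, ← Nat.cast_smul_eq_nsmul ℝ,
          smul_smul, hlen, mul_inv_cancel₀ this, one_smul]
      change dist (bary l : Fin (n + 1) → ℝ) z ≤ _
      rw [dist_eq_norm, e]
      refine (norm_sum_le _ _).trans (Finset.sum_le_sum fun i _ => ?_)
      rw [norm_smul, Real.norm_of_nonneg (by positivity), ← dist_eq_norm]
      rfl
    have hball : ∀ (z : Simp n) (r : ℝ), (∀ y ∈ l, dist y z ≤ r) → dist (bary l) z ≤ r := by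
      intro z r h
      refine (hbary z).trans ?_
      have h1 : ∀ i : Fin l.length, (l.length : ℝ)⁻¹ * dist (l.get i) z ≤ (l.length : ℝ)⁻¹ * r :=
        fun i => mul_le_mul_of_nonneg_left (h _ (List.get_mem _ _)) (by positivity)
      refine (Finset.sum_le_sum fun i _ => h1 i).trans ?_
      rw [Finset.sum_const, Finset.card_univ, Fintype.card_fin, nsmul_eq_mul, hlen]
      have : (k : ℝ) + 2 ≠ 0 := by positivity
      rw [← mul_assoc, mul_inv_cancel₀ this, one_mul]
    -- The distance from a vertex to the barycenter: one of the `k + 2` terms vanishes.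
    have hvert : ∀ d : ℝ, (∀ x ∈ l, ∀ y ∈ l, dist x y ≤ d) →
        ∀ y ∈ l, dist y (bary l) ≤ ((k + 1 : ℕ) : ℝ) / ((k + 1 : ℕ) + 1) * d := by
      intro d hd y hy
      rw [dist_comm]
      refine (hbary y).trans ?_
      obtain ⟨i₀, rfl⟩ := List.get_of_mem hy
      rw [← Finset.mul_sum, ← Finset.add_sum_erase _ _ (Finset.mem_univ i₀), dist_self, zero_add]
      have h1 : ∑ i ∈ Finset.univ.erase i₀, dist (l.get i) (l.get i₀) ≤ ((k + 1 : ℕ) : ℝ) * d := by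
        refine (Finset.sum_le_card_nsmul _ _ d fun i _ =>
          hd _ (List.get_mem _ _) _ (List.get_mem _ _)).trans ?_
        rw [Finset.card_erase_of_mem (Finset.mem_univ _), Finset.card_univ, Fintype.card_fin, hl,
          nsmul_eq_mul]
        simp
      refine (mul_le_mul_of_nonneg_left h1 (by positivity)).trans (le_of_eq ?_)
      rw [hlen]
      push_cast
      field_simp
      ring
    rw [sdList_succ_single, hb]
    simp only [map_sum, map_smul]
    refine Submodule.sum_mem _ fun i _ => Submodule.smul_mem _ _ ?_
    have hi := ih (hw i)
    rw [Finsupp.mem_supported] at hi ⊢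
    intro l' hl'
    classical
    have hl'' := Finsupp.mapDomain_support hl'
    obtain ⟨l₁, hl₁, rfl⟩ := Finset.mem_image.1 hl''
    obtain ⟨g1, g2, g3⟩ := hi hl₁
    have hhull : ∀ (z : Simp n) (r : ℝ), (∀ y ∈ l, dist y z ≤ r) → ∀ x ∈ l₁, dist x z ≤ r :=
      fun z r h x hx => g2 z r (fun y hy => h y (hmem i y hy)) x hx
    refine ⟨by simp [g1], fun z r h x hx => ?_, fun d hd x hx y hy => ?_⟩
    · rcases List.mem_cons.1 hx with rfl | hx
      · exact hball z r h
      · exact hhull z r h x hx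
    · have hd0 : 0 ≤ d := by
        obtain ⟨a, ha⟩ := List.exists_mem_of_ne_nil l h0
        exact dist_nonneg.trans (hd a ha a ha)
      have hb0 := hhull (bary l) _ (hvert d hd)
      rcases List.mem_cons.1 hx with rfl | hx <;> rcases List.mem_cons.1 hy with rfl | hy
      · rw [dist_self]
        positivity
      · rw [dist_comm]
        exact hb0 y hy
      · exact hb0 x hx
      · refine (g3 d (fun a ha b hb => hd a (hmem i a ha) b (hmem i b hb)) x hx y hy).trans ?_
        refine mul_le_mul_of_nonneg_right ?_ hd0
        rw [div_le_div_iff₀ (by positivity) (by positivity)]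
        push_cast
        nlinarith

end Subdivision

/-! ### Small singular chains -/

section SmallChains

open ListChain

variable {R : Type*} [CommRing R] {X Z : Type*} [TopologicalSpace X] [TopologicalSpace Z]

theorem mem_chainsIn_single {n : ℕ} {A : Set X} {σ : SingSimplex n X} (h : Set.range σ ⊆ A)
    (a : R) : Finsupp.single σ a ∈ chainsIn R n A :=
  Finsupp.single_mem_supported _ _ h

theorem chainsIn_mono {n : ℕ} {A B : Set X} (h : A ⊆ B) : chainsIn R n A ≤ chainsIn R n B :=
  Finsupp.supported_mono fun _ hσ => hσ.trans h

theorem linearCombination_mem_chainsIn {n : ℕ} {M : Type*} [AddCommGroup M] [Module R M]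
    {A : Set X} {N : Submodule R M} {f : SingSimplex n X → M}
    (h : ∀ σ : SingSimplex n X, Set.range σ ⊆ A → f σ ∈ N) {c : Chains R n X}
    (hc : c ∈ chainsIn R n A) : Finsupp.linearCombination R f c ∈ N := by
  rw [Finsupp.linearCombination_apply]
  exact Submodule.finsuppSum_mem _ _ _ _ fun σ hσ =>
    Submodule.smul_mem _ _ (h σ ((Finsupp.mem_supported _ _).1 hc (Finsupp.mem_support_iff.2 hσ)))

theorem chainMap_eq_linearCombination (n : ℕ) (f : C(X, Z)) (c : Chains R n X) :
    chainMap R n f c = Finsupp.linearCombination R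
      (fun σ : SingSimplex n X => Finsupp.single (f.comp σ) (1 : R)) c := by
  refine LinearMap.congr_fun (f := chainMap R n f) ?_ c
  ext1 σ
  ext1
  simp [chainMap_single]

theorem chainMap_mem_chainsIn {n : ℕ} {f : C(X, Z)} {A : Set X} {B : Set Z} (h : Set.MapsTo f A B)
    {c : Chains R n X} (hc : c ∈ chainsIn R n A) : chainMap R n f c ∈ chainsIn R n B := by
  rw [chainMap_eq_linearCombination]
  refine linearCombination_mem_chainsIn (fun σ hσ => mem_chainsIn_single ?_ _) hc
  rintro _ ⟨t, rfl⟩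
  exact h (hσ ⟨t, rfl⟩)

theorem mem_chainsIn_univ {n : ℕ} (c : Chains R n X) : c ∈ chainsIn R n Set.univ :=
  (Finsupp.mem_supported _ _).2 fun _ _ => Set.subset_univ _

theorem chainMap_mem_chainsIn_range {n : ℕ} {f : C(X, Z)} {B : Set Z} (h : ∀ x, f x ∈ B)
    (c : Chains R n X) : chainMap R n f c ∈ chainsIn R n B :=
  chainMap_mem_chainsIn (fun x _ => h x) (mem_chainsIn_univ c)

theorem bdrySucc_mem_chainsIn {n : ℕ} {A : Set X} {c : Chains R (n + 1) X}
    (hc : c ∈ chainsIn R (n + 1) A) : bdrySucc R X n c ∈ chainsIn R n A := by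
  refine linearCombination_mem_chainsIn (fun σ hσ => ?_) hc
  refine Submodule.sum_mem _ fun i _ => Submodule.smul_mem _ _ (mem_chainsIn_single ?_ _)
  rintro _ ⟨t, rfl⟩
  exact hσ ⟨_, rfl⟩

/-- The list of the vertices of the standard simplex. -/
noncomputable abbrev stdVertices (k : ℕ) : List (Simp k) :=
  List.ofFn fun i : Fin (k + 1) => (stdSimplex.vertex i : Simp k)

variable (R X) in
/-- Barycentric subdivision of singular chains. -/
noncomputable def sd (k : ℕ) : Chains R k X →ₗ[R] Chains R k X :=
  Finsupp.linearCombination R fun σ : SingSimplex k X =>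
    chainMap R k σ (realize (affRealization k) k
      (sdList R k k (Finsupp.single (stdVertices k) 1)))

variable (R X) in
/-- The natural chain homotopy from the identity to barycentric subdivision. -/
noncomputable def sdHomotopy (k : ℕ) : Chains R k X →ₗ[R] Chains R (k + 1) X :=
  Finsupp.linearCombination R fun σ : SingSimplex k X =>
    chainMap R (k + 1) σ (realize (affRealization k) (k + 1)
      (sdHomotopyList R k k (Finsupp.single (stdVertices k) 1)))

theorem sd_single (k : ℕ) (σ : SingSimplex k X) : sd R X k (Finsupp.single σ 1) =
    chainMap R k σ (realize (affRealization k) k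
      (sdList R k k (Finsupp.single (stdVertices k) 1))) := by
  simp [sd]

theorem sdHomotopy_single (k : ℕ) (σ : SingSimplex k X) : sdHomotopy R X k (Finsupp.single σ 1) =
    chainMap R (k + 1) σ (realize (affRealization k) (k + 1)
      (sdHomotopyList R k k (Finsupp.single (stdVertices k) 1))) := by
  simp [sdHomotopy]

theorem sd_chainMap (k : ℕ) (f : C(X, Z)) (c : Chains R k X) :
    sd R Z k (chainMap R k f c) = chainMap R k f (sd R X k c) := by
  refine LinearMap.congr_fun (f := (sd R Z k).comp (chainMap R k f))
    (g := (chainMap R k f).comp (sd R X k)) ?_ c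
  ext1 σ
  ext1
  simp [chainMap_single, sd_single, chainMap_comp_apply]

theorem sd_mem_chainsIn {k : ℕ} {A : Set X} {c : Chains R k X} (hc : c ∈ chainsIn R k A) :
    sd R X k c ∈ chainsIn R k A :=
  linearCombination_mem_chainsIn (fun _ hσ =>
    chainMap_mem_chainsIn_range (fun x => hσ ⟨x, rfl⟩) _) hc

theorem sdHomotopy_mem_chainsIn {k : ℕ} {A : Set X} {c : Chains R k X} (hc : c ∈ chainsIn R k A) :
    sdHomotopy R X k c ∈ chainsIn R (k + 1) A :=
  linearCombination_mem_chainsIn (fun _ hσ =>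
    chainMap_mem_chainsIn_range (fun x => hσ ⟨x, rfl⟩) _) hc

theorem map_stdVertices {k n : ℕ} (w : Fin (k + 1) → Simp n) :
    (stdVertices k).map (affSimplex w) = List.ofFn w := by
  rw [List.map_ofFn]
  congr 1
  funext i
  exact affSimplex_vertex w i

theorem map_stdVertices_face {k : ℕ} (i : Fin (k + 2)) :
    (stdVertices k).map (simpMap i.succAbove) =
      List.ofFn ((fun j : Fin (k + 2) => (stdSimplex.vertex j : Simp (k + 1))) ∘ i.succAbove) := by
  rw [simpMap_eq_affSimplex, map_stdVertices]
  rfl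

theorem isAffineMap_simpMap {m n : ℕ} (f : Fin (m + 1) → Fin (n + 1)) :
    IsAffineMap (simpMap f) := by
  rw [simpMap_eq_affSimplex]
  exact isAffineMap_affSimplex _

theorem sd_realize {k n : ℕ} {l : List (Simp n)} (hl : l.length = k + 1) :
    sd R (Simp n) k (realize (affRealization n) k (Finsupp.single l 1)) =
      realize (affRealization n) k (sdList R n k (Finsupp.single l 1)) := by
  obtain ⟨w, rfl⟩ := exists_ofFn hl
  rw [realize_single_ofFn]
  refine (sd_single k (affSimplex w)).trans ?_
  rw [← realize_map_affine R (isAffineMap_affSimplex w), map_sdList (isAffineMap_affSimplex w),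
    map_single, map_stdVertices]

theorem realize_stdVertices (k : ℕ) : realize (affRealization k) k
    (Finsupp.single (stdVertices k) (1 : R)) = Finsupp.single (ContinuousMap.id _) 1 := by
  rw [realize_single_ofFn]
  congr 1
  refine Eq.trans ?_ (simpMap_id k)
  rw [simpMap_eq_affSimplex]
  rfl

theorem bdrySucc_sd (k : ℕ) (c : Chains R (k + 1) X) :
    bdrySucc R X k (sd R X (k + 1) c) = sd R X k (bdrySucc R X k c) := by
  refine LinearMap.congr_fun (f := (bdrySucc R X k).comp (sd R X (k + 1)))
    (g := (sd R X k).comp (bdrySucc R X k)) ?_ c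
  ext1 σ
  ext1
  simp only [LinearMap.comp_apply, Finsupp.lsingle_apply]
  rw [sd_single, bdrySucc_chainMap, bdrySucc_realize, bdry_sdList, bdry_single, bdrySucc,
    Finsupp.linearCombination_single, one_smul, bdrySimplex, bdryList_ofFn]
  simp only [map_sum, map_smul, sd_single]
  refine Finset.sum_congr rfl fun i _ => ?_
  congr 1
  rw [← map_stdVertices_face, ← map_single (R := R), ← map_sdList (isAffineMap_simpMap _),
    realize_map_affine R (isAffineMap_simpMap _), face, chainMap_comp_apply]

theorem bdrySucc_sdHomotopy (k : ℕ) (c : Chains R (k + 1) X) :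
    bdrySucc R X (k + 1) (sdHomotopy R X (k + 1) c) =
      c - sdHomotopy R X k (bdrySucc R X k c) - sd R X (k + 1) c := by
  refine LinearMap.congr_fun (f := (bdrySucc R X (k + 1)).comp (sdHomotopy R X (k + 1)))
    (g := LinearMap.id - (sdHomotopy R X k).comp (bdrySucc R X k) - sd R X (k + 1)) ?_ c
  ext1 σ
  ext1
  simp only [LinearMap.comp_apply, Finsupp.lsingle_apply, LinearMap.sub_apply, LinearMap.id_apply]
  rw [sd_single, sdHomotopy_single, bdrySucc_chainMap, bdrySucc_realize, bdry_sdHomotopyList,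
    map_sub, map_sub, map_sub, map_sub]
  congr 1
  congr 1
  · rw [realize_stdVertices, chainMap_single]
    rfl
  · rw [bdry_single, bdrySucc, Finsupp.linearCombination_single, one_smul, bdrySimplex,
      bdryList_ofFn]
    simp only [map_sum, map_smul, sdHomotopy_single]
    refine Finset.sum_congr rfl fun i _ => ?_
    congr 1
    rw [← map_stdVertices_face, ← map_sdHomotopyList (isAffineMap_simpMap _) _ (by simp),
      realize_map_affine R (isAffineMap_simpMap _), face, chainMap_comp_apply]

theorem sd_iterate_mem_chainsIn {k : ℕ} {A : Set X} {c : Chains R k X} (hc : c ∈ chainsIn R k A)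
    (m : ℕ) : ((sd R X k) ^ m) c ∈ chainsIn R k A := by
  induction m with
  | zero => exact hc
  | succ m ih =>
    rw [pow_succ', Module.End.mul_apply]
    exact sd_mem_chainsIn ih

theorem bdrySucc_sd_iterate {k : ℕ} (c : Chains R (k + 1) X) (m : ℕ) :
    bdrySucc R X k (((sd R X (k + 1)) ^ m) c) = ((sd R X k) ^ m) (bdrySucc R X k c) := by
  induction m with
  | zero => rfl
  | succ m ih =>
    rw [pow_succ', Module.End.mul_apply, bdrySucc_sd, ih, pow_succ', Module.End.mul_apply]

/-- A chain differs from its iterated subdivision by a boundary and a chain that depends on its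
boundary only; both stay in any subset that contains the chain, or its boundary. -/
theorem sub_sd_iterate {k : ℕ} (c : Chains R (k + 1) X) (m : ℕ) :
    ∃ d : Chains R (k + 2) X, ∃ e : Chains R (k + 1) X,
      c - ((sd R X (k + 1)) ^ m) c = bdrySucc R X (k + 1) d + e ∧
      (∀ A, c ∈ chainsIn R (k + 1) A → d ∈ chainsIn R (k + 2) A) ∧
      (∀ A, bdrySucc R X k c ∈ chainsIn R k A → e ∈ chainsIn R (k + 1) A) ∧
      (bdrySucc R X k c = 0 → e = 0) := by
  induction m with
  | zero => exact ⟨0, 0, by simp, fun _ _ => Submodule.zero_mem _,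
      fun _ _ => Submodule.zero_mem _, fun _ => rfl⟩
  | succ m ih =>
    obtain ⟨d, e, h, hd, he, he0⟩ := ih
    refine ⟨d + sdHomotopy R X (k + 1) (((sd R X (k + 1)) ^ m) c),
      e + sdHomotopy R X k (((sd R X k) ^ m) (bdrySucc R X k c)), ?_, fun A hA => ?_,
      fun A hA => ?_, fun h0 => ?_⟩
    · rw [map_add, bdrySucc_sdHomotopy, bdrySucc_sd_iterate, pow_succ', Module.End.mul_apply,
        ← sub_add_sub_cancel c (((sd R X (k + 1)) ^ m) c), h]
      abel
    · exact Submodule.add_mem _ (hd A hA) (sdHomotopy_mem_chainsIn (sd_iterate_mem_chainsIn hA m))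
    · exact Submodule.add_mem _ (he A hA) (sdHomotopy_mem_chainsIn (sd_iterate_mem_chainsIn hA m))
    · rw [he0 h0, h0, map_zero, map_zero, add_zero]

/-- The iterated subdivision of the standard simplex has small mesh. -/
theorem sdList_iterate_mem_supported (k m : ℕ) :
    ((sdList R k k) ^ m) (Finsupp.single (stdVertices k) 1) ∈ Finsupp.supported R R
      {l : List (Simp k) | l.length = k + 1 ∧
        ∀ x ∈ l, ∀ y ∈ l, dist x y ≤ ((k : ℝ) / (k + 1)) ^ m} := by
  induction m with
  | zero =>
    refine Finsupp.single_mem_supported _ _ ⟨List.length_ofFn, fun x _ y _ => ?_⟩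
    rw [pow_zero]
    exact (Metric.dist_le_diam_of_mem (bounded_stdSimplex _) x.2 y.2).trans diam_stdSimplex_le
  | succ m ih =>
    rw [pow_succ' (sdList R k k), Module.End.mul_apply]
    set c := ((sdList R k k) ^ m) (Finsupp.single (stdVertices k) 1)
    rw [← Finsupp.sum_single c, Finsupp.sum, map_sum]
    refine Submodule.sum_mem _ fun l hl => ?_
    obtain ⟨h1, h2⟩ := (Finsupp.mem_supported _ _).1 ih hl
    rw [← Finsupp.smul_single_one, map_smul]
    refine Submodule.smul_mem _ _ (Finsupp.supported_mono ?_ (sdList_mem_supported k k h1))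
    rintro l' ⟨g1, -, g3⟩
    refine ⟨g1, fun x hx y hy => (g3 _ h2 x hx y hy).trans (le_of_eq ?_)⟩
    ring

theorem sd_iterate_single (k m : ℕ) (σ : SingSimplex k X) :
    ((sd R X k) ^ m) (Finsupp.single σ 1) = chainMap R k σ (realize (affRealization k) k
      (((sdList R k k) ^ m) (Finsupp.single (stdVertices k) 1))) := by
  induction m with
  | zero =>
    rw [pow_zero, pow_zero, Module.End.one_apply, Module.End.one_apply, realize_stdVertices,
      chainMap_single]
    rfl
  | succ m ih =>
    rw [pow_succ', Module.End.mul_apply, ih, sd_chainMap, pow_succ', Module.End.mul_apply]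
    congr 1
    have h := sdList_iterate_mem_supported (R := R) k m
    set c := ((sdList R k k) ^ m) (Finsupp.single (stdVertices k) 1)
    rw [← Finsupp.sum_single c, Finsupp.sum]
    simp only [map_sum]
    refine Finset.sum_congr rfl fun l hl => ?_
    rw [← Finsupp.smul_single_one]
    simp only [map_smul]
    rw [sd_realize ((Finsupp.mem_supported _ _).1 h hl).1]

theorem affSimplex_mem_ball {k : ℕ} {w : Fin (k + 1) → Simp k} {δ : ℝ}
    (h : ∀ i j, dist (w i) (w j) < δ) (t : Simp k) : affSimplex w t ∈ Metric.ball (w 0) δ := by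
  have h1 := (convex_ball (w 0 : Fin (k + 1) → ℝ) δ).sum_mem (t := Finset.univ) (w := t)
    (z := fun i => (w i : Fin (k + 1) → ℝ)) (fun i _ => stdSimplex.zero_le t i)
    (stdSimplex.sum_eq_one t) (fun i _ => h i 0)
  exact h1

/-- Any chain in the union of two open sets becomes, after sufficiently many subdivisions, a sum of
chains in the two sets. -/
theorem exists_sd_iterate_mem_sup {k : ℕ} {P Q : Set X} (hP : IsOpen P) (hQ : IsOpen Q)
    {c : Chains R k X} (hc : c ∈ chainsIn R k (P ∪ Q)) :
    ∃ m, ((sd R X k) ^ m) c ∈ chainsIn R k P ⊔ chainsIn R k Q := by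
  have hmono : ∀ (c : Chains R k X) (m m' : ℕ), m ≤ m' →
      ((sd R X k) ^ m) c ∈ chainsIn R k P ⊔ chainsIn R k Q →
      ((sd R X k) ^ m') c ∈ chainsIn R k P ⊔ chainsIn R k Q := by
    intro c m m' hm h
    obtain ⟨j, rfl⟩ := Nat.exists_eq_add_of_le' hm
    rw [pow_add, Module.End.mul_apply]
    obtain ⟨a, ha, b, hb, hab⟩ := Submodule.mem_sup.1 h
    rw [← hab, map_add]
    exact Submodule.add_mem_sup (sd_iterate_mem_chainsIn ha j) (sd_iterate_mem_chainsIn hb j)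
  have hsimplex : ∀ σ : SingSimplex k X, Set.range σ ⊆ P ∪ Q →
      ∃ m, ((sd R X k) ^ m) (Finsupp.single σ 1) ∈ chainsIn R k P ⊔ chainsIn R k Q := by
    intro σ hσ
    -- `δ` is a Lebesgue number of the cover of the simplex by the preimages of `P` and `Q`.
    obtain ⟨δ, hδ, hleb⟩ := lebesgue_number_lemma_of_metric (s := (Set.univ : Set (Simp k)))
      (c := fun b : Bool => σ ⁻¹' (if b then P else Q)) isCompact_univ
      (fun b => by
        cases b
        · exact hQ.preimage σ.continuous
        · exact hP.preimage σ.continuous)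
      (fun x _ => by
        rw [Set.mem_iUnion]
        rcases hσ ⟨x, rfl⟩ with h | h
        · exact ⟨true, h⟩
        · exact ⟨false, h⟩)
    -- A subdivision shrinks the simplices by the factor `k / (k + 1)`.
    have hq : (k : ℝ) / (k + 1) < 1 := by
      rw [div_lt_one (by positivity)]
      linarith
    obtain ⟨m, hm⟩ := exists_pow_lt_of_lt_one hδ hq
    refine ⟨m, ?_⟩
    rw [sd_iterate_single]
    have h := sdList_iterate_mem_supported (R := R) k m
    set c := ((sdList R k k) ^ m) (Finsupp.single (stdVertices k) 1)
    rw [← Finsupp.sum_single c, Finsupp.sum]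
    simp only [map_sum]
    refine Submodule.sum_mem _ fun l hl => ?_
    obtain ⟨h1, h2⟩ := (Finsupp.mem_supported _ _).1 h hl
    obtain ⟨w, rfl⟩ := exists_ofFn h1
    rw [realize_single_ofFn, chainMap_single]
    have hw : ∀ t, affSimplex w t ∈ Metric.ball (w 0) δ :=
      affSimplex_mem_ball fun i j => lt_of_le_of_lt
        (h2 _ (List.mem_ofFn.2 ⟨i, rfl⟩) _ (List.mem_ofFn.2 ⟨j, rfl⟩)) hm
    obtain ⟨b, hb⟩ := hleb (w 0) (Set.mem_univ _)
    cases b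
    · refine Submodule.mem_sup_right (mem_chainsIn_single ?_ _)
      rintro _ ⟨t, rfl⟩
      exact hb (hw t)
    · refine Submodule.mem_sup_left (mem_chainsIn_single ?_ _)
      rintro _ ⟨t, rfl⟩
      exact hb (hw t)
  rw [chainsIn, Finsupp.supported_eq_span_single] at hc
  induction hc using Submodule.span_induction with
  | mem x hx =>
    obtain ⟨σ, hσ, rfl⟩ := hx
    exact hsimplex σ hσ
  | zero => exact ⟨0, by simp⟩
  | add x y _ _ hx hy =>
    obtain ⟨m, hm⟩ := hx
    obtain ⟨m', hm'⟩ := hy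
    refine ⟨max m m', ?_⟩
    rw [map_add]
    exact Submodule.add_mem _ (hmono _ _ _ (le_max_left _ _) hm) (hmono _ _ _ (le_max_right _ _) hm')
  | smul a x _ hx =>
    obtain ⟨m, hm⟩ := hx
    refine ⟨m, ?_⟩
    rw [map_smul]
    exact Submodule.smul_mem _ _ hm

end SmallChains

/-! ### Chains in subspaces -/

section Subspaces

variable {R : Type*} [CommRing R] {X F P : Type*} [TopologicalSpace X] [TopologicalSpace F]
  [TopologicalSpace P]

/-- The inclusion of a subset. -/
def subsetIncl (A : Set P) : C(A, P) := ⟨Subtype.val, continuous_subtype_val⟩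

theorem exists_chainMap_subsetIncl {n : ℕ} {A : Set P} {c : Chains R n P}
    (hc : c ∈ chainsIn R n A) : ∃ c' : Chains R n A, chainMap R n (subsetIncl A) c' = c := by
  have h : chainsIn R n A ≤ LinearMap.range (chainMap R n (subsetIncl A)) := by
    rw [chainsIn, Finsupp.supported_eq_span_single, Submodule.span_le]
    rintro _ ⟨σ, hσ, rfl⟩
    refine ⟨Finsupp.single ⟨fun t => ⟨σ t, hσ ⟨t, rfl⟩⟩, σ.continuous.subtype_mk _⟩ 1, ?_⟩
    rw [chainMap_single]
    rfl
  exact h hc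

theorem chainMap_injective {n : ℕ} {f : C(F, X)} (hf : Function.Injective f) :
    Function.Injective (chainMap R n f) := by
  refine Finsupp.mapDomain_injective fun σ τ h => ?_
  ext t : 1
  exact hf (DFunLike.congr_fun h t)

theorem bdry_mem_chainsIn {n : ℕ} {A : Set P} {c : Chains R n P} (hc : c ∈ chainsIn R n A) :
    bdry R P n c ∈ chainsIn R (n - 1) A := by
  cases n with
  | zero => exact Submodule.zero_mem _
  | succ n => exact bdrySucc_mem_chainsIn hc

theorem bdrySucc_bdrySucc (n : ℕ) (c : Chains R (n + 2) X) :
    bdrySucc R X n (bdrySucc R X (n + 1) c) = 0 := by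
  refine LinearMap.congr_fun (f := (bdrySucc R X n).comp (bdrySucc R X (n + 1))) (g := 0) ?_ c
  ext1 σ
  ext1
  simp only [LinearMap.comp_apply, Finsupp.lsingle_apply, LinearMap.zero_apply]
  have h := ListChain.bdrySucc_realize (R := R) (affRealization (n + 2)) (n + 1)
    (Finsupp.single (stdVertices (n + 2)) 1)
  have h' := ListChain.bdrySucc_realize (R := R) (affRealization (n + 2)) n
    (ListChain.bdry (Finsupp.single (stdVertices (n + 2)) 1))
  rw [ListChain.bdry_bdry, map_zero] at h'
  rw [← h, realize_stdVertices] at h'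
  have h2 := congrArg (chainMap R n σ) h'
  rw [map_zero, ← bdrySucc_chainMap, ← bdrySucc_chainMap, chainMap_single] at h2
  exact h2

theorem bdry_bdrySucc (n : ℕ) (c : Chains R (n + 1) X) :
    bdry R X n (bdrySucc R X n c) = 0 := by
  cases n with
  | zero => rfl
  | succ n => exact bdrySucc_bdrySucc n c

theorem chainsIn_inter {n : ℕ} (A B : Set P) :
    chainsIn R n A ⊓ chainsIn R n B = chainsIn R n (A ∩ B) := by
  rw [chainsIn, chainsIn, ← Finsupp.supported_inter, chainsIn]
  congr 1
  ext σ
  simp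

theorem mem_chainsIn_inter {n : ℕ} {A B : Set P} {c : Chains R n P} (hA : c ∈ chainsIn R n A)
    (hB : c ∈ chainsIn R n B) : c ∈ chainsIn R n (A ∩ B) := by
  rw [← chainsIn_inter]
  exact ⟨hA, hB⟩

theorem eq_zero_of_mem_chainsIn_empty {n : ℕ} {c : Chains R n P} (hc : c ∈ chainsIn R n ∅) :
    c = 0 := by
  rw [← Finsupp.support_eq_empty, Finset.eq_empty_iff_forall_notMem]
  intro σ hσ
  exact (Finsupp.mem_supported _ _).1 hc hσ (Set.mem_range_self (stdSimplex.vertex 0))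

/-- A chain in the union of two disjoint open sets is a sum of chains in the two sets, since
simplices are connected. -/
theorem exists_add_of_disjoint_open {n : ℕ} {A B : Set P} (hA : IsOpen A) (hB : IsOpen B)
    (hAB : Disjoint A B) {c : Chains R n P} (hc : c ∈ chainsIn R n (A ∪ B)) :
    ∃ a ∈ chainsIn R n A, ∃ b ∈ chainsIn R n B, a + b = c := by
  refine Submodule.mem_sup.1 ?_
  have h : chainsIn R n (A ∪ B) ≤ chainsIn R n A ⊔ chainsIn R n B := by
    rw [chainsIn, Finsupp.supported_eq_span_single, Submodule.span_le]
    rintro _ ⟨σ, hσ, rfl⟩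
    have : PreconnectedSpace (Simp n) :=
      isPreconnected_iff_preconnectedSpace.1 (isPathConnected_stdSimplex _).isConnected.isPreconnected
    have h1 := (isPreconnected_range σ.continuous).subset_or_subset hA hB hAB hσ
    rcases h1 with h1 | h1
    · exact Submodule.mem_sup_left (mem_chainsIn_single h1 _)
    · exact Submodule.mem_sup_right (mem_chainsIn_single h1 _)
  exact h hc

/-- Let `A` deform, inside itself, into a section over `F` of `pr : P → F`. A cycle in `A` whose
image in `F` bounds, bounds in `A`. -/
theorem exists_bdrySucc_eq_of_homotopic {n : ℕ} {A : Set P} {pr : C(P, F)} {s : C(F, A)}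
    (h : (s.comp (pr.comp (subsetIncl A))).Homotopic (ContinuousMap.id A)) {c : Chains R n P}
    (hcA : c ∈ chainsIn R n A) (hc : bdry R P n c = 0)
    (hpr : chainMap R n pr c ∈ boundaries R n F) :
    ∃ d ∈ chainsIn R (n + 1) A, bdrySucc R P n d = c := by
  obtain ⟨c', rfl⟩ := exists_chainMap_subsetIncl hcA
  have hinj : Function.Injective (subsetIncl A) := Subtype.val_injective
  have hc' : bdry R A n c' = 0 := by
    apply chainMap_injective (R := R) hinj
    rw [← bdry_chainMap, hc, map_zero]
  obtain ⟨d, hd⟩ := chainMap_sub_mem_boundaries h n hc'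
  obtain ⟨e, he⟩ := hpr
  have hd' : bdrySucc R A n d = c' - chainMap R n s (chainMap R n pr (chainMap R n (subsetIncl A) c')) := by
    rw [← chainMap_comp_apply, ← chainMap_comp_apply]
    refine hd.trans ?_
    rw [chainMap_id]
    rfl
  have he' : bdrySucc R F n e = chainMap R n pr (chainMap R n (subsetIncl A) c') := he
  refine ⟨chainMap R (n + 1) (subsetIncl A) (d + chainMap R (n + 1) s e),
    chainMap_mem_chainsIn_range (fun x => x.2) _, ?_⟩
  rw [bdrySucc_chainMap, map_add, hd', bdrySucc_chainMap, he', sub_add_cancel]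

end Subspaces

/-! ### Star-shaped subsets of the sphere -/

section Star

/-- A cone in `ℝ³ ∖ 0` that is star-shaped about the unit vector `m`. -/
structure IsStarCone (C : Set E3) (m : E3) : Prop where
  zero_notMem : (0 : E3) ∉ C
  smul_mem : ∀ x ∈ C, ∀ a : ℝ, 0 < a → a • x ∈ C
  segment_mem : ∀ x ∈ C, ∀ t : ℝ, 0 ≤ t → t ≤ 1 → t • x + (1 - t) • m ∈ C

/-- The part of the sphere in a cone. -/
abbrev sphereCone (C : Set E3) : Set S2 := {x | (x : E3) ∈ C}

theorem unitVector_mem {C : Set E3} {m : E3} (h : IsStarCone C m) {x : E3} (hx : x ∈ C)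
    (hx0 : x ≠ 0) : ((unitVector x hx0 : S2) : E3) ∈ C :=
  h.smul_mem x hx _ (inv_pos.2 (norm_pos_iff.2 hx0))

theorem unitVector_self (x : S2) (hx : (x : E3) ≠ 0) : unitVector (x : E3) hx = x := by
  apply Subtype.ext
  have : ‖(x : E3)‖ = 1 := mem_sphere_zero_iff_norm.1 x.2
  simp [unitVector]

theorem unitVector_congr {x y : E3} (h : x = y) (hx : x ≠ 0) (hy : y ≠ 0) :
    unitVector x hx = unitVector y hy := by
  subst h
  rfl

theorem coe_S2_ne_zero (x : S2) : (x : E3) ≠ 0 := ne_zero_of_mem_unit_sphere x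

/-- The family of radial contractions of the product of a star-shaped part of the sphere with a
space `F`. -/
theorem star_homotopic {F : Type*} [TopologicalSpace F] {C : Set E3} {m : S2}
    (h : IsStarCone C m) (hm : (m : E3) ∈ C) {E : Type*} [TopologicalSpace E] (j : E → S2)
    (hj : Topology.IsEmbedding j) (hjC : ∀ x : S2, (x : E3) ∈ C → x ∈ Set.range j)
    {A : Set (E × F)} (hA : ∀ p, p ∈ A ↔ (j p.1 : E3) ∈ C) :
    ∃ s : C(F, A), (∀ f, j (s f).1.1 = m ∧ (s f).1.2 = f) ∧
      (s.comp ((ContinuousMap.snd : C(E × F, F)).comp (subsetIncl A))).Homotopic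
        (ContinuousMap.id A) := by
  obtain ⟨e, he⟩ := hjC m hm
  have hseg : ∀ p : unitInterval × A,
      (p.1 : ℝ) • (j p.2.1.1 : E3) + (1 - (p.1 : ℝ)) • (m : E3) ∈ C := fun p =>
    h.segment_mem _ ((hA _).1 p.2.2) _ p.1.2.1 p.1.2.2
  have hne : ∀ p : unitInterval × A,
      (p.1 : ℝ) • (j p.2.1.1 : E3) + (1 - (p.1 : ℝ)) • (m : E3) ≠ 0 := fun p h0 =>
    h.zero_notMem (h0 ▸ hseg p)
  have hcont : Continuous fun p : unitInterval × A => unitVector _ (hne p) := by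
    refine continuous_unitVector ?_ hne
    have := hj.continuous
    fun_prop
  have hmem : ∀ p, ((unitVector _ (hne p) : S2) : E3) ∈ C := fun p => unitVector_mem h (hseg p) _
  choose k hk using fun p => hjC _ (hmem p)
  have hkc : Continuous k := by
    rw [hj.continuous_iff]
    exact hcont.congr fun p => (hk p).symm
  refine ⟨⟨fun f => ⟨(e, f), (hA _).2 (by rw [he]; exact hm)⟩, by fun_prop⟩,
    fun f => ⟨he, rfl⟩, ⟨⟨⟨fun p => ⟨(k p, p.2.1.2), (hA _).2 (by rw [hk]; exact hmem p)⟩, ?_⟩,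
      fun x => ?_, fun x => ?_⟩⟩⟩
  · fun_prop
  · apply Subtype.ext
    refine Prod.ext (hj.injective ?_) rfl
    refine (hk _).trans (Eq.trans ?_ he.symm)
    refine (unitVector_congr (by simp) _ (coe_S2_ne_zero m)).trans (unitVector_self m _)
  · apply Subtype.ext
    refine Prod.ext (hj.injective ?_) rfl
    refine (hk _).trans ?_
    refine (unitVector_congr (by simp) _ (coe_S2_ne_zero (j x.1.1))).trans (unitVector_self _ _)

theorem inner_E3 (x y : E3) : inner ℝ x y = x 0 * y 0 + x 1 * y 1 + x 2 * y 2 := by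
  rw [PiLp.inner_apply, Fin.sum_univ_three]
  simp [mul_comm]

@[simp] theorem cross_zero (u v : E3) : cross u v 0 = u 1 * v 2 - u 2 * v 1 := rfl
@[simp] theorem cross_one (u v : E3) : cross u v 1 = u 2 * v 0 - u 0 * v 2 := rfl
@[simp] theorem cross_two (u v : E3) : cross u v 2 = u 0 * v 1 - u 1 * v 0 := rfl

theorem triple_eq (u v w : E3) : triple u v w =
    u 0 * (v 1 * w 2 - v 2 * w 1) + u 1 * (v 2 * w 0 - v 0 * w 2) +
      u 2 * (v 0 * w 1 - v 1 * w 0) := by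
  simp [triple, inner_E3]

theorem E3_ext {x y : E3} (h0 : x 0 = y 0) (h1 : x 1 = y 1) (h2 : x 2 = y 2) : x = y := by
  ext i
  fin_cases i <;> assumption

/-- Cramer's rule. -/
theorem triple_smul_eq (u v w x : E3) : triple u v w • x =
    inner ℝ x u • cross v w + inner ℝ x v • cross w u + inner ℝ x w • cross u v := by
  apply E3_ext <;> simp [triple_eq, inner_E3] <;> ring

theorem inner_self_S2 (q : S2) : inner ℝ (q : E3) (q : E3) = 1 := by
  rw [real_inner_self_eq_norm_sq, mem_sphere_zero_iff_norm.1 q.2, one_pow]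

/-- Unit vectors `a`, `b` that complete `q` to a negatively oriented orthonormal basis. -/
theorem exists_frame (q : S2) : ∃ a b : S2, inner ℝ (a : E3) (q : E3) = 0 ∧
    inner ℝ (b : E3) (q : E3) = 0 ∧ inner ℝ (a : E3) (b : E3) = 0 ∧
    triple (q : E3) a b < 0 ∧
    ∀ x : E3, inner ℝ x (a : E3) = 0 → inner ℝ x (b : E3) = 0 →
      x = inner ℝ x (q : E3) • (q : E3) := by
  have hq := inner_self_S2 q
  obtain ⟨a, haq⟩ : ∃ a : S2, inner ℝ (a : E3) (q : E3) = 0 := by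
    have : ∃ y : E3, y ≠ 0 ∧ inner ℝ y (q : E3) = 0 := by
      rw [inner_E3] at hq
      by_cases h : (q : E3) 0 = 0 ∧ (q : E3) 1 = 0
      · refine ⟨WithLp.toLp 2 ![1, 0, 0], fun h0 => ?_, ?_⟩
        · have := congrArg (fun x : E3 => x 0) h0
          simp at this
        · rw [inner_E3]
          simp [h.1]
      · refine ⟨WithLp.toLp 2 ![(q : E3) 1, -(q : E3) 0, 0], fun h0 => h ?_, ?_⟩
        · have h1 := congrArg (fun x : E3 => x 0) h0
          have h2 := congrArg (fun x : E3 => x 1) h0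
          simp at h1 h2
          exact ⟨h2, h1⟩
        · rw [inner_E3]
          simp
          ring
    obtain ⟨y, hy, hyq⟩ := this
    refine ⟨unitVector y hy, ?_⟩
    change inner ℝ (‖y‖⁻¹ • y) (q : E3) = 0
    rw [inner_smul_left, hyq, mul_zero]
  have haa := inner_self_S2 a
  have hbb : inner ℝ (cross a q) (cross a q) = 1 := by
    have : inner ℝ (cross a q) (cross a q) =
        inner ℝ (a : E3) (a : E3) * inner ℝ (q : E3) (q : E3) - inner ℝ (a : E3) (q : E3) ^ 2 := by
      simp only [inner_E3, cross_zero, cross_one, cross_two]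
      ring
    rw [this, haa, hq, haq]
    norm_num
  have hbn : ‖cross a q‖ = 1 := by
    rw [norm_eq_sqrt_real_inner, hbb, Real.sqrt_one]
  refine ⟨a, ⟨cross a q, mem_sphere_zero_iff_norm.2 hbn⟩, haq, ?_, ?_, ?_, fun x hxa hxb => ?_⟩
  · simp only [inner_E3, cross_zero, cross_one, cross_two]
    ring
  · simp only [inner_E3, cross_zero, cross_one, cross_two]
    ring
  · have : triple (q : E3) a (cross a q) = - inner ℝ (cross a q) (cross a q) := by
      simp only [triple_eq, inner_E3, cross_zero, cross_one, cross_two]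
      ring
    rw [this, hbb]
    norm_num
  · have h1 : triple (q : E3) a (cross a q) = - inner ℝ (cross a q) (cross a q) := by
      simp only [triple_eq, inner_E3, cross_zero, cross_one, cross_two]
      ring
    have h2 := triple_smul_eq (q : E3) a (cross a q) (x - inner ℝ x (q : E3) • (q : E3))
    have h3 : inner ℝ (cross (a : E3) q) (q : E3) = 0 := by
      simp only [inner_E3, cross_zero, cross_one, cross_two]
      ring
    have h3' := (real_inner_comm _ _).trans h3
    have haq' := (real_inner_comm _ _).trans haq
    rw [inner_sub_left, inner_sub_left, inner_sub_left, inner_smul_left, inner_smul_left,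
      inner_smul_left, hxa, hxb, hq, haq', h3', h1, hbb] at h2
    simp at h2
    exact (sub_eq_zero.1 h2).symm

end Star

/-! ### The punctured sphere and its sectors -/

section Existence

/-- The sphere without the antipode of `q`. -/
abbrev PuncturedSphere (q : S2) := {x : S2 // (x : E3) ≠ -(q : E3)}

/-- The point `q` of the sphere without its antipode. -/
def centre (q : S2) : PuncturedSphere q :=
  ⟨q, fun h => coe_S2_ne_zero q (by
    rw [eq_neg_iff_add_eq_zero, ← two_smul ℝ] at h
    simpa using h)⟩

/-- A trivialization of `g : X → S²` over the complement of the antipode of `q`, which is the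
identity on the fibre over `q`. -/
structure PuncturedTrivialization {X : Type*} [TopologicalSpace X] (g : C(X, S2)) (q : S2) where
  /-- The parametrization of the part of `X` over the punctured sphere. -/
  toFun : C(PuncturedSphere q × Fibre g q, X)
  /-- The projection to the fibre. -/
  retract : C({y : X // (g y : E3) ≠ -(q : E3)}, Fibre g q)
  proj_toFun : ∀ p, g (toFun p) = p.1
  toFun_centre : ∀ f, toFun (centre q, f) = f
  retract_toFun : ∀ p h, retract ⟨toFun p, h⟩ = p.2
  toFun_retract : ∀ y, toFun (⟨g y.1, y.2⟩, retract y) = y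

/-- The sector of `ℝ³` where the coordinates `⟨x, a⟩`, `⟨x, b⟩` are not on the ray `b = 0`, `a ≥ 0`. -/
def slitCone (a b : E3) : Set E3 := {x | ¬ (inner ℝ x b = 0 ∧ 0 ≤ inner ℝ x a)}

/-- The open half-space `⟨x, b⟩ > 0`. -/
def halfCone (b : E3) : Set E3 := {x | 0 < inner ℝ x b}

/-- The complement of the ray through `-q`. -/
def rayComplement (q : E3) : Set E3 := {x | ∀ s : ℝ, 0 ≤ s → x ≠ -(s • q)}

theorem isStarCone_slitCone {a b : E3} (hab : inner ℝ a b = 0) (ha : inner ℝ a a = 1) :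
    IsStarCone (slitCone a b) (-a) where
  zero_notMem h := h (by simp)
  smul_mem x hx s hs h := by
    rw [inner_smul_left, inner_smul_left] at h
    refine hx ⟨(mul_eq_zero.1 h.1).resolve_left (by simpa using hs.ne'), ?_⟩
    exact nonneg_of_mul_nonneg_right h.2 hs
  segment_mem x hx t h0 h1 h := by
    simp only [inner_add_left, inner_smul_left, inner_neg_left, hab, ha, conj_trivial] at h
    obtain ⟨h2, h3⟩ := h
    have ht : 0 < t := by
      rcases h0.eq_or_lt with rfl | h0
      · norm_num at h3
      · exact h0
    refine hx ⟨?_, ?_⟩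
    · have : t * inner ℝ x b = 0 := by linarith
      exact (mul_eq_zero.1 this).resolve_left ht.ne'
    · have : 0 ≤ t * inner ℝ x a := by linarith
      exact nonneg_of_mul_nonneg_right this ht

theorem isStarCone_halfCone {b : E3} (hb : inner ℝ b b = 1) : IsStarCone (halfCone b) b where
  zero_notMem h := by simp [halfCone] at h
  smul_mem x hx s hs := by
    change 0 < inner ℝ _ _
    rw [inner_smul_left]
    exact mul_pos hs hx
  segment_mem x hx t h0 h1 := by
    change 0 < inner ℝ _ _
    have hx' : 0 < inner ℝ x b := hx
    simp only [inner_add_left, inner_smul_left, hb, conj_trivial]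
    rcases h0.eq_or_lt with rfl | h0
    · norm_num
    · have := mul_pos h0 hx'
      linarith

theorem isStarCone_rayComplement {q : E3} (hq : q ≠ 0) : IsStarCone (rayComplement q) q where
  zero_notMem h := h 0 le_rfl (by simp)
  smul_mem x hx a ha s hs h := by
    refine hx (a⁻¹ * s) (by positivity) ?_
    rw [mul_smul, ← smul_neg, ← h, smul_smul, inv_mul_cancel₀ ha.ne', one_smul]
  segment_mem x hx t h0 h1 s hs h := by
    rcases h0.eq_or_lt with rfl | h0
    · have : (1 + s) • q = 0 := by
        rw [add_smul]
        simp only [zero_smul, sub_zero, zero_add] at h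
        rw [h]
        simp
      rcases smul_eq_zero.1 this with h2 | h2
      · linarith
      · exact hq h2
    · refine hx (t⁻¹ * (s + (1 - t))) (mul_nonneg (by positivity) (by linarith)) ?_
      rw [mul_smul, ← smul_neg, add_smul, neg_add, ← h, add_neg_cancel_right, smul_smul,
        inv_mul_cancel₀ h0.ne', one_smul]

theorem mem_rayComplement_iff {q x : S2} : (x : E3) ∈ rayComplement q ↔ (x : E3) ≠ -(q : E3) := by
  refine ⟨fun h h0 => h 1 zero_le_one (by rw [one_smul, h0]), fun h s hs h0 => h ?_⟩
  have h1 := congrArg norm h0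
  rw [norm_neg, norm_smul, mem_sphere_zero_iff_norm.1 x.2, mem_sphere_zero_iff_norm.1 q.2,
    Real.norm_of_nonneg hs, mul_one] at h1
  rw [h0, ← h1, one_smul]

/-! ### A relative Künneth theorem -/

section Homology

variable {R : Type*} [CommRing R] {F : Type*} [TopologicalSpace F] {q : S2}

/-- A cycle lying over a star-shaped part of the punctured sphere, whose image in `F` bounds,
bounds over the same part. -/
theorem exists_bdrySucc_eq_of_isStarCone {C : Set E3} {m : S2} (h : IsStarCone C m)
    (hm : (m : E3) ∈ C) (hC : ∀ x : S2, (x : E3) ∈ C → (x : E3) ≠ -(q : E3)) {n : ℕ}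
    {c : Chains R n (PuncturedSphere q × F)}
    (hcC : c ∈ chainsIn R n {p : PuncturedSphere q × F | (p.1.1 : E3) ∈ C})
    (hc : bdry R (PuncturedSphere q × F) n c = 0)
    (hF : chainMap R n ContinuousMap.snd c ∈ boundaries R n F) :
    ∃ d ∈ chainsIn R (n + 1) {p : PuncturedSphere q × F | (p.1.1 : E3) ∈ C},
      bdrySucc R _ n d = c := by
  obtain ⟨s, -, hs⟩ := star_homotopic (F := F) h hm (Subtype.val : PuncturedSphere q → S2)
    Topology.IsEmbedding.subtypeVal (fun x hx => ⟨⟨x, hC x hx⟩, rfl⟩)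
    (A := {p | (p.1.1 : E3) ∈ C}) (fun p => Iff.rfl)
  exact exists_bdrySucc_eq_of_homotopic hs hcC hc hF

/-- The section of the product over a point of the punctured sphere. -/
def productSection (F : Type*) [TopologicalSpace F] (x : PuncturedSphere q) :
    C(F, PuncturedSphere q × F) :=
  (ContinuousMap.const F x).prodMk (ContinuousMap.id F)

theorem snd_productSection (x : PuncturedSphere q) (n : ℕ) (c : Chains R n F) :
    chainMap R n ContinuousMap.snd (chainMap R n (productSection F x) c) = c := by
  rw [← chainMap_comp_apply]
  exact chainMap_id n c

theorem simpMap_apply_eq_zero {m n : ℕ} {f : Fin (m + 1) → Fin (n + 1)} {k : Fin (n + 1)}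
    (h : ∀ j, f j ≠ k) (t : Simp m) : (simpMap f t) k = 0 := by
  have h1 := sum_smul_simpMap (fun i => if i = k then (1 : ℝ) else 0) f t
  simpa [h] using h1

theorem edgeList_mem_supported {W K : Type*} (a b : K) (l : List W) :
    ListChain.edgeList R a b l ∈
      Finsupp.supported R R {l' : List (K × W) | ∀ x ∈ l', x.1 = a ∨ x.1 = b} := by
  rw [ListChain.edgeList_eq_sum]
  refine Submodule.sum_mem _ fun j _ => Submodule.smul_mem _ _ ?_
  refine Finsupp.single_mem_supported _ _ fun x hx => ?_
  rcases List.mem_append.1 hx with hx | hx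
  · obtain ⟨y, -, rfl⟩ := List.mem_map.1 hx
    exact Or.inl rfl
  · obtain ⟨y, -, rfl⟩ := List.mem_map.1 hx
    exact Or.inr rfl

/-- The product of an edge of the triangle with a chain stays where the edge is mapped to. -/
theorem edgeTimes_mem_chainsIn {X : Type*} [TopologicalSpace X] {n : ℕ} {Θ : C(Simp 2 × F, X)}
    {a b k : Fin 3} (ha : a ≠ k) (hb : b ≠ k) {A : Set X}
    (h : ∀ (r : Simp 2) (x : F), r k = 0 → Θ (r, x) ∈ A) (c : Chains R n F) :
    edgeTimes R n Θ a b c ∈ chainsIn R (n + 1) A := by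
  refine linearCombination_mem_chainsIn (fun τ _ => ?_) (mem_chainsIn_univ c)
  have h1 := edgeList_mem_supported (R := R) a b (allVertices n)
  set d := ListChain.edgeList R a b (allVertices n)
  rw [← Finsupp.sum_single d, Finsupp.sum, map_sum]
  refine Submodule.sum_mem _ fun l hl => ?_
  have h2 := (Finsupp.mem_supported _ _).1 h1 hl
  by_cases hlen : l.length = n + 1 + 1
  · obtain ⟨w, rfl⟩ := ListChain.exists_ofFn hlen
    rw [ListChain.realize_single_ofFn]
    refine mem_chainsIn_single ?_ _
    rintro _ ⟨t, rfl⟩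
    refine h _ _ (simpMap_apply_eq_zero (fun j hj => ?_) t)
    rcases h2 (w j) (List.mem_ofFn.2 ⟨j, rfl⟩) with h3 | h3
    · exact ha (h3.symm.trans hj)
    · exact hb (h3.symm.trans hj)
  · rw [ListChain.realize_single_of_length_ne _ hlen]
    exact Submodule.zero_mem _

theorem snd_slice {Θ : C(Simp 2 × F, PuncturedSphere q × F)} (hΘ : ∀ p, (Θ p).2 = p.2)
    (r : Simp 2) (n : ℕ) (c : Chains R n F) :
    chainMap R n ContinuousMap.snd (chainMap R n (slice Θ r) c) = c := by
  rw [← chainMap_comp_apply]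
  refine Eq.trans ?_ (chainMap_id n c)
  congr 2
  ext x
  exact hΘ _

/-- The relative Künneth theorem for the punctured sphere modulo the complement of `q`: every chain
in the product whose boundary avoids the slice over `q` is, modulo boundaries and chains that avoid
this slice, the product of a triangle around `q` with a cycle of `F`. The complement of `q` is
covered by the two slit sectors `A` and `B`, which meet in two half-spaces; the cycle of `F` is the
part over `b > 0` of the intersection of the boundary with `A ∩ B`. -/
theorem exists_triangleTimes {n : ℕ} {a b : S2} (hbq : inner ℝ (b : E3) (q : E3) = 0)
    (hab : inner ℝ (a : E3) (b : E3) = 0)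
    (haq : inner ℝ (a : E3) (q : E3) = 0)
    (hbasis : ∀ x : E3, inner ℝ x (a : E3) = 0 → inner ℝ x (b : E3) = 0 →
      x = inner ℝ x (q : E3) • (q : E3))
    {Θ : C(Simp 2 × F, PuncturedSphere q × F)} (hΘ : ∀ p, (Θ p).2 = p.2)
    (h01 : ∀ (r : Simp 2) (x : F), r 2 = 0 → ((Θ (r, x)).1.1 : E3) ∈ slitCone a b)
    (h02 : ∀ (r : Simp 2) (x : F), r 1 = 0 → ((Θ (r, x)).1.1 : E3) ∈ slitCone a b)
    (h12 : ∀ (r : Simp 2) (x : F), r 0 = 0 → ((Θ (r, x)).1.1 : E3) ∈ slitCone (-(a : E3)) b)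
    (h1 : ∀ x : F, ((Θ (stdSimplex.vertex 1, x)).1.1 : E3) ∈ halfCone b)
    (h2 : ∀ x : F, ((Θ (stdSimplex.vertex 2, x)).1.1 : E3) ∈ halfCone (-(b : E3)))
    {z : Chains R (n + 2) (PuncturedSphere q × F)}
    (hz : bdrySucc R _ (n + 1) z ∈
      chainsIn R (n + 1) {p : PuncturedSphere q × F | p.1.1 ≠ q}) :
    ∃ c : Chains R n F, bdry R F n c = 0 ∧
      z - triangleTimes R n Θ c ∈ boundaries R (n + 2) (PuncturedSphere q × F) ⊔
        chainsIn R (n + 2) {p : PuncturedSphere q × F | p.1.1 ≠ q} := by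
  have haa := inner_self_S2 a
  have hbb := inner_self_S2 b
  have hqq := inner_self_S2 q
  have hna : ((-a : S2) : E3) = -(a : E3) := rfl
  have hnb : ((-b : S2) : E3) = -(b : E3) := rfl
  set A : Set (PuncturedSphere q × F) := {p | (p.1.1 : E3) ∈ slitCone a b} with hA
  set B : Set (PuncturedSphere q × F) := {p | (p.1.1 : E3) ∈ slitCone (-(a : E3)) b} with hB
  set U : Set (PuncturedSphere q × F) := {p | (p.1.1 : E3) ∈ halfCone b} with hU
  set L : Set (PuncturedSphere q × F) := {p | (p.1.1 : E3) ∈ halfCone (-(b : E3))} with hL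
  have hcoord : ∀ y : E3, Continuous fun p : PuncturedSphere q × F => inner ℝ (p.1.1 : E3) y :=
    fun y => by fun_prop
  have hAo : IsOpen A := by
    have : A = ({p : PuncturedSphere q × F | inner ℝ (p.1.1 : E3) (b : E3) = 0} ∩
        {p | 0 ≤ inner ℝ (p.1.1 : E3) (a : E3)})ᶜ := rfl
    rw [this, isOpen_compl_iff]
    exact (isClosed_eq (hcoord _) continuous_const).inter (isClosed_le continuous_const (hcoord _))
  have hBo : IsOpen B := by
    have : B = ({p : PuncturedSphere q × F | inner ℝ (p.1.1 : E3) (b : E3) = 0} ∩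
        {p | 0 ≤ inner ℝ (p.1.1 : E3) (-(a : E3))})ᶜ := rfl
    rw [this, isOpen_compl_iff]
    exact (isClosed_eq (hcoord _) continuous_const).inter (isClosed_le continuous_const (hcoord _))
  have hUo : IsOpen U := isOpen_lt continuous_const (hcoord _)
  have hLo : IsOpen L := isOpen_lt continuous_const (hcoord _)
  have hcover : {p : PuncturedSphere q × F | p.1.1 ≠ q} = A ∪ B := by
    ext p
    simp only [hA, hB, slitCone, Set.mem_ofPred_eq, Set.mem_union, inner_neg_right]
    constructor
    · intro hp
      by_contra! h
      have h3 := hbasis p.1.1 (le_antisymm (by linarith [h.2.2]) h.1.2) h.1.1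
      rcases eq_or_ne (inner ℝ (p.1.1 : E3) (q : E3)) 1 with h4 | h4
      · rw [h4, one_smul] at h3
        exact hp (Subtype.ext h3)
      · have h5 := inner_self_S2 p.1.1
        have h6 : inner ℝ (p.1.1 : E3) (q : E3) * inner ℝ (p.1.1 : E3) (q : E3) = 1 := by
          have h8 := congrArg (fun y : E3 => inner ℝ y y) h3
          simp only [inner_smul_left, inner_smul_right, hqq, h5, conj_trivial, mul_one] at h8
          exact h8.symm
        have h7 : inner ℝ (p.1.1 : E3) (q : E3) = -1 :=
          (mul_self_eq_one_iff.1 h6).resolve_left h4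
        rw [h7, neg_one_smul] at h3
        exact p.1.2 h3
    · intro h hp
      rw [hp, real_inner_comm (q : E3) (b : E3) |>.symm, real_inner_comm (q : E3) (a : E3) |>.symm,
        hbq, haq] at h
      simp at h
  have hUA : U ⊆ A := fun p hp h => hp.ne' h.1
  have hUB : U ⊆ B := fun p hp h => hp.ne' h.1
  have hLA : L ⊆ A := fun p hp h => by
    have : 0 < inner ℝ (p.1.1 : E3) (-(b : E3)) := hp
    rw [inner_neg_right, h.1] at this
    simp at this
  have hLB : L ⊆ B := fun p hp h => by
    have : 0 < inner ℝ (p.1.1 : E3) (-(b : E3)) := hp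
    rw [inner_neg_right, h.1] at this
    simp at this
  have hAB : A ∩ B ⊆ U ∪ L := by
    rintro p ⟨hpA, hpB⟩
    change 0 < inner ℝ (p.1.1 : E3) (b : E3) ∨ 0 < inner ℝ (p.1.1 : E3) (-(b : E3))
    rw [inner_neg_right]
    by_contra! h
    have h0 : inner ℝ (p.1.1 : E3) (b : E3) = 0 := le_antisymm h.1 (by linarith [h.2])
    rcases le_total 0 (inner ℝ (p.1.1 : E3) (a : E3)) with h1 | h1
    · exact hpA ⟨h0, h1⟩
    · refine hpB ⟨h0, ?_⟩
      rw [inner_neg_right]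
      linarith
  have hUL : Disjoint U L := by
    rw [Set.disjoint_left]
    intro p hp hp'
    have : 0 < inner ℝ (p.1.1 : E3) (-(b : E3)) := hp'
    have h0 : 0 < inner ℝ (p.1.1 : E3) (b : E3) := hp
    rw [inner_neg_right] at this
    linarith
  -- None of the sectors contains the antipode of `q`.
  have hne : ∀ (x : S2), (x : E3) = -(q : E3) →
      inner ℝ (x : E3) (a : E3) = 0 ∧ inner ℝ (x : E3) (b : E3) = 0 := fun x hx => by
    rw [hx, inner_neg_left, inner_neg_left, real_inner_comm, haq, real_inner_comm, hbq]
    simp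
  have hnA : ∀ x : S2, (x : E3) ∈ slitCone (a : E3) b → (x : E3) ≠ -(q : E3) := fun x hx h0 =>
    hx ⟨(hne x h0).2, (hne x h0).1.ge⟩
  have hnB : ∀ x : S2, (x : E3) ∈ slitCone (-(a : E3)) b → (x : E3) ≠ -(q : E3) := fun x hx h0 =>
    hx ⟨(hne x h0).2, by rw [inner_neg_right, (hne x h0).1, neg_zero]⟩
  have hnU : ∀ x : S2, (x : E3) ∈ halfCone (b : E3) → (x : E3) ≠ -(q : E3) := fun x hx h0 =>
    hx.ne' (hne x h0).2
  have hnL : ∀ x : S2, (x : E3) ∈ halfCone (-(b : E3)) → (x : E3) ≠ -(q : E3) := fun x hx h0 => by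
    have : 0 < inner ℝ (x : E3) (-(b : E3)) := hx
    rw [inner_neg_right, (hne x h0).2] at this
    simp at this
  have starA := fun (k : ℕ) (c : Chains R k (PuncturedSphere q × F)) =>
    exists_bdrySucc_eq_of_isStarCone (c := c) (m := -a) (isStarCone_slitCone hab haa)
      (by
        intro h
        have h2 := h.2
        rw [hna, inner_neg_left, haa] at h2
        norm_num at h2) hnA
  have starB := fun (k : ℕ) (c : Chains R k (PuncturedSphere q × F)) =>
    exists_bdrySucc_eq_of_isStarCone (c := c) (m := a)
      (by simpa using isStarCone_slitCone (a := -(a : E3)) (b := b)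
            (by rw [inner_neg_left, hab, neg_zero]) (by rw [inner_neg_neg, haa]))
      (by
        intro h
        have h2 := h.2
        rw [inner_neg_right, haa] at h2
        norm_num at h2) hnB
  have starU := fun (k : ℕ) (c : Chains R k (PuncturedSphere q × F)) =>
    exists_bdrySucc_eq_of_isStarCone (c := c) (m := b) (isStarCone_halfCone hbb)
      (by change 0 < inner ℝ _ _; rw [hbb]; norm_num) hnU
  have starL := fun (k : ℕ) (c : Chains R k (PuncturedSphere q × F)) =>
    exists_bdrySucc_eq_of_isStarCone (c := c) (m := -b)
      (isStarCone_halfCone (by rw [hnb, inner_neg_neg, hbb]))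
      (by change 0 < inner ℝ _ _; rw [hnb, inner_neg_neg, hbb]; norm_num) hnL
  have starE := fun (k : ℕ) (c : Chains R k (PuncturedSphere q × F)) =>
    exists_bdrySucc_eq_of_isStarCone (c := c) (m := q) (isStarCone_rayComplement (coe_S2_ne_zero q))
      (mem_rayComplement_iff.2 fun h => (centre q).2 h) (fun x hx => mem_rayComplement_iff.1 hx)
  -- Subdivide until the boundary is a sum of chains in the two sectors.
  rw [hcover] at hz ⊢
  obtain ⟨m, hm⟩ := exists_sd_iterate_mem_sup hAo hBo hz
  obtain ⟨d, e, hde, -, he, -⟩ := sub_sd_iterate z m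
  have he' := he (A ∪ B) hz
  obtain ⟨α, hα, β, hβ, hαβ⟩ := Submodule.mem_sup.1 hm
  rw [← bdrySucc_sd_iterate] at hαβ
  set z' := ((sd R (PuncturedSphere q × F) (n + 2)) ^ m) z with hz'
  have hαβ0 : bdrySucc R _ n α = - bdrySucc R _ n β := by
    have := bdrySucc_bdrySucc n z'
    rw [← hαβ, map_add] at this
    exact eq_neg_of_add_eq_zero_left this
  have hc : bdrySucc R _ n α ∈ chainsIn R n (U ∪ L) := by
    refine chainsIn_mono hAB (mem_chainsIn_inter (bdrySucc_mem_chainsIn hα) ?_)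
    rw [hαβ0]
    exact Submodule.neg_mem _ (bdrySucc_mem_chainsIn hβ)
  obtain ⟨cU, hcU, cL, hcL, hcUL⟩ := exists_add_of_disjoint_open hUo hLo hUL hc
  have hcyc : bdry R _ n cU + bdry R _ n cL = 0 := by
    rw [← map_add, hcUL, bdry_bdrySucc]
  have hcU0 : bdry R _ n cU = 0 := by
    refine eq_zero_of_mem_chainsIn_empty ?_
    rw [← Set.disjoint_iff_inter_eq_empty.1 hUL]
    refine mem_chainsIn_inter (bdry_mem_chainsIn hcU) ?_
    rw [eq_neg_of_add_eq_zero_left hcyc]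
    exact Submodule.neg_mem _ (bdry_mem_chainsIn hcL)
  have hcL0 : bdry R _ n cL = 0 := by rwa [hcU0, zero_add] at hcyc
  set c : Chains R n F := chainMap R n ContinuousMap.snd cU with hcdef
  have hc0 : bdry R F n c = 0 := by rw [hcdef, bdry_chainMap, hcU0, map_zero]
  refine ⟨c, hc0, ?_⟩
  set s1 := chainMap R n (slice Θ (stdSimplex.vertex 1)) c with hs1
  set s2 := chainMap R n (slice Θ (stdSimplex.vertex 2)) c with hs2
  set e01 := edgeTimes R n Θ 0 1 c with he01
  set e02 := edgeTimes R n Θ 0 2 c with he02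
  set e12 := edgeTimes R n Θ 1 2 c with he12
  have m01 : e01 ∈ chainsIn R (n + 1) A :=
    edgeTimes_mem_chainsIn (k := 2) (by decide) (by decide) h01 c
  have m02 : e02 ∈ chainsIn R (n + 1) A :=
    edgeTimes_mem_chainsIn (k := 1) (by decide) (by decide) h02 c
  have m12 : e12 ∈ chainsIn R (n + 1) B :=
    edgeTimes_mem_chainsIn (k := 0) (by decide) (by decide) h12 c
  have b01 := bdry_edgeTimes_of_cycle n Θ 0 1 hc0
  have b02 := bdry_edgeTimes_of_cycle n Θ 0 2 hc0
  have hT := bdry_triangleTimes_of_cycle n Θ hc0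
  -- The two components of the intersection with `A ∩ B` bound separately.
  obtain ⟨εU, hεU, hεU'⟩ := starU n (cU - s1)
    (Submodule.sub_mem _ hcU (chainMap_mem_chainsIn_range h1 c))
    (by rw [map_sub, hcU0, hs1, bdry_chainMap, hc0, map_zero, sub_zero])
    (by rw [map_sub, hs1, snd_slice hΘ, sub_self]; exact Submodule.zero_mem _)
  obtain ⟨εL, hεL, hεL'⟩ := starL n (cL + s2)
    (Submodule.add_mem _ hcL (chainMap_mem_chainsIn_range h2 c))
    (by rw [map_add, hcL0, hs2, bdry_chainMap, hc0, map_zero, add_zero])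
    ⟨chainMap R (n + 1) ContinuousMap.snd α, by
      refine (bdrySucc_chainMap n _ α).trans ?_
      rw [map_add, hs2, snd_slice hΘ, hcdef, ← map_add, add_comm cL, hcUL]⟩
  set α' := α + e02 - e01 - εU - εL with hα'
  set β' := β - e12 + εU + εL with hβ'
  have hα'A : α' ∈ chainsIn R (n + 1) A :=
    Submodule.sub_mem _ (Submodule.sub_mem _ (Submodule.sub_mem _ (Submodule.add_mem _ hα m02) m01)
      (chainsIn_mono hUA hεU)) (chainsIn_mono hLA hεL)
  have hβ'B : β' ∈ chainsIn R (n + 1) B :=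
    Submodule.add_mem _ (Submodule.add_mem _ (Submodule.sub_mem _ hβ m12)
      (chainsIn_mono hUB hεU)) (chainsIn_mono hLB hεL)
  have hsum : bdrySucc R _ (n + 1) (z' - triangleTimes R n Θ c) = α' + β' := by
    rw [map_sub, ← hαβ, hT]
    simp only [hα', hβ', he01, he02, he12]
    abel
  have hα'0 : bdrySucc R _ n α' = 0 := by
    have : bdrySucc R _ n α' = bdrySucc R _ n α + bdrySucc R _ n e02 - bdrySucc R _ n e01 -
        bdrySucc R _ n εU - bdrySucc R _ n εL := by
      simp only [hα', map_sub, map_add]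
    rw [this, hεU', hεL', he01, he02, b01, b02, ← hcUL]
    abel
  have hβ'0 : bdrySucc R _ n β' = 0 := by
    have := bdrySucc_bdrySucc n (z' - triangleTimes R n Θ c)
    rwa [hsum, map_add, hα'0, zero_add] at this
  -- Move the class in `F` of the part over `A` to the part over `B`.
  let u : PuncturedSphere q := ⟨b, hnU b (by change 0 < inner ℝ _ _; rw [hbb]; norm_num)⟩
  set γ := chainMap R (n + 1) (productSection F u) (chainMap R (n + 1) ContinuousMap.snd α') with hγ
  have hub : (u.1 : E3) ∈ halfCone b := by change 0 < inner ℝ _ _; rw [hbb]; norm_num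
  have hγU : γ ∈ chainsIn R (n + 1) U := chainMap_mem_chainsIn_range (fun x => hub) _
  have hγ0 : bdry R _ (n + 1) γ = 0 := by
    rw [hγ, bdry_chainMap, bdry_chainMap]
    change chainMap R n _ (chainMap R n _ (bdrySucc R _ n α')) = 0
    rw [hα'0, map_zero, map_zero]
  have hγF : chainMap R (n + 1) ContinuousMap.snd γ = chainMap R (n + 1) ContinuousMap.snd α' :=
    snd_productSection u _ _
  obtain ⟨dA, hdA, hdA'⟩ := starA (n + 1) (α' - γ)
    (Submodule.sub_mem _ hα'A (chainsIn_mono hUA hγU))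
    (by
      rw [map_sub, hγ0, sub_zero]
      exact hα'0)
    (by rw [map_sub, hγF, sub_self]; exact Submodule.zero_mem _)
  obtain ⟨dB, hdB, hdB'⟩ := starB (n + 1) (β' + γ)
    (Submodule.add_mem _ hβ'B (chainsIn_mono hUB hγU))
    (by
      rw [map_add, hγ0, add_zero]
      exact hβ'0)
    ⟨chainMap R (n + 2) ContinuousMap.snd (z' - triangleTimes R n Θ c), by
      refine (bdrySucc_chainMap (n + 1) _ _).trans ?_
      rw [hsum, (chainMap R (n + 1) ContinuousMap.snd).map_add α' β',
        (chainMap R (n + 1) ContinuousMap.snd).map_add β' γ, hγF]; exact add_comm _ _⟩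
  set ζ := z' - triangleTimes R n Θ c - (dA + dB) with hζ
  have hζ0 : bdrySucc R _ (n + 1) ζ = 0 := by
    rw [hζ, map_sub, hsum, map_add, hdA', hdB']
    abel
  set η := chainMap R (n + 2) (productSection F u) (chainMap R (n + 2) ContinuousMap.snd ζ) with hη
  have hηU : η ∈ chainsIn R (n + 2) U := chainMap_mem_chainsIn_range (fun x => hub) _
  have hη0 : bdrySucc R _ (n + 1) η = 0 := by
    rw [hη, bdrySucc_chainMap, bdrySucc_chainMap, hζ0, map_zero, map_zero]
  obtain ⟨dE, -, hdE'⟩ := starE (n + 2) (ζ - η)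
    (chainsIn_mono (fun p _ => mem_rayComplement_iff.2 p.1.2) (mem_chainsIn_univ _))
    (by
      change bdrySucc R _ (n + 1) _ = 0
      rw [map_sub, hη0, hζ0, sub_zero])
    (by rw [map_sub, hη, snd_productSection, sub_self]; exact Submodule.zero_mem _)
  have hfinal : z - triangleTimes R n Θ c =
      bdrySucc R _ (n + 2) (d + dE) + (e + dA + dB + η) := by
    rw [map_add, hdE', eq_sub_of_add_eq hde.symm, hζ]
    abel
  rw [hfinal]
  refine Submodule.add_mem_sup ⟨d + dE, rfl⟩ ?_
  exact Submodule.add_mem _ (Submodule.add_mem _ (Submodule.add_mem _ he'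
    (chainsIn_mono Set.subset_union_left hdA)) (chainsIn_mono Set.subset_union_right hdB))
    (chainsIn_mono (hUA.trans Set.subset_union_left) hηU)

end Homology

end Existence

/-! ### Spherical triangles -/

section Triangles

theorem sphSimplex_coe {n : ℕ} (v : Fin (n + 1) → E3) (hv : AvoidsZero v) (r : Simp n) :
    ((sphSimplex v hv r : S2) : E3) = ‖∑ i, r i • v i‖⁻¹ • ∑ i, r i • v i := rfl

/-- Coordinates with respect to a positively oriented basis are unique. -/
theorem eq_mul_of_sum_smul_eq {v : Fin 3 → E3} (hv : 0 < triple (v 0) (v 1) (v 2))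
    {r w : Fin 3 → ℝ} {c : ℝ} (h : ∑ i, r i • v i = c • ∑ i, w i • v i) (i : Fin 3) :
    r i = c * w i := by
  have h0 := congrArg (fun x : E3 => x 0) h
  have h1 := congrArg (fun x : E3 => x 1) h
  have h2 := congrArg (fun x : E3 => x 2) h
  simp only [Fin.sum_univ_three, PiLp.add_apply, PiLp.smul_apply, smul_eq_mul] at h0 h1 h2
  have key : (r i - c * w i) * triple (v 0) (v 1) (v 2) = 0 := by
    rw [triple_eq]
    fin_cases i
    · change (r 0 - c * w 0) * _ = 0
      linear_combination h0 * (v 1 1 * v 2 2 - v 1 2 * v 2 1) +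
        h1 * (v 1 2 * v 2 0 - v 1 0 * v 2 2) + h2 * (v 1 0 * v 2 1 - v 1 1 * v 2 0)
    · change (r 1 - c * w 1) * _ = 0
      linear_combination h0 * (v 2 1 * v 0 2 - v 2 2 * v 0 1) +
        h1 * (v 2 2 * v 0 0 - v 2 0 * v 0 2) + h2 * (v 2 0 * v 0 1 - v 2 1 * v 0 0)
    · change (r 2 - c * w 2) * _ = 0
      linear_combination h0 * (v 0 1 * v 1 2 - v 0 2 * v 1 1) +
        h1 * (v 0 2 * v 1 0 - v 0 0 * v 1 2) + h2 * (v 0 0 * v 1 1 - v 0 1 * v 1 0)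
  exact sub_eq_zero.1 ((mul_eq_zero.1 key).resolve_right hv.ne')

theorem eq_smul_of_norm_inv_smul_eq {x y : E3} (hx : x ≠ 0) {s : ℝ}
    (h : ‖x‖⁻¹ • x = s • ‖y‖⁻¹ • y) : x = (s * (‖x‖ * ‖y‖⁻¹)) • y := by
  have h1 := congrArg (fun z : E3 => ‖x‖ • z) h
  simp only [smul_smul] at h1
  rw [mul_inv_cancel₀ (norm_ne_zero_iff.2 hx), one_smul] at h1
  exact h1.trans (by congr 1; ring)

/-- A point of a positive triangle that equals an interior point is an interior point. -/
theorem pos_of_sphSimplex_eq {v : Fin 3 → E3} {hv : AvoidsZero v}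
    (hpos : 0 < triple (v 0) (v 1) (v 2)) {w r : Simp 2} (hw : ∀ i, 0 < w i)
    (h : sphSimplex v hv r = sphSimplex v hv w) (i : Fin 3) : 0 < r i := by
  have h1 : ‖∑ i, r i • v i‖⁻¹ • ∑ i, r i • v i = (1 : ℝ) • ‖∑ i, w i • v i‖⁻¹ • ∑ i, w i • v i := by
    rw [one_smul]
    exact congrArg Subtype.val h
  rw [eq_mul_of_sum_smul_eq hpos (eq_smul_of_norm_inv_smul_eq (hv r) h1) i]
  have h2 := norm_pos_iff.2 (hv r)
  have h3 := norm_pos_iff.2 (hv w)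
  have h4 := hw i
  positivity

/-- A positive triangle does not contain the antipode of an interior point. -/
theorem sphSimplex_ne_neg {v : Fin 3 → E3} {hv : AvoidsZero v}
    (hpos : 0 < triple (v 0) (v 1) (v 2)) {w r : Simp 2} (hw : ∀ i, 0 < w i) :
    ((sphSimplex v hv r : S2) : E3) ≠ -((sphSimplex v hv w : S2) : E3) := by
  intro h
  have h1 : ‖∑ i, r i • v i‖⁻¹ • ∑ i, r i • v i =
      (-1 : ℝ) • ‖∑ i, w i • v i‖⁻¹ • ∑ i, w i • v i := by
    rw [neg_one_smul]
    exact h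
  have h5 := eq_mul_of_sum_smul_eq hpos (eq_smul_of_norm_inv_smul_eq (hv r) h1) 0
  have h2 := norm_pos_iff.2 (hv r)
  have h3 := norm_pos_iff.2 (hv w)
  have h4 := hw 0
  have h6 : 0 ≤ r 0 := r.2.1 0
  have h7 : 0 < ‖∑ i, r i • v i‖ * ‖∑ i, w i • v i‖⁻¹ * w 0 := by positivity
  linarith

end Triangles

/-! ### Existence of the intersection with a fibre -/

section

variable {R : Type*} [CommRing R] {F X Z : Type*} [TopologicalSpace F] [TopologicalSpace X]
  [TopologicalSpace Z]

theorem chainMap_triangleTimes (n : ℕ) (Θ : C(Simp 2 × F, X)) (f : C(X, Z)) (c : Chains R n F) :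
    chainMap R (n + 2) f (triangleTimes R n Θ c) = triangleTimes R n (f.comp Θ) c := by
  refine LinearMap.congr_fun (f := (chainMap R (n + 2) f).comp (triangleTimes R n Θ))
    (g := triangleTimes R n (f.comp Θ)) ?_ c
  ext1 τ
  ext1
  simp only [LinearMap.comp_apply, Finsupp.lsingle_apply, triangleTimes,
    Finsupp.linearCombination_single, one_smul, map_sum, map_smul, chainMap_single,
    ContinuousMap.comp_assoc]

theorem mem_chainsIn_of_chainMap {n : ℕ} {f : C(X, Z)} (hf : Function.Injective f) {A : Set X}
    {B : Set Z} (hAB : ∀ x, f x ∈ B → x ∈ A) {c : Chains R n X}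
    (hc : chainMap R n f c ∈ chainsIn R n B) : c ∈ chainsIn R n A := by
  classical
  intro σ hσ
  have hinj : Function.Injective fun σ : SingSimplex n X => f.comp σ := fun σ σ' h => by
    ext1 r
    exact hf (DFunLike.congr_fun h r)
  have h1 : f.comp σ ∈ (chainMap R n f c).support := by
    change _ ∈ (Finsupp.mapDomain _ c).support
    rw [Finsupp.mapDomain_support_of_injective hinj]
    exact Finset.mem_image_of_mem _ hσ
  have h2 := hc h1
  rintro _ ⟨r, rfl⟩
  exact hAB _ (h2 ⟨r, rfl⟩)

/-- If `g` is trivial over the complement of the antipode of `q`, then every class has an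
intersection with the fibre over `q`. -/
theorem exists_isFibreIntersection {g : C(X, S2)} {q : S2} (Ψ : PuncturedTrivialization g q)
    {n : ℕ} (T : Homology R (n + 2) X) :
    ∃ β : Homology R n (Fibre g q), IsFibreIntersection g q T β := by
  obtain ⟨t, rfl⟩ := Submodule.Quotient.mk_surjective _ T
  have ht : bdrySucc R X (n + 1) t.1 = 0 := t.2
  have hP : IsOpen {x : X | (g x : E3) ≠ -(q : E3)} :=
    isOpen_ne_fun (continuous_subtype_val.comp g.continuous) continuous_const
  have hQ : IsOpen {x : X | g x ≠ q} := isOpen_ne_fun g.continuous continuous_const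
  have hcov : t.1 ∈ chainsIn R (n + 2) ({x : X | (g x : E3) ≠ -(q : E3)} ∪ {x | g x ≠ q}) := by
    refine chainsIn_mono (fun x _ => ?_) (mem_chainsIn_univ t.1)
    by_cases h : g x = q
    · exact Or.inl fun h' => (centre q).2 ((congrArg Subtype.val h).symm.trans h')
    · exact Or.inr h
  -- Up to a boundary, `t` is a chain over the punctured sphere plus a chain off the fibre.
  obtain ⟨m, hm⟩ := exists_sd_iterate_mem_sup hP hQ hcov
  obtain ⟨tU, htU, tV, htV, hsum⟩ := Submodule.mem_sup.1 hm
  obtain ⟨d, e, hde, -, -, he⟩ := sub_sd_iterate t.1 m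
  rw [he ht, add_zero] at hde
  obtain ⟨tU', htU'⟩ := exists_chainMap_subsetIncl htU
  -- The trivialization transports the part over the punctured sphere to the product.
  set φ : C({x : X | (g x : E3) ≠ -(q : E3)}, PuncturedSphere q × Fibre g q) :=
    ⟨fun y => (⟨g y.1, y.2⟩, Ψ.retract y), ((g.continuous.comp continuous_subtype_val).subtype_mk
      _).prodMk Ψ.retract.continuous⟩ with hφ
  have hΨφ : Ψ.toFun.comp φ = subsetIncl _ := by
    ext1 y
    exact Ψ.toFun_retract y
  set z := chainMap R (n + 2) φ tU' with hz
  have hΨz : chainMap R (n + 2) Ψ.toFun z = tU := by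
    rw [hz, ← chainMap_comp_apply, hΨφ, htU']
  have hdU' : bdrySucc R _ (n + 1) tU' ∈
      chainsIn R (n + 1) {y : {x : X | (g x : E3) ≠ -(q : E3)} | g y.1 ≠ q} := by
    refine mem_chainsIn_of_chainMap (f := subsetIncl _) (B := {x : X | g x ≠ q})
      Subtype.val_injective (fun x h => h) ?_
    rw [← bdrySucc_chainMap, htU']
    have h1 : bdrySucc R X (n + 1) (tU + tV) = 0 := by
      rw [hsum, bdrySucc_sd_iterate, ht, map_zero]
    rw [map_add] at h1
    rw [eq_neg_of_add_eq_zero_left h1]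
    exact Submodule.neg_mem _ (bdrySucc_mem_chainsIn htV)
  have hdz : bdrySucc R _ (n + 1) z ∈
      chainsIn R (n + 1) {p : PuncturedSphere q × Fibre g q | p.1.1 ≠ q} := by
    rw [hz, bdrySucc_chainMap]
    exact chainMap_mem_chainsIn (fun y hy => hy) hdU'
  obtain ⟨a, b, haq, hbq, hab, hneg, hbasis⟩ := exists_frame q
  have haa := inner_self_S2 a
  have hbb := inner_self_S2 b
  have hqq := inner_self_S2 q
  have hba : inner ℝ (b : E3) (a : E3) = 0 := by rw [real_inner_comm, hab]
  have hqa : inner ℝ (q : E3) (a : E3) = 0 := by rw [real_inner_comm, haq]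
  have hqb : inner ℝ (q : E3) (b : E3) = 0 := by rw [real_inner_comm, hbq]
  -- A triangle with `q` in its interior; it is positive as the frame `(q, a, b)` is negative.
  set v : Fin 3 → E3 := ![q.1 - a, q.1 + a + b, q.1 + a - b] with hv
  have hy : ∀ r : Simp 2, ∑ i, r i • v i =
      q.1 + (r 1 + r 2 - r 0) • (a : E3) + (r 1 - r 2) • (b : E3) := by
    intro r
    have hs : r 0 + r 1 + r 2 = 1 := by
      have := stdSimplex.sum_eq_one r
      rwa [Fin.sum_univ_three] at this
    have hq1 : (q : E3) = (r 0 + r 1 + r 2) • (q : E3) := by rw [hs, one_smul]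
    rw [Fin.sum_univ_three]
    conv_rhs => rw [hq1]
    simp only [hv, Matrix.cons_val_zero, Matrix.cons_val_one, Matrix.cons_val]
    module
  have hyq : ∀ r : Simp 2, inner ℝ (∑ i, r i • v i) (q : E3) = 1 := fun r => by
    rw [hy]
    simp [inner_add_left, inner_smul_left, haq, hbq]
  have hya : ∀ r : Simp 2, inner ℝ (∑ i, r i • v i) (a : E3) = r 1 + r 2 - r 0 := fun r => by
    rw [hy]
    simp [inner_add_left, inner_smul_left, hqa, hba]
  have hyb : ∀ r : Simp 2, inner ℝ (∑ i, r i • v i) (b : E3) = r 1 - r 2 := fun r => by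
    rw [hy]
    simp [inner_add_left, inner_smul_left, hqb, hab]
  have hav : AvoidsZero v := fun r h => by
    have := hyq r
    rw [h, inner_zero_left] at this
    exact zero_ne_one this
  have hpos : 0 < triple (v 0) (v 1) (v 2) := by
    have : triple (v 0) (v 1) (v 2) = -4 * triple (q : E3) a b := by
      simp only [hv, Matrix.cons_val_zero, Matrix.cons_val_one, Matrix.cons_val, triple_eq,
        PiLp.add_apply, PiLp.sub_apply]
      ring
    rw [this]
    linarith
  set w : Simp 2 := ⟨![1 / 2, 1 / 4, 1 / 4], by
    constructor
    · intro i
      fin_cases i <;> norm_num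
    · rw [Fin.sum_univ_three]
      simp only [Matrix.cons_val_zero, Matrix.cons_val_one, Matrix.cons_val]
      norm_num⟩ with hw
  have hw0 : w 0 = 1 / 2 := rfl
  have hw1 : w 1 = 1 / 4 := rfl
  have hw2 : w 2 = 1 / 4 := rfl
  have hwpos : ∀ i, 0 < w i := fun i => by
    fin_cases i
    · exact hw0 ▸ by norm_num
    · exact hw1 ▸ by norm_num
    · exact hw2 ▸ by norm_num
  have hDw : sphSimplex v hav w = q := by
    have : ∑ i, w i • v i = q := by
      rw [hy, hw0, hw1, hw2]
      norm_num
    exact (unitVector_congr this (hav w) (coe_S2_ne_zero q)).trans (unitVector_self q _)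
  have hne : ∀ r : Simp 2, ((sphSimplex v hav r : S2) : E3) ≠ -(q : E3) := fun r => by
    have := sphSimplex_ne_neg (hv := hav) (r := r) hpos hwpos
    rwa [hDw] at this
  set Θ₀ : C(Simp 2 × Fibre g q, PuncturedSphere q × Fibre g q) :=
    ⟨fun p => (⟨sphSimplex v hav p.1, hne p.1⟩, p.2),
      (((sphSimplex v hav).continuous.comp continuous_fst).subtype_mk _).prodMk continuous_snd⟩
    with hΘ₀
  have hcoe : ∀ (r : Simp 2) (x : Fibre g q) (c : E3), inner ℝ ((Θ₀ (r, x)).1.1 : E3) c =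
      ‖∑ i, r i • v i‖⁻¹ * inner ℝ (∑ i, r i • v i) c := fun r x c => by
    change inner ℝ (‖∑ i, r i • v i‖⁻¹ • ∑ i, r i • v i) c = _
    rw [inner_smul_left]
    rfl
  have hn : ∀ r : Simp 2, 0 < ‖∑ i, r i • v i‖⁻¹ := fun r => inv_pos.2 (norm_pos_iff.2 (hav r))
  have hs : ∀ r : Simp 2, r 0 + r 1 + r 2 = 1 := fun r => by
    have := stdSimplex.sum_eq_one r
    rwa [Fin.sum_univ_three] at this
  -- Two edges avoid the ray `⟨·, b⟩ = 0`, `⟨·, a⟩ ≥ 0`, and the third one avoids the opposite ray.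
  obtain ⟨c, hc, hcz⟩ := exists_triangleTimes (q := q) (n := n) hbq hab haq hbasis (Θ := Θ₀)
    (z := z)
    (fun p => rfl)
    (by
      rintro r x hr ⟨h1, h2⟩
      rw [hcoe, hyb] at h1
      rw [hcoe, hya] at h2
      have h3 := (mul_eq_zero.1 h1).resolve_left (hn r).ne'
      have h4 := nonneg_of_mul_nonneg_right h2 (hn r)
      have := hs r
      linarith)
    (by
      rintro r x hr ⟨h1, h2⟩
      rw [hcoe, hyb] at h1
      rw [hcoe, hya] at h2
      have h3 := (mul_eq_zero.1 h1).resolve_left (hn r).ne'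
      have h4 := nonneg_of_mul_nonneg_right h2 (hn r)
      have := hs r
      linarith)
    (by
      rintro r x hr ⟨h1, h2⟩
      rw [inner_neg_right, hcoe, hya, ← mul_neg] at h2
      have h4 := nonneg_of_mul_nonneg_right h2 (hn r)
      have := hs r
      linarith)
    (by
      intro x
      change 0 < inner ℝ _ _
      rw [hcoe, hyb]
      refine mul_pos (hn _) ?_
      simp [stdSimplex.vertex])
    (by
      intro x
      change 0 < inner ℝ _ _
      rw [inner_neg_right, hcoe, hyb, ← mul_neg]
      refine mul_pos (hn _) ?_
      simp [stdSimplex.vertex])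
    hdz
  refine ⟨homClass ⟨c, hc⟩, v, hav, w, Ψ.toFun.comp Θ₀, t, ⟨c, hc⟩, hpos, hwpos, hDw, ?_, ?_, rfl,
    rfl, ?_⟩
  · intro r x
    exact Ψ.proj_toFun _
  · intro x
    have : Θ₀ (w, x) = (centre q, x) := Prod.ext (Subtype.ext hDw) rfl
    rw [ContinuousMap.comp_apply, this]
    exact Ψ.toFun_centre x
  · have hsplit : t.1 - triangleTimes R n (Ψ.toFun.comp Θ₀) c =
        bdrySucc R X (n + 2) d + (tV + chainMap R (n + 2) Ψ.toFun (z - triangleTimes R n Θ₀ c)) := by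
      rw [map_sub, chainMap_triangleTimes, hΨz, ← hde, ← hsum]
      change t.1 - _ = t.1 - _ + _
      abel
    rw [hsplit]
    refine Submodule.add_mem _ (Submodule.mem_sup_left ⟨d, rfl⟩)
      (Submodule.add_mem _ (Submodule.mem_sup_right htV) ?_)
    obtain ⟨_, ⟨y, rfl⟩, e', he', h'⟩ := Submodule.mem_sup.1 hcz
    rw [← h', map_add]
    refine Submodule.add_mem _ (Submodule.mem_sup_left ⟨chainMap R (n + 3) Ψ.toFun y, ?_⟩)
      (Submodule.mem_sup_right (chainMap_mem_chainsIn (fun p hp => ?_) he'))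
    · exact bdrySucc_chainMap (n + 2) _ _
    · change g (Ψ.toFun p) ≠ q
      rw [Ψ.proj_toFun]
      exact hp

end

/-! ### Cap products and uniqueness of the intersection with a fibre -/

section CapFibre

variable {R : Type*} [CommRing R] {F X Z : Type*} [TopologicalSpace F] [TopologicalSpace X]
  [TopologicalSpace Z]

theorem capChain_single {n : ℕ} (φ : Cochains 2 X) (σ : SingSimplex (n + 2) X) (a : R) :
    capChain R 2 n rfl φ (Finsupp.single σ a) =
      a • Finsupp.single (back 2 n rfl σ) ((φ (front 2 (by omega) σ) : ℤ) : R) := by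
  rw [capChain, Finsupp.linearCombination_single]

/-- A cochain of the sphere that vanishes on the simplices that do not meet `q`. -/
def VanishesOff (κ : Cochains 2 S2) (q : S2) : Prop :=
  ∀ σ : SingSimplex 2 S2, q ∉ Set.range σ → κ σ = 0

theorem capChain_eq_zero_of_mem_chainsIn {κ : Cochains 2 S2} {q : S2} (hκ : VanishesOff κ q)
    {g : C(X, S2)} {n : ℕ} {c : Chains R (n + 2) X}
    (hc : c ∈ chainsIn R (n + 2) {x | g x ≠ q}) :
    capChain R 2 n rfl (cochainMap 2 g κ) c = 0 := by
  refine linearCombination_mem_chainsIn (N := ⊥) (fun σ hσ => ?_) hc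
  have : cochainMap 2 g κ (front 2 (by omega) σ) = 0 := by
    refine hκ _ ?_
    rintro ⟨r, hr⟩
    exact hσ ⟨_, rfl⟩ hr
  rw [this]
  simp

/-- The cap product of a triangle times a simplex with a cochain concentrated at an interior point
of the triangle: all front faces but one are degenerate. -/
theorem capChain_triangleTimes {κ : Cochains 2 S2} {q : S2} (hκ : VanishesOff κ q)
    {g : C(X, S2)} {v : Fin 3 → E3} {hv : AvoidsZero v} (hpos : 0 < triple (v 0) (v 1) (v 2))
    {w : Simp 2} (hw : ∀ i, 0 < w i) (hwq : sphSimplex v hv w = q) {Θ : C(Simp 2 × F, X)}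
    (hΘ : ∀ r x, g (Θ (r, x)) = sphSimplex v hv r) (n : ℕ) (c : Chains R n F) :
    capChain R 2 n rfl (cochainMap 2 g κ) (triangleTimes R n Θ c) =
      (κ (sphSimplex v hv) : R) • chainMap R n (slice Θ (stdSimplex.vertex 2)) c := by
  classical
  refine LinearMap.congr_fun
    (f := (capChain R 2 n rfl (cochainMap 2 g κ)).comp (triangleTimes R n Θ))
    (g := (κ (sphSimplex v hv) : R) • chainMap R n (slice Θ (stdSimplex.vertex 2))) ?_ c
  ext1 τ
  ext1
  simp only [LinearMap.comp_apply, Finsupp.lsingle_apply, triangleTimes, LinearMap.smul_apply,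
    Finsupp.linearCombination_single, one_smul, map_sum, map_smul, chainMap_single, capChain_single]
  have hfront : ∀ i j : Fin (n + 1), cochainMap 2 g κ (front 2 (by omega) (Θ.comp
      ((simpMap (prodVertex₁ i j)).prodMk (τ.comp (simpMap (prodVertex₂ i j)))))) =
      κ ((sphSimplex v hv).comp (simpMap fun k : Fin 3 =>
        prodVertex₁ i j (⟨k, by omega⟩ : Fin (n + 2 + 1)))) := by
    intro i j
    change κ _ = κ _
    congr 1
    ext1 r
    refine (hΘ _ _).trans ?_
    change sphSimplex v hv (((simpMap (prodVertex₁ i j)).comp (simpMap _)) r) = _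
    rw [simpMap_comp]
    rfl
  -- Unless `j = 0`, the front face of a simplex of the product misses the third vertex of the triangle.
  -- So it lies on an edge, off the interior point `q`.
  have hzero : ∀ i j : Fin (n + 1), i ≤ j → j ≠ 0 →
      κ ((sphSimplex v hv).comp (simpMap fun k : Fin 3 =>
        prodVertex₁ i j (⟨k, by omega⟩ : Fin (n + 2 + 1)))) = 0 := by
    intro i j hij hj
    refine hκ _ ?_
    rintro ⟨r, hr⟩
    have h1 := pos_of_sphSimplex_eq hpos hw (hr.trans hwq.symm) 2
    refine h1.ne' ?_
    have hj' : 1 ≤ (j : ℕ) := Nat.one_le_iff_ne_zero.2 fun h => hj (Fin.ext h)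
    change stdSimplex.map _ r 2 = 0
    rw [stdSimplex.map_coe, FunOnFinite.linearMap_apply_apply]
    refine Finset.sum_eq_zero fun k hk => ?_
    have h2 := (Finset.mem_filter.1 hk).2
    exfalso
    unfold prodVertex₁ at h2
    split_ifs at h2 with h3 h4
    · cases h2
    · cases h2
    · have := k.2
      simp only at h4
      omega
  rw [Finset.sum_eq_single 0]
  · rw [Finset.sum_eq_single 0]
    · rw [hfront]
      have h1 : (simpMap fun k : Fin 3 =>
          prodVertex₁ (0 : Fin (n + 1)) 0 (⟨k, by omega⟩ : Fin (n + 2 + 1))) =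
          ContinuousMap.id (Simp 2) := by
        rw [← simpMap_id]
        congr 1
        funext k
        fin_cases k <;> rfl
      have h2 : back 2 n rfl (Θ.comp ((simpMap (prodVertex₁ (0 : Fin (n + 1)) 0)).prodMk
          (τ.comp (simpMap (prodVertex₂ (0 : Fin (n + 1)) 0))))) =
          (slice Θ (stdSimplex.vertex 2)).comp τ := by
        ext1 r
        change Θ (((simpMap _).comp (simpMap _)) r, τ (((simpMap _).comp (simpMap _)) r)) =
          Θ (stdSimplex.vertex 2, τ r)
        rw [simpMap_comp, simpMap_comp]
        have h3 : (prodVertex₁ (0 : Fin (n + 1)) 0 ∘ fun k : Fin (n + 1) =>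
            (⟨k + 2, by omega⟩ : Fin (n + 2 + 1))) = fun _ => 2 := by
          funext k
          simp [prodVertex₁]
        have h4 : (prodVertex₂ (0 : Fin (n + 1)) 0 ∘ fun k : Fin (n + 1) =>
            (⟨k + 2, by omega⟩ : Fin (n + 2 + 1))) = id := by
          funext k
          simp [prodVertex₂]
        rw [h3, h4, simpMap_const_apply, simpMap_id]
        rfl
      rw [h1, h2, ContinuousMap.comp_id]
      simp
    · intro j hj hj0
      rw [hfront, hzero 0 j (Finset.mem_filter.1 hj).2 hj0]
      simp
    · intro h
      exact absurd (Finset.mem_filter.2 ⟨Finset.mem_univ _, le_rfl⟩) h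
  · intro i _ hi
    refine Finset.sum_eq_zero fun j hj => ?_
    have hij := (Finset.mem_filter.1 hj).2
    rw [hfront, hzero i j hij (by
      rintro rfl
      exact hi (le_antisymm hij (Fin.zero_le _)))]
    simp
  · intro h
    exact absurd (Finset.mem_univ _) h

theorem slice_homotopic (Θ : C(Simp 2 × F, X)) (r s : Simp 2) :
    (slice Θ r).Homotopic (slice Θ s) := by
  obtain ⟨γ⟩ : Joined r s := by
    have : PathConnectedSpace (Simp 2) := by infer_instance
    exact PathConnectedSpace.joined r s
  exact ⟨{  toFun := fun p => Θ (γ p.1, p.2)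
            continuous_toFun := by fun_prop
            map_zero_left := fun x => by simp [slice_apply]
            map_one_left := fun x => by simp [slice_apply] }⟩

/-- The cap product with a class concentrated at `q` is the intersection with the fibre over
`q`. -/
theorem cap_eq_of_isFibreIntersection {κ : cocycles 2 S2} {q : S2} (hκ : VanishesOff κ.1 q)
    (hD : ∀ (v : Fin 3 → E3) (hv : AvoidsZero v) (w : Simp 2), 0 < triple (v 0) (v 1) (v 2) →
      (∀ i, 0 < w i) → sphSimplex v hv w = q → κ.1 (sphSimplex v hv) = 1)
    {g : C(X, S2)} {n : ℕ} {T : Homology R (n + 2) X} {β : Homology R n (Fibre g q)}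
    (h : IsFibreIntersection g q T β) :
    cap R n (cohomologyMap 2 g (cohClass κ)) T = homologyMap R n (fibreIncl g q) β := by
  obtain ⟨v, hv, w, Θ, t, b, hpos, hw, hwq, hΘ, hΘw, rfl, rfl, htb⟩ := h
  refine SubQuot.mk_eq_mk.2 ?_
  change capChain R 2 n rfl (cochainMap 2 g κ.1) t.1 - chainMap R n (fibreIncl g q) b.1 ∈ _
  obtain ⟨_, ⟨d, rfl⟩, e, he, hde⟩ := Submodule.mem_sup.1 htb
  have h1 : t.1 = triangleTimes R n Θ b.1 + bdrySucc R X (n + 2) d + e := by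
    rw [eq_add_of_sub_eq hde.symm]
    change bdrySucc R X (n + 2) d + e + _ = _
    abel
  have hcoc : cobdry 2 X (cochainMap 2 g κ.1) = 0 := by
    have : cobdry 2 S2 κ.1 = 0 := κ.2
    rw [cobdry_cochainMap, this, map_zero]
  have hzero : capChain R 3 n rfl (0 : Cochains 3 X) d = 0 := by
    simp [capChain, Finsupp.linearCombination_apply]
  have hsl : slice Θ w = fibreIncl g q := by
    ext1 x
    exact hΘw x
  rw [h1, map_add, map_add, capChain_triangleTimes hκ hpos hw hwq hΘ, hD v hv w hpos hw hwq,
    capChain_eq_zero_of_mem_chainsIn hκ he, capChain_bdry_two, hcoc, hzero, Int.cast_one, one_smul,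
    zero_add, add_zero, add_sub_right_comm, ← hsl]
  exact Submodule.add_mem _ (chainMap_sub_mem_boundaries (slice_homotopic Θ _ _) n b.2) ⟨_, rfl⟩

/-- The intersection with a fibre is unique if `g` is trivial over the complement of the antipode
of `q`. -/
theorem isFibreIntersection_unique {κ : cocycles 2 S2} {q : S2} (hκ : VanishesOff κ.1 q)
    (hD : ∀ (v : Fin 3 → E3) (hv : AvoidsZero v) (w : Simp 2), 0 < triple (v 0) (v 1) (v 2) →
      (∀ i, 0 < w i) → sphSimplex v hv w = q → κ.1 (sphSimplex v hv) = 1)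
    {g : C(X, S2)} (Ψ : PuncturedTrivialization g q)
    {n : ℕ} {T : Homology R (n + 2) X} {β β' : Homology R n (Fibre g q)}
    (h : IsFibreIntersection g q T β) (h' : IsFibreIntersection g q T β') : β = β' := by
  obtain ⟨v, hv, w, Θ, t, b, hpos, hw, hwq, hΘ, hΘw, rfl, rfl, htb⟩ := h
  obtain ⟨v', hv', w', Θ', t', b', hpos', hw', hwq', hΘ', hΘw', htt', rfl, htb'⟩ := h'
  refine SubQuot.mk_eq_mk.2 ?_
  set U : Set X := {x | (g x : E3) ≠ -(q : E3)} with hU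
  have hUo : IsOpen U := isOpen_ne_fun (continuous_subtype_val.comp g.continuous) continuous_const
  have hVo : IsOpen {x : X | g x ≠ q} := isOpen_ne_fun g.continuous continuous_const
  have hcover : ∀ x, x ∈ U ∪ {x : X | g x ≠ q} := fun x => by
    by_cases hx : g x = q
    · exact Or.inl fun h' => (centre q).2 ((congrArg Subtype.val hx).symm.trans h')
    · exact Or.inr hx
  set C := triangleTimes R n Θ b.1 - triangleTimes R n Θ' b'.1 with hC
  -- the two products, as chains over the punctured sphere
  have hmem : ∀ p, Θ p ∈ U := fun p => by
    change (g (Θ (p.1, p.2)) : E3) ≠ _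
    rw [hΘ]
    have h := sphSimplex_ne_neg (hv := hv) (r := p.1) hpos hw
    rwa [hwq] at h
  have hmem' : ∀ p, Θ' p ∈ U := fun p => by
    change (g (Θ' (p.1, p.2)) : E3) ≠ _
    rw [hΘ']
    have h := sphSimplex_ne_neg (hv := hv') (r := p.1) hpos' hw'
    rwa [hwq'] at h
  set ΘU : C(Simp 2 × Fibre g q, U) := ⟨fun p => ⟨Θ p, hmem p⟩, Θ.continuous.subtype_mk _⟩ with hΘU
  set ΘU' : C(Simp 2 × Fibre g q, U) :=
    ⟨fun p => ⟨Θ' p, hmem' p⟩, Θ'.continuous.subtype_mk _⟩ with hΘU'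
  set CU := triangleTimes R n ΘU b.1 - triangleTimes R n ΘU' b'.1 with hCU
  have hCUC : chainMap R (n + 2) (subsetIncl U) CU = C := by
    rw [hCU, map_sub, chainMap_triangleTimes, chainMap_triangleTimes]
    rfl
  have hCmem : C ∈ chainsIn R (n + 2) U := by
    rw [← hCUC]
    exact chainMap_mem_chainsIn_range (fun x => x.2) _
  -- the difference bounds relative to the complement of the fibre
  obtain ⟨d, e, he, hde⟩ : ∃ d e, e ∈ chainsIn R (n + 2) {x : X | g x ≠ q} ∧
      C = bdrySucc R X (n + 2) d + e := by
    obtain ⟨_, ⟨d₁, rfl⟩, e₁, he₁, h₁⟩ := Submodule.mem_sup.1 htb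
    obtain ⟨_, ⟨d₂, rfl⟩, e₂, he₂, h₂⟩ := Submodule.mem_sup.1 htb'
    obtain ⟨d₃, h₃⟩ := SubQuot.mk_eq_mk.1 htt'
    refine ⟨d₂ - d₁ - d₃, e₂ - e₁, Submodule.sub_mem _ he₂ he₁, ?_⟩
    change bdrySucc R X (n + 2) d₁ + e₁ = _ at h₁
    change bdrySucc R X (n + 2) d₂ + e₂ = _ at h₂
    change bdrySucc R X (n + 2) d₃ = _ at h₃
    rw [map_sub, map_sub, h₃, hC, eq_sub_of_add_eq h₁, eq_sub_of_add_eq h₂]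
    abel
  -- subdivision makes it bound over the punctured sphere
  obtain ⟨m, hm⟩ := exists_sd_iterate_mem_sup hUo hVo
    (chainsIn_mono (fun x _ => hcover x) (mem_chainsIn_univ d))
  obtain ⟨dU, hdU, dV, hdV, hsum⟩ := Submodule.mem_sup.1 hm
  obtain ⟨x, y, hxy, hx, hy, -⟩ := sub_sd_iterate C m
  have hyV : y ∈ chainsIn R (n + 2) {x : X | g x ≠ q} := by
    refine hy _ ?_
    rw [hde, map_add, bdrySucc_bdrySucc, zero_add]
    exact bdrySucc_mem_chainsIn he
  set D := x + dU with hDdef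
  have hDU : D ∈ chainsIn R (n + 3) U := Submodule.add_mem _ (hx U hCmem) hdU
  obtain ⟨DU, hDU'⟩ := exists_chainMap_subsetIncl hDU
  set EU := CU - bdrySucc R U (n + 2) DU with hEU
  have hEUV : EU ∈ chainsIn R (n + 2) {x : U | g x.1 ≠ q} := by
    refine mem_chainsIn_of_chainMap (f := subsetIncl U) (B := {x : X | g x ≠ q})
      Subtype.val_injective (fun x h => h) ?_
    have h1 : chainMap R (n + 2) (subsetIncl U) EU =
        y + bdrySucc R X (n + 2) dV + (sd R X (n + 2) ^ m) e := by
      rw [hEU, map_sub, ← bdrySucc_chainMap, hCUC, hDU', hDdef, map_add]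
      have h2 : (sd R X (n + 2) ^ m) C =
          bdrySucc R X (n + 2) (dU + dV) + (sd R X (n + 2) ^ m) e := by
        rw [hsum, bdrySucc_sd_iterate, ← map_add, ← hde]
      have h3 : C = bdrySucc R X (n + 2) x + y + (sd R X (n + 2) ^ m) C := by
        rw [← hxy]
        exact (sub_add_cancel C _).symm
      rw [h3, h2, map_add]
      abel
    rw [h1]
    exact Submodule.add_mem _ (Submodule.add_mem _ hyV (bdrySucc_mem_chainsIn hdV))
      (sd_iterate_mem_chainsIn he m)
  set gU : C(U, S2) := g.comp (subsetIncl U) with hgU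
  have hcoc : cobdry 2 U (cochainMap 2 gU κ.1) = 0 := by
    have : cobdry 2 S2 κ.1 = 0 := κ.2
    rw [cobdry_cochainMap, this, map_zero]
  have hzero : capChain R 3 n rfl (0 : Cochains 3 U) DU = 0 := by
    simp [capChain, Finsupp.linearCombination_apply]
  have hcap : capChain R 2 n rfl (cochainMap 2 gU κ.1) CU =
      bdrySucc R U n (capChain R 2 (n + 1) rfl (cochainMap 2 gU κ.1) DU) := by
    have h1 := capChain_bdry_two R n (cochainMap 2 gU κ.1) DU
    rw [hcoc, hzero, zero_add] at h1
    rw [← h1, ← sub_eq_zero, ← map_sub]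
    exact capChain_eq_zero_of_mem_chainsIn hκ hEUV
  rw [hCU, map_sub, capChain_triangleTimes hκ hpos hw hwq (g := gU) (fun r x => hΘ r x),
    capChain_triangleTimes hκ hpos' hw' hwq' (g := gU) (fun r x => hΘ' r x), hD v hv w hpos hw hwq,
    hD v' hv' w' hpos' hw' hwq', Int.cast_one, one_smul, one_smul] at hcap
  -- retract to the fibre
  have hret : ∀ f : Fibre g q, ∀ h : (g f.1 : E3) ≠ -(q : E3), Ψ.retract ⟨f.1, h⟩ = f := by
    intro f h
    have h1 := Ψ.retract_toFun (centre q, f) (by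
      rw [Ψ.toFun_centre]
      exact h)
    simp only [Ψ.toFun_centre] at h1
    exact h1
  have hhom : ∀ (Θ₁ : C(Simp 2 × Fibre g q, U)) (w₁ : Simp 2), (∀ x, (Θ₁ (w₁, x)).1 = x.1) →
      ((ContinuousMap.id (Fibre g q))).Homotopic
        ((Ψ.retract.comp (slice Θ₁ (stdSimplex.vertex 2)))) := by
    intro Θ₁ w₁ h
    have h1 : Ψ.retract.comp (slice Θ₁ w₁) = ContinuousMap.id _ := by
      ext1 x
      have h2 : Θ₁ (w₁, x) = ⟨x.1, by
          rw [← h x]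
          exact (Θ₁ (w₁, x)).2⟩ := Subtype.ext (h x)
      change Ψ.retract (Θ₁ (w₁, x)) = x
      rw [h2]
      exact hret x _
    rw [← h1]
    exact ContinuousMap.Homotopic.comp (ContinuousMap.Homotopic.refl _) (slice_homotopic Θ₁ _ _)
  have h1 := chainMap_sub_mem_boundaries (hhom ΘU w hΘw) n b.2
  have h2 := chainMap_sub_mem_boundaries (hhom ΘU' w' hΘw') n b'.2
  rw [chainMap_id, chainMap_comp_apply] at h1 h2
  have h3 := congrArg (chainMap R n Ψ.retract) hcap
  rw [map_sub] at h3
  have h4 : b.1 - b'.1 = (chainMap R n Ψ.retract (chainMap R n (slice ΘU (stdSimplex.vertex 2)) b.1) -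
      chainMap R n Ψ.retract (chainMap R n (slice ΘU' (stdSimplex.vertex 2)) b'.1)) -
      ((chainMap R n Ψ.retract (chainMap R n (slice ΘU (stdSimplex.vertex 2)) b.1)) - b.1) +
      ((chainMap R n Ψ.retract (chainMap R n (slice ΘU' (stdSimplex.vertex 2)) b'.1)) - b'.1) := by
    abel
  rw [h4, h3]
  exact Submodule.add_mem _ (Submodule.sub_mem _ ⟨_, bdrySucc_chainMap n _ _⟩ h1) h2

end CapFibre

/-! ### Maps of the sphere induced by linear maps -/

section LinearMaps

/-- The map of the sphere induced by an injective linear map. -/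
noncomputable def sphereMap (L : E3 →L[ℝ] E3) (h : ∀ x, x ≠ 0 → L x ≠ 0) : C(S2, S2) where
  toFun x := unitVector (L x) (h x (coe_S2_ne_zero x))
  continuous_toFun := continuous_unitVector (L.continuous.comp continuous_subtype_val) _

theorem unitVector_smul {x : E3} (hx : x ≠ 0) {c : ℝ} (hc : 0 < c) (h : c • x ≠ 0) :
    unitVector (c • x) h = unitVector x hx := by
  apply Subtype.ext
  simp only [unitVector, norm_smul, Real.norm_eq_abs, abs_of_pos hc, mul_inv, smul_smul]
  congr 1
  field_simp

theorem sphereMap_apply_unitVector (L : E3 →L[ℝ] E3) (h : ∀ x, x ≠ 0 → L x ≠ 0) {x : E3}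
    (hx : x ≠ 0) : sphereMap L h (unitVector x hx) = unitVector (L x) (h x hx) := by
  have hn : 0 < ‖x‖⁻¹ := inv_pos.2 (norm_pos_iff.2 hx)
  have h2 : ‖x‖⁻¹ • L x ≠ 0 := smul_ne_zero hn.ne' (h x hx)
  rw [← unitVector_smul (h x hx) hn h2]
  exact unitVector_congr (map_smul L _ _) (h _ (smul_ne_zero hn.ne' hx)) h2

theorem sphereMap_comp {K L M : E3 →L[ℝ] E3} (hK : ∀ x, x ≠ 0 → K x ≠ 0)
    (hL : ∀ x, x ≠ 0 → L x ≠ 0) (hM : ∀ x, x ≠ 0 → M x ≠ 0) (h : K = L * M) :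
    sphereMap K hK = (sphereMap L hL).comp (sphereMap M hM) := by
  subst h
  ext1 x
  exact (sphereMap_apply_unitVector L hL (hM x (coe_S2_ne_zero x))).symm

theorem sphereMap_one (h : ∀ x : E3, x ≠ 0 → (1 : E3 →L[ℝ] E3) x ≠ 0) :
    sphereMap 1 h = ContinuousMap.id S2 := by
  ext1 x
  exact unitVector_self x (coe_S2_ne_zero x)

theorem sphereMap_homotopic {L M : E3 →L[ℝ] E3} (hL : ∀ x, x ≠ 0 → L x ≠ 0)
    (hM : ∀ x, x ≠ 0 → M x ≠ 0)
    (h : ∀ t : ℝ, 0 ≤ t → t ≤ 1 → ∀ x, (1 - t) • L x + t • M x = 0 → x = 0) :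
    (sphereMap L hL).Homotopic (sphereMap M hM) := by
  have h0 : ∀ p : unitInterval × S2, (1 - (p.1 : ℝ)) • L p.2 + (p.1 : ℝ) • M p.2 ≠ 0 := fun p hp =>
    coe_S2_ne_zero p.2 (h p.1 p.1.2.1 p.1.2.2 _ hp)
  refine ⟨{ toFun := fun p => unitVector _ (h0 p)
            continuous_toFun := continuous_unitVector (by fun_prop) h0
            map_zero_left := fun x => ?_
            map_one_left := fun x => ?_ }⟩
  · exact unitVector_congr (by simp) (h0 (0, x)) (hL x (coe_S2_ne_zero x))
  · exact unitVector_congr (by simp) (h0 (1, x)) (hM x (coe_S2_ne_zero x))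

/-- The linear map of a matrix. -/
noncomputable abbrev matrixMap (M : Matrix (Fin 3) (Fin 3) ℝ) : E3 →L[ℝ] E3 :=
  Matrix.toEuclideanCLM (n := Fin 3) (𝕜 := ℝ) M

theorem matrixMap_apply (M : Matrix (Fin 3) (Fin 3) ℝ) (x : E3) (i : Fin 3) :
    matrixMap M x i = ∑ j, M i j * x j := rfl

/-- The rotation by a right angle in the coordinate plane of `i` and `j`. -/
noncomputable def quarterTurn (i j : Fin 3) : E3 →L[ℝ] E3 :=
  LinearMap.toContinuousLinearMap
    { toFun := fun x => WithLp.toLp 2 fun l => if l = i then -x j else if l = j then x i else x l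
      map_add' := fun x y => by
        ext l
        simp only [PiLp.add_apply]
        split_ifs <;> ring
      map_smul' := fun c x => by
        ext l
        simp only [PiLp.smul_apply, smul_eq_mul, RingHom.id_apply]
        split_ifs <;> ring }

theorem quarterTurn_apply (i j : Fin 3) (x : E3) (l : Fin 3) :
    quarterTurn i j x l = if l = i then -x j else if l = j then x i else x l := rfl

/-- Two negative entries are removed by a rotation: both segments, from the diagonal matrix to a quarter
turn in the plane of the two coordinates and from there to the identity, consist of invertible maps. -/
theorem sphereMap_diagonal_homotopic_of_neg {d : Fin 3 → ℝ} {i j k : Fin 3} (hij : i ≠ j)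
    (hik : i ≠ k) (hjk : j ≠ k) (hi : d i < 0) (hj : d j < 0) (hk : 0 < d k)
    (h : ∀ x, x ≠ 0 → matrixMap (Matrix.diagonal d) x ≠ 0) :
    (sphereMap (matrixMap (Matrix.diagonal d)) h).Homotopic (ContinuousMap.id S2) := by
  have hall : ∀ l : Fin 3, l = i ∨ l = j ∨ l = k := by omega
  have hD : ∀ (x : E3) l, matrixMap (Matrix.diagonal d) x l = d l * x l := fun x l => by
    simp [matrixMap_apply, Matrix.diagonal_apply]
  have hone : ∀ x : E3, x ≠ 0 → (1 : E3 →L[ℝ] E3) x ≠ 0 := fun x hx => hx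
  have hext : ∀ x : E3, x i = 0 → x j = 0 → x k = 0 → x = 0 := by
    intro x h1 h2 h3
    ext l
    rcases hall l with rfl | rfl | rfl <;> assumption
  have hJ1 : ∀ t : ℝ, 0 ≤ t → t ≤ 1 → ∀ x,
      (1 - t) • quarterTurn i j x + t • (1 : E3 →L[ℝ] E3) x = 0 → x = 0 := by
    intro t h0 h1 x hx
    have e := fun l => congrArg (fun y : E3 => y l) hx
    have ei := e i
    have ej := e j
    have ek := e k
    simp only [PiLp.add_apply, PiLp.smul_apply, smul_eq_mul, quarterTurn_apply, if_true,
      hij.symm, if_false, hik.symm, hjk.symm, one_apply_eq_self, PiLp.zero_apply]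
      at ei ej ek
    have hp : 0 < (1 - t) ^ 2 + t ^ 2 := by nlinarith
    refine hext x ?_ ?_ (by linarith)
    · refine (mul_eq_zero.1 (?_ : ((1 - t) ^ 2 + t ^ 2) * x i = 0)).resolve_left hp.ne'
      linear_combination t * ei + (1 - t) * ej
    · refine (mul_eq_zero.1 (?_ : ((1 - t) ^ 2 + t ^ 2) * x j = 0)).resolve_left hp.ne'
      linear_combination t * ej - (1 - t) * ei
  have hJ : ∀ x, x ≠ 0 → quarterTurn i j x ≠ 0 := fun x hx h' =>
    hx (hJ1 0 le_rfl zero_le_one x (by simp [h']))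
  rw [← sphereMap_one hone]
  refine ContinuousMap.Homotopic.trans (sphereMap_homotopic h hJ ?_)
    (sphereMap_homotopic hJ hone hJ1)
  intro t h0 h1 x hx
  have e := fun l => congrArg (fun y : E3 => y l) hx
  have ei := e i
  have ej := e j
  have ek := e k
  simp only [PiLp.add_apply, PiLp.smul_apply, smul_eq_mul, quarterTurn_apply, if_true,
    hij.symm, if_false, hik.symm, hjk.symm, hD, PiLp.zero_apply] at ei ej ek
  have hij' := mul_pos_of_neg_of_neg hi hj
  have hp : 0 < (1 - t) ^ 2 * (d i * d j) + t ^ 2 := by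
    rcases h1.eq_or_lt with rfl | h1
    · norm_num
    · have : 0 < (1 - t) ^ 2 * (d i * d j) := mul_pos (pow_pos (by linarith) 2) hij'
      positivity
  have hpk : 0 < (1 - t) * d k + t := by
    rcases h0.eq_or_lt with rfl | h0
    · linarith
    · have : 0 ≤ (1 - t) * d k := mul_nonneg (by linarith) hk.le
      linarith
  refine hext x ?_ ?_ ?_
  · refine (mul_eq_zero.1 (?_ : ((1 - t) ^ 2 * (d i * d j) + t ^ 2) * x i = 0)).resolve_left hp.ne'
    linear_combination (1 - t) * d j * ei + t * ej
  · refine (mul_eq_zero.1 (?_ : ((1 - t) ^ 2 * (d i * d j) + t ^ 2) * x j = 0)).resolve_left hp.ne'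
    linear_combination (1 - t) * d i * ej - t * ei
  · refine (mul_eq_zero.1 (?_ : ((1 - t) * d k + t) * x k = 0)).resolve_left hpk.ne'
    linear_combination ek

theorem sphereMap_diagonal_homotopic_of_pos {d : Fin 3 → ℝ} (hd : ∀ i, 0 < d i)
    (h : ∀ x, x ≠ 0 → matrixMap (Matrix.diagonal d) x ≠ 0) :
    (sphereMap (matrixMap (Matrix.diagonal d)) h).Homotopic (ContinuousMap.id S2) := by
  have hone : ∀ x : E3, x ≠ 0 → (1 : E3 →L[ℝ] E3) x ≠ 0 := fun x hx => hx
  rw [← sphereMap_one hone]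
  refine sphereMap_homotopic h hone fun t h0 h1 x hx => ?_
  ext l
  have e := congrArg (fun y : E3 => y l) hx
  simp only [PiLp.add_apply, PiLp.smul_apply, smul_eq_mul, matrixMap_apply, Matrix.diagonal_apply,
    one_apply_eq_self, PiLp.zero_apply, ite_mul, zero_mul, Finset.sum_ite_eq,
    Finset.mem_univ, if_true] at e
  have hp : 0 < (1 - t) * d l + t := by
    rcases h0.eq_or_lt with rfl | h0
    · simpa using hd l
    · have : 0 ≤ (1 - t) * d l := mul_nonneg (by linarith) (hd l).le
      linarith
  refine (mul_eq_zero.1 (?_ : ((1 - t) * d l + t) * x l = 0)).resolve_left hp.ne'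
  linear_combination e

theorem sphereMap_diagonal_homotopic {d : Fin 3 → ℝ} (hd : 0 < d 0 * d 1 * d 2)
    (h : ∀ x, x ≠ 0 → matrixMap (Matrix.diagonal d) x ≠ 0) :
    (sphereMap (matrixMap (Matrix.diagonal d)) h).Homotopic (ContinuousMap.id S2) := by
  rcases lt_trichotomy (d 0) 0 with h0 | h0 | h0
  · rcases lt_trichotomy (d 1) 0 with h1 | h1 | h1
    · have h2 : 0 < d 2 := pos_of_mul_pos_right hd (mul_pos_of_neg_of_neg h0 h1).le
      exact sphereMap_diagonal_homotopic_of_neg (i := 0) (j := 1) (k := 2) (by decide) (by decide)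
        (by decide) h0 h1 h2 h
    · simp [h1] at hd
    · have h2 : d 2 < 0 := by
        by_contra! h2
        have := mul_nonpos_of_nonpos_of_nonneg (mul_neg_of_neg_of_pos h0 h1).le h2
        linarith
      exact sphereMap_diagonal_homotopic_of_neg (i := 0) (j := 2) (k := 1) (by decide) (by decide)
        (by decide) h0 h2 h1 h
  · simp [h0] at hd
  · rcases lt_trichotomy (d 1) 0 with h1 | h1 | h1
    · have h2 : d 2 < 0 := by
        by_contra! h2
        have := mul_nonpos_of_nonpos_of_nonneg (mul_neg_of_pos_of_neg h0 h1).le h2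
        linarith
      exact sphereMap_diagonal_homotopic_of_neg (i := 1) (j := 2) (k := 0) (by decide) (by decide)
        (by decide) h1 h2 h0 h
    · simp [h1] at hd
    · have h2 : 0 < d 2 := pos_of_mul_pos_right hd (mul_pos h0 h1).le
      exact sphereMap_diagonal_homotopic_of_pos (fun i => by fin_cases i <;> assumption) h

theorem neg_ne_zero_of_ne_zero (x : E3) (hx : x ≠ 0) : (-1 : E3 →L[ℝ] E3) x ≠ 0 := by
  simpa using hx

theorem sphereMap_transvection_homotopic (t : Matrix.TransvectionStruct (Fin 3) ℝ)
    (h : ∀ x, x ≠ 0 → matrixMap t.toMatrix x ≠ 0) :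
    (sphereMap (matrixMap t.toMatrix) h).Homotopic (ContinuousMap.id S2) := by
  have hone : ∀ x : E3, x ≠ 0 → (1 : E3 →L[ℝ] E3) x ≠ 0 := fun x hx => hx
  rw [← sphereMap_one hone]
  refine sphereMap_homotopic _ hone fun s h0 h1 x hx => ?_
  have e : ∀ l, x l + (1 - s) * (if l = t.i then t.c * x t.j else 0) = 0 := by
    intro l
    have := congrArg (fun y : E3 => y l) hx
    have hT : matrixMap t.toMatrix x l = x l + (if l = t.i then t.c * x t.j else 0) := by
      rw [matrixMap_apply]
      simp only [Matrix.TransvectionStruct.toMatrix, Matrix.transvection, Matrix.add_apply,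
        add_mul, Finset.sum_add_distrib, Matrix.one_apply, Matrix.single_apply]
      simp only [ite_mul, one_mul, zero_mul, Finset.sum_ite_eq, Finset.mem_univ, if_true]
      congr 1
      by_cases hl : l = t.i
      · simp [hl]
      · simp [hl, Ne.symm hl]
    simp only [PiLp.add_apply, PiLp.smul_apply, smul_eq_mul, hT, one_apply_eq_self,
      PiLp.zero_apply] at this
    linear_combination this
  have hj : x t.j = 0 := by
    have := e t.j
    rwa [if_neg t.hij.symm, mul_zero, add_zero] at this
  ext l
  have := e l
  rwa [hj, mul_zero, ite_self, mul_zero, add_zero] at this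

theorem neg_one_mul_neg_self (L : E3 →L[ℝ] E3) : -1 * -L = L := by
  ext x l
  simp

theorem sphereMap_neg_one_comp_self :
    (sphereMap (-1) neg_ne_zero_of_ne_zero).comp (sphereMap (-1) neg_ne_zero_of_ne_zero) =
      ContinuousMap.id S2 :=
  (sphereMap_comp (fun _ hx => hx) _ _ (neg_one_mul_neg_self 1).symm).symm.trans (sphereMap_one _)

/-- A nonsingular matrix is a product of transvections and a diagonal matrix, so up to homotopy its map
of the sphere depends on the sign of the determinant only. -/
theorem sphereMap_matrix_homotopic (M : Matrix (Fin 3) (Fin 3) ℝ) (hM : M.det ≠ 0) :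
    ∃ h : ∀ x, x ≠ 0 → matrixMap M x ≠ 0,
      (0 < M.det → (sphereMap (matrixMap M) h).Homotopic (ContinuousMap.id S2)) ∧
      (M.det < 0 → (sphereMap (matrixMap M) h).Homotopic
        (sphereMap (-1) neg_ne_zero_of_ne_zero)) := by
  have hne : ∀ M : Matrix (Fin 3) (Fin 3) ℝ, M.det ≠ 0 → ∀ x, x ≠ 0 → matrixMap M x ≠ 0 := by
    intro M hM x hx h
    apply hx
    have h1 := Matrix.eq_zero_of_mulVec_eq_zero (v := (x : Fin 3 → ℝ)) hM (by
      funext i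
      have := congrArg (fun y : E3 => y i) h
      rw [matrixMap_apply] at this
      exact this)
    ext i
    exact congrFun h1 i
  have hone : ∀ x : E3, x ≠ 0 → (1 : E3 →L[ℝ] E3) x ≠ 0 := fun x hx => hx
  refine Matrix.diagonal_transvection_induction_of_det_ne_zero (fun M => ∃ h : ∀ x, x ≠ 0 → matrixMap M x ≠ 0,
      (0 < M.det → (sphereMap (matrixMap M) h).Homotopic (ContinuousMap.id S2)) ∧
      (M.det < 0 → (sphereMap (matrixMap M) h).Homotopic
        (sphereMap (-1) neg_ne_zero_of_ne_zero))) M hM ?_ ?_ ?_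
  · intro d hd
    refine ⟨hne _ hd, fun h => ?_, fun h => ?_⟩
    · rw [Matrix.det_diagonal, Fin.prod_univ_three] at h
      exact sphereMap_diagonal_homotopic h _
    · rw [Matrix.det_diagonal, Fin.prod_univ_three] at h
      have hd' : 0 < (-d) 0 * (-d) 1 * (-d) 2 := by
        simp only [Pi.neg_apply]
        linarith
      have h1 : (Matrix.diagonal (-d)).det ≠ 0 := by
        rw [Matrix.det_diagonal, Fin.prod_univ_three]
        exact hd'.ne'
      have h2 := sphereMap_diagonal_homotopic hd' (hne _ h1)
      have h3 : matrixMap (Matrix.diagonal d) = -1 * matrixMap (Matrix.diagonal (-d)) := by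
        have h4 : matrixMap (-Matrix.diagonal d) = -matrixMap (Matrix.diagonal d) := map_neg _ _
        have h5 : Matrix.diagonal (-d) = -Matrix.diagonal d := (Matrix.diagonal_neg d).symm
        rw [h5, h4]
        exact (neg_one_mul_neg_self _).symm
      have h4 : sphereMap (matrixMap (Matrix.diagonal d)) (hne _ hd) =
          (sphereMap (-1) neg_ne_zero_of_ne_zero).comp
            (sphereMap (matrixMap (Matrix.diagonal (-d))) (hne _ h1)) :=
        sphereMap_comp _ _ _ h3
      rw [h4]
      have h5 := ContinuousMap.Homotopic.comp
        (ContinuousMap.Homotopic.refl (sphereMap (-1) neg_ne_zero_of_ne_zero)) h2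
      rwa [ContinuousMap.comp_id] at h5
  · intro t
    have ht : t.toMatrix.det = 1 := t.det
    have h0 : t.toMatrix.det ≠ 0 := by
      rw [ht]
      exact one_ne_zero
    refine ⟨hne _ h0, fun _ => sphereMap_transvection_homotopic t _, fun h => ?_⟩
    rw [ht] at h
    exact absurd h (not_lt.2 zero_le_one)
  · rintro A B hA hB ⟨hA', hA1, hA2⟩ ⟨hB', hB1, hB2⟩
    have hAB : (A * B).det ≠ 0 := by
      rw [Matrix.det_mul]
      exact mul_ne_zero hA hB
    have hmul : matrixMap (A * B) = matrixMap A * matrixMap B := map_mul _ A B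
    have hcomp : sphereMap (matrixMap (A * B)) (hne _ hAB) =
        (sphereMap (matrixMap A) hA').comp (sphereMap (matrixMap B) hB') :=
      sphereMap_comp _ _ _ hmul
    have hneg := sphereMap_neg_one_comp_self
    refine ⟨hne _ hAB, fun h => ?_, fun h => ?_⟩
    · rw [Matrix.det_mul] at h
      rw [hcomp]
      rcases hA.lt_or_gt with h0 | h0
      · rw [← hneg]
        exact ContinuousMap.Homotopic.comp (hA2 h0) (hB2 (by
          by_contra! h'
          have := mul_nonpos_of_nonpos_of_nonneg h0.le h'
          linarith))
      · have := ContinuousMap.Homotopic.comp (hA1 h0) (hB1 (pos_of_mul_pos_right h h0.le))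
        rwa [ContinuousMap.comp_id] at this
    · rw [Matrix.det_mul] at h
      rw [hcomp]
      rcases hA.lt_or_gt with h0 | h0
      · have := ContinuousMap.Homotopic.comp (hA2 h0) (hB1 (by
          by_contra! h'
          have := mul_nonneg_of_nonpos_of_nonpos h0.le h'
          linarith))
        rwa [ContinuousMap.comp_id] at this
      · have := ContinuousMap.Homotopic.comp (hA1 h0) (hB2 (by
          by_contra! h'
          have := mul_nonneg h0.le h'
          linarith))
        rwa [ContinuousMap.id_comp] at this

/-- The map of the sphere induced by an orientation-preserving linear map is homotopic to the
identity. -/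
theorem sphereMap_homotopic_id {L : E3 →L[ℝ] E3}
    (hL : 0 < triple (L (EuclideanSpace.single 0 1)) (L (EuclideanSpace.single 1 1))
      (L (EuclideanSpace.single 2 1))) :
    ∃ h : ∀ x, x ≠ 0 → L x ≠ 0, (sphereMap L h).Homotopic (ContinuousMap.id S2) := by
  set M : Matrix (Fin 3) (Fin 3) ℝ :=
    (Matrix.toEuclideanCLM (n := Fin 3) (𝕜 := ℝ)).symm L with hMdef
  have hM : matrixMap M = L := (Matrix.toEuclideanCLM (n := Fin 3) (𝕜 := ℝ)).apply_symm_apply L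
  have hentry : ∀ i j, L (EuclideanSpace.single j 1) i = M i j := fun i j => by
    rw [← hM, matrixMap_apply]
    simp
  have hdet : M.det = triple (L (EuclideanSpace.single 0 1)) (L (EuclideanSpace.single 1 1))
      (L (EuclideanSpace.single 2 1)) := by
    rw [triple_eq, Matrix.det_fin_three]
    simp only [hentry]
    ring
  rw [← hdet] at hL
  obtain ⟨h, h1, -⟩ := sphereMap_matrix_homotopic M hL.ne'
  rw [← hM]
  exact ⟨h, h1 hL⟩

end LinearMaps

/-! ### Homology in low degrees -/

section LowDegree

variable {R : Type*} [CommRing R] {X : Type*} [TopologicalSpace X]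

/-- The augmentation of a chain: the sum of its coefficients. -/
noncomputable def augmentation (R : Type*) [CommRing R] (n : ℕ) (X : Type*) [TopologicalSpace X] :
    Chains R n X →ₗ[R] R :=
  Finsupp.linearCombination R fun _ => (1 : R)

theorem augmentation_chainMap {Z : Type*} [TopologicalSpace Z] (n : ℕ) (f : C(X, Z))
    (c : Chains R n X) : augmentation R n Z (chainMap R n f c) = augmentation R n X c := by
  refine LinearMap.congr_fun (f := (augmentation R n Z).comp (chainMap R n f))
    (g := augmentation R n X) ?_ c
  ext1 σ
  ext1
  simp [chainMap_single, augmentation]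

theorem augmentation_bdrySucc (c : Chains R 1 X) :
    augmentation R 0 X (bdrySucc R X 0 c) = 0 := by
  refine LinearMap.congr_fun (f := (augmentation R 0 X).comp (bdrySucc R X 0)) (g := 0) ?_ c
  ext1 σ
  ext1
  simp [bdrySucc, bdrySimplex, augmentation]

/-- The singular simplex of a path. -/
noncomputable def pathSimplex {x y : X} (γ : Path x y) : SingSimplex 1 X where
  toFun t := γ ⟨t 1, stdSimplex.zero_le t 1, stdSimplex.le_one t 1⟩
  continuous_toFun := γ.continuous.comp
    (Continuous.subtype_mk ((continuous_apply 1).comp continuous_subtype_val) _)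

/-- The singular simplex of a point. -/
def pointSimplex (x : X) : SingSimplex 0 X := ContinuousMap.const _ x

theorem bdrySucc_one_single (γ : SingSimplex 1 X) :
    bdrySucc R X 0 (Finsupp.single γ 1) =
      Finsupp.single (pointSimplex (γ (stdSimplex.vertex 1))) 1 -
        Finsupp.single (pointSimplex (γ (stdSimplex.vertex 0))) 1 := by
  have h : ∀ i : Fin 2, face i γ = pointSimplex (γ (stdSimplex.vertex (i.succAbove 0))) := by
    intro i
    ext1 r
    change γ (simpMap _ r) = γ _
    congr 1
    rw [← simpMap_const_apply (m := 0) (i.succAbove 0) r]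
    congr 2
    funext k
    fin_cases k
    rfl
  rw [bdrySucc, Finsupp.linearCombination_single, one_smul, bdrySimplex, Fin.sum_univ_two, h, h]
  simp [sub_eq_add_neg]

theorem bdrySucc_pathSimplex {x y : X} (γ : Path x y) :
    bdrySucc R X 0 (Finsupp.single (pathSimplex γ) 1) =
      Finsupp.single (pointSimplex y) 1 - Finsupp.single (pointSimplex x) 1 := by
  rw [bdrySucc_one_single]
  have h0 : pathSimplex γ (stdSimplex.vertex 0) = x := by
    refine Eq.trans ?_ γ.source
    change γ _ = _
    congr 1
  have h1 : pathSimplex γ (stdSimplex.vertex 1) = y := by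
    refine Eq.trans ?_ γ.target
    change γ _ = _
    congr 1
  rw [h0, h1]

/-- A 0-chain of augmentation zero bounds: join its points to a base point. -/
theorem exists_bdrySucc_eq_of_augmentation_eq_zero [PathConnectedSpace X] {c : Chains R 0 X}
    (hc : augmentation R 0 X c = 0) : ∃ d, bdrySucc R X 0 d = c := by
  obtain ⟨x₀⟩ := PathConnectedSpace.nonempty (X := X)
  have γ := fun x => (PathConnectedSpace.joined x₀ x).somePath
  refine ⟨Finsupp.linearCombination R (fun σ : SingSimplex 0 X =>
    Finsupp.single (pathSimplex (γ (σ (stdSimplex.vertex 0)))) (1 : R)) c, ?_⟩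
  have h : ∀ c : Chains R 0 X, bdrySucc R X 0 (Finsupp.linearCombination R
      (fun σ : SingSimplex 0 X =>
        Finsupp.single (pathSimplex (γ (σ (stdSimplex.vertex 0)))) (1 : R)) c) =
      c - augmentation R 0 X c • Finsupp.single (pointSimplex x₀) (1 : R) := by
    intro c
    refine LinearMap.congr_fun (f := (bdrySucc R X 0).comp (Finsupp.linearCombination R
      (fun σ : SingSimplex 0 X =>
        Finsupp.single (pathSimplex (γ (σ (stdSimplex.vertex 0)))) (1 : R))))
      (g := LinearMap.id - (augmentation R 0 X).smulRight
        (Finsupp.single (pointSimplex x₀) (1 : R))) ?_ c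
    ext1 σ
    ext1
    have hσ : pointSimplex (σ (stdSimplex.vertex 0)) = σ := by
      ext1 r
      change σ _ = σ _
      congr 1
      rw [← simpMap_const_apply (m := 0) 0 r]
      have : (fun _ => (0 : Fin 1)) = (id : Fin 1 → Fin 1) := by
        funext k
        fin_cases k
        rfl
      rw [this, simpMap_id]
      rfl
    simp [bdrySucc_pathSimplex, hσ, augmentation]
  rw [h, hc, zero_smul, sub_zero]

theorem exists_bdrySucc_eq_of_contractible {A : Set X} {x₀ : A}
    (h : (ContinuousMap.const A x₀).Homotopic (ContinuousMap.id A)) {c : Chains R 1 X}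
    (hcA : c ∈ chainsIn R 1 A) (hc : bdrySucc R X 0 c = 0) : ∃ d, bdrySucc R X 1 d = c := by
  obtain ⟨c', rfl⟩ := exists_chainMap_subsetIncl hcA
  have hinj : Function.Injective (subsetIncl A) := Subtype.val_injective
  have hc' : bdrySucc R A 0 c' = 0 := by
    apply chainMap_injective (R := R) hinj
    rw [← bdrySucc_chainMap, hc, map_zero]
  obtain ⟨d, hd⟩ := chainMap_sub_mem_boundaries h 1 hc'
  have hconst : chainMap R 1 (ContinuousMap.const A x₀) c' =
      bdrySucc R A 1 (augmentation R 1 A c' • Finsupp.single (ContinuousMap.const _ x₀) 1) := by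
    refine LinearMap.congr_fun (f := chainMap R 1 (ContinuousMap.const A x₀))
      (g := (bdrySucc R A 1).comp ((augmentation R 1 A).smulRight
        (Finsupp.single (ContinuousMap.const _ x₀) 1))) ?_ c'
    ext1 σ
    ext1
    have hf : ∀ i : Fin 3, face i (ContinuousMap.const (Simp 2) x₀) =
        ContinuousMap.const (Simp 1) x₀ := fun i => rfl
    have hg : (ContinuousMap.const A x₀).comp σ = ContinuousMap.const (Simp 1) x₀ := rfl
    simp [chainMap_single, augmentation, bdrySucc, bdrySimplex, Fin.sum_univ_three, hf, hg]
  have hd' : bdrySucc R A 1 d = c' - chainMap R 1 (ContinuousMap.const A x₀) c' := by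
    refine hd.trans ?_
    rw [chainMap_id]
  refine ⟨chainMap R 2 (subsetIncl A)
    (d + augmentation R 1 A c' • Finsupp.single (ContinuousMap.const _ x₀) 1), ?_⟩
  rw [bdrySucc_chainMap, map_add, hd', ← hconst, sub_add_cancel]

end LowDegree

/-! ### The first homology of the sphere -/

section SphereHomology

theorem star_contractible {C : Set E3} {m : S2} (h : IsStarCone C m) (hm : (m : E3) ∈ C) :
    (ContinuousMap.const (sphereCone C) (⟨m, hm⟩ : sphereCone C)).Homotopic
      (ContinuousMap.id (sphereCone C)) := by
  have hseg : ∀ p : unitInterval × sphereCone C,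
      (p.1 : ℝ) • (p.2.1 : E3) + (1 - (p.1 : ℝ)) • (m : E3) ∈ C := fun p =>
    h.segment_mem _ p.2.2 _ p.1.2.1 p.1.2.2
  have hne : ∀ p : unitInterval × sphereCone C,
      (p.1 : ℝ) • (p.2.1 : E3) + (1 - (p.1 : ℝ)) • (m : E3) ≠ 0 := fun p h0 =>
    h.zero_notMem (h0 ▸ hseg p)
  refine ⟨{ toFun := fun p => ⟨unitVector _ (hne p), unitVector_mem h (hseg p) _⟩
            continuous_toFun :=
              (continuous_unitVector (by fun_prop) hne).subtype_mk _
            map_zero_left := fun x => Subtype.ext ?_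
            map_one_left := fun x => Subtype.ext ?_ }⟩
  · exact (unitVector_congr (by simp) (hne (0, x)) (coe_S2_ne_zero m)).trans (unitVector_self m _)
  · exact (unitVector_congr (by simp) (hne (1, x)) (coe_S2_ne_zero x.1)).trans
      (unitVector_self x.1 _)

/-- The sphere without two antipodal points is path connected, as the complement of a line in `ℝ³` is. -/
theorem joined_of_ne {q x y : S2} (hx : x ≠ q ∧ x ≠ -q) (hy : y ≠ q ∧ y ≠ -q) :
    ∃ γ : Path x y, ∀ t, γ t ≠ q ∧ γ t ≠ -q := by
  have hspan : ∀ z : S2, z ≠ q ∧ z ≠ -q → (z : E3) ∈ ((Submodule.span ℝ {(q : E3)} : Set E3))ᶜ := by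
    intro z hz h
    obtain ⟨c, hc⟩ := Submodule.mem_span_singleton.1 h
    have h1 := congrArg norm hc
    rw [norm_smul, mem_sphere_zero_iff_norm.1 z.2, mem_sphere_zero_iff_norm.1 q.2, mul_one,
      Real.norm_eq_abs] at h1
    rcases (abs_eq zero_le_one).1 h1 with rfl | rfl
    · exact hz.1 (Subtype.ext (by rw [← hc, one_smul]))
    · exact hz.2 (Subtype.ext (by
        rw [← hc, neg_one_smul]
        rfl))
  have hcodim : 1 < Module.rank ℝ (E3 ⧸ Submodule.span ℝ {(q : E3)}) := by
    have h1 := Submodule.finrank_quotient_add_finrank (Submodule.span ℝ {(q : E3)})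
    rw [finrank_span_singleton (coe_S2_ne_zero q), finrank_euclideanSpace, Fintype.card_fin] at h1
    rw [← Module.finrank_eq_rank]
    have : Module.finrank ℝ (E3 ⧸ Submodule.span ℝ {(q : E3)}) = 2 := by omega
    rw [this]
    norm_num
  obtain ⟨γ, hγ⟩ := (isPathConnected_compl_of_one_lt_codim hcodim).joinedIn x (hspan x hx) y
    (hspan y hy)
  have hne : ∀ t, γ t ≠ 0 := fun t h => hγ t (by
    rw [h]
    exact Submodule.zero_mem _)
  refine ⟨{ toFun := fun t => unitVector (γ t) (hne t)
            continuous_toFun := continuous_unitVector γ.continuous hne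
            source' := (unitVector_congr γ.source (hne 0) (coe_S2_ne_zero x)).trans
              (unitVector_self x _)
            target' := (unitVector_congr γ.target (hne 1) (coe_S2_ne_zero y)).trans
              (unitVector_self y _) }, fun t => ?_⟩
  have hback : ∀ z : E3, (unitVector (γ t) (hne t) : E3) = z →
      z ∈ Submodule.span ℝ {(q : E3)} → False := by
    intro z hz hz'
    apply hγ t
    have h1 : γ t = ‖γ t‖ • z := by
      rw [← hz]
      change γ t = ‖γ t‖ • ‖γ t‖⁻¹ • γ t
      rw [smul_smul, mul_inv_cancel₀ (norm_ne_zero_iff.2 (hne t)), one_smul]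
    rw [h1]
    exact Submodule.smul_mem _ _ hz'
  constructor
  · intro h
    exact hback q (congrArg Subtype.val h) (Submodule.mem_span_singleton_self _)
  · intro h
    exact hback (-(q : E3)) (congrArg Subtype.val h)
      (Submodule.neg_mem _ (Submodule.mem_span_singleton_self _))

instance pathConnectedSpace_S2 : PathConnectedSpace S2 := by
  have h : 1 < Module.rank ℝ E3 := by
    rw [← Module.finrank_eq_rank, finrank_euclideanSpace, Fintype.card_fin]
    norm_num
  exact isPathConnected_iff_pathConnectedSpace.1 (isPathConnected_sphere h 0 zero_le_one)

theorem ne_iff_mem_rayComplement {q x : S2} : x ≠ q ↔ (x : E3) ∈ rayComplement (-q : S2) := by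
  rw [mem_rayComplement_iff]
  have : -((-q : S2) : E3) = q := neg_neg (q : E3)
  rw [this, Ne, Ne, Subtype.ext_iff]

/-- The complement of a point of the sphere is contractible. -/
theorem contractible_ne (q : S2) : ∃ x₀ : {x : S2 | x ≠ q},
    (ContinuousMap.const {x : S2 | x ≠ q} x₀).Homotopic (ContinuousMap.id _) := by
  have h : {x : S2 | x ≠ q} = sphereCone (rayComplement (-q : S2)) := by
    ext x
    exact ne_iff_mem_rayComplement
  rw [h]
  exact ⟨_, star_contractible (isStarCone_rayComplement (coe_S2_ne_zero (-q)))
    (mem_rayComplement_iff.2 (centre (-q)).2)⟩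

/-- The first homology of the sphere vanishes. -/
theorem exists_bdrySucc_eq_of_one_cycle {R : Type*} [CommRing R] {c : Chains R 1 S2}
    (hc : bdrySucc R S2 0 c = 0) : ∃ d, bdrySucc R S2 1 d = c := by
  obtain ⟨q⟩ := PathConnectedSpace.nonempty (X := S2)
  have hqq : q ≠ -q := fun h => (centre q).2 (congrArg Subtype.val h)
  have hopen : ∀ q : S2, IsOpen {x : S2 | x ≠ q} := fun q => isOpen_ne
  -- Mayer–Vietoris for the complements of the two poles `q`, `-q`: the common boundary of the two parts
  -- of the cycle bounds in the path-connected intersection, and the two complements are contractible.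
  obtain ⟨m, hm⟩ := exists_sd_iterate_mem_sup (hopen q) (hopen (-q)) (c := c)
    (chainsIn_mono (fun x _ => by
      by_cases h : x = q
      · exact Or.inr (h ▸ hqq)
      · exact Or.inl h) (mem_chainsIn_univ c))
  obtain ⟨cU, hcU, cV, hcV, hsum⟩ := Submodule.mem_sup.1 hm
  obtain ⟨d, e, hde, -, -, he⟩ := sub_sd_iterate c m
  rw [he hc, add_zero] at hde
  have hd0 : bdrySucc R S2 0 cU = -bdrySucc R S2 0 cV := by
    rw [eq_neg_iff_add_eq_zero, ← map_add, hsum, bdrySucc_sd_iterate, hc, map_zero]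
  set W : Set S2 := {x | x ≠ q} ∩ {x | x ≠ -q} with hW
  have haW : bdrySucc R S2 0 cU ∈ chainsIn R 0 W := mem_chainsIn_inter
    (bdrySucc_mem_chainsIn hcU) (hd0 ▸ Submodule.neg_mem _ (bdrySucc_mem_chainsIn hcV))
  obtain ⟨a, ha⟩ := exists_chainMap_subsetIncl haW
  have hWpc : PathConnectedSpace W := by
    obtain ⟨a, b, haq, hbq, hab, -, -⟩ := exists_frame q
    refine ⟨⟨a, ?_, ?_⟩, fun x y => ?_⟩
    · rintro rfl
      rw [inner_self_S2] at haq
      exact one_ne_zero haq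
    · rintro rfl
      have : inner ℝ ((-q : S2) : E3) (q : E3) = -inner ℝ (q : E3) (q : E3) := inner_neg_left _ _
      rw [this, inner_self_S2] at haq
      norm_num at haq
    · obtain ⟨γ, hγ⟩ := joined_of_ne x.2 y.2
      exact ⟨{ toFun := fun t => ⟨γ t, hγ t⟩
               continuous_toFun := γ.continuous.subtype_mk _
               source' := Subtype.ext γ.source
               target' := Subtype.ext γ.target }⟩
  have haug : augmentation R 0 W a = 0 := by
    rw [← augmentation_chainMap 0 (subsetIncl W), ha, augmentation_bdrySucc]
  obtain ⟨p, hp⟩ := exists_bdrySucc_eq_of_augmentation_eq_zero haug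
  set p' := chainMap R 1 (subsetIncl W) p with hp'
  have hp'W : p' ∈ chainsIn R 1 W := chainMap_mem_chainsIn_range (fun x => x.2) _
  have hdp : bdrySucc R S2 0 p' = bdrySucc R S2 0 cU := by rw [hp', bdrySucc_chainMap, hp, ha]
  obtain ⟨xU, hxU⟩ := contractible_ne q
  obtain ⟨xV, hxV⟩ := contractible_ne (-q)
  obtain ⟨dU, hdU⟩ := exists_bdrySucc_eq_of_contractible hxU (c := cU - p')
    (Submodule.sub_mem _ hcU (chainsIn_mono (fun x hx => hx.1) hp'W))
    (by rw [map_sub, hdp, sub_self])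
  obtain ⟨dV, hdV⟩ := exists_bdrySucc_eq_of_contractible hxV (c := cV + p')
    (Submodule.add_mem _ hcV (chainsIn_mono (fun x hx => hx.2) hp'W))
    (by rw [map_add, hdp, hd0, add_neg_cancel])
  refine ⟨d + (dU + dV), ?_⟩
  rw [map_add, map_add, hdU, hdV, ← hde, ← hsum]
  change c - _ + _ = c
  abel

/-- A two-dimensional cocycle of the sphere that vanishes on all cycles is a coboundary. -/
theorem mem_coboundaries_of_forall_cycle {κ : Cochains 2 S2}
    (h : ∀ c : Chains ℤ 2 S2, bdrySucc ℤ S2 1 c = 0 → evalChain 2 κ c = 0) :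
    κ ∈ coboundaries 2 S2 := by
  obtain ⟨q⟩ := PathConnectedSpace.nonempty (X := S2)
  -- `P` joins the points to the base point `q`; it completes every edge to a cycle, which bounds `e σ`.
  -- The primitive of `κ` is its value on `e σ`.
  have γ := fun x : S2 => (PathConnectedSpace.joined q x).somePath
  set P : Chains ℤ 0 S2 →ₗ[ℤ] Chains ℤ 1 S2 := Finsupp.linearCombination ℤ
    (fun σ : SingSimplex 0 S2 =>
      Finsupp.single (pathSimplex (γ (σ (stdSimplex.vertex 0)))) (1 : ℤ)) with hP
  have hcyc : ∀ σ : SingSimplex 1 S2, bdrySucc ℤ S2 0 (Finsupp.single σ 1 -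
      P (bdrySucc ℤ S2 0 (Finsupp.single σ 1))) = 0 := by
    intro σ
    have hpt : ∀ x, P (Finsupp.single (pointSimplex x) 1) = Finsupp.single (pathSimplex (γ x)) 1 :=
      fun x => by
        rw [hP, Finsupp.linearCombination_single, one_smul]
        rfl
    rw [map_sub, bdrySucc_one_single, map_sub, map_sub, hpt, hpt, bdrySucc_pathSimplex,
      bdrySucc_pathSimplex]
    abel
  choose e he using fun σ => exists_bdrySucc_eq_of_one_cycle (hcyc σ)
  refine ⟨fun σ => evalChain 2 κ (e σ), ?_⟩
  funext σ
  set E : Chains ℤ 1 S2 →ₗ[ℤ] Chains ℤ 2 S2 := Finsupp.linearCombination ℤ e with hE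
  have hbE : ∀ c, bdrySucc ℤ S2 1 (E c) = c - P (bdrySucc ℤ S2 0 c) := by
    intro c
    refine LinearMap.congr_fun (f := (bdrySucc ℤ S2 1).comp E)
      (g := LinearMap.id - P.comp (bdrySucc ℤ S2 0)) ?_ c
    ext1 σ
    ext1
    simp only [LinearMap.comp_apply, Finsupp.lsingle_apply, LinearMap.sub_apply, LinearMap.id_apply]
    rw [hE, Finsupp.linearCombination_single, one_smul, he]
  have h1 := h (E (bdrySucc ℤ S2 1 (Finsupp.single σ 1)) - Finsupp.single σ 1) (by
    rw [map_sub, hbE, bdrySucc_bdrySucc, P.map_zero, sub_zero, sub_self])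
  rw [map_sub, evalChain_single, sub_eq_zero] at h1
  rw [← h1]
  have h2 : bdrySucc ℤ S2 1 (Finsupp.single σ 1) = bdrySimplex ℤ σ := by
    rw [bdrySucc, Finsupp.linearCombination_single, one_smul]
  rw [h2, bdrySimplex, map_sum, map_sum]
  change ∑ i : Fin 3, (-1 : ℤ) ^ (i : ℕ) * evalChain 2 κ (e (face i σ)) = _
  refine Finset.sum_congr rfl fun i _ => ?_
  rw [map_smul, map_smul, hE, Finsupp.linearCombination_single, one_smul, smul_eq_mul]

end SphereHomology

/-! ### The second cohomology of the sphere -/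

section SphereCohomology

theorem sphereMap_comp_sphSimplex {L : E3 →L[ℝ] E3} (hL : ∀ x, x ≠ 0 → L x ≠ 0) {n : ℕ}
    {u v : Fin (n + 1) → E3} (hu : AvoidsZero u) (hv : AvoidsZero v) (h : ∀ i, L (u i) = v i) :
    (sphereMap L hL).comp (sphSimplex u hu) = sphSimplex v hv := by
  ext1 r
  refine (sphereMap_apply_unitVector L hL (hu r)).trans (unitVector_congr ?_ _ (hv r))
  simp [map_sum, h]

theorem cochain_cycle_eq_of_sub_mem {X : Type*} [TopologicalSpace X] {φ ψ : Cochains 2 X}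
    (h : φ - ψ ∈ coboundaries 2 X) {c : Chains ℤ 2 X} (hc : bdrySucc ℤ X 1 c = 0) :
    evalChain 2 φ c = evalChain 2 ψ c := by
  obtain ⟨θ, hθ⟩ := h
  have h1 := evalChain_cobdry 1 θ c
  rw [hθ, evalChain_sub] at h1
  have h2 : bdry ℤ X 2 c = 0 := hc
  rw [h2, map_zero] at h1
  exact sub_eq_zero.1 h1

/-- A positively oriented triangle is completed to a cycle in the fundamental class by a chain that
misses a given interior point: an orientation-preserving linear map takes a face of the tetrahedron to
the triangle, and the induced map of the sphere is homotopic to the identity. -/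
theorem exists_chain_complement {v : Fin 3 → E3} (hv : AvoidsZero v)
    (hpos : 0 < triple (v 0) (v 1) (v 2)) {w : Simp 2} (hw : ∀ i, 0 < w i) :
    ∃ e ∈ chainsIn ℤ 2 {x | x ≠ sphSimplex v hv w},
      bdrySucc ℤ S2 1 (Finsupp.single (sphSimplex v hv) 1 + e) = 0 ∧
      ∀ κ : cocycles 2 S2, evalChain 2 κ.1 (Finsupp.single (sphSimplex v hv) 1 + e) =
        evalChain 2 κ.1 sphereChain := by
  -- The linear map that takes the standard basis, which spans the face `0` of the tetrahedron, to `v`.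
  set L : E3 →L[ℝ] E3 := ∑ i, (EuclideanSpace.proj i : E3 →L[ℝ] ℝ).smulRight (v i) with hL
  have hLx : ∀ x : E3, L x = ∑ i, x i • v i := fun x => by
    simp [hL]
  have hLs : ∀ i, L (EuclideanSpace.single i 1) = v i := fun i => by
    rw [hLx]
    simp
  obtain ⟨h0, hhom⟩ := sphereMap_homotopic_id (L := L) (by
    rw [hLs, hLs, hLs]
    exact hpos)
  -- On the other faces of the tetrahedron some coordinate is not positive.
  have hoff : ∀ i : Fin 4, i ≠ 0 → Set.range ((sphereMap L h0).comp
      (sphSimplex (tetra ∘ i.succAbove) (tetra_face_avoidsZero i))) ⊆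
        {x | x ≠ sphSimplex v hv w} := by
    rintro i hi _ ⟨r, rfl⟩ hr
    have h2 : unitVector (L (∑ k, r k • (tetra ∘ i.succAbove) k)) (h0 _ (tetra_face_avoidsZero i r)) =
        sphSimplex v hv w := by
      rw [← hr]
      exact (sphereMap_apply_unitVector L h0 (tetra_face_avoidsZero i r)).symm
    set y : E3 := ∑ k, r k • (tetra ∘ i.succAbove) k with hy
    have h3 : ‖L y‖⁻¹ • L y = (1 : ℝ) • ‖∑ i, w i • v i‖⁻¹ • ∑ i, w i • v i := by
      rw [one_smul]
      exact congrArg Subtype.val h2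
    have h4 := eq_smul_of_norm_inv_smul_eq (h0 _ (tetra_face_avoidsZero i r)) h3
    rw [hLx] at h4
    have hpos' : ∀ j, 0 < y j := fun j => by
      rw [eq_mul_of_sum_smul_eq hpos h4 j]
      have h5 := norm_pos_iff.2 (hv w)
      have h6 := hw j
      have h7 : 0 < ‖∑ j, y j • v j‖ := by
        rw [← hLx]
        exact norm_pos_iff.2 (h0 _ (tetra_face_avoidsZero i r))
      positivity
    have hr0 : 0 ≤ r 0 := stdSimplex.zero_le r 0
    have hp0 := hpos' 0
    have hp1 := hpos' 1
    have hp2 := hpos' 2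
    fin_cases i
    · exact hi rfl
    all_goals
      simp [hy, Fin.sum_univ_three, tetra, Fin.succAbove, Fin.lt_def] at hp0 hp1 hp2
      linarith
  have hface : (sphereMap L h0).comp
      (sphSimplex (tetra ∘ (0 : Fin 4).succAbove) (tetra_face_avoidsZero 0)) = sphSimplex v hv := by
    refine sphereMap_comp_sphSimplex h0 _ _ fun i => ?_
    rw [hLx, Fin.sum_univ_three]
    fin_cases i <;> simp [tetra]
  set e : Chains ℤ 2 S2 := ∑ i : Fin 3, (-1 : ℤ) ^ (i.succ : ℕ) • Finsupp.single
    ((sphereMap L h0).comp (sphSimplex (tetra ∘ i.succ.succAbove) (tetra_face_avoidsZero i.succ)))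
      (1 : ℤ) with he
  have hsum : Finsupp.single (sphSimplex v hv) 1 + e = chainMap ℤ 2 (sphereMap L h0) sphereChain := by
    rw [sphereChain, map_sum, Fin.sum_univ_succ, he]
    simp only [map_smul, chainMap_single]
    rw [hface, Fin.val_zero, pow_zero, one_smul]
  refine ⟨e, ?_, ?_, fun κ => ?_⟩
  · refine Submodule.sum_mem _ fun i _ => Submodule.smul_mem _ _ ?_
    exact Finsupp.single_mem_supported ℤ _ (hoff i.succ (Fin.succ_ne_zero i))
  · have h1 := bdry_chainMap ℤ 2 (sphereMap L h0) sphereChain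
    rw [show bdry ℤ S2 2 sphereChain = 0 from sphereChain_mem_cycles, map_zero] at h1
    rw [hsum]
    exact h1
  · have h1 := cochain_cycle_eq_of_sub_mem (cochainMap_sub_mem_coboundaries hhom 1 κ.2)
      (c := sphereChain) sphereChain_mem_cycles
    rw [evalChain_cochainMap, evalChain_cochainMap, chainMap_id, ← hsum] at h1
    exact h1.symm

/-- A cocycle concentrated at an interior point of a positively oriented triangle takes the same
value on this triangle as on the fundamental cycle. -/
theorem apply_sphSimplex_eq {κ : cocycles 2 S2} {q : S2} (hκ : VanishesOff κ.1 q)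
    {v : Fin 3 → E3} {hv : AvoidsZero v} (hpos : 0 < triple (v 0) (v 1) (v 2))
    {w : Simp 2} (hw : ∀ i, 0 < w i) (hwq : sphSimplex v hv w = q) :
    κ.1 (sphSimplex v hv) = evalChain 2 κ.1 sphereChain := by
  obtain ⟨e, he, -, h⟩ := exists_chain_complement hv hpos hw
  have h0 : evalChain 2 κ.1 e = 0 := by
    rw [evalChain, Finsupp.linearCombination_apply, Finsupp.sum]
    refine Finset.sum_eq_zero fun σ hσ => ?_
    rw [hκ σ fun hq => he hσ hq hwq.symm, smul_zero]
  rw [← h, map_add, h0, add_zero, evalChain_single]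

/-- Every class of the sphere is concentrated at any given point, as the complement of a point is
contractible. -/
theorem exists_vanishesOff (κ : cocycles 2 S2) (q : S2) :
    ∃ κ' : cocycles 2 S2, VanishesOff κ'.1 q ∧ cohClass κ' = cohClass κ := by
  classical
  obtain ⟨x₀, hx₀⟩ := contractible_ne q
  set V : Set S2 := {x | x ≠ q} with hV
  obtain ⟨ψ, hψ⟩ : cochainMap 2 (subsetIncl V) κ.1 ∈ coboundaries 2 V :=
    mem_coboundaries_of_contractible hx₀ (by
      have h0 : cobdry 2 S2 κ.1 = 0 := κ.2
      change cobdry 2 V _ = 0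
      rw [cobdry_cochainMap, h0, map_zero])
  set ψ' : Cochains 1 S2 := fun σ =>
    if h : ∀ r, σ r ∈ V then ψ ⟨fun r => ⟨σ r, h r⟩, σ.continuous.subtype_mk _⟩ else 0 with hψ'
  have hδ : cobdry 1 S2 ψ' ∈ cocycles 2 S2 := by
    change cobdry 2 S2 (cobdry 1 S2 ψ') = 0
    funext σ
    have h1 := evalChain_cobdry 2 (cobdry 1 S2 ψ') (Finsupp.single σ 1)
    rw [evalChain_single, evalChain_cobdry] at h1
    refine h1.trans ?_
    have h2 : bdry ℤ S2 2 (bdry ℤ S2 3 (Finsupp.single σ 1)) = 0 := bdrySucc_bdrySucc 1 _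
    rw [h2, map_zero]
    rfl
  refine ⟨κ - ⟨_, hδ⟩, fun σ hσ => ?_, SubQuot.mk_eq_mk.2 ?_⟩
  · have hσV : ∀ r, σ r ∈ V := fun r h => hσ ⟨r, h⟩
    set σ' : SingSimplex 2 V := ⟨fun r => ⟨σ r, hσV r⟩, σ.continuous.subtype_mk _⟩ with hσ'
    have h1 : κ.1 σ = cobdry 1 V ψ σ' := (congrFun hψ σ').symm
    have h2 : cobdry 1 S2 ψ' σ = cobdry 1 V ψ σ' := by
      change ∑ i : Fin 3, (-1 : ℤ) ^ (i : ℕ) * ψ' (face i σ) =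
        ∑ i : Fin 3, (-1 : ℤ) ^ (i : ℕ) * ψ (face i σ')
      refine Finset.sum_congr rfl fun i _ => ?_
      congr 1
      rw [hψ']
      exact dif_pos fun r => hσV _
    change κ.1 σ - cobdry 1 S2 ψ' σ = 0
    rw [h1, h2, sub_self]
  · change κ.1 - cobdry 1 S2 ψ' - κ.1 ∈ _
    rw [sub_sub_cancel_left]
    exact Submodule.neg_mem _ ⟨ψ', rfl⟩

/-- The trivialization of the identity of the sphere. -/
def idTrivialization (q : S2) : PuncturedTrivialization (ContinuousMap.id S2) q where
  toFun := ⟨fun p => p.1.1, by fun_prop⟩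
  retract := ContinuousMap.const _ ⟨q, rfl⟩
  proj_toFun _ := rfl
  toFun_centre f := f.2.symm
  retract_toFun p _ := Subtype.ext p.2.2.symm
  toFun_retract _ := rfl

theorem evalChain_eq_augmentation_capChain {X : Type*} [TopologicalSpace X] (κ : Cochains 2 X)
    (c : Chains ℤ 2 X) :
    evalChain 2 κ c = augmentation ℤ 0 X (capChain ℤ 2 0 rfl κ c) := by
  refine LinearMap.congr_fun (f := evalChain 2 κ)
    (g := (augmentation ℤ 0 X).comp (capChain ℤ 2 0 rfl κ)) ?_ c
  ext1 σ
  ext1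
  have h : front 2 (by omega) σ = σ := by
    have : (fun k : Fin 3 => (⟨k, by omega⟩ : Fin 3)) = id := rfl
    change σ.comp (simpMap _) = σ
    rw [this, simpMap_id, ContinuousMap.comp_id]
  simp only [LinearMap.comp_apply, Finsupp.lsingle_apply, evalChain_single]
  rw [capChain_single (n := 0)]
  simp [augmentation, h]

/-- A two-dimensional class of the sphere is determined by its value on the fundamental class. -/
theorem cohClass_eq_of_evalChain_eq {κ κ' : cocycles 2 S2}
    (h : evalChain 2 κ.1 sphereChain = evalChain 2 κ'.1 sphereChain) :
    cohClass κ = cohClass κ' := by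
  obtain ⟨q⟩ := PathConnectedSpace.nonempty (X := S2)
  obtain ⟨κ₁, hκ₁, hκ₁'⟩ := exists_vanishesOff (κ - κ') q
  have h1 : evalChain 2 κ₁.1 sphereChain = 0 := by
    rw [cochain_cycle_eq_of_sub_mem (SubQuot.mk_eq_mk.1 hκ₁') sphereChain_mem_cycles]
    change evalChain 2 (κ.1 - κ'.1) sphereChain = 0
    rw [evalChain_sub, h, sub_self]
  have h2 : κ₁.1 ∈ coboundaries 2 S2 := by
    refine mem_coboundaries_of_forall_cycle fun c hc => ?_
    -- A cycle is a multiple of the triangle around `q`, up to boundaries and chains off `q`.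
    obtain ⟨β, v, hv, w, Θ, t, b, hpos, hw, hwq, hΘ, -, ht, -, htb⟩ :=
      exists_isFibreIntersection (R := ℤ) (n := 0) (idTrivialization q)
        (homClass ⟨c, show bdry ℤ S2 2 c = 0 from hc⟩)
    obtain ⟨d, hd⟩ := SubQuot.mk_eq_mk.1 ht
    obtain ⟨_, ⟨d', rfl⟩, e, he, hde⟩ := Submodule.mem_sup.1 htb
    have hcob : ∀ d : Chains ℤ 3 S2, evalChain 2 κ₁.1 (bdry ℤ S2 3 d) = 0 := fun d => by
      have h0 : cobdry 2 S2 κ₁.1 = 0 := κ₁.2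
      rw [← evalChain_cobdry, h0]
      simp [evalChain]
    have h3 : c = triangleTimes ℤ 0 Θ b.1 + bdry ℤ S2 3 d' + e - bdry ℤ S2 3 d := by
      have e1 : t.1 = triangleTimes ℤ 0 Θ b.1 + (bdry ℤ S2 3 d' + e) := by
        rw [hde]
        abel
      have e2 : c = t.1 - bdry ℤ S2 3 d := by
        rw [hd]
        change c = t.1 - (t.1 - c)
        abel
      rw [e2, e1]
      abel
    have hDκ := apply_sphSimplex_eq hκ₁ hpos hw hwq
    rw [h3, map_sub, map_add, map_add, hcob, hcob, sub_zero, add_zero,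
      evalChain_eq_augmentation_capChain, evalChain_eq_augmentation_capChain]
    have e3 := capChain_triangleTimes hκ₁ hpos hw hwq hΘ 0 b.1
    have e4 := capChain_eq_zero_of_mem_chainsIn hκ₁ he
    rw [hDκ, h1] at e3
    have e5 : cochainMap 2 (ContinuousMap.id S2) κ₁.1 = κ₁.1 := by
      funext σ
      change κ₁.1 ((ContinuousMap.id S2).comp σ) = _
      rw [ContinuousMap.id_comp]
    rw [e5] at e3 e4
    rw [e3, e4]
    simp
  have h3 := SubQuot.mk_eq_mk.1 hκ₁'
  refine SubQuot.mk_eq_mk.2 ?_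
  have h4 := Submodule.sub_mem _ h2 h3
  rw [sub_sub_cancel] at h4
  exact h4

theorem eq_of_kronecker_eq {κ κ' : Cohomology 2 S2}
    (h : kronecker 2 κ sphereClass = kronecker 2 κ' sphereClass) : κ = κ' := by
  obtain ⟨a, rfl⟩ := Submodule.Quotient.mk_surjective _ κ
  obtain ⟨a', rfl⟩ := Submodule.Quotient.mk_surjective _ κ'
  exact cohClass_eq_of_evalChain_eq h

/-- The intersection with a fibre and the cap product with the pull-back of the dual class, for a
map that is trivial over every punctured sphere. -/
theorem fibreIntersection_eq_cap {R : Type*} [CommRing R] {X : Type*} [TopologicalSpace X]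
    {g : C(X, S2)} {q : S2} (Ψ : PuncturedTrivialization g q) {κ : Cohomology 2 S2}
    (hκ : kronecker 2 κ sphereClass = 1) {n : ℕ} (T : Homology R (n + 2) X) :
    (∃! β : Homology R n (Fibre g q), IsFibreIntersection g q T β) ∧
      ∀ β : Homology R n (Fibre g q), IsFibreIntersection g q T β →
        cap R n (cohomologyMap 2 g κ) T = homologyMap R n (fibreIncl g q) β := by
  obtain ⟨a, rfl⟩ := Submodule.Quotient.mk_surjective _ κ
  obtain ⟨κ', hκ', h'⟩ := exists_vanishesOff a q
  have h1 : evalChain 2 κ'.1 sphereChain = 1 :=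
    (cochain_cycle_eq_of_sub_mem (SubQuot.mk_eq_mk.1 h') sphereChain_mem_cycles).trans hκ
  have hD : ∀ (v : Fin 3 → E3) (hv : AvoidsZero v) (w : Simp 2), 0 < triple (v 0) (v 1) (v 2) →
      (∀ i, 0 < w i) → sphSimplex v hv w = q → κ'.1 (sphSimplex v hv) = 1 :=
    fun v hv w h2 h3 h4 => (apply_sphSimplex_eq hκ' h2 h3 h4).trans h1
  obtain ⟨β, hβ⟩ := exists_isFibreIntersection Ψ T
  refine ⟨⟨β, hβ, fun β' hβ' => isFibreIntersection_unique hκ' hD Ψ hβ' hβ⟩, fun β' hβ' => ?_⟩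
  rw [← cap_eq_of_isFibreIntersection hκ' hD hβ', h']
  rfl

end SphereCohomology

/-! ### Winding numbers -/

section Winding

theorem exists_log {k : ℕ} {h : Simp k → ℂ} (hc : Continuous h) (h0 : ∀ t, h t ≠ 0) :
    ∃ θ : C(Simp k, ℂ), ∀ t, Complex.exp (θ t) = h t := by
  have hconv := convex_stdSimplex ℝ (Fin (k + 1))
  have : LocallyPathConnectedSpace (Simp k) := hconv.locallyPathConnectedSpace
  have : ContractibleSpace (Simp k) := hconv.contractibleSpace
    ⟨_, (stdSimplex.vertex (S := ℝ) (0 : Fin (k + 1))).2⟩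
  obtain ⟨θ, ⟨-, hθ⟩, -⟩ := Complex.isCoveringMap_exp.existsUnique_continuousMap_lifts
    (⟨fun t => ⟨h t, h0 t⟩, hc.subtype_mk _⟩ : C(Simp k, {z : ℂ // z ≠ 0}))
    (stdSimplex.vertex 0) (Complex.log (h (stdSimplex.vertex 0)))
    (Subtype.ext (Complex.exp_log (h0 _)))
  exact ⟨θ, fun t => congrArg Subtype.val (congrFun hθ t)⟩

theorem log_sub_log_eq {k : ℕ} {θ θ' : C(Simp k, ℂ)}
    (h : ∀ t, Complex.exp (θ t) = Complex.exp (θ' t)) (s t : Simp k) :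
    θ t - θ s = θ' t - θ' s := by
  have h1 : Complex.exp (θ s - θ' s) = 1 := by
    rw [Complex.exp_sub, h, div_self (Complex.exp_ne_zero _)]
  have h2 : (θ : Simp k → ℂ) = fun t => θ' t + (θ s - θ' s) := by
    refine Complex.isCoveringMap_exp.eq_of_comp_eq θ.continuous (by fun_prop) ?_ s (by ring)
    funext t
    refine Subtype.ext ?_
    change Complex.exp (θ t) = Complex.exp (θ' t + (θ s - θ' s))
    rw [Complex.exp_add, h1, mul_one, h]
  have h3 := congrFun h2 t
  rw [h3]
  ring

/-- The total change of the logarithm of a nonvanishing function along the 1-simplex. -/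
noncomputable def logChange (u : Simp 1 → ℂ) : ℂ :=
  open Classical in
  if h : ∃ θ : C(Simp 1, ℂ), ∀ r, Complex.exp (θ r) = u r then
    h.choose (stdSimplex.vertex 1) - h.choose (stdSimplex.vertex 0)
  else 0

theorem logChange_eq {u : Simp 1 → ℂ} {θ : C(Simp 1, ℂ)} (h : ∀ r, Complex.exp (θ r) = u r) :
    logChange u = θ (stdSimplex.vertex 1) - θ (stdSimplex.vertex 0) := by
  have h' : ∃ θ : C(Simp 1, ℂ), ∀ r, Complex.exp (θ r) = u r := ⟨θ, h⟩
  rw [logChange, dif_pos h']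
  exact log_sub_log_eq (fun t => (h'.choose_spec t).trans (h t).symm) _ _

theorem logChange_mul {u v : Simp 1 → ℂ} (hu : Continuous u) (hv : Continuous v)
    (hu0 : ∀ r, u r ≠ 0) (hv0 : ∀ r, v r ≠ 0) :
    logChange (fun r => u r * v r) = logChange u + logChange v := by
  obtain ⟨θ, hθ⟩ := exists_log hu hu0
  obtain ⟨η, hη⟩ := exists_log hv hv0
  have h : ∀ r, Complex.exp ((θ + η) r) = u r * v r := fun r => by
    rw [ContinuousMap.add_apply, Complex.exp_add, hθ, hη]
  rw [logChange_eq hθ, logChange_eq hη, logChange_eq h, ContinuousMap.add_apply,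
    ContinuousMap.add_apply]
  ring

theorem exp_logChange {u : Simp 1 → ℂ} (hu : Continuous u) (hu0 : ∀ r, u r ≠ 0) :
    Complex.exp (logChange u) = u (stdSimplex.vertex 1) / u (stdSimplex.vertex 0) := by
  obtain ⟨θ, hθ⟩ := exists_log hu hu0
  rw [logChange_eq hθ, Complex.exp_sub, hθ, hθ]

theorem logChange_of_mem_slitPlane {u : Simp 1 → ℂ} (hu : Continuous u)
    (h : ∀ r, u r ∈ Complex.slitPlane) :
    logChange u = Complex.log (u (stdSimplex.vertex 1)) - Complex.log (u (stdSimplex.vertex 0)) :=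
  logChange_eq (θ := ⟨fun r => Complex.log (u r), hu.clog h⟩)
    fun r => Complex.exp_log (Complex.slitPlane_ne_zero (h r))

theorem logChange_const_mul {u : Simp 1 → ℂ} (hu : Continuous u) (hu0 : ∀ r, u r ≠ 0) {a : ℂ}
    (ha : a ≠ 0) : logChange (fun r => a * u r) = logChange u := by
  obtain ⟨θ, hθ⟩ := exists_log hu hu0
  have h : ∀ r, Complex.exp ((ContinuousMap.const (Simp 1) (Complex.log a) + θ) r) = a * u r :=
      fun r => by
    rw [ContinuousMap.add_apply, Complex.exp_add, hθ, ContinuousMap.const_apply,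
      Complex.exp_log ha]
  rw [logChange_eq hθ, logChange_eq h]
  simp

/-- The total change of the logarithm around the boundary of the triangle. -/
noncomputable def bdryChange (u : Fin 3 → Simp 1 → ℂ) : ℂ :=
  ∑ i : Fin 3, (-1 : ℂ) ^ (i : ℕ) * logChange (u i)

theorem bdryChange_eq (u : Fin 3 → Simp 1 → ℂ) :
    bdryChange u = logChange (u 0) - logChange (u 1) + logChange (u 2) := by
  rw [bdryChange, Fin.sum_univ_three]
  simp only [Fin.val_zero, Fin.val_one, Fin.val_two, pow_zero, pow_one, one_mul, even_two,
    Even.neg_pow, one_pow]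
  ring

theorem bdryChange_mul {u v : Fin 3 → Simp 1 → ℂ} (hu : ∀ i, Continuous (u i))
    (hv : ∀ i, Continuous (v i)) (hu0 : ∀ i r, u i r ≠ 0) (hv0 : ∀ i r, v i r ≠ 0) :
    bdryChange (fun i r => u i r * v i r) = bdryChange u + bdryChange v := by
  simp only [bdryChange, ← Finset.sum_add_distrib, ← mul_add]
  refine Finset.sum_congr rfl fun i _ => ?_
  rw [logChange_mul (hu i) (hv i) (hu0 i) (hv0 i)]

theorem simpMap_vertex {m n : ℕ} (f : Fin (m + 1) → Fin (n + 1)) (i : Fin (m + 1)) :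
    simpMap f (stdSimplex.vertex i) = stdSimplex.vertex (f i) := by
  rw [simpMap_eq_affSimplex, affSimplex_vertex]

/-- Functions on the edges of the triangle that agree at the vertices. -/
def VertexCompatible (u : Fin 3 → Simp 1 → ℂ) : Prop :=
  u 0 (stdSimplex.vertex 0) = u 2 (stdSimplex.vertex 1) ∧
    u 0 (stdSimplex.vertex 1) = u 1 (stdSimplex.vertex 1) ∧
    u 1 (stdSimplex.vertex 0) = u 2 (stdSimplex.vertex 0)

theorem vertexCompatible_of_vertex {u : Fin 3 → Simp 1 → ℂ} (y : Fin 3 → ℂ)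
    (h : ∀ (i : Fin 3) (a : Fin 2), u i (stdSimplex.vertex a) = y (i.succAbove a)) :
    VertexCompatible u := by
  refine ⟨?_, ?_, ?_⟩ <;> · rw [h, h]; rfl

theorem bdryChange_of_mem_slitPlane {u : Fin 3 → Simp 1 → ℂ} (hu : ∀ i, Continuous (u i))
    (h : ∀ i r, u i r ∈ Complex.slitPlane) (hc : VertexCompatible u) : bdryChange u = 0 := by
  obtain ⟨h1, h2, h3⟩ := hc
  rw [bdryChange_eq, logChange_of_mem_slitPlane (hu 0) (h 0), logChange_of_mem_slitPlane (hu 1) (h 1),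
    logChange_of_mem_slitPlane (hu 2) (h 2), h1, h2, h3]
  ring

theorem bdryChange_face {h : Simp 2 → ℂ} (hc : Continuous h) (h0 : ∀ t, h t ≠ 0) :
    bdryChange (fun i r => h (simpMap i.succAbove r)) = 0 := by
  obtain ⟨θ, hθ⟩ := exists_log hc h0
  have e : ∀ i : Fin 3, logChange (fun r => h (simpMap i.succAbove r)) =
      θ (stdSimplex.vertex (i.succAbove 1)) - θ (stdSimplex.vertex (i.succAbove 0)) := by
    intro i
    rw [logChange_eq (θ := θ.comp (simpMap i.succAbove)) fun r => hθ _]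
    simp only [ContinuousMap.comp_apply, simpMap_vertex]
  rw [bdryChange_eq, e, e, e]
  simp [Fin.succAbove, Fin.lt_def]

theorem exists_bdryChange_eq {u : Fin 3 → Simp 1 → ℂ} (hu : ∀ i, Continuous (u i))
    (hu0 : ∀ i r, u i r ≠ 0) (hc : VertexCompatible u) :
    ∃ n : ℤ, bdryChange u = 2 * Real.pi * Complex.I * n := by
  obtain ⟨h1, h2, h3⟩ := hc
  have h : Complex.exp (bdryChange u) = 1 := by
    rw [bdryChange_eq, Complex.exp_add, Complex.exp_sub, exp_logChange (hu 0) (hu0 0),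
      exp_logChange (hu 1) (hu0 1), exp_logChange (hu 2) (hu0 2), h1, h2, h3]
    have := hu0 1 (stdSimplex.vertex 1)
    have := hu0 2 (stdSimplex.vertex 1)
    have := hu0 2 (stdSimplex.vertex 0)
    field_simp
  obtain ⟨n, hn⟩ := Complex.exp_eq_one_iff.1 h
  exact ⟨n, by rw [hn]; ring⟩

end Winding

/-! ### Sections of line bundles over the sphere -/

section LineBundle

variable {A : TautSquareRoot} {T : Type*} [TopologicalSpace T]

open Bundle

theorem triv_snd_smul {q : S2} (e : Trivialization ℂ (π ℂ A.N)) [e.IsLinear ℂ] (hq : q ∈ e.baseSet)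
    (z : ℂ) (v : A.N q) : (e ⟨q, z • v⟩).2 = z * (e ⟨q, v⟩).2 :=
  (e.linear ℂ hq).map_smul z v

theorem triv_snd_ne_zero {q : S2} (e : Trivialization ℂ (π ℂ A.N)) [e.IsLinear ℂ]
    (hq : q ∈ e.baseSet) {v : A.N q} (hv : v ≠ 0) : (e ⟨q, v⟩).2 ≠ 0 := by
  intro h
  apply hv
  have h0 : (e ⟨q, (0 : A.N q)⟩).2 = 0 := (e.linear ℂ hq).map_zero
  have h1 : e ⟨q, v⟩ = e ⟨q, (0 : A.N q)⟩ := by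
    refine Prod.ext ?_ (h.trans h0.symm)
    rw [e.coe_fst (e.mem_source.2 hq), e.coe_fst (e.mem_source.2 hq)]
  have h2 := e.injOn (e.mem_source.2 hq) (e.mem_source.2 hq) h1
  exact eq_of_heq (TotalSpace.mk.inj h2).2

/-- The fibres are one-dimensional. -/
theorem exists_eq_smul {q : S2} {f : A.N q} (hf : f ≠ 0) (v : A.N q) : ∃ z : ℂ, v = z • f := by
  set e := trivializationAt ℂ A.N q
  have hq : q ∈ e.baseSet := mem_baseSet_trivializationAt ℂ A.N q
  have h0 := triv_snd_ne_zero e hq hf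
  refine ⟨(e ⟨q, v⟩).2 / (e ⟨q, f⟩).2, ?_⟩
  rw [← sub_eq_zero]
  by_contra h
  apply triv_snd_ne_zero e hq h
  have h1 := (e.linear ℂ hq).map_sub v (((e ⟨q, v⟩).2 / (e ⟨q, f⟩).2) • f)
  refine h1.trans ?_
  rw [triv_snd_smul e hq, div_mul_cancel₀ _ h0, sub_self]

theorem smul_eq_smul_iff_of_ne_zero {q : S2} {f : A.N q} (hf : f ≠ 0) {z w : ℂ} : z • f = w • f ↔ z = w := by
  refine ⟨fun h => ?_, fun h => by rw [h]⟩
  set e := trivializationAt ℂ A.N q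
  have hq : q ∈ e.baseSet := mem_baseSet_trivializationAt ℂ A.N q
  have h1 := congrArg (fun v => (e ⟨q, v⟩).2) h
  simp only [triv_snd_smul e hq] at h1
  exact mul_right_cancel₀ (triv_snd_ne_zero e hq hf) h1

/-- A family of vectors of the line bundle along a map to the sphere is continuous. -/
def ContSection (h : T → S2) (s : ∀ t, A.N (h t)) : Prop :=
  Continuous fun t => TotalSpace.mk' ℂ (h t) (s t)

theorem ContSection.continuous_base {h : T → S2} {s : ∀ t, A.N (h t)} (hs : ContSection h s) :
    Continuous h :=
  (FiberBundle.continuous_proj ℂ A.N).comp hs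

theorem ContSection.comp {T' : Type*} [TopologicalSpace T'] {h : T → S2} {s : ∀ t, A.N (h t)}
    (hs : ContSection h s) {k : T' → T} (hk : Continuous k) :
    ContSection (fun t => h (k t)) fun t => s (k t) :=
  Continuous.comp (g := fun t => TotalSpace.mk' ℂ (h t) (s t)) hs hk

theorem ContSection.continuousAt_triv {h : T → S2} {s : ∀ t, A.N (h t)} (hs : ContSection h s)
    (t₀ : T) : ContinuousAt (fun t => (trivializationAt ℂ A.N (h t₀) ⟨h t, s t⟩).2) t₀ :=
  ((FiberBundle.continuousAt_totalSpace ℂ _).1 hs.continuousAt).2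

/-- The quotient of two continuous sections is continuous. -/
theorem continuous_of_eq_smul {h : T → S2} {s f : ∀ t, A.N (h t)} (hs : ContSection h s)
    (hf : ContSection h f) (hf0 : ∀ t, f t ≠ 0) {u : T → ℂ} (hu : ∀ t, s t = u t • f t) :
    Continuous u := by
  rw [continuous_iff_continuousAt]
  intro t₀
  set e := trivializationAt ℂ A.N (h t₀) with he
  have hq : h t₀ ∈ e.baseSet := mem_baseSet_trivializationAt ℂ A.N _
  have h1 := (hs.continuousAt_triv t₀).div (hf.continuousAt_triv t₀)
    (triv_snd_ne_zero e hq (hf0 t₀))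
  refine h1.congr ?_
  filter_upwards [hs.continuous_base.continuousAt.eventually (e.open_baseSet.mem_nhds hq)] with t ht
  rw [Pi.div_apply, hu, triv_snd_smul e ht, mul_div_cancel_right₀ _ (triv_snd_ne_zero e ht (hf0 t))]

theorem ContSection.smul {h : T → S2} {s : ∀ t, A.N (h t)} (hs : ContSection h s) {u : T → ℂ}
    (hu : Continuous u) : ContSection h fun t => u t • s t := by
  refine continuous_iff_continuousAt.2 fun t₀ => ?_
  refine (FiberBundle.continuousAt_totalSpace ℂ _).2 ⟨hs.continuous_base.continuousAt, ?_⟩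
  set e := trivializationAt ℂ A.N (h t₀) with he
  have hq : h t₀ ∈ e.baseSet := mem_baseSet_trivializationAt ℂ A.N _
  refine (hu.continuousAt.mul (hs.continuousAt_triv t₀)).congr ?_
  filter_upwards [hs.continuous_base.continuousAt.eventually (e.open_baseSet.mem_nhds hq)] with t ht
  exact (triv_snd_smul e ht _ _).symm

theorem ContSection.add {h : T → S2} {s s' : ∀ t, A.N (h t)} (hs : ContSection h s)
    (hs' : ContSection h s') : ContSection h fun t => s t + s' t := by
  refine continuous_iff_continuousAt.2 fun t₀ => ?_
  refine (FiberBundle.continuousAt_totalSpace ℂ _).2 ⟨hs.continuous_base.continuousAt, ?_⟩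
  set e := trivializationAt ℂ A.N (h t₀) with he
  have hq : h t₀ ∈ e.baseSet := mem_baseSet_trivializationAt ℂ A.N _
  refine ((hs.continuousAt_triv t₀).add (hs'.continuousAt_triv t₀)).congr ?_
  filter_upwards [hs.continuous_base.continuousAt.eventually (e.open_baseSet.mem_nhds hq)] with t ht
  exact ((e.linear ℂ ht).map_add _ _).symm

theorem ContSection.sum {ι : Type*} (I : Finset ι) {h : T → S2} (hh : Continuous h)
    {s : ι → ∀ t, A.N (h t)} (hs : ∀ i ∈ I, ContSection h (s i)) :
    ContSection h fun t => ∑ i ∈ I, s i t := by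
  classical
  induction I using Finset.induction_on with
  | empty =>
    simp only [Finset.sum_empty]
    refine continuous_iff_continuousAt.2 fun t₀ => ?_
    refine (FiberBundle.continuousAt_totalSpace ℂ _).2 ⟨hh.continuousAt, ?_⟩
    set e := trivializationAt ℂ A.N (h t₀) with he
    have hq : h t₀ ∈ e.baseSet := mem_baseSet_trivializationAt ℂ A.N _
    refine (continuousAt_const (y := (0 : ℂ))).congr ?_
    filter_upwards [hh.continuousAt.eventually (e.open_baseSet.mem_nhds hq)] with t ht
    exact (e.linear ℂ ht).map_zero.symm
  | insert i I hi ih =>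
    simp only [Finset.sum_insert hi]
    exact (hs i (Finset.mem_insert_self _ _)).add
      (ih fun j hj => hs j (Finset.mem_insert_of_mem hj))

/-- Near a given point the line bundle has a functional and a section, both cut off to be defined
everywhere. -/
theorem exists_cutoff (A : TautSquareRoot) (b : S2) :
    ∃ (ρ : S2 → ℝ) (φ : TotalSpace ℂ A.N → ℂ) (s : ∀ y, A.N y), Continuous ρ ∧ 0 < ρ b ∧
      Continuous φ ∧ ContSection (fun y => y) s ∧
      (∀ x (a : A.N x), φ ⟨x, a⟩ • s x = ((ρ x : ℂ) ^ 2) • a) ∧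
      ∀ x (z : ℂ) (a : A.N x), φ ⟨x, z • a⟩ = z * φ ⟨x, a⟩ := by
  set e := trivializationAt ℂ A.N b with he
  have hb : b ∈ e.baseSet := mem_baseSet_trivializationAt ℂ A.N b
  obtain ⟨r, hr, hball⟩ := Metric.nhds_basis_closedBall.mem_iff.1 (e.open_baseSet.mem_nhds hb)
  set ρ : S2 → ℝ := fun x => max 0 (r - dist x b) with hρ
  have hρc : Continuous ρ := by fun_prop
  have hρ0 : ∀ x, x ∉ e.baseSet → ∀ᶠ y in nhds x, ρ y = 0 := by
    intro x hx
    have h1 : r < dist x b := by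
      by_contra! h
      exact hx (hball (Metric.mem_closedBall.2 h))
    have h2 : ∀ᶠ y in nhds x, r < dist y b :=
      (continuous_id.dist continuous_const).continuousAt.eventually (lt_mem_nhds h1)
    filter_upwards [h2] with y hy
    exact max_eq_left (by linarith)
  refine ⟨ρ, fun v => (ρ v.proj : ℂ) * (e v).2, fun y => (ρ y : ℂ) • e.symm y 1, hρc, ?_, ?_, ?_,
    ?_, ?_⟩
  · simp [hρ, hr]
  · refine continuous_iff_continuousAt.2 fun v => ?_
    have hproj : Continuous fun v : TotalSpace ℂ A.N => v.proj := FiberBundle.continuous_proj ℂ A.N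
    by_cases hv : v.proj ∈ e.baseSet
    · exact (Complex.continuous_ofReal.comp (hρc.comp hproj)).continuousAt.mul
        (continuous_snd.continuousAt.comp (e.continuousAt (e.mem_source.2 hv)))
    · refine (continuousAt_const (y := (0 : ℂ))).congr ?_
      filter_upwards [hproj.continuousAt.eventually (hρ0 _ hv)] with w hw
      rw [hw]
      simp
  · refine continuous_iff_continuousAt.2 fun y => ?_
    refine (FiberBundle.continuousAt_totalSpace ℂ _).2 ⟨continuousAt_id, ?_⟩
    set e' := trivializationAt ℂ A.N y with he'
    have hy' : y ∈ e'.baseSet := mem_baseSet_trivializationAt ℂ A.N y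
    by_cases hy : y ∈ e.baseSet
    · have h1 : ContinuousAt (fun x => e.toOpenPartialHomeomorph.symm (x, (1 : ℂ))) y :=
        ContinuousAt.comp (f := fun x : S2 => (x, (1 : ℂ)))
          (e.toOpenPartialHomeomorph.continuousAt_symm (e.mem_target.2 hy)) (by fun_prop)
      have h2 : ContinuousAt (fun x => (e' (e.toOpenPartialHomeomorph.symm (x, (1 : ℂ)))).2) y := by
        refine continuous_snd.continuousAt.comp (ContinuousAt.comp (g := e') ?_ h1)
        refine e'.continuousAt (e'.mem_source.2 ?_)
        rw [← e.mk_symm hy]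
        exact hy'
      refine ((Complex.continuous_ofReal.comp hρc).continuousAt.mul h2).congr ?_
      filter_upwards [e.open_baseSet.mem_nhds hy, e'.open_baseSet.mem_nhds hy'] with x hx hx'
      change (ρ x : ℂ) * (e' (e.toOpenPartialHomeomorph.symm (x, (1 : ℂ)))).2 = _
      rw [← e.mk_symm hx]
      exact (triv_snd_smul e' hx' _ _).symm
    · refine (continuousAt_const (y := (0 : ℂ))).congr ?_
      filter_upwards [hρ0 y hy, e'.open_baseSet.mem_nhds hy'] with x hx hx'
      rw [hx, Complex.ofReal_zero, zero_smul]
      exact (e'.linear ℂ hx').map_zero.symm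
  · intro x a
    by_cases hx : x ∈ e.baseSet
    · have h1 : a = (e ⟨x, a⟩).2 • e.symm x 1 := by
        rw [← sub_eq_zero]
        by_contra h
        apply triv_snd_ne_zero e hx h
        refine ((e.linear ℂ hx).map_sub _ _).trans ?_
        rw [triv_snd_smul e hx, e.apply_mk_symm hx, mul_one, sub_self]
      conv_rhs => rw [h1]
      rw [smul_smul, smul_smul]
      congr 1
      ring
    · have h0 : ρ x = 0 := (hρ0 x hx).self_of_nhds
      change ((ρ x : ℂ) * (e ⟨x, a⟩).2) • ((ρ x : ℂ) • e.symm x (1 : ℂ)) = ((ρ x : ℂ) ^ 2) • a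
      rw [h0]
      simp
  · intro x z a
    by_cases hx : x ∈ e.baseSet
    · change (ρ x : ℂ) * (e ⟨x, z • a⟩).2 = z * ((ρ x : ℂ) * (e ⟨x, a⟩).2)
      rw [triv_snd_smul e hx]
      ring
    · have h0 : ρ x = 0 := (hρ0 x hx).self_of_nhds
      change (ρ x : ℂ) * (e ⟨x, z • a⟩).2 = z * ((ρ x : ℂ) * (e ⟨x, a⟩).2)
      rw [h0]
      simp

/-- A continuous family of linear maps between fibres over nearby points, injective over points at
distance less than `δ`. -/
theorem exists_transport (A : TautSquareRoot) :
    ∃ (P : TotalSpace ℂ A.N → ∀ y, A.N y) (δ : ℝ), 0 < δ ∧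
      (∀ x y (a : A.N x), a ≠ 0 → dist x y < δ → P ⟨x, a⟩ y ≠ 0) ∧
      ∀ (T : Type) [TopologicalSpace T] (h h' : T → S2) (s : ∀ t, A.N (h t)), ContSection h s →
        Continuous h' → ContSection h' fun t => P ⟨h t, s t⟩ (h' t) := by
  choose ρ φ s hρ hρb hφ hs hφs hφz using exists_cutoff A
  obtain ⟨I, hI⟩ := isCompact_univ.elim_finite_subcover (fun b => {x : S2 | ρ b x ≠ 0})
    (fun b => isOpen_ne_fun (hρ b) continuous_const)
    (fun x _ => Set.mem_iUnion.2 ⟨x, (hρb x).ne'⟩)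
  have hlam : ∀ x, (∑ b ∈ I, ((ρ b x : ℂ) ^ 2)) ≠ 0 := by
    intro x h
    obtain ⟨b, hb, hbx⟩ := Set.mem_iUnion₂.1 (hI (Set.mem_univ x))
    have h1 : (∑ b ∈ I, ρ b x ^ 2) = 0 := by exact_mod_cast h
    have h2 := (Finset.sum_eq_zero_iff_of_nonneg fun b _ => sq_nonneg (ρ b x)).1 h1 b hb
    exact hbx (pow_eq_zero_iff two_ne_zero |>.1 h2)
  -- The transport of a vector over `x` to `y`: local sections weighted by cut-off coordinates. It is the
  -- multiplication by the positive number `∑ ρ_b(x)²` for `y = x`, so it is injective for `y` near `x`.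
  set P : TotalSpace ℂ A.N → ∀ y, A.N y := fun v y => ∑ b ∈ I, φ b v • s b y with hP
  have hV : ∀ q : S2, ∃ V : Set S2, IsOpen V ∧ q ∈ V ∧
      ∀ x ∈ V, ∀ y ∈ V, ∀ a : A.N x, a ≠ 0 → P ⟨x, a⟩ y ≠ 0 := by
    intro q
    set e := trivializationAt ℂ A.N q with he
    have hq : q ∈ e.baseSet := mem_baseSet_trivializationAt ℂ A.N q
    set G : S2 × S2 → ℂ := fun p =>
      ∑ b ∈ I, φ b (e.toOpenPartialHomeomorph.symm (p.1, 1)) * (e ⟨p.2, s b p.2⟩).2 with hG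
    have hGe : ∀ x ∈ e.baseSet, ∀ y ∈ e.baseSet,
        (e ⟨y, P ⟨x, e.symm x 1⟩ y⟩).2 = G (x, y) := by
      intro x hx y hy
      refine (map_sum (IsLinearMap.mk' _ (e.linear ℂ hy)) _ _).trans ?_
      rw [hG]
      refine Finset.sum_congr rfl fun b _ => ?_
      refine (triv_snd_smul e hy _ _).trans ?_
      rw [← e.mk_symm hx]
    have hGc : ContinuousAt G (q, q) := by
      refine tendsto_finsetSum _ fun b _ => ?_
      refine Filter.Tendsto.mul ?_ ?_
      · refine ((hφ b).continuousAt.comp (ContinuousAt.comp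
          (e.toOpenPartialHomeomorph.continuousAt_symm (e.mem_target.2 hq)) ?_) :
          ContinuousAt (fun p : S2 × S2 => φ b (e.toOpenPartialHomeomorph.symm (p.1, 1))) (q, q))
        exact ContinuousAt.prodMk continuousAt_fst continuousAt_const
      · exact ContinuousAt.comp (f := fun p : S2 × S2 => p.2) (x := (q, q))
          (ContSection.continuousAt_triv (hs b) q) continuousAt_snd
    have hGq : G (q, q) ≠ 0 := by
      rw [← hGe q hq q hq]
      refine triv_snd_ne_zero e hq ?_
      have h1 : P ⟨q, e.symm q 1⟩ q = (∑ b ∈ I, ((ρ b q : ℂ) ^ 2)) • e.symm q (1 : ℂ) := by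
        rw [hP, Finset.sum_smul]
        exact Finset.sum_congr rfl fun b _ => hφs b q _
      rw [h1]
      refine smul_ne_zero (hlam q) fun h => ?_
      have h2 := e.apply_mk_symm hq (1 : ℂ)
      rw [h] at h2
      have h3 : (e ⟨q, (0 : A.N q)⟩).2 = 0 := (e.linear ℂ hq).map_zero
      rw [h2] at h3
      exact one_ne_zero h3
    have h1 := hGc.eventually (isOpen_ne.mem_nhds hGq)
    rw [nhds_prod_eq] at h1
    obtain ⟨V, hVq, hV⟩ := (Filter.eventually_prod_self_iff (r := fun x y => G (x, y) ≠ 0)).1 h1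
    obtain ⟨W, hW, hWo, hWq⟩ := mem_nhds_iff.1
      (Filter.inter_mem hVq (e.open_baseSet.mem_nhds hq))
    refine ⟨W, hWo, hWq, fun x hx y hy a ha h0 => ?_⟩
    have hx' := (hW hx).2
    have hy' := (hW hy).2
    have hsx : e.symm x (1 : ℂ) ≠ 0 := by
      intro h
      have h2 := e.apply_mk_symm hx' (1 : ℂ)
      rw [h] at h2
      have h3 : (e ⟨x, (0 : A.N x)⟩).2 = 0 := (e.linear ℂ hx').map_zero
      rw [h2] at h3
      exact one_ne_zero h3
    obtain ⟨z, rfl⟩ := exists_eq_smul hsx a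
    have hz : z ≠ 0 := fun h => ha (by rw [h, zero_smul])
    have h2 : P ⟨x, z • e.symm x 1⟩ y = z • P ⟨x, e.symm x 1⟩ y := by
      simp only [hP, hφz, Finset.smul_sum, smul_smul]
    rw [h2, smul_eq_zero, or_iff_right hz] at h0
    apply hV x (hW hx).1 y (hW hy).1
    rw [← hGe x hx' y hy', h0]
    exact (e.linear ℂ hy').map_zero
  choose V hVo hVq hV using hV
  obtain ⟨δ, hδ, hδV⟩ := lebesgue_number_lemma_of_metric isCompact_univ hVo
    (fun x _ => Set.mem_iUnion.2 ⟨x, hVq x⟩)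
  refine ⟨P, δ, hδ, fun x y a ha hxy => ?_, fun T _ h h' s' hs' hh' => ?_⟩
  · obtain ⟨q, hq⟩ := hδV x (Set.mem_univ x)
    exact hV q x (hq (Metric.mem_ball_self hδ)) y (hq (by rwa [Metric.mem_ball, dist_comm])) a ha
  · exact ContSection.sum I hh' fun b _ => ((hs b).comp hh').smul ((hφ b).comp hs')

/-- The line bundle has a nonvanishing section along every singular simplex. -/
theorem exists_section (A : TautSquareRoot) {k : ℕ} (σ : C(Simp k, S2)) :
    ∃ f : ∀ t, A.N (σ t), ContSection σ f ∧ ∀ t, f t ≠ 0 := by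
  obtain ⟨P, δ, hδ, hP0, hP⟩ := exists_transport A
  have hcontr : ContractibleSpace (Simp k) := (convex_stdSimplex ℝ (Fin (k + 1))).contractibleSpace
    ⟨_, (stdSimplex.vertex (S := ℝ) (0 : Fin (k + 1))).2⟩
  -- Contract the simplex to a point, over which there is a section, and transport this section along the
  -- contraction in steps shorter than `δ`.
  obtain ⟨t₀, ⟨K⟩⟩ := id_nullhomotopic (Simp k)
  set H : C(unitInterval × Simp k, S2) := σ.comp K.symm.toContinuousMap with hH
  have hH0 : ∀ t, H (0, t) = σ t₀ := fun t => congrArg σ (K.symm.apply_zero t)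
  have hH1 : ∀ t, H (1, t) = σ t := fun t => congrArg σ (K.symm.apply_one t)
  obtain ⟨η, hη, hHη⟩ := Metric.uniformContinuous_iff.1
    (CompactSpace.uniformContinuous_of_continuous H.continuous) δ hδ
  obtain ⟨m, hm⟩ := exists_nat_one_div_lt hη
  set τ : ℕ → unitInterval := fun j => Set.projIcc 0 1 zero_le_one ((j : ℝ) / (m + 1)) with hτ
  have hm0 : (0 : ℝ) < m + 1 := by positivity
  have hτd : ∀ j, dist (τ j) (τ (j + 1)) < η := by
    intro j
    refine lt_of_le_of_lt ?_ hm
    have h1 : dist (τ j) (τ (j + 1)) ≤ dist ((j : ℝ) / (m + 1)) (((j + 1 : ℕ) : ℝ) / (m + 1)) := by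
      have := (LipschitzWith.projIcc (zero_le_one (α := ℝ))).dist_le_mul ((j : ℝ) / (m + 1))
        (((j + 1 : ℕ) : ℝ) / (m + 1))
      rwa [NNReal.coe_one, one_mul] at this
    refine h1.trans (le_of_eq ?_)
    rw [Real.dist_eq, ← sub_div, abs_div, abs_of_pos hm0]
    push_cast
    rw [sub_add_cancel_left, abs_neg, abs_one]
  have key : ∀ j, ∃ f : ∀ t, A.N (H (τ j, t)), ContSection (fun t => H (τ j, t)) f ∧
      ∀ t, f t ≠ 0 := by
    intro j
    induction j with
    | zero =>
      obtain ⟨ρ, φ, s, -, hρ, -, hs, hφs, -⟩ := exists_cutoff A (σ t₀)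
      have hτ0 : τ 0 = 0 := by
        simp only [hτ, Nat.cast_zero, zero_div]
        exact Set.projIcc_left _
      have hs0 : s (σ t₀) ≠ 0 := by
        intro h
        set e := trivializationAt ℂ A.N (σ t₀)
        have hq : σ t₀ ∈ e.baseSet := mem_baseSet_trivializationAt ℂ A.N _
        have h1 := hφs (σ t₀) (e.symm (σ t₀) 1)
        rw [h, smul_zero, eq_comm, smul_eq_zero] at h1
        rcases h1 with h1 | h1
        · exact hρ.ne' (by exact_mod_cast pow_eq_zero_iff two_ne_zero |>.1 h1)
        · have h2 := e.apply_mk_symm hq (1 : ℂ)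
          rw [h1] at h2
          have h3 : (e ⟨σ t₀, (0 : A.N (σ t₀))⟩).2 = 0 := (e.linear ℂ hq).map_zero
          rw [h2] at h3
          exact one_ne_zero h3
      refine ⟨fun t => s (H (τ 0, t)), hs.comp (by fun_prop), fun t => ?_⟩
      have h4 : ∀ y, y = σ t₀ → s y ≠ 0 := by
        rintro _ rfl
        exact hs0
      exact h4 _ (by rw [hτ0, hH0])
    | succ j ih =>
      obtain ⟨f, hf, hf0⟩ := ih
      refine ⟨fun t => P ⟨H (τ j, t), f t⟩ (H (τ (j + 1), t)),
        hP (Simp k) _ _ f hf (by fun_prop), fun t => hP0 _ _ _ (hf0 t) (hHη ?_)⟩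
      rw [Prod.dist_eq, dist_self, max_eq_left dist_nonneg]
      exact hτd j
  have hτ1 : τ (m + 1) = 1 := by
    have : (((m + 1 : ℕ) : ℝ)) / (m + 1) = 1 := by
      push_cast
      exact div_self hm0.ne'
    simp only [hτ, this]
    exact Set.projIcc_right _
  have h1 := key (m + 1)
  have h2 : (fun t => H (τ (m + 1), t)) = σ := by
    funext t
    rw [hτ1, hH1]
  have h3 : ∀ h : Simp k → S2, (fun t => H (τ (m + 1), t)) = h →
      ∃ f : ∀ t, A.N (h t), ContSection h f ∧ ∀ t, f t ≠ 0 := by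
    rintro _ rfl
    exact h1
  exact h3 σ h2

end LineBundle

/-! ### Obstruction cochains of a line bundle -/

section EulerCocycle

variable {A : TautSquareRoot} {X : Type*} [TopologicalSpace X]

open Bundle

/-- The obstruction cocycle of the line bundle `g^*N`, computed from nonvanishing sections over
points and paths. On each triangle the winding number of these sections is measured against an
arbitrary nonvanishing complex section, instead of a real frame. -/
structure LineEuler (g : C(X, S2)) (A : TautSquareRoot) (c : Cochains 2 X) (s₀ : ∀ x, A.N (g x))
    (s₁ : ∀ (γ : SingSimplex 1 X) (r : Simp 1), A.N (g (γ r))) : Prop where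
  point_ne_zero : ∀ x, s₀ x ≠ 0
  path_ne_zero : ∀ γ r, s₁ γ r ≠ 0
  contSection : ∀ γ, ContSection (fun r => g (γ r)) (s₁ γ)
  endpoint : ∀ γ i, s₁ γ (stdSimplex.vertex i) = s₀ (γ (stdSimplex.vertex i))
  winding : ∀ (σ : SingSimplex 2 X) (f : ∀ t, A.N (g (σ t))), ContSection (fun t => g (σ t)) f →
    (∀ t, f t ≠ 0) → ∀ u : Fin 3 → Simp 1 → ℂ,
      (∀ i r, s₁ (face i σ) r = u i r • f (simpMap i.succAbove r)) →
        bdryChange u = 2 * Real.pi * Complex.I * c σ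

/-- The cochain `c` is an obstruction cochain of the line bundle `g^*N`. -/
def IsEulerCochain (g : C(X, S2)) (A : TautSquareRoot) (c : Cochains 2 X) : Prop :=
  ∃ s₀ s₁, LineEuler g A c s₀ s₁

theorem ne_zero_of_eq_smul {q : S2} {s f : A.N q} {u : ℂ} (hs : s ≠ 0) (h : s = u • f) : u ≠ 0 := by
  rintro rfl
  exact hs (by rw [h, zero_smul])

theorem continuous_of_face_eq_smul {g : C(X, S2)} {σ : SingSimplex 2 X}
    {s₁ : ∀ (γ : SingSimplex 1 X) (r : Simp 1), A.N (g (γ r))}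
    (hs : ∀ γ, ContSection (fun r => g (γ r)) (s₁ γ)) {f : ∀ t, A.N (g (σ t))}
    (hf : ContSection (fun t => g (σ t)) f) (hf0 : ∀ t, f t ≠ 0) {u : Fin 3 → Simp 1 → ℂ}
    (hu : ∀ i r, s₁ (face i σ) r = u i r • f (simpMap i.succAbove r)) (i : Fin 3) :
    Continuous (u i) :=
  continuous_of_eq_smul (hs (face i σ)) (hf.comp (simpMap i.succAbove).continuous)
    (fun _ => hf0 _) (hu i)

/-- The winding number does not depend on the section that it is measured against. -/
theorem bdryChange_eq_of_section {g : C(X, S2)} {σ : SingSimplex 2 X}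
    {s₁ : ∀ (γ : SingSimplex 1 X) (r : Simp 1), A.N (g (γ r))} (hs0 : ∀ γ r, s₁ γ r ≠ 0)
    (hs : ∀ γ, ContSection (fun r => g (γ r)) (s₁ γ)) {f f' : ∀ t, A.N (g (σ t))}
    (hf : ContSection (fun t => g (σ t)) f) (hf0 : ∀ t, f t ≠ 0)
    (hf' : ContSection (fun t => g (σ t)) f') (hf0' : ∀ t, f' t ≠ 0) {u u' : Fin 3 → Simp 1 → ℂ}
    (hu : ∀ i r, s₁ (face i σ) r = u i r • f (simpMap i.succAbove r))
    (hu' : ∀ i r, s₁ (face i σ) r = u' i r • f' (simpMap i.succAbove r)) :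
    bdryChange u = bdryChange u' := by
  choose h hh using fun t => exists_eq_smul (hf0 t) (f' t)
  have hc : Continuous h := continuous_of_eq_smul hf' hf hf0 hh
  have hh0 : ∀ t, h t ≠ 0 := fun t => ne_zero_of_eq_smul (hf0' t) (hh t)
  have e : u = fun i r => u' i r * h (simpMap i.succAbove r) := by
    funext i r
    refine (smul_eq_smul_iff_of_ne_zero (hf0 (simpMap i.succAbove r))).1 ?_
    rw [← hu, mul_smul, ← hh]
    exact hu' i r
  rw [e, bdryChange_mul (continuous_of_face_eq_smul hs hf' hf0' hu')
    (v := fun i r => h (simpMap i.succAbove r)) (fun i => hc.comp (simpMap i.succAbove).continuous)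
    (fun i r => ne_zero_of_eq_smul (hs0 _ r) (hu' i r)) (fun i r => hh0 _), bdryChange_face hc hh0,
    add_zero]

theorem LineEuler.comp {Z : Type*} [TopologicalSpace Z] {g : C(Z, S2)} {c : Cochains 2 Z}
    {s₀ : ∀ x, A.N (g x)} {s₁ : ∀ (γ : SingSimplex 1 Z) (r : Simp 1), A.N (g (γ r))}
    (h : LineEuler g A c s₀ s₁) (k : C(X, Z)) :
    LineEuler (g.comp k) A (cochainMap 2 k c) (fun x => s₀ (k x)) (fun γ r => s₁ (k.comp γ) r) where
  point_ne_zero x := h.point_ne_zero (k x)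
  path_ne_zero γ r := h.path_ne_zero (k.comp γ) r
  contSection γ := h.contSection (k.comp γ)
  endpoint γ i := h.endpoint (k.comp γ) i
  winding σ f hf hf0 u hu := h.winding (k.comp σ) f hf hf0 u hu

theorem IsEulerCochain.comp {Z : Type*} [TopologicalSpace Z] {g : C(Z, S2)} {c : Cochains 2 Z}
    (h : IsEulerCochain g A c) (k : C(X, Z)) :
    IsEulerCochain (g.comp k) A (cochainMap 2 k c) := by
  obtain ⟨s₀, s₁, h⟩ := h
  exact ⟨_, _, h.comp k⟩

theorem exists_logChange_sub_eq {η : Simp 1 → ℂ} (hc : Continuous η) (h0 : ∀ r, η r ≠ 0) {a b : ℂ}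
    (ha : Complex.exp a = η (stdSimplex.vertex 0)) (hb : Complex.exp b = η (stdSimplex.vertex 1)) :
    ∃ n : ℤ, logChange η = b - a + 2 * Real.pi * Complex.I * n := by
  have h : Complex.exp (logChange η) = Complex.exp (b - a) := by
    rw [exp_logChange hc h0, Complex.exp_sub, ha, hb]
  obtain ⟨n, hn⟩ := Complex.exp_eq_exp_iff_exists_int.1 h
  exact ⟨n, by rw [hn]; ring⟩

theorem two_pi_I_mul_injective {a b : ℤ}
    (h : 2 * Real.pi * Complex.I * (a : ℂ) = 2 * Real.pi * Complex.I * b) : a = b := by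
  exact_mod_cast mul_left_cancel₀ Complex.two_pi_I_ne_zero h

/-- Two obstruction cochains of the same line bundle differ by a coboundary: the difference cochain
counts the windings of the ratio of the sections along paths. -/
theorem IsEulerCochain.sub_mem_coboundaries {g : C(X, S2)} {c c' : Cochains 2 X}
    (h : IsEulerCochain g A c) (h' : IsEulerCochain g A c') : c - c' ∈ coboundaries 2 X := by
  obtain ⟨s₀, s₁, h⟩ := h
  obtain ⟨s₀', s₁', h'⟩ := h'
  -- The ratios `ε`, `η` of the two systems of sections at the points and along the paths; the change of
  -- the logarithm of `η` along a path, corrected by the logarithms of `ε` at its ends, is `2πi` times the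
  -- integral cochain `d` whose coboundary is the difference.
  choose ε hε using fun x => exists_eq_smul (h'.point_ne_zero x) (s₀ x)
  choose η hη using fun γ r => exists_eq_smul (h'.path_ne_zero γ r) (s₁ γ r)
  have hηc : ∀ γ, Continuous (η γ) := fun γ =>
    continuous_of_eq_smul (h.contSection γ) (h'.contSection γ) (h'.path_ne_zero γ) (hη γ)
  have hη0 : ∀ γ r, η γ r ≠ 0 := fun γ r => ne_zero_of_eq_smul (h.path_ne_zero γ r) (hη γ r)
  have hε0 : ∀ x, ε x ≠ 0 := fun x => ne_zero_of_eq_smul (h.point_ne_zero x) (hε x)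
  have hend : ∀ γ i, Complex.exp (Complex.log (ε (γ (stdSimplex.vertex i)))) =
      η γ (stdSimplex.vertex i) := by
    intro γ i
    rw [Complex.exp_log (hε0 _)]
    refine (smul_eq_smul_iff_of_ne_zero (h'.path_ne_zero γ (stdSimplex.vertex i))).1 ?_
    rw [← hη, h.endpoint, h'.endpoint]
    exact (hε _).symm
  choose d hd using fun γ => exists_logChange_sub_eq (hηc γ) (hη0 γ) (hend γ 0) (hend γ 1)
  refine ⟨d, ?_⟩
  funext σ
  obtain ⟨f, hf, hf0⟩ := exists_section A (g.comp σ)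
  choose u' hu' using fun (i : Fin 3) (r : Simp 1) =>
    exists_eq_smul (hf0 (simpMap i.succAbove r)) (s₁' (face i σ) r)
  have hu : ∀ (i : Fin 3) (r : Simp 1), s₁ (face i σ) r =
      (η (face i σ) r * u' i r) • f (simpMap i.succAbove r) := by
    intro i r
    rw [hη, mul_smul, ← hu']
    rfl
  have e1 := h.winding σ f hf hf0 _ hu
  have e2 := h'.winding σ f hf hf0 _ hu'
  rw [bdryChange_mul (fun i => hηc _) (continuous_of_face_eq_smul h'.contSection hf hf0 hu')
    (fun i r => hη0 _ r) (fun i r => ne_zero_of_eq_smul (h'.path_ne_zero _ r) (hu' i r)), e2] at e1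
  apply two_pi_I_mul_injective
  have e3 : cobdry 1 X d σ = d (face 0 σ) - d (face 1 σ) + d (face 2 σ) := by
    change ∑ i : Fin 3, (-1 : ℤ) ^ (i : ℕ) * d (face i σ) = _
    rw [Fin.sum_univ_three]
    simp only [Fin.val_zero, Fin.val_one, Fin.val_two]
    ring
  have e4 : ∀ (i : Fin 3) (a : Fin 2), (face i σ) (stdSimplex.vertex a) =
      σ (stdSimplex.vertex (i.succAbove a)) := fun i a =>
    congrArg σ (simpMap_vertex i.succAbove a)
  have s00 : (0 : Fin 3).succAbove (0 : Fin 2) = 1 := rfl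
  have s01 : (0 : Fin 3).succAbove (1 : Fin 2) = 2 := rfl
  have s10 : (1 : Fin 3).succAbove (0 : Fin 2) = 0 := rfl
  have s11 : (1 : Fin 3).succAbove (1 : Fin 2) = 2 := rfl
  have s20 : (2 : Fin 3).succAbove (0 : Fin 2) = 0 := rfl
  have s21 : (2 : Fin 3).succAbove (1 : Fin 2) = 1 := rfl
  rw [bdryChange_eq, hd, hd, hd] at e1
  simp only [e4, s00, s01, s10, s11, s20, s21] at e1
  rw [e3, Pi.sub_apply]
  push_cast
  linear_combination e1

theorem exists_ne_zero (A : TautSquareRoot) (q : S2) : ∃ v : A.N q, v ≠ 0 := by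
  obtain ⟨f, -, hf⟩ := exists_section (k := 0) A (ContinuousMap.const _ q)
  exact ⟨f (stdSimplex.vertex 0), hf _⟩

/-- Nonzero vectors over the endpoints of a path extend to a nonvanishing section along it. -/
theorem exists_section_of_endpoints (A : TautSquareRoot) (γ : SingSimplex 1 S2)
    (a : ∀ q, A.N q) (ha : ∀ q, a q ≠ 0) :
    ∃ s : ∀ r, A.N (γ r), ContSection γ s ∧ (∀ r, s r ≠ 0) ∧
      ∀ i, s (stdSimplex.vertex i) = a (γ (stdSimplex.vertex i)) := by
  obtain ⟨f, hf, hf0⟩ := exists_section A γ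
  choose z hz using fun i : Fin 2 =>
    exists_eq_smul (hf0 (stdSimplex.vertex i)) (a (γ (stdSimplex.vertex i)))
  have hz0 : ∀ i, z i ≠ 0 := fun i => ne_zero_of_eq_smul (ha _) (hz i)
  have hcoord : ∀ i : Fin 2, Continuous fun r : Simp 1 => ((r i : ℝ) : ℂ) := fun i =>
    Complex.continuous_ofReal.comp ((continuous_apply i).comp continuous_subtype_val)
  refine ⟨fun r => Complex.exp (∑ i : Fin 2, ((r i : ℝ) : ℂ) * Complex.log (z i)) • f r,
    hf.smul ?_, fun r => smul_ne_zero (Complex.exp_ne_zero _) (hf0 r), fun i => ?_⟩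
  · exact Complex.continuous_exp.comp
      (continuous_finsetSum _ fun i _ => (hcoord i).mul continuous_const)
  · have e : ∑ j : Fin 2, ((stdSimplex.vertex (S := ℝ) i j : ℝ) : ℂ) * Complex.log (z j) =
        Complex.log (z i) := by
      fin_cases i <;> simp [Fin.sum_univ_two, stdSimplex.vertex]
    beta_reduce
    rw [hz i, e, Complex.exp_log (hz0 i)]

theorem sum_face_face_eq_zero (G : (Fin 2 → Fin 4) → ℂ) :
    ∑ i : Fin 4, (-1 : ℂ) ^ (i : ℕ) *
      ∑ j : Fin 3, (-1 : ℂ) ^ (j : ℕ) * G (i.succAbove ∘ j.succAbove) = 0 := by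
  have h00 : ((0 : Fin 4).succAbove ∘ (0 : Fin 3).succAbove) = ![2, 3] := by decide
  have h01 : ((0 : Fin 4).succAbove ∘ (1 : Fin 3).succAbove) = ![1, 3] := by decide
  have h02 : ((0 : Fin 4).succAbove ∘ (2 : Fin 3).succAbove) = ![1, 2] := by decide
  have h10 : ((1 : Fin 4).succAbove ∘ (0 : Fin 3).succAbove) = ![2, 3] := by decide
  have h11 : ((1 : Fin 4).succAbove ∘ (1 : Fin 3).succAbove) = ![0, 3] := by decide
  have h12 : ((1 : Fin 4).succAbove ∘ (2 : Fin 3).succAbove) = ![0, 2] := by decide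
  have h20 : ((2 : Fin 4).succAbove ∘ (0 : Fin 3).succAbove) = ![1, 3] := by decide
  have h21 : ((2 : Fin 4).succAbove ∘ (1 : Fin 3).succAbove) = ![0, 3] := by decide
  have h22 : ((2 : Fin 4).succAbove ∘ (2 : Fin 3).succAbove) = ![0, 1] := by decide
  have h30 : ((3 : Fin 4).succAbove ∘ (0 : Fin 3).succAbove) = ![1, 2] := by decide
  have h31 : ((3 : Fin 4).succAbove ∘ (1 : Fin 3).succAbove) = ![0, 2] := by decide
  have h32 : ((3 : Fin 4).succAbove ∘ (2 : Fin 3).succAbove) = ![0, 1] := by decide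
  have e3 : ((3 : Fin 4) : ℕ) = 3 := rfl
  rw [Fin.sum_univ_four]
  simp only [Fin.sum_univ_three, h00, h01, h02, h10, h11, h12, h20, h21, h22, h30, h31, h32,
    Fin.val_zero, Fin.val_one, Fin.val_two, e3]
  ring

/-- The line bundle over the sphere has an obstruction cocycle. -/
theorem exists_isEulerCochain (A : TautSquareRoot) :
    ∃ c : cocycles 2 S2, IsEulerCochain (ContinuousMap.id S2) A c.1 := by
  choose s₀ hs₀ using exists_ne_zero A
  choose s₁ hs hs0 hend using fun γ => exists_section_of_endpoints A γ s₀ hs₀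
  choose f hf hf0 using fun σ : SingSimplex 2 S2 => exists_section A σ
  choose u hu using fun (σ : SingSimplex 2 S2) (i : Fin 3) (r : Simp 1) =>
    exists_eq_smul (hf0 σ (simpMap i.succAbove r)) (s₁ (face i σ) r)
  have hn : ∀ σ, ∃ n : ℤ, bdryChange (u σ) = 2 * Real.pi * Complex.I * n := by
    intro σ
    refine exists_bdryChange_eq (continuous_of_face_eq_smul (g := ContinuousMap.id S2) hs (hf σ)
      (hf0 σ) (hu σ)) (fun i r => ne_zero_of_eq_smul (hs0 _ r) (hu σ i r)) ?_
    choose y hy using fun k : Fin 3 =>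
      exists_eq_smul (hf0 σ (stdSimplex.vertex k)) (s₀ (σ (stdSimplex.vertex k)))
    refine vertexCompatible_of_vertex y fun i a => ?_
    have h1 := hu σ i (stdSimplex.vertex a)
    rw [hend] at h1
    have h2 : ∀ t, t = stdSimplex.vertex (i.succAbove a) → s₀ (σ t) = u σ i (stdSimplex.vertex a) • f σ t →
        u σ i (stdSimplex.vertex a) = y (i.succAbove a) := by
      rintro _ rfl h
      exact (smul_eq_smul_iff_of_ne_zero (hf0 σ _)).1 (h.symm.trans (hy _))
    exact h2 _ (simpMap_vertex _ _) h1
  choose c hc using hn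
  have hL : LineEuler (ContinuousMap.id S2) A c s₀ s₁ :=
    { point_ne_zero := hs₀
      path_ne_zero := hs0
      contSection := hs
      endpoint := hend
      winding := fun σ f' hf' hf0' u' hu' => by
        rw [← hc]
        exact bdryChange_eq_of_section (g := ContinuousMap.id S2) hs0 hs hf' hf0' (hf σ) (hf0 σ)
          hu' (hu σ) }
  refine ⟨⟨c, ?_⟩, s₀, s₁, hL⟩
  -- The cochain is closed: measured by a section `F` over the whole tetrahedron, the windings around the
  -- faces are sums over edges, and every edge occurs twice with opposite signs.
  change cobdry 2 S2 c = 0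
  funext τ
  obtain ⟨F, hF, hF0⟩ := exists_section A τ
  choose U hU using fun (e : Fin 2 → Fin 4) (r : Simp 1) =>
    exists_eq_smul (hF0 (simpMap e r)) (s₁ (τ.comp (simpMap e)) r)
  have hU' : ∀ (e : Fin 2 → Fin 4) (γ : SingSimplex 1 S2), γ = τ.comp (simpMap e) → ∀ r t,
      t = simpMap e r → HEq (s₁ γ r) (U e r • F t) := by
    rintro e _ rfl r _ rfl
    exact heq_of_eq (hU e r)
  have key : ∀ i : Fin 4, 2 * Real.pi * Complex.I * (c (face i τ) : ℂ) =
      ∑ j : Fin 3, (-1 : ℂ) ^ (j : ℕ) * logChange (U (i.succAbove ∘ j.succAbove)) := by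
    intro i
    refine (hL.winding (face i τ) (fun t => F (simpMap i.succAbove t))
      (hF.comp (simpMap i.succAbove).continuous) (fun t => hF0 _)
      (fun j => U (i.succAbove ∘ j.succAbove)) fun j r => eq_of_heq ?_).symm
    refine hU' _ _ (comp_simpMap_comp τ _ _) r _ ?_
    rw [← simpMap_comp]
    rfl
  apply two_pi_I_mul_injective
  change 2 * Real.pi * Complex.I * ((∑ i : Fin 4, (-1 : ℤ) ^ (i : ℕ) * c (face i τ) : ℤ) : ℂ) = _
  rw [← (sum_face_face_eq_zero fun e => logChange (U e)).trans
    (by simp : (0 : ℂ) = 2 * Real.pi * Complex.I * (((0 : Cochains 3 S2) τ : ℤ) : ℂ))]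
  push_cast
  rw [Finset.mul_sum]
  refine Finset.sum_congr rfl fun i _ => ?_
  rw [← key]
  ring

end EulerCocycle

/-! ### The Euler class of a pulled-back line bundle -/

section EulerClass

variable {A : TautSquareRoot} {X : Type*} [TopologicalSpace X]

open Bundle

theorem continuous_pullback_iff {T : Type*} [TopologicalSpace T] {g : C(X, S2)} {h : T → X}
    (f : ∀ t, A.N (g (h t))) :
    (Continuous fun t => (TotalSpace.mk' ℂ (h t) (f t) : TotalSpace ℂ (g *ᵖ A.N))) ↔
      Continuous h ∧ ContSection (fun t => g (h t)) f := by
  rw [(inducing_pullbackTotalSpaceEmbedding (F := ℂ) (E := A.N) (f := g)).continuous_iff,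
    continuous_prodMk]
  rfl

/-- A real-linear combination of `1` and `z`, for `z` in the upper half plane, compared with the
same combination of `1` and `i`. -/
theorem div_mem_slitPlane {z w : ℂ} (hz : 0 < z.im) (hw : w ≠ 0) :
    ((w.re : ℂ) + z * w.im) / w ∈ Complex.slitPlane := by
  have hn : 0 < Complex.normSq w := Complex.normSq_pos.2 hw
  have hre : (((w.re : ℂ) + z * w.im) / w).re =
      (w.re ^ 2 + z.re * w.re * w.im + z.im * w.im ^ 2) / Complex.normSq w := by
    rw [Complex.div_re]
    simp
    ring
  have him : (((w.re : ℂ) + z * w.im) / w).im =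
      (z.im * w.re * w.im - w.re * w.im - z.re * w.im ^ 2) / Complex.normSq w := by
    rw [Complex.div_im]
    simp
    ring
  rw [Complex.mem_slitPlane_iff, hre, him]
  by_cases h0 : z.im * w.re * w.im - w.re * w.im - z.re * w.im ^ 2 = 0
  · left
    refine div_pos ?_ hn
    by_cases hb : w.im = 0
    · have ha : w.re ≠ 0 := fun h => hw (Complex.ext h hb)
      rw [hb]
      have := sq_pos_of_ne_zero ha
      nlinarith
    · have h1 : z.re * w.im = z.im * w.re - w.re := by
        apply mul_right_cancel₀ hb
        linarith
      have h2 : w.re ^ 2 + z.re * w.re * w.im + z.im * w.im ^ 2 =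
          z.im * (w.re ^ 2 + w.im ^ 2) := by
        linear_combination w.re * h1
      rw [h2]
      have := sq_pos_of_ne_zero hb
      positivity
  · exact Or.inr (div_ne_zero h0 hn.ne')

theorem exists_re_add_mul_im {z : ℂ} (hz : 0 < z.im) (y : ℂ) :
    ∃ w : ℂ, ∀ w' : ℂ, (w'.re : ℂ) + z * w'.im = y → w' = w := by
  refine ⟨⟨y.re - z.re * (y.im / z.im), y.im / z.im⟩, ?_⟩
  rintro w' rfl
  have h1 : ((w'.re : ℂ) + z * w'.im).im / z.im = w'.im := by
    simp [hz.ne']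
  apply Complex.ext
  · simp only [h1]
    simp
  · exact h1.symm

/-- The winding of a family of vectors around the boundary of a triangle, measured in a positive
real frame of a complex line bundle, agrees with the winding of its complex coefficient. -/
theorem bdryChange_eq_of_frame {f : Simp 2 → ℂ} (hf : Continuous f) (hf0 : ∀ t, 0 < (f t).im)
    {θ : Fin 3 → C(Simp 1, ℂ)} {y : Fin 3 → ℂ}
    (hy : ∀ (i : Fin 3) (a : Fin 2), ((Complex.exp (θ i (stdSimplex.vertex a))).re : ℂ) +
      f (stdSimplex.vertex (i.succAbove a)) * (Complex.exp (θ i (stdSimplex.vertex a))).im =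
        y (i.succAbove a)) :
    bdryChange (fun i r => ((Complex.exp (θ i r)).re : ℂ) +
      f (simpMap i.succAbove r) * (Complex.exp (θ i r)).im) =
      ∑ i : Fin 3, (-1 : ℂ) ^ (i : ℕ) *
        (θ i (stdSimplex.vertex 1) - θ i (stdSimplex.vertex 0)) := by
  have hexp : ∀ i, Continuous fun r => Complex.exp (θ i r) := fun i =>
    Complex.continuous_exp.comp (θ i).continuous
  set v : Fin 3 → Simp 1 → ℂ := fun i r => (((Complex.exp (θ i r)).re : ℂ) +
      f (simpMap i.succAbove r) * (Complex.exp (θ i r)).im) / Complex.exp (θ i r) with hv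
  have hvm : ∀ i r, v i r ∈ Complex.slitPlane := fun i r =>
    div_mem_slitPlane (hf0 _) (Complex.exp_ne_zero _)
  have hvc : ∀ i, Continuous (v i) := by
    intro i
    refine Continuous.div ?_ (hexp i) fun r => Complex.exp_ne_zero _
    exact (Complex.continuous_ofReal.comp (Complex.continuous_re.comp (hexp i))).add
      ((hf.comp (simpMap i.succAbove).continuous).mul
        (Complex.continuous_ofReal.comp (Complex.continuous_im.comp (hexp i))))
  have hcomp : VertexCompatible v := by
    choose w hw using fun k : Fin 3 =>
      exists_re_add_mul_im (hf0 (stdSimplex.vertex k)) (y k)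
    refine vertexCompatible_of_vertex (fun k => y k / w k) fun i a => ?_
    simp only [hv, simpMap_vertex]
    rw [hy, hw _ _ (hy i a)]
  have h1 : (fun i r => ((Complex.exp (θ i r)).re : ℂ) +
      f (simpMap i.succAbove r) * (Complex.exp (θ i r)).im) =
      fun i r => Complex.exp (θ i r) * v i r := by
    funext i r
    rw [hv, mul_div_cancel₀ _ (Complex.exp_ne_zero _)]
  rw [h1, bdryChange_mul hexp hvc (fun i r => Complex.exp_ne_zero _)
    (fun i r => Complex.slitPlane_ne_zero (hvm i r)), bdryChange_of_mem_slitPlane hvc hvm hcomp,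
    add_zero, bdryChange]
  exact Finset.sum_congr rfl fun i _ => by rw [logChange_eq (θ := θ i) fun r => rfl]

theorem smul_eq_re_smul_add_im_smul {q : S2} (w : ℂ) (v : A.N q) :
    w • v = w.re • v + w.im • Complex.I • v := by
  change _ = (w.re : ℂ) • v + (w.im : ℂ) • Complex.I • v
  rw [smul_smul, ← add_smul, Complex.re_add_im]

/-- Trivializations by positive real frames, used in the definition of the Euler class, give the same
winding numbers as trivializations by complex sections: the frame is a path of frames `(f, z f)` with
`Im z > 0`, which does not change windings. -/
theorem IsEulerClassPullback.exists_isEulerCochain {g : C(X, S2)} {e : Cohomology 2 X}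
    (h : IsEulerClassPullback g A e) :
    ∃ c : cocycles 2 X, cohClass c = e ∧ IsEulerCochain g A c.1 := by
  obtain ⟨c, s₀, s₁, hce, hs₀, hs0, hs, hend, hσ⟩ := h
  have hs' : ∀ γ : SingSimplex 1 X, ContSection (fun r => g (γ r)) (s₁ γ) := fun γ =>
    ((continuous_pullback_iff (A := A) (g := g) (h := γ) (s₁ γ)).1 (hs γ)).2
  refine ⟨c, hce, s₀, s₁, hs₀, hs0, hs', hend, fun σ f hf hf0 u hu => ?_⟩
  obtain ⟨f₁, f₂, θ, hf₁, hf₂, hpos, hsθ, hcθ⟩ := hσ σ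
  replace hf₁ := ((continuous_pullback_iff (A := A) (g := g) (h := σ) f₁).1 hf₁).2
  replace hf₂ := ((continuous_pullback_iff (A := A) (g := g) (h := σ) f₂).1 hf₂).2
  choose hf₁0 z hz hzf using hpos
  have hzc : Continuous z := continuous_of_eq_smul hf₂ hf₁ hf₁0 hzf
  have hu' : ∀ (i : Fin 3) (r : Simp 1), s₁ (face i σ) r = (((Complex.exp (θ i r)).re : ℂ) +
      z (simpMap i.succAbove r) * (Complex.exp (θ i r)).im) • f₁ (simpMap i.succAbove r) := by
    intro i r
    refine (hsθ i r).trans ?_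
    rw [hzf, add_smul, mul_comm, mul_smul]
    rfl
  rw [bdryChange_eq_of_section hs0 hs' hf hf0 hf₁ hf₁0 hu hu']
  choose y hy using fun k : Fin 3 =>
    exists_eq_smul (A := A) (hf₁0 (stdSimplex.vertex k)) (s₀ (σ (stdSimplex.vertex k)))
  rw [hcθ]
  refine bdryChange_eq_of_frame hzc hz (y := y) fun i a => ?_
  have h1 := hu' i (stdSimplex.vertex a)
  rw [hend] at h1
  have h2 : ∀ t, t = stdSimplex.vertex (i.succAbove a) → ∀ w : ℂ → ℂ,
      (s₀ (σ t) : A.N (g (σ t))) = w (z t) • f₁ t →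
        w (z (stdSimplex.vertex (i.succAbove a))) = y (i.succAbove a) := by
    rintro _ rfl w h
    exact (smul_eq_smul_iff_of_ne_zero (A := A) (hf₁0 _)).1 (h.symm.trans (hy _))
  exact h2 _ (simpMap_vertex _ _) (fun x => ((Complex.exp (θ i (stdSimplex.vertex a))).re : ℂ) +
      x * (Complex.exp (θ i (stdSimplex.vertex a))).im) h1

/-- A complex section `f` gives the positive real frame `(f, i f)`. -/
theorem IsEulerCochain.isEulerClassPullback {g : C(X, S2)} {c : cocycles 2 X}
    (h : IsEulerCochain g A c.1) : IsEulerClassPullback g A (cohClass c) := by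
  obtain ⟨s₀, s₁, h⟩ := h
  refine ⟨c, s₀, s₁, rfl, h.point_ne_zero, h.path_ne_zero, fun γ =>
    (continuous_pullback_iff (A := A) (g := g) (h := γ) (s₁ γ)).2 ⟨γ.continuous, h.contSection γ⟩,
    h.endpoint, fun σ => ?_⟩
  obtain ⟨f, hf, hf0⟩ := exists_section A (g.comp σ)
  choose u hu using fun (i : Fin 3) (r : Simp 1) =>
    exists_eq_smul (hf0 (simpMap i.succAbove r)) (s₁ (face i σ) r)
  have huc := continuous_of_face_eq_smul h.contSection hf hf0 hu
  choose θ hθ using fun i => exists_log (huc i)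
    fun r => ne_zero_of_eq_smul (h.path_ne_zero _ r) (hu i r)
  refine ⟨f, fun t => Complex.I • f t, θ, ?_, ?_, fun t => ⟨hf0 t, Complex.I, by simp, rfl⟩,
    fun i r => ?_, ?_⟩
  · exact (continuous_pullback_iff (A := A) (g := g) (h := σ) f).2 ⟨σ.continuous, hf⟩
  · exact (continuous_pullback_iff (A := A) (g := g) (h := σ) fun t => Complex.I • f t).2
      ⟨σ.continuous, hf.smul continuous_const⟩
  · refine (hu i r).trans ?_
    rw [hθ]
    exact smul_eq_re_smul_add_im_smul (u i r) (f (simpMap i.succAbove r))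
  · rw [← h.winding σ f hf hf0 u hu, bdryChange]
    exact Finset.sum_congr rfl fun i _ => by rw [logChange_eq (hθ i)]

end EulerClass

/-! ### Complex multiplication in tangent planes -/

section TangentRotation

/-- The action of a complex number on the plane orthogonal to a unit vector. -/
noncomputable def planeMul (x : E3) (z : ℂ) (v : E3) : E3 := z.re • v + z.im • cross x v

/-- The complex number that takes one vector of the plane orthogonal to `x` to another. -/
noncomputable def planeRatio (x T F : E3) : ℂ :=
  ⟨inner ℝ T F / inner ℝ F F, inner ℝ T (cross x F) / inner ℝ F F⟩

theorem planeMul_apply (x : E3) (z : ℂ) (v : E3) (i : Fin 3) :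
    planeMul x z v i = z.re * v i + z.im * cross x v i := rfl

theorem planeMul_planeRatio (q : S2) {T F : E3} (hT : inner ℝ (q : E3) T = 0)
    (hF : inner ℝ (q : E3) F = 0) (hF0 : F ≠ 0) : planeMul q (planeRatio q T F) F = T := by
  have hq := inner_self_S2 q
  have hn : inner ℝ F F ≠ 0 := inner_self_ne_zero.2 hF0
  have h1 := triple_smul_eq (q : E3) F (cross q F) T
  have h2 : triple (q : E3) F (cross q F) = inner ℝ F F := by
    rw [inner_E3] at hq hF
    simp only [triple_eq, inner_E3, cross_zero, cross_one, cross_two]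
    linear_combination (F 0 * F 0 + F 1 * F 1 + F 2 * F 2) * hq -
      ((q : E3) 0 * F 0 + (q : E3) 1 * F 1 + (q : E3) 2 * F 2) * hF
  have h3 : cross (cross (q : E3) F) q = F := by
    rw [inner_E3] at hq hF
    apply E3_ext <;> simp only [cross_zero, cross_one, cross_two]
    · linear_combination F 0 * hq - (q : E3) 0 * hF
    · linear_combination F 1 * hq - (q : E3) 1 * hF
    · linear_combination F 2 * hq - (q : E3) 2 * hF
  rw [h2, h3, real_inner_comm (q : E3) T, hT, zero_smul, zero_add] at h1
  rw [planeMul, planeRatio]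
  apply smul_right_injective E3 hn
  simp only [smul_add, smul_smul, mul_div_cancel₀ _ hn]
  exact h1.symm

theorem planeRatio_planeMul (q : S2) (z : ℂ) {F : E3} (hF : inner ℝ (q : E3) F = 0) (hF0 : F ≠ 0) :
    planeRatio q (planeMul q z F) F = z := by
  have hq := inner_self_S2 q
  have hn : inner ℝ F F ≠ 0 := inner_self_ne_zero.2 hF0
  rw [inner_E3] at hq hF
  apply Complex.ext
  · rw [planeRatio]
    simp only
    rw [div_eq_iff hn]
    simp only [inner_E3, planeMul_apply, cross_zero, cross_one, cross_two]
    ring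
  · rw [planeRatio]
    simp only
    rw [div_eq_iff hn]
    simp only [inner_E3, planeMul_apply, cross_zero, cross_one, cross_two]
    linear_combination z.im * (F 0 * F 0 + F 1 * F 1 + F 2 * F 2) * hq -
      z.im * ((q : E3) 0 * F 0 + (q : E3) 1 * F 1 + (q : E3) 2 * F 2) * hF

theorem planeMul_mul (q : S2) (z w : ℂ) {v : E3} (hv : inner ℝ (q : E3) v = 0) :
    planeMul q (z * w) v = planeMul q z (planeMul q w v) := by
  have hq := inner_self_S2 q
  rw [inner_E3] at hq hv
  apply E3_ext <;> simp only [planeMul_apply, cross_zero, cross_one, cross_two, Complex.mul_re,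
    Complex.mul_im]
  · linear_combination (z.im * w.im * v 0) * hq - z.im * w.im * (q : E3) 0 * hv
  · linear_combination (z.im * w.im * v 1) * hq - z.im * w.im * (q : E3) 1 * hv
  · linear_combination (z.im * w.im * v 2) * hq - z.im * w.im * (q : E3) 2 * hv

theorem planeRatio_ne_zero (q : S2) {T F : E3} (hT : inner ℝ (q : E3) T = 0)
    (hF : inner ℝ (q : E3) F = 0) (hF0 : F ≠ 0) (hT0 : T ≠ 0) : planeRatio q T F ≠ 0 := by
  intro h
  have h1 := planeMul_planeRatio q hT hF hF0
  rw [h] at h1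
  apply hT0
  rw [← h1]
  simp [planeMul]

theorem continuous_cross {T : Type*} [TopologicalSpace T] {f g : T → E3} (hf : Continuous f)
    (hg : Continuous g) : Continuous fun t => cross (f t) (g t) := by
  unfold cross
  fun_prop

theorem continuous_planeRatio {T : Type*} [TopologicalSpace T] {x v F : T → E3}
    (hx : Continuous x) (hv : Continuous v) (hF : Continuous F) (hF0 : ∀ t, F t ≠ 0) :
    Continuous fun t => planeRatio (x t) (v t) (F t) := by
  have hn : ∀ t, inner ℝ (F t) (F t) ≠ 0 := fun t => inner_self_ne_zero.2 (hF0 t)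
  exact Complex.equivRealProdCLM.symm.continuous.comp
    (((hv.inner hF).div (hF.inner hF) hn).prodMk
      ((hv.inner (continuous_cross hx hF)).div (hF.inner hF) hn))

end TangentRotation

/-! ### The Euler number of the square root -/

section EulerNumber

variable {A : TautSquareRoot}

theorem ContSection.continuous_sq {T : Type*} [TopologicalSpace T] {h : T → S2}
    {s : ∀ t, A.N (h t)} (hs : ContSection h s) : Continuous fun t => A.sq (h t) (s t) :=
  A.continuous_sq.comp hs

theorem sq_smul_eq_planeMul {q : S2} (z : ℂ) (v : A.N q) :
    A.sq q (z • v) = planeMul q (z * z) (A.sq q v) := by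
  rw [← sq]
  exact A.sq_smul q z v

theorem planeRatio_sq_smul {q : S2} (z : ℂ) (v : A.N q) {F : E3} (hF : inner ℝ (q : E3) F = 0)
    (hF0 : F ≠ 0) : planeRatio q (A.sq q (z • v)) F = (z * z) * planeRatio q (A.sq q v) F := by
  rw [sq_smul_eq_planeMul]
  conv_lhs => rw [← planeMul_planeRatio q (A.sq_mem q v) hF hF0]
  rw [← planeMul_mul _ _ _ hF, planeRatio_planeMul _ _ hF hF0]

/-- Twice the winding of a section is the winding of its square, measured against a tangent vector
field of the sphere. -/
theorem two_mul_winding_eq {c : Cochains 2 S2} {s₀ : ∀ x, A.N x}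
    {s₁ : ∀ (γ : SingSimplex 1 S2) (r : Simp 1), A.N (γ r)}
    (h : LineEuler (ContinuousMap.id S2) A c s₀ s₁) {F : S2 → E3} (hF : Continuous F)
    (hFt : ∀ x : S2, inner ℝ (x : E3) (F x) = 0) (σ : SingSimplex 2 S2) (hσ : ∀ t, F (σ t) ≠ 0) :
    2 * (2 * Real.pi * Complex.I * c σ) = bdryChange fun i r =>
      planeRatio (face i σ r) (A.sq (face i σ r) (s₁ (face i σ) r)) (F (face i σ r)) := by
  obtain ⟨f, hf, hf0⟩ := exists_section A σ
  choose u hu using fun (i : Fin 3) (r : Simp 1) =>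
    exists_eq_smul (hf0 (simpMap i.succAbove r)) (s₁ (face i σ) r)
  have huc := continuous_of_face_eq_smul (g := ContinuousMap.id S2) h.contSection hf hf0 hu
  have hu0 : ∀ i r, u i r ≠ 0 := fun i r => ne_zero_of_eq_smul (h.path_ne_zero _ r) (hu i r)
  set k : Simp 2 → ℂ := fun t => planeRatio (σ t) (A.sq (σ t) (f t)) (F (σ t)) with hk
  have hkc : Continuous k := continuous_planeRatio (continuous_subtype_val.comp σ.continuous)
    hf.continuous_sq (hF.comp σ.continuous) hσ
  have hk0 : ∀ t, k t ≠ 0 := fun t => planeRatio_ne_zero (σ t) (A.sq_mem _ _) (hFt _) (hσ t)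
    (A.sq_ne_zero _ _ (hf0 t))
  have e : (fun i r => planeRatio (face i σ r) (A.sq (face i σ r) (s₁ (face i σ) r))
      (F (face i σ r))) = fun i r => (u i r * u i r) * k (simpMap i.succAbove r) := by
    funext i r
    rw [hu]
    exact planeRatio_sq_smul _ _ (hFt _) (hσ _)
  rw [e, bdryChange_mul (u := fun i r => u i r * u i r)
    (v := fun i r => k (simpMap i.succAbove r)) (fun i => (huc i).mul (huc i))
    (fun i => hkc.comp (simpMap i.succAbove).continuous)
    (fun i r => mul_ne_zero (hu0 i r) (hu0 i r)) (fun i r => hk0 _), bdryChange_face hkc hk0,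
    bdryChange_mul huc huc hu0 hu0, h.winding σ f hf hf0 u hu]
  ring

/-- The tangent field of the sphere obtained from `e₀` by parallel transport along the great circles
through the pole `a e₂`, for `a = ±1`, rescaled so as to vanish only at the other pole. -/
noncomputable def polarField (a : ℝ) (x : E3) : E3 :=
  WithLp.toLp 2 ![1 + a * x 2 - x 0 * x 0, -(x 0 * x 1), -(x 0 * (x 2 + a))]

theorem continuous_polarField (a : ℝ) : Continuous (polarField a) := by
  unfold polarField
  fun_prop

@[simp] theorem polarField_zero (a : ℝ) (x : E3) :
    polarField a x 0 = 1 + a * x 2 - x 0 * x 0 := rfl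
@[simp] theorem polarField_one (a : ℝ) (x : E3) : polarField a x 1 = -(x 0 * x 1) := rfl
@[simp] theorem polarField_two (a : ℝ) (x : E3) : polarField a x 2 = -(x 0 * (x 2 + a)) := rfl

theorem inner_polarField (a : ℝ) (x : S2) : inner ℝ (x : E3) (polarField a x) = 0 := by
  have hq := inner_self_S2 x
  rw [inner_E3] at hq ⊢
  simp only [polarField_zero, polarField_one, polarField_two]
  linear_combination -(x : E3) 0 * hq

theorem polarField_ne_zero {a : ℝ} (ha : a * a = 1) {x : S2} (hx : 1 + a * (x : E3) 2 ≠ 0) :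
    polarField a x ≠ 0 := by
  intro h
  apply hx
  have hq := inner_self_S2 x
  have h0 := congrArg (fun y : E3 => y 0) h
  have h2 := congrArg (fun y : E3 => y 2) h
  rw [inner_E3] at hq
  simp only [polarField_zero, polarField_two, PiLp.zero_apply] at h0 h2
  by_cases h3 : (x : E3) 0 = 0
  · rw [h3] at h0
    linarith
  · have h4 : (x : E3) 2 + a = 0 := by
      rw [neg_eq_zero] at h2
      exact (mul_eq_zero.1 h2).resolve_left h3
    linear_combination a * h4 - ha

/-- The horizontal coordinates as a complex number. -/
noncomputable def horizontal (x : E3) : ℂ := ⟨x 0, x 1⟩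

theorem polarField_neg_one_eq (x : S2) (hx : 1 + (x : E3) 2 ≠ 0) :
    polarField (-1) x = planeMul x (-(horizontal x * horizontal x) *
      ((1 / ((1 + (x : E3) 2) * (1 + (x : E3) 2)) : ℝ) : ℂ)) (polarField 1 x) := by
  have hq := inner_self_S2 x
  rw [inner_E3] at hq
  have hx2 : (1 + (x : E3) 2) * (1 + (x : E3) 2) ≠ 0 := mul_ne_zero hx hx
  apply smul_right_injective E3 hx2
  set d := (1 + (x : E3) 2) * (1 + (x : E3) 2) with hd
  have e : ∀ z : ℂ, d • planeMul x (z * ((1 / d : ℝ) : ℂ)) (polarField 1 x) =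
      planeMul x z (polarField 1 x) := by
    intro z
    rw [planeMul, planeMul, smul_add, smul_smul, smul_smul, Complex.re_mul_ofReal,
      Complex.im_mul_ofReal]
    congr 2 <;> field_simp
  change d • _ = d • _
  rw [e]
  apply E3_ext <;>
  simp only [planeMul_apply, PiLp.smul_apply, smul_eq_mul, horizontal, cross_zero, cross_one,
    cross_two, polarField_zero, polarField_one, polarField_two, Complex.neg_re, Complex.neg_im,
    Complex.mul_re, Complex.mul_im, hd]
  · linear_combination (-((x : E3) 0 * (x : E3) 0 + 1 + (x : E3) 2)) * hq
  · linear_combination ((x : E3) 0 * (x : E3) 1) * hq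
  · linear_combination (-((x : E3) 0 * (1 + (x : E3) 2))) * hq

theorem continuous_simp_coord {n : ℕ} (i : Fin (n + 1)) :
    Continuous fun r : Simp n => ((r i : ℝ) : ℂ) :=
  Complex.continuous_ofReal.comp ((continuous_apply i).comp continuous_subtype_val)

theorem segment_mem_slitPlane {z : ℂ} (hz : z.im ≠ 0) (r : Simp 1) :
    ((r 0 : ℝ) : ℂ) + ((r 1 : ℝ) : ℂ) * z ∈ Complex.slitPlane := by
  rw [Complex.mem_slitPlane_iff]
  have hr := stdSimplex.sum_eq_one r
  rw [Fin.sum_univ_two] at hr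
  by_cases h : r 1 = 0
  · left
    rw [h, add_zero] at hr
    simp [h, hr]
  · right
    simp [h, hz]

theorem segment_eq_mul {a b z : ℂ} (hb : b = a * z) (r : Simp 1) :
    ((r 0 : ℝ) : ℂ) * a + ((r 1 : ℝ) : ℂ) * b = a * (((r 0 : ℝ) : ℂ) + ((r 1 : ℝ) : ℂ) * z) := by
  rw [hb]
  ring

theorem logChange_segment {a b z : ℂ} (ha : a ≠ 0) (hz : z.im ≠ 0) (hb : b = a * z) :
    logChange (fun r => ((r 0 : ℝ) : ℂ) * a + ((r 1 : ℝ) : ℂ) * b) = Complex.log z := by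
  have hc : Continuous fun r : Simp 1 => ((r 0 : ℝ) : ℂ) + ((r 1 : ℝ) : ℂ) * z :=
    (continuous_simp_coord 0).add ((continuous_simp_coord 1).mul continuous_const)
  simp only [segment_eq_mul hb]
  rw [logChange_const_mul hc (fun r => Complex.slitPlane_ne_zero (segment_mem_slitPlane hz r)) ha,
    logChange_of_mem_slitPlane hc (segment_mem_slitPlane hz)]
  simp [stdSimplex.vertex]

/-- The third roots of unity. -/
noncomputable def cubeRoot : Fin 3 → ℂ :=
  ![1, ⟨-1 / 2, √3 / 2⟩, ⟨-1 / 2, -(√3 / 2)⟩]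

theorem sqrt_three_mul_self : √3 * √3 = 3 := Real.mul_self_sqrt (by norm_num)

theorem cubeRoot_ne_zero (k : Fin 3) : cubeRoot k ≠ 0 := by
  intro h
  have h1 := congrArg Complex.re h
  fin_cases k <;> simp [cubeRoot] at h1

theorem log_cubeRoot_one : Complex.log (cubeRoot 1) = 2 * Real.pi / 3 * Complex.I := by
  have h : cubeRoot 1 = Complex.exp ((2 * Real.pi / 3 : ℝ) * Complex.I) := by
    have e : (2 * Real.pi / 3 : ℝ) = Real.pi - Real.pi / 3 := by ring
    apply Complex.ext
    · rw [Complex.exp_ofReal_mul_I_re, e, Real.cos_pi_sub, Real.cos_pi_div_three]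
      simp [cubeRoot]
      norm_num
    · rw [Complex.exp_ofReal_mul_I_im, e, Real.sin_pi_sub, Real.sin_pi_div_three]
      simp [cubeRoot]
  have hpi := Real.pi_pos
  rw [h, Complex.log_exp]
  · push_cast
    ring
  · simp
    linarith
  · simp
    linarith

theorem log_cubeRoot_two : Complex.log (cubeRoot 2) = -(2 * Real.pi / 3 * Complex.I) := by
  have h : cubeRoot 2 = Complex.exp ((-(2 * Real.pi / 3) : ℝ) * Complex.I) := by
    have e : (2 * Real.pi / 3 : ℝ) = Real.pi - Real.pi / 3 := by ring
    apply Complex.ext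
    · rw [Complex.exp_ofReal_mul_I_re, Real.cos_neg, e, Real.cos_pi_sub, Real.cos_pi_div_three]
      simp [cubeRoot]
      norm_num
    · rw [Complex.exp_ofReal_mul_I_im, Real.sin_neg, e, Real.sin_pi_sub, Real.sin_pi_div_three]
      simp [cubeRoot]
  have hpi := Real.pi_pos
  rw [h, Complex.log_exp]
  · push_cast
    ring
  · simp
    linarith
  · simp
    linarith

theorem exists_cubeRoot_eq (i : Fin 3) : ∃ z : ℂ, z.im ≠ 0 ∧
    cubeRoot (i.succAbove 1) = cubeRoot (i.succAbove 0) * z := by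
  have h3 := sqrt_three_mul_self
  have h1 : (cubeRoot 1).im ≠ 0 := by simp [cubeRoot]
  have h2 : (cubeRoot 2).im ≠ 0 := by simp [cubeRoot]
  fin_cases i
  · refine ⟨cubeRoot 1, h1, ?_⟩
    apply Complex.ext <;> simp [cubeRoot, Fin.succAbove] <;> linarith
  · exact ⟨cubeRoot 2, h2, by simp [cubeRoot, Fin.succAbove]⟩
  · exact ⟨cubeRoot 1, h1, by simp [cubeRoot, Fin.succAbove]⟩

/-- The boundary of the triangle of third roots of unity winds once around the origin. -/
theorem bdryChange_cubeRoot : bdryChange (fun i r => ((r 0 : ℝ) : ℂ) * cubeRoot (i.succAbove 0) +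
    ((r 1 : ℝ) : ℂ) * cubeRoot (i.succAbove 1)) = 2 * Real.pi * Complex.I := by
  have h1 : (cubeRoot 1).im ≠ 0 := by simp [cubeRoot]
  have h2 : (cubeRoot 2).im ≠ 0 := by simp [cubeRoot]
  have s00 : (0 : Fin 3).succAbove (0 : Fin 2) = 1 := rfl
  have s01 : (0 : Fin 3).succAbove (1 : Fin 2) = 2 := rfl
  have s10 : (1 : Fin 3).succAbove (0 : Fin 2) = 0 := rfl
  have s11 : (1 : Fin 3).succAbove (1 : Fin 2) = 2 := rfl
  have s20 : (2 : Fin 3).succAbove (0 : Fin 2) = 0 := rfl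
  have s21 : (2 : Fin 3).succAbove (1 : Fin 2) = 1 := rfl
  have h3 := sqrt_three_mul_self
  rw [bdryChange_eq]
  simp only [s00, s01, s10, s11, s20, s21]
  rw [logChange_segment (cubeRoot_ne_zero 1) h1, logChange_segment (cubeRoot_ne_zero 0) h2,
    logChange_segment (cubeRoot_ne_zero 0) h1, log_cubeRoot_one, log_cubeRoot_two]
  · ring
  · simp [cubeRoot]
  · simp [cubeRoot]
  · apply Complex.ext <;> simp [cubeRoot] <;> linarith

/-- The vertices of an equilateral triangle at height one. -/
noncomputable def polarTriangle (k : Fin 3) : E3 :=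
  WithLp.toLp 2 ![(cubeRoot k).re, (cubeRoot k).im, 1]

theorem horizontal_sum {ι : Type*} [Fintype ι] (t : ι → ℝ) (f : ι → Fin 3) :
    horizontal (∑ i, t i • polarTriangle (f i)) = ∑ i, ((t i : ℝ) : ℂ) * cubeRoot (f i) := by
  apply Complex.ext
  · simp [horizontal, polarTriangle]
  · simp [horizontal, polarTriangle]

theorem polarTriangle_sum_two (t : Simp 2) : (∑ i, t i • polarTriangle i) 2 = 1 := by
  have h := stdSimplex.sum_eq_one t
  rw [Fin.sum_univ_three] at h ⊢
  simpa [polarTriangle] using h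

theorem polarTriangle_avoidsZero : AvoidsZero (n := 2) polarTriangle := by
  intro t h
  have h1 := polarTriangle_sum_two t
  rw [h] at h1
  exact zero_ne_one h1

theorem triple_polarTriangle :
    0 < triple (polarTriangle 0) (polarTriangle 1) (polarTriangle 2) := by
  have h : 0 < √3 := Real.sqrt_pos.2 (by norm_num)
  simp [triple_eq, polarTriangle, cubeRoot]
  linarith

/-- The Euler number of a square root of the tautological plane bundle is one. On a triangle around
the pole the square of a section is measured against a vector field that vanishes at the opposite
pole only, on the complement of the pole against one that vanishes at this pole only; the two fields
differ by the factor `-(x₀ + i x₁)² / (1 + x₂)²`, which winds twice around the pole. -/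
theorem IsEulerCochain.evalChain_sphereChain {c : cocycles 2 S2}
    (h : IsEulerCochain (ContinuousMap.id S2) A c.1) : evalChain 2 c.1 sphereChain = 1 := by
  obtain ⟨s₀, s₁, h⟩ := h
  set D := sphSimplex polarTriangle polarTriangle_avoidsZero with hD
  set y : Simp 2 → E3 := fun t => ∑ i, t i • polarTriangle i with hy
  have hy0 : ∀ t, y t ≠ 0 := polarTriangle_avoidsZero
  have hyN : ∀ t, 0 < ‖y t‖⁻¹ := fun t => inv_pos.2 (norm_pos_iff.2 (hy0 t))
  have hyc : Continuous y := continuous_finsetSum _ fun i _ =>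
    ((continuous_apply i).comp continuous_subtype_val).smul continuous_const
  have hD2 : ∀ t, (D t : E3) 2 = ‖y t‖⁻¹ := fun t => by
    change ‖y t‖⁻¹ * y t 2 = _
    rw [hy, polarTriangle_sum_two, mul_one]
  set w : Simp 2 := ⟨fun _ => 1 / 3, ⟨fun _ => by norm_num, by norm_num⟩⟩ with hw
  have hw0 : ∀ i, 0 < w i := fun i => by
    change (0 : ℝ) < 1 / 3
    norm_num
  obtain ⟨e, he, hce, hκ⟩ := exists_chain_complement polarTriangle_avoidsZero triple_polarTriangle hw0
  rw [← hκ]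
  have hh : ∀ t, horizontal (D t) = ((‖y t‖⁻¹ : ℝ) : ℂ) * horizontal (y t) := fun t => by
    apply Complex.ext
    · simp [horizontal, hD, sphSimplex_coe, hy]
    · simp [horizontal, hD, sphSimplex_coe, hy]
  -- The interior point `D w` is the pole `e₂`, the only zero of `polarField (-1)`.
  have hpole : ∀ x : S2, x ≠ D w → (1 : ℝ) + (-1) * (x : E3) 2 ≠ 0 := by
    intro x hx h0
    apply hx
    have hx2 : (x : E3) 2 = 1 := by linarith
    have hq := inner_self_S2 x
    rw [inner_E3, hx2] at hq
    have hx0 : (x : E3) 0 = 0 := by nlinarith [sq_nonneg ((x : E3) 0), sq_nonneg ((x : E3) 1)]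
    have hx1 : (x : E3) 1 = 0 := by nlinarith [sq_nonneg ((x : E3) 0), sq_nonneg ((x : E3) 1)]
    have hyw : horizontal (D w) = 0 := by
      rw [hh, hy, horizontal_sum, Fin.sum_univ_three]
      have : (cubeRoot 0 + cubeRoot 1 + cubeRoot 2) = 0 := by
        apply Complex.ext
        · simp [cubeRoot]
          norm_num
        · simp [cubeRoot]
      change _ * (((1 / 3 : ℝ) : ℂ) * cubeRoot 0 + ((1 / 3 : ℝ) : ℂ) * cubeRoot 1 +
        ((1 / 3 : ℝ) : ℂ) * cubeRoot 2) = 0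
      rw [← mul_add, ← mul_add, this, mul_zero, mul_zero]
    have h0 : (D w : E3) 0 = 0 := congrArg Complex.re hyw
    have h1 : (D w : E3) 1 = 0 := congrArg Complex.im hyw
    have hq' := inner_self_S2 (D w)
    rw [inner_E3, h0, h1] at hq'
    have hp : 0 < (D w : E3) 2 := by
      rw [hD2]
      exact hyN w
    have h2 : (D w : E3) 2 = 1 := by nlinarith
    exact Subtype.ext (E3_ext (hx0.trans h0.symm) (hx1.trans h1.symm) (hx2.trans h2.symm))
  -- The squared sections along the edges, measured by the vector field; `Lm` sums up the changes of
  -- their logarithms.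
  set ρ : ℝ → ∀ (γ : SingSimplex 1 S2), Simp 1 → ℂ := fun a γ r =>
    planeRatio (γ r) (A.sq (γ r) (s₁ γ r)) (polarField a (γ r)) with hρ
  set Lm : Chains ℤ 1 S2 →ₗ[ℤ] ℂ := Finsupp.linearCombination ℤ fun γ => logChange (ρ (-1) γ) with hLm
  have hLb : ∀ σ : SingSimplex 2 S2, Lm (bdrySimplex ℤ σ) =
      bdryChange fun i => ρ (-1) (face i σ) := by
    intro σ
    rw [bdrySimplex, map_sum, bdryChange]
    refine Finset.sum_congr rfl fun i _ => ?_
    rw [map_smul, hLm, Finsupp.linearCombination_single, one_smul, zsmul_eq_mul]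
    push_cast
    rfl
  have hpc : ∀ a, Continuous fun x : S2 => polarField a x := fun a =>
    (continuous_polarField a).comp continuous_subtype_val
  -- On the chain off the pole the field `polarField (-1)` computes the winding numbers.
  have hoff : Lm (bdrySucc ℤ S2 1 e) = 2 * (2 * Real.pi * Complex.I * (evalChain 2 c.1 e : ℂ)) := by
    have e1 : bdrySucc ℤ S2 1 e = ∑ σ ∈ e.support, e σ • bdrySimplex ℤ σ :=
      Finsupp.linearCombination_apply ℤ e
    have e2 : evalChain 2 c.1 e = ∑ σ ∈ e.support, e σ * c.1 σ :=
      Finsupp.linearCombination_apply ℤ e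
    rw [e1, e2, map_sum]
    push_cast
    rw [Finset.mul_sum, Finset.mul_sum]
    refine Finset.sum_congr rfl fun σ hσ => ?_
    have hσ' : Set.range σ ⊆ {x | x ≠ D w} := he hσ
    have e3 := two_mul_winding_eq h (hpc (-1)) (inner_polarField (-1)) σ
      fun t => polarField_ne_zero (by norm_num) (hpole _ (hσ' ⟨t, rfl⟩))
    rw [map_smul, hLb, zsmul_eq_mul]
    refine (congrArg _ e3.symm).trans ?_
    ring
  have hup : ∀ t, (1 : ℝ) + 1 * (D t : E3) 2 ≠ 0 := fun t => by
    rw [hD2]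
    have := hyN t
    positivity
  have hup' : ∀ t, (1 : ℝ) + (D t : E3) 2 ≠ 0 := fun t => by
    have := hup t
    rwa [one_mul] at this
  -- On the triangle the field `polarField 1` does.
  have hon := two_mul_winding_eq h (hpc 1) (inner_polarField 1) D
    fun t => polarField_ne_zero (by norm_num) (hup t)
  set aff : Fin 3 → Simp 1 → ℂ := fun i r => ((r 0 : ℝ) : ℂ) * cubeRoot (i.succAbove 0) +
    ((r 1 : ℝ) : ℂ) * cubeRoot (i.succAbove 1) with haff
  have haffc : ∀ i, Continuous (aff i) := fun i =>
    ((continuous_simp_coord 0).mul continuous_const).add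
      ((continuous_simp_coord 1).mul continuous_const)
  have hya : ∀ (i : Fin 3) (r : Simp 1), horizontal (y (simpMap i.succAbove r)) = aff i r := by
    intro i r
    rw [hy]
    simp only [sum_simpMap]
    rw [horizontal_sum, Fin.sum_univ_two]
  set p : Simp 2 → ℂ := fun t => -(((‖y t‖⁻¹ * ‖y t‖⁻¹ *
    (1 / ((1 + (D t : E3) 2) * (1 + (D t : E3) 2)))) : ℝ) : ℂ) with hp
  have hpc' : Continuous p := by
    have h1 : Continuous fun t => (D t : E3) 2 := by
      have : Continuous fun t => (D t : E3) := continuous_subtype_val.comp D.continuous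
      fun_prop
    have h2 : Continuous fun t => ‖y t‖⁻¹ := hyc.norm.inv₀ fun t => norm_ne_zero_iff.2 (hy0 t)
    exact (Complex.continuous_ofReal.comp ((h2.mul h2).mul (continuous_const.div
      ((continuous_const.add h1).mul (continuous_const.add h1))
        fun t => mul_ne_zero (hup' t) (hup' t)))).neg
  have hp0 : ∀ t, p t ≠ 0 := fun t => neg_ne_zero.2 (Complex.ofReal_ne_zero.2
    (mul_ne_zero (mul_ne_zero (hyN t).ne' (hyN t).ne')
      (one_div_ne_zero (mul_ne_zero (hup' t) (hup' t)))))
  have haff0 : ∀ i r, aff i r ≠ 0 := by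
    intro i r
    obtain ⟨z, hz, hz'⟩ := exists_cubeRoot_eq i
    rw [haff]
    simp only [segment_eq_mul hz']
    exact mul_ne_zero (cubeRoot_ne_zero _) (Complex.slitPlane_ne_zero (segment_mem_slitPlane hz r))
  have hfield : ∀ i r, polarField (-1) (face i D r) =
      planeMul (face i D r : S2) ((aff i r * aff i r) * p (simpMap i.succAbove r))
        (polarField 1 (face i D r)) := by
    intro i r
    have hx : face i D r = D (simpMap i.succAbove r) := rfl
    rw [hx, polarField_neg_one_eq _ (hup' _), hh, ← hya]
    congr 1
    rw [hp]
    push_cast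
    ring
  have hU : ∀ i r, polarField 1 (face i D r) ≠ 0 := fun i r =>
    polarField_ne_zero (a := 1) (by norm_num) (hup _)
  have hV : ∀ i r, polarField (-1) (face i D r) ≠ 0 := by
    intro i r h0
    have h2 := planeRatio_planeMul (face i D r) ((aff i r * aff i r) * p (simpMap i.succAbove r))
      (inner_polarField 1 _) (hU i r)
    rw [← hfield, h0] at h2
    refine mul_ne_zero (mul_ne_zero (haff0 i r) (haff0 i r)) (hp0 _) (h2.symm.trans ?_)
    apply Complex.ext <;> simp [planeRatio]
  have hm : ∀ i r, ρ 1 (face i D) r =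
      ρ (-1) (face i D) r * ((aff i r * aff i r) * p (simpMap i.succAbove r)) := by
    intro i r
    have h2 := planeMul_planeRatio (face i D r) (A.sq_mem (face i D r) (s₁ (face i D) r))
      (inner_polarField (-1) _) (hV i r)
    rw [hfield, ← planeMul_mul _ _ _ (inner_polarField 1 _), ← hfield] at h2
    change planeRatio (face i D r : S2) (A.sq (face i D r) (s₁ (face i D) r)) _ = _
    rw [← h2, planeRatio_planeMul _ _ (inner_polarField 1 _) (hU i r)]
  -- Along the boundary of the triangle the ratio of the two fields is the square of a function of winding
  -- number one, up to a nonvanishing function on the whole triangle.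
  have hsum : bdryChange (fun i => ρ 1 (face i D)) = bdryChange (fun i => ρ (-1) (face i D)) +
      2 * (2 * Real.pi * Complex.I) := by
    have hρc : ∀ i, Continuous (ρ (-1) (face i D)) := fun i =>
      continuous_planeRatio (continuous_subtype_val.comp (face i D).continuous)
        (ContSection.continuous_sq (h := face i D) (h.contSection (face i D))) ((hpc (-1)).comp (face i D).continuous) (hV i)
    have hρ0 : ∀ i r, ρ (-1) (face i D) r ≠ 0 := fun i r =>
      planeRatio_ne_zero _ (A.sq_mem _ _) (inner_polarField (-1) _) (hV i r)
        (A.sq_ne_zero _ _ (h.path_ne_zero _ r))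
    have e1 : (fun i => ρ 1 (face i D)) = fun i r =>
        ρ (-1) (face i D) r * ((aff i r * aff i r) * p (simpMap i.succAbove r)) := by
      funext i r
      exact hm i r
    have hpf : ∀ i : Fin 3, Continuous fun r => p (simpMap i.succAbove r) := fun i =>
      hpc'.comp (simpMap i.succAbove).continuous
    have haa : ∀ i r, aff i r * aff i r ≠ 0 := fun i r => mul_ne_zero (haff0 i r) (haff0 i r)
    rw [e1, bdryChange_mul (u := fun i => ρ (-1) (face i D))
      (v := fun i r => (aff i r * aff i r) * p (simpMap i.succAbove r)) hρc
      (fun i => ((haffc i).mul (haffc i)).mul (hpf i)) hρ0 (fun i r => mul_ne_zero (haa i r) (hp0 _)),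
      bdryChange_mul (u := fun i r => aff i r * aff i r)
      (v := fun i r => p (simpMap i.succAbove r)) (fun i => (haffc i).mul (haffc i)) hpf haa
      (fun i r => hp0 _), bdryChange_face hpc' hp0, bdryChange_mul haffc haffc haff0 haff0, haff,
      bdryChange_cubeRoot]
    ring
  have hcycle : Lm (bdrySucc ℤ S2 1 (Finsupp.single D 1 + e)) = 0 := by
    rw [hce, map_zero]
  rw [map_add, map_add, hoff, bdrySucc, Finsupp.linearCombination_single, one_smul, hLb] at hcycle
  rw [map_add, evalChain_single]
  apply two_pi_I_mul_injective
  have h2 : (2 : ℂ) ≠ 0 := two_ne_zero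
  apply mul_left_cancel₀ h2
  have hon' : 2 * (2 * Real.pi * Complex.I * (c.1 D : ℂ)) = bdryChange fun i => ρ 1 (face i D) := hon
  rw [hsum] at hon'
  push_cast
  linear_combination hon' + hcycle

end EulerNumber

/-! ### The Euler class as a pull-back -/

section EulerClassValue

variable {A : TautSquareRoot} {X : Type*} [TopologicalSpace X]

theorem exists_kronecker_eq_one (A : TautSquareRoot) :
    ∃ κ : Cohomology 2 S2, kronecker 2 κ sphereClass = 1 := by
  obtain ⟨c, hc⟩ := exists_isEulerCochain A
  exact ⟨cohClass c, hc.evalChain_sphereChain⟩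

/-- The pull-back of the class dual to the fundamental class is represented by an obstruction
cocycle. -/
theorem exists_isEulerCochain_of_kronecker (g : C(X, S2)) (A : TautSquareRoot)
    {κ : Cohomology 2 S2} (hκ : kronecker 2 κ sphereClass = 1) :
    ∃ c : cocycles 2 X, cohClass c = cohomologyMap 2 g κ ∧ IsEulerCochain g A c.1 := by
  obtain ⟨c, hc⟩ := exists_isEulerCochain A
  have h1 : κ = cohClass c := eq_of_kronecker_eq (hκ.trans hc.evalChain_sphereChain.symm)
  have h2 := hc.comp g
  rw [ContinuousMap.id_comp] at h2
  have h3 : cochainMap 2 g c.1 ∈ cocycles 2 X := by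
    have h0 : cobdry 2 S2 c.1 = 0 := c.2
    change cobdry 2 X (cochainMap 2 g c.1) = 0
    rw [cobdry_cochainMap, h0, map_zero]
  exact ⟨⟨_, h3⟩, by rw [h1]; rfl, h2⟩

theorem IsEulerClassPullback.eq_cohomologyMap {g : C(X, S2)} {κ : Cohomology 2 S2}
    (hκ : kronecker 2 κ sphereClass = 1) {e : Cohomology 2 X} (h : IsEulerClassPullback g A e) :
    e = cohomologyMap 2 g κ := by
  obtain ⟨c, hc, hA⟩ := h.exists_isEulerCochain
  obtain ⟨c', hc', hA'⟩ := exists_isEulerCochain_of_kronecker g A hκ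
  rw [← hc, ← hc']
  exact SubQuot.mk_eq_mk.2 (hA.sub_mem_coboundaries hA')

end EulerClassValue

/-! ### The contact-plane bundle over a point -/

section ContactPlane

theorem triple_map (L : E3 →L[ℝ] E3) (u v w : E3) : triple (L u) (L v) (L w) =
    triple (L (EuclideanSpace.single 0 1)) (L (EuclideanSpace.single 1 1))
      (L (EuclideanSpace.single 2 1)) * triple u v w := by
  have h : ∀ x : E3, L x = x 0 • L (EuclideanSpace.single 0 1) + x 1 • L (EuclideanSpace.single 1 1) +
      x 2 • L (EuclideanSpace.single 2 1) := by
    intro x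
    rw [← map_smul, ← map_smul, ← map_smul, ← map_add, ← map_add]
    congr 1
    apply E3_ext <;> simp
  rw [h u, h v, h w]
  simp only [triple_eq, PiLp.add_apply, PiLp.smul_apply, smul_eq_mul]
  ring

theorem triple_cross_self (q : S2) {v : E3} (hv : inner ℝ (q : E3) v = 0) :
    triple (q : E3) v (cross q v) = inner ℝ v v := by
  have hq := inner_self_S2 q
  rw [inner_E3] at hq hv
  simp only [triple_eq, inner_E3, cross_zero, cross_one, cross_two]
  linear_combination (v 0 * v 0 + v 1 * v 1 + v 2 * v 2) * hq -
    ((q : E3) 0 * v 0 + (q : E3) 1 * v 1 + (q : E3) 2 * v 2) * hv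

variable {Y : Type*} [TopologicalSpace Y] [ChartedSpace E3 Y]

theorem inner_covectorDual {p : Y} (τ : TangentSpace (𝓡 3) p ≃L[ℝ] E3)
    (a : TangentSpace (𝓡 3) p →L[ℝ] ℝ) (v : E3) : inner ℝ (covectorDual τ a) v = a (τ.symm v) :=
  InnerProductSpace.toDual_symm_apply

/-- The inverse of a positive framing preserves orientations. -/
theorem IsPositiveFraming.symm_pos {p : Y} {τ : TangentSpace (𝓡 3) p ≃L[ℝ] E3}
    (hτ : IsPositiveFraming τ) {u v w : E3} (h : 0 < triple u v w) :
    0 < triple (τ.symm u : E3) (τ.symm v : E3) (τ.symm w : E3) := by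
  set L : E3 →L[ℝ] E3 := (τ : TangentSpace (𝓡 3) p →L[ℝ] E3) with hL
  have hLs : ∀ x : E3, L (τ.symm x : E3) = x := fun x => τ.apply_symm_apply x
  have h1 := triple_map L (τ.symm u : E3) (τ.symm v : E3) (τ.symm w : E3)
  rw [hLs, hLs, hLs] at h1
  have h2 : 0 < triple (L (EuclideanSpace.single 0 1)) (L (EuclideanSpace.single 1 1))
      (L (EuclideanSpace.single 2 1)) :=
    hτ (EuclideanSpace.single 0 1) (EuclideanSpace.single 1 1) (EuclideanSpace.single 2 1)
      (by simp [triple_eq])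
  rw [h1] at h
  exact pos_of_mul_pos_right h h2.le

open Bundle

theorem continuous_tautPlane {T : Type*} [TopologicalSpace T] (ξ₀ : ContactStructure Y) (p : Y)
    {h : T → IsotopyClass ξ₀} (hh : Continuous h) {v : T → E3} (hv : Continuous v)
    (hm : ∀ t, (v t : TangentSpace (𝓡 3) p) ∈ contactPlane p (h t).1) :
    Continuous fun t => (TotalSpace.mk' E3 (h t) ⟨v t, hm t⟩ :
      TotalSpace E3 (TautPlane ξ₀ p)) :=
  continuous_induced_rng.2 (hh.prodMk hv)

variable [IsManifold (𝓡 3) ∞ Y]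

theorem form_symm_eq {p : Y} (τ : TangentSpace (𝓡 3) p ≃L[ℝ] E3) (α : ContactForm Y) (v : E3) :
    α.form p (τ.symm v) =
      ‖covectorDual τ (α.form p)‖ * inner ℝ (evalAt p τ ⟦α⟧ : E3) v := by
  have h : ‖covectorDual τ (α.form p)‖ ≠ 0 :=
    norm_ne_zero_iff.2 (covectorDual_ne_zero τ (α.form_ne_zero p))
  change _ = _ * inner ℝ (‖covectorDual τ (α.form p)‖⁻¹ • covectorDual τ (α.form p)) v
  rw [real_inner_smul_left, mul_inv_cancel_left₀ h, inner_covectorDual]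

theorem symm_mem_contactPlane {p : Y} (τ : TangentSpace (𝓡 3) p ≃L[ℝ] E3) (ξ : ContactStructure Y)
    {v : E3} (hv : inner ℝ (evalAt p τ ξ : E3) v = 0) : τ.symm v ∈ contactPlane p ξ := by
  induction ξ using Quotient.inductionOn with
  | h α =>
    change α.form p (τ.symm v) = 0
    rw [form_symm_eq, hv, mul_zero]

theorem planePos_symm (ξ₀ : ContactStructure Y) {p : Y} {τ : TangentSpace (𝓡 3) p ≃L[ℝ] E3}
    (hτ : IsPositiveFraming τ) (ξ : IsotopyClass ξ₀) {v w : E3}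
    (hv : τ.symm v ∈ contactPlane p ξ.1) (hw : τ.symm w ∈ contactPlane p ξ.1)
    (h : 0 < triple (ev ξ₀ p τ ξ : E3) v w) :
    planePos ξ₀ p ξ ⟨τ.symm v, hv⟩ ⟨τ.symm w, hw⟩ := by
  obtain ⟨α, hα⟩ := Quotient.exists_rep ξ.1
  refine ⟨α, hα, τ.symm (ev ξ₀ p τ ξ : E3), ?_, hτ.symm_pos h⟩
  have h1 : ev ξ₀ p τ ξ = evalAt p τ ⟦α⟧ := congrArg (evalAt p τ) hα.symm
  rw [form_symm_eq, h1, inner_self_S2, mul_one]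
  exact norm_pos_iff.2 (covectorDual_ne_zero τ (α.form_ne_zero p))

/-- Squaring a section of a square root doubles its winding: twice the Euler class of the square
root is the Euler class of the contact-plane bundle. -/
theorem IsEulerCochain.isEulerClass_tautPlane {A : TautSquareRoot} {ξ₀ : ContactStructure Y} {p : Y}
    {τ : TangentSpace (𝓡 3) p ≃L[ℝ] E3} (hτ : IsPositiveFraming τ) {c : cocycles 2 (IsotopyClass ξ₀)}
    (h : IsEulerCochain (ev ξ₀ p τ) A c.1) :
    IsEulerClass E3 (TautPlane ξ₀ p) (planePos ξ₀ p) (cohClass c + cohClass c) := by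
  set g := ev ξ₀ p τ with hg
  obtain ⟨s₀, s₁, h⟩ := h
  have hm : ∀ (ξ : IsotopyClass ξ₀) {v : E3}, inner ℝ (g ξ : E3) v = 0 →
      τ.symm v ∈ contactPlane p ξ.1 := fun ξ v hv => symm_mem_contactPlane τ ξ.1 hv
  have hτc : Continuous fun v : E3 => (τ.symm v : E3) := τ.symm.continuous
  have hne : ∀ {v : E3}, v ≠ 0 → (τ.symm v : TangentSpace (𝓡 3) p) ≠ 0 := fun hv h0 =>
    hv (τ.symm.map_eq_zero_iff.1 h0)
  have hcr : ∀ (q : S2) (v : E3), inner ℝ (q : E3) (cross q v) = 0 := fun q v => by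
    simp only [inner_E3, cross_zero, cross_one, cross_two]
    ring
  refine ⟨c + c, fun ξ => ⟨τ.symm (A.sq (g ξ) (s₀ ξ)), hm ξ (A.sq_mem _ _)⟩,
    fun γ r => ⟨τ.symm (A.sq (g (γ r)) (s₁ γ r)), hm (γ r) (A.sq_mem _ _)⟩, rfl,
    fun ξ h0 => ?_, fun γ r h0 => ?_, fun γ => ?_, fun γ i => ?_, fun σ => ?_⟩
  · exact hne (A.sq_ne_zero _ _ (h.point_ne_zero ξ)) (congrArg Subtype.val h0)
  · exact hne (A.sq_ne_zero _ _ (h.path_ne_zero γ r)) (congrArg Subtype.val h0)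
  · exact continuous_tautPlane ξ₀ p γ.continuous (hτc.comp (h.contSection γ).continuous_sq)
      fun r => hm (γ r) (A.sq_mem _ _)
  · apply Subtype.ext
    change τ.symm (A.sq (g (γ (stdSimplex.vertex i))) (s₁ γ (stdSimplex.vertex i))) = _
    rw [h.endpoint]
  obtain ⟨f, hf, hf0⟩ := exists_section A (g.comp σ)
  choose u hu using fun (i : Fin 3) (r : Simp 1) =>
    exists_eq_smul (hf0 (simpMap i.succAbove r)) (s₁ (face i σ) r)
  have huc := continuous_of_face_eq_smul h.contSection hf hf0 hu
  choose θ hθ using fun i => exists_log (huc i)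
    fun r => ne_zero_of_eq_smul (h.path_ne_zero _ r) (hu i r)
  have hF : ∀ t, A.sq (g (σ t)) (f t) ≠ 0 := fun t => A.sq_ne_zero _ _ (hf0 t)
  refine ⟨fun t => ⟨τ.symm (A.sq (g (σ t)) (f t)), hm (σ t) (A.sq_mem _ _)⟩,
    fun t => ⟨τ.symm (cross (g (σ t)) (A.sq (g (σ t)) (f t))), hm (σ t) (hcr _ _)⟩,
    fun i => θ i + θ i, ?_, ?_, fun t => ?_, fun i r => ?_, ?_⟩
  · exact continuous_tautPlane ξ₀ p σ.continuous (hτc.comp hf.continuous_sq)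
      fun t => hm (σ t) (A.sq_mem _ _)
  · exact continuous_tautPlane ξ₀ p σ.continuous (hτc.comp (continuous_cross
      (continuous_subtype_val.comp (g.continuous.comp σ.continuous)) hf.continuous_sq))
      fun t => hm (σ t) (hcr _ _)
  · refine planePos_symm ξ₀ hτ (σ t) _ _ ?_
    rw [triple_cross_self _ (A.sq_mem _ _)]
    exact real_inner_self_pos.2 (hF t)
  · apply Subtype.ext
    have h1 : Complex.exp ((θ i + θ i) r) = u i r * u i r := by
      rw [ContinuousMap.add_apply, Complex.exp_add, hθ]
    rw [h1]
    change (τ.symm (A.sq (g (face i σ r)) (s₁ (face i σ) r)) : TangentSpace (𝓡 3) p) = _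
    rw [hu]
    refine (congrArg τ.symm (sq_smul_eq_planeMul _ _)).trans ?_
    rw [planeMul, map_add, map_smul, map_smul]
    rfl
  · have h1 := h.winding σ f hf hf0 u hu
    rw [bdryChange] at h1
    simp only [logChange_eq (hθ _)] at h1
    have h2 : (((c + c : cocycles 2 (IsotopyClass ξ₀)).1 σ : ℤ) : ℂ) = c.1 σ + c.1 σ :=
      Int.cast_add (c.1 σ) (c.1 σ)
    rw [h2, mul_add, ← h1, ← Finset.sum_add_distrib]
    refine Finset.sum_congr rfl fun i _ => ?_
    rw [ContinuousMap.add_apply, ContinuousMap.add_apply]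
    ring

/-- The pull-back of the dual class of the sphere is the class `μ̄(1)`. -/
theorem isMuBarOne_cohomologyMap (A : TautSquareRoot) (ξ₀ : ContactStructure Y) {p : Y}
    {τ : TangentSpace (𝓡 3) p ≃L[ℝ] E3} (hτ : IsPositiveFraming τ) {κ : Cohomology 2 S2}
    (hκ : kronecker 2 κ sphereClass = 1) :
    IsMuBarOne ξ₀ p (cohomologyMap 2 (ev ξ₀ p τ) κ) := by
  obtain ⟨c, hc, hA⟩ := exists_isEulerCochain_of_kronecker (ev ξ₀ p τ) A hκ
  rw [← hc]
  exact ⟨hA.isEulerClass_tautPlane hτ, τ, hτ, A, hA.isEulerClassPullback⟩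

end ContactPlane

/-! ### Existence of the square root -/

section SquareRoot

/-- The pole over which the chart of the square root labelled by a Boolean is not defined is
`-poleSign b • e₂`. -/
def poleSign (b : Bool) : ℝ := cond b 1 (-1)

theorem poleSign_mul_self (b : Bool) : poleSign b * poleSign b = 1 := by
  cases b <;> simp [poleSign]

/-- The complement of a pole. -/
def polarSet (b : Bool) : Set S2 := {x | 1 + poleSign b * (x : E3) 2 ≠ 0}

/-- The square root of the ratio of the two polar fields. -/
noncomputable def polarRoot (x : E3) : ℂ :=
  Complex.I * horizontal x * ((1 / (1 + x 2) : ℝ) : ℂ)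

/-- The transition functions of the square root of the tautological plane bundle. -/
noncomputable def polarTransition : Bool → Bool → S2 → ℂ
  | false, true, x => polarRoot x
  | true, false, x => (polarRoot x)⁻¹
  | _, _, _ => 1

theorem polarRoot_ne_zero {x : S2} (h : x ∈ polarSet true) (h' : x ∈ polarSet false) :
    polarRoot x ≠ 0 := by
  simp only [polarSet, poleSign, cond_true, cond_false, Set.mem_ofPred_eq, one_mul] at h h'
  refine mul_ne_zero (mul_ne_zero Complex.I_ne_zero fun h0 => ?_)
    (Complex.ofReal_ne_zero.2 (one_div_ne_zero h))
  have h1 : (x : E3) 0 = 0 := congrArg Complex.re h0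
  have h2 : (x : E3) 1 = 0 := congrArg Complex.im h0
  have hq := inner_self_S2 x
  rw [inner_E3, h1, h2] at hq
  apply mul_ne_zero h h'
  linear_combination -hq

theorem polarTransition_comp (i j k : Bool) {x : S2} (hi : x ∈ polarSet i) (hj : x ∈ polarSet j)
    (hk : x ∈ polarSet k) :
    polarTransition j k x * polarTransition i j x = polarTransition i k x := by
  have h : ∀ h1 : x ∈ polarSet true, ∀ h2 : x ∈ polarSet false, polarRoot x ≠ 0 :=
    fun h1 h2 => polarRoot_ne_zero h1 h2
  cases i <;> cases j <;> cases k <;> simp [polarTransition]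
  · exact inv_mul_cancel₀ (h hj hi)
  · exact mul_inv_cancel₀ (h hi hj)

theorem isOpen_polarSet (i : Bool) : IsOpen (polarSet i) := by
  refine isOpen_ne_fun ?_ continuous_const
  fun_prop

theorem continuousOn_polarTransition (i j : Bool) :
    ContinuousOn (polarTransition i j) (polarSet i ∩ polarSet j) := by
  have h : ContinuousOn (fun x : S2 => polarRoot x) (polarSet true) := by
    have h1 : Continuous fun x : S2 => horizontal x := by
      refine Complex.equivRealProdCLM.symm.continuous.comp
        (f := fun x : S2 => ((x : E3) 0, (x : E3) 1)) ?_
      fun_prop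
    refine (continuous_const.mul h1).continuousOn.mul
      (Complex.continuous_ofReal.comp_continuousOn (continuousOn_const.div (by fun_prop) ?_))
    intro x hx
    simpa [polarSet, poleSign] using hx
  cases i <;> cases j
  · exact continuousOn_const
  · exact h.mono Set.inter_subset_right
  · exact (h.mono Set.inter_subset_left).inv₀ fun x hx => polarRoot_ne_zero hx.1 hx.2
  · exact continuousOn_const

theorem planeMul_polarTransition (i j : Bool) {x : S2} (hi : x ∈ polarSet i) (hj : x ∈ polarSet j)
    (v : ℂ) : planeMul x ((polarTransition i j x * v) * (polarTransition i j x * v))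
      (polarField (poleSign j) x) = planeMul x (v * v) (polarField (poleSign i) x) := by
  have key : ∀ (h : x ∈ polarSet true), polarField (-1) x =
      planeMul x (polarRoot x * polarRoot x) (polarField 1 x) := by
    intro h
    simp only [polarSet, poleSign, cond_true, Set.mem_ofPred_eq, one_mul] at h
    rw [polarField_neg_one_eq x h]
    congr 1
    rw [polarRoot, one_div, one_div, mul_inv]
    push_cast
    linear_combination (-(horizontal x * horizontal x * ((1 + ((x : E3) 2 : ℂ))⁻¹) ^ 2)) *
      Complex.I_mul_I
  cases i <;> cases j
  · simp [polarTransition]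
  · simp only [polarTransition, poleSign, cond_true, cond_false]
    rw [key hj, ← planeMul_mul _ _ _ (inner_polarField 1 x)]
    congr 1
    ring
  · simp only [polarTransition, poleSign, cond_true, cond_false]
    rw [key hi, ← planeMul_mul _ _ _ (inner_polarField 1 x)]
    congr 1
    have := polarRoot_ne_zero hi hj
    field_simp
  · simp [polarTransition]

open Classical in
/-- A square root of the tautological plane bundle, given by transition functions. -/
noncomputable def polarCore : VectorBundleCore ℂ S2 ℂ Bool where
  baseSet := polarSet
  isOpen_baseSet := isOpen_polarSet
  indexAt x := if x ∈ polarSet true then true else false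
  mem_baseSet_at x := by
    by_cases h : x ∈ polarSet true
    · rwa [if_pos h]
    · rw [if_neg h]
      simp only [polarSet, poleSign, cond_true, cond_false, Set.mem_ofPred_eq, one_mul, not_not] at h ⊢
      intro h'
      linarith
  coordChange i j x := polarTransition i j x • (1 : ℂ →L[ℂ] ℂ)
  coordChange_self i x _ v := by cases i <;> simp [polarTransition]
  continuousOn_coordChange i j := (continuousOn_polarTransition i j).smul continuousOn_const
  coordChange_comp i j k x hx v := by
    change polarTransition j k x * (polarTransition i j x * v) = polarTransition i k x * v
    rw [← mul_assoc, polarTransition_comp i j k hx.1.1 hx.1.2 hx.2]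

theorem planeMul_ne_zero (q : S2) {z : ℂ} (hz : z ≠ 0) {F : E3} (hF : inner ℝ (q : E3) F = 0)
    (hF0 : F ≠ 0) : planeMul q z F ≠ 0 := by
  intro h
  have h1 := planeRatio_planeMul q z hF hF0
  rw [h] at h1
  apply hz
  rw [← h1]
  apply Complex.ext <;> simp [planeRatio]

theorem inner_planeMul (q : S2) (z : ℂ) {F : E3} (hF : inner ℝ (q : E3) F = 0) :
    inner ℝ (q : E3) (planeMul q z F) = 0 := by
  rw [planeMul, inner_add_right, inner_smul_right, inner_smul_right, hF]
  simp only [inner_E3, cross_zero, cross_one, cross_two]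
  ring

theorem continuous_planeMul : Continuous fun y : E3 × ℂ × E3 => planeMul y.1 y.2.1 y.2.2 := by
  have h := continuous_cross (continuous_fst (X := E3) (Y := ℂ × E3))
    (continuous_snd.comp continuous_snd)
  unfold planeMul
  fun_prop

/-- The square of a vector of the bundle `polarCore`, given by its coordinate in the preferred
chart. -/
noncomputable def polarSq (x : S2) (v : ℂ) : E3 :=
  planeMul x (v * v) (polarField (poleSign (polarCore.indexAt x)) x)

/-- The square root of the tautological plane bundle defined by the polar fields. -/
noncomputable def polarSquareRoot : TautSquareRoot where
  N := polarCore.Fiber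
  addCommGroup _ := inferInstanceAs (AddCommGroup ℂ)
  sq x v := polarSq x v
  sq_mem x v := inner_planeMul x _ (inner_polarField _ x)
  sq_smul x z v := by
    have h : ∀ a : ℂ, polarSq x (z * a) = planeMul x (z ^ 2) (polarSq x a) := by
      intro a
      rw [polarSq, polarSq, ← planeMul_mul x _ _ (inner_polarField _ x)]
      congr 1
      ring
    exact h v
  sq_ne_zero x v hv := planeMul_ne_zero x (mul_ne_zero hv hv) (inner_polarField _ x)
    (polarField_ne_zero (poleSign_mul_self _) (polarCore.mem_baseSet_at x))
  continuous_sq := by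
    refine continuous_iff_continuousAt.2 fun y => ?_
    set i := polarCore.indexAt y.proj with hi
    have hy : y.proj ∈ polarSet i := polarCore.mem_baseSet_at y.proj
    have h1 : ContinuousAt (polarCore.localTriv i) y := (polarCore.localTriv i).continuousAt hy
    have hproj : Continuous fun y : Bundle.TotalSpace ℂ polarCore.Fiber => y.proj :=
      FiberBundle.continuous_proj ℂ polarCore.Fiber
    have h2 : ContinuousAt (fun y : Bundle.TotalSpace ℂ polarCore.Fiber => planeMul y.proj
        ((polarCore.localTriv i y).2 * (polarCore.localTriv i y).2)
          (polarField (poleSign i) y.proj)) y := by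
      refine continuous_planeMul.continuousAt.comp (f := fun y : Bundle.TotalSpace ℂ polarCore.Fiber =>
        ((y.proj : E3), (polarCore.localTriv i y).2 * (polarCore.localTriv i y).2,
          polarField (poleSign i) y.proj)) ?_
      refine (continuous_subtype_val.comp hproj).continuousAt.prodMk
        (ContinuousAt.prodMk ?_ ?_)
      · exact (continuous_snd.continuousAt.comp h1).mul (continuous_snd.continuousAt.comp h1)
      · exact ((continuous_polarField _).comp (continuous_subtype_val.comp hproj)).continuousAt
    refine h2.congr ?_
    filter_upwards [hproj.continuousAt.eventually ((isOpen_polarSet i).mem_nhds hy)] with x hx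
    exact planeMul_polarTransition (polarCore.indexAt x.proj) i (polarCore.mem_baseSet_at _) hx x.snd

end SquareRoot

/-! ### Continuity of derivatives with respect to a parameter -/

section ParametricDerivatives

variable {P : Type*} [TopologicalSpace P]

/-- A family of functions on `ℝ³`, depending on a parameter in a topological space, is `k` times
differentiable on `W`, and its derivatives up to order `k` are continuous in the parameter and the
point together. -/
def ContDerivs : ℕ → ∀ {G : Type} [NormedAddCommGroup G] [NormedSpace ℝ G],
    (P → E3 → G) → Set (P × E3) → Prop
  | 0, _, _, _, f, W => ContinuousOn (fun x : P × E3 => f x.1 x.2) W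
  | k + 1, G, _, _, f, W => ContinuousOn (fun x : P × E3 => f x.1 x.2) W ∧
      ∃ f' : P → E3 → E3 →L[ℝ] G,
        (∀ x ∈ W, HasFDerivAt (f x.1) (f' x.1 x.2) x.2) ∧ ContDerivs k f' W

variable {G H K : Type} [NormedAddCommGroup G] [NormedSpace ℝ G] [NormedAddCommGroup H]
  [NormedSpace ℝ H] [NormedAddCommGroup K] [NormedSpace ℝ K] {W : Set (P × E3)}

theorem ContDerivs.continuousOn {k : ℕ} {f : P → E3 → G} (h : ContDerivs k f W) :
    ContinuousOn (fun x : P × E3 => f x.1 x.2) W := by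
  cases k with
  | zero => exact h
  | succ k => exact h.1

theorem ContDerivs.of_succ {k : ℕ} {f : P → E3 → G} (h : ContDerivs (k + 1) f W) :
    ContDerivs k f W := by
  induction k generalizing G with
  | zero => exact h.1
  | succ k ih =>
    obtain ⟨h0, f', hf, h'⟩ := h
    exact ⟨h0, f', hf, ih h'⟩

theorem ContDerivs.mono {k : ℕ} {f : P → E3 → G} (h : ContDerivs k f W) {W' : Set (P × E3)}
    (hW : W' ⊆ W) : ContDerivs k f W' := by
  induction k generalizing G with
  | zero => exact ContinuousOn.mono h hW
  | succ k ih =>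
    obtain ⟨h0, f', hf, h'⟩ := h
    exact ⟨h0.mono hW, f', fun x hx => hf x (hW hx), ih h'⟩

theorem eventually_mem_slice (hW : IsOpen W) {x : P × E3} (hx : x ∈ W) :
    ∀ᶠ z in nhds x.2, (x.1, z) ∈ W :=
  (Continuous.prodMk_right x.1).continuousAt.eventually (hW.mem_nhds hx)

theorem ContDerivs.congr {k : ℕ} {f g : P → E3 → G} (h : ContDerivs k f W) (hW : IsOpen W)
    (hfg : ∀ x ∈ W, g x.1 x.2 = f x.1 x.2) : ContDerivs k g W := by
  cases k with
  | zero => exact ContinuousOn.congr h hfg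
  | succ k =>
    obtain ⟨h0, f', hf, h'⟩ := h
    refine ⟨h0.congr hfg, f', fun x hx => (hf x hx).congr_of_eventuallyEq ?_, h'⟩
    filter_upwards [eventually_mem_slice hW hx] with z hz using hfg _ hz

theorem ContDerivs.add {k : ℕ} {f g : P → E3 → G} (hf : ContDerivs k f W)
    (hg : ContDerivs k g W) : ContDerivs k (fun p z => f p z + g p z) W := by
  induction k generalizing G with
  | zero => exact ContinuousOn.add hf hg
  | succ k ih =>
    obtain ⟨hf0, f', hf1, hf'⟩ := hf
    obtain ⟨hg0, g', hg1, hg'⟩ := hg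
    exact ⟨hf0.add hg0, _, fun x hx => (hf1 x hx).add (hg1 x hx), ih hf' hg'⟩

theorem ContDerivs.bilinear {k : ℕ} (B : G →L[ℝ] H →L[ℝ] K) {f : P → E3 → G} {g : P → E3 → H}
    (hf : ContDerivs k f W) (hg : ContDerivs k g W) :
    ContDerivs k (fun p z => B (f p z) (g p z)) W := by
  have hc : ContinuousOn (fun x : P × E3 => B (f x.1 x.2) (g x.1 x.2)) W :=
    (B.continuous.comp_continuousOn hf.continuousOn).clm_apply hg.continuousOn
  induction k generalizing G H K with
  | zero => exact hc
  | succ k ih =>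
    have hf2 := hf.of_succ
    have hg2 := hg.of_succ
    obtain ⟨hf0, f', hf1, hf'⟩ := hf
    obtain ⟨hg0, g', hg1, hg'⟩ := hg
    refine ⟨hc, fun p z => B.precompR E3 (f p z) (g' p z) + B.precompL E3 (f' p z) (g p z),
      fun x hx => B.hasFDerivAt_of_bilinear (hf1 x hx) (hg1 x hx), ?_⟩
    refine ContDerivs.add (ih _ hf2 hg' ?_) (ih _ hf' hg2 ?_)
    · exact ((B.precompR E3).continuous.comp_continuousOn hf0).clm_apply hg'.continuousOn
    · exact ((B.precompL E3).continuous.comp_continuousOn hf'.continuousOn).clm_apply hg0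

theorem ContDerivs.comp {k : ℕ} {f : P → E3 → G} {h : P → E3 → E3} {W' : Set (P × E3)}
    (hf : ContDerivs k f W') (hh : ContDerivs k h W) (hW : ∀ x ∈ W, (x.1, h x.1 x.2) ∈ W') :
    ContDerivs k (fun p z => f p (h p z)) W := by
  have hc : ContinuousOn (fun x : P × E3 => f x.1 (h x.1 x.2)) W :=
    hf.continuousOn.comp (continuousOn_fst.prodMk hh.continuousOn) hW
  induction k generalizing G with
  | zero => exact hc
  | succ k ih =>
    have hh2 := hh.of_succ
    obtain ⟨hf0, f', hf1, hf'⟩ := hf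
    obtain ⟨hh0, h', hh1, hh'⟩ := hh
    refine ⟨hc, fun p z => (f' p (h p z)).comp (h' p z),
      fun x hx => (hf1 _ (hW x hx)).comp x.2 (hh1 x hx), ?_⟩
    exact ContDerivs.bilinear (ContinuousLinearMap.compL ℝ E3 E3 G)
      (ih hf' hh2 (hf'.continuousOn.comp (continuousOn_fst.prodMk hh0) hW)) hh'

theorem contDerivs_of_contDiffOn (k : ℕ) {F : E3 × E3 → G} {D : Set (E3 × E3)} (hD : IsOpen D)
    (hF : ContDiffOn ℝ ∞ F D) {U : P → E3} (hU : Continuous U) (hW : ∀ x ∈ W, (U x.1, x.2) ∈ D) :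
    ContDerivs k (fun p z => F (U p, z)) W := by
  have hUc : Continuous fun x : P × E3 => (U x.1, x.2) :=
    (hU.comp continuous_fst).prodMk continuous_snd
  induction k generalizing G with
  | zero => exact hF.continuousOn.comp hUc.continuousOn hW
  | succ k ih =>
    refine ⟨hF.continuousOn.comp hUc.continuousOn hW,
      fun p z => (fderiv ℝ F (U p, z)).comp (ContinuousLinearMap.inr ℝ E3 E3), fun x hx => ?_, ?_⟩
    · have h1 := ((hF.contDiffAt (hD.mem_nhds (hW x hx))).differentiableAt (by simp)).hasFDerivAt
      exact h1.comp x.2 (hasFDerivAt_prodMk_right (U x.1) x.2)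
    · refine ih (F := fun y => (fderiv ℝ F y).comp (ContinuousLinearMap.inr ℝ E3 E3)) ?_
      exact (hF.fderiv_of_isOpen hD (m := ∞) le_rfl).clm_comp contDiffOn_const

theorem contDerivs_of_iteratedFDeriv (k : ℕ) {f : P → E3 → G}
    (hf : ∀ x ∈ W, ContDiffAt ℝ ∞ (f x.1) x.2)
    (hc : ∀ j, ContinuousOn (fun x : P × E3 => iteratedFDeriv ℝ j (f x.1) x.2) W) :
    ContDerivs k f W := by
  have h0 : ContinuousOn (fun x : P × E3 => f x.1 x.2) W := by
    have h1 := (continuousMultilinearCurryFin0 ℝ E3 G).continuous.comp_continuousOn (hc 0)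
    refine h1.congr fun x _ => ?_
    simp [iteratedFDeriv_zero_eq_comp]
  induction k generalizing G with
  | zero => exact h0
  | succ k ih =>
    have hc' : ∀ j, ContinuousOn
        (fun x : P × E3 => iteratedFDeriv ℝ j (fderiv ℝ (f x.1)) x.2) W := by
      intro j
      refine ((continuousMultilinearCurryRightEquiv' ℝ j E3 G).continuous.comp_continuousOn
        (hc (j + 1))).congr fun x _ => ?_
      simp [iteratedFDeriv_succ_eq_comp_right]
    refine ⟨h0, fun p z => fderiv ℝ (f p) z, fun x hx =>
      ((hf x hx).differentiableAt (by simp)).hasFDerivAt, ih (f := fun p => fderiv ℝ (f p))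
        (fun x hx => (hf x hx).fderiv_right (m := ∞) le_rfl) hc' ?_⟩
    have h1 := (continuousMultilinearCurryFin0 ℝ E3 (E3 →L[ℝ] G)).continuous.comp_continuousOn (hc' 0)
    refine h1.congr fun x _ => ?_
    simp [iteratedFDeriv_zero_eq_comp]

theorem ContDerivs.continuousOn_iteratedFDeriv (hW : IsOpen W) {k : ℕ} {f : P → E3 → G}
    (h : ContDerivs k f W) :
    ContinuousOn (fun x : P × E3 => iteratedFDeriv ℝ k (f x.1) x.2) W := by
  induction k generalizing G with
  | zero =>
    refine ((continuousMultilinearCurryFin0 ℝ E3 G).symm.continuous.comp_continuousOn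
      h.continuousOn).congr fun x _ => ?_
    simp [iteratedFDeriv_zero_eq_comp]
  | succ k ih =>
    obtain ⟨h0, f', hf, h'⟩ := h
    refine ((continuousMultilinearCurryRightEquiv' ℝ k E3 G).symm.continuous.comp_continuousOn
      (ih h')).congr fun x hx => ?_
    have e : fderiv ℝ (f x.1) =ᶠ[nhds x.2] f' x.1 := by
      filter_upwards [eventually_mem_slice hW hx] with z hz using (hf _ hz).fderiv
    have e2 := (e.iteratedFDeriv ℝ k).self_of_nhds
    simp [iteratedFDeriv_succ_eq_comp_right, e2]

end ParametricDerivatives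

/-! ### Rotations in Cayley coordinates -/

section Rotation

theorem contDiff_cross {V : Type*} [NormedAddCommGroup V] [NormedSpace ℝ V] {f g : V → E3}
    (hf : ContDiff ℝ ∞ f) (hg : ContDiff ℝ ∞ g) : ContDiff ℝ ∞ fun x => cross (f x) (g x) := by
  rw [contDiff_euclidean] at hf hg ⊢
  intro i
  fin_cases i <;>
  exact ((hf _).mul (hg _)).sub ((hf _).mul (hg _))

/-- The rotation of `ℝ³` with Cayley parameter `u`. -/
noncomputable def cayley (u v : E3) : E3 :=
  v + (2 / (1 + inner ℝ u u)) • (cross u v + cross u (cross u v))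

theorem one_add_inner_self_pos (u : E3) : 0 < 1 + inner ℝ u u := by
  have := real_inner_self_nonneg (x := u)
  linarith

theorem cayley_apply (u v : E3) (i : Fin 3) :
    cayley u v i = v i + (2 / (1 + inner ℝ u u)) * (cross u v i + cross u (cross u v) i) := rfl

theorem inner_cayley_self (u v : E3) : inner ℝ (cayley u v) (cayley u v) = inner ℝ v v := by
  have hd := (one_add_inner_self_pos u).ne'
  set s := 2 / (1 + inner ℝ u u) with hs
  have h2 : s * (1 + inner ℝ u u) = 2 := div_mul_cancel₀ _ hd
  set w := cross u v + cross u (cross u v) with hw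
  have h1 : inner ℝ v w = -inner ℝ (cross u v) (cross u v) := by
    rw [hw]
    simp only [inner_E3, PiLp.add_apply, cross_zero, cross_one, cross_two]
    ring
  have h3 : inner ℝ w w = (1 + inner ℝ u u) * inner ℝ (cross u v) (cross u v) := by
    rw [hw]
    simp only [inner_E3, PiLp.add_apply, cross_zero, cross_one, cross_two]
    ring
  have h4 : cayley u v = v + s • w := rfl
  rw [h4, inner_add_left, inner_add_right, inner_add_right, inner_smul_left, inner_smul_right,
    inner_smul_left, inner_smul_right, real_inner_comm v w, h1, h3]
  simp only [conj_trivial]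
  linear_combination (s * inner ℝ (cross u v) (cross u v)) * h2

theorem cayley_neg_cayley (u v : E3) : cayley (-u) (cayley u v) = v := by
  obtain ⟨s, hs⟩ : ∃ s, s = 2 / (1 + inner ℝ u u) := ⟨_, rfl⟩
  have h2 : s * (1 + inner ℝ u u) = 2 := by
    rw [hs, div_mul_cancel₀ _ (one_add_inner_self_pos u).ne']
  have e : ∀ i, cayley (-u) (cayley u v) i = cayley u v i + s *
      (cross (-u) (cayley u v) i + cross (-u) (cross (-u) (cayley u v)) i) := fun i => by
    rw [cayley_apply, inner_neg_neg, hs]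
  have e' : ∀ i, cayley u v i = v i + s * (cross u v i + cross u (cross u v) i) := fun i => by
    rw [cayley_apply, hs]
  rw [inner_E3] at h2
  apply E3_ext <;> rw [e] <;>
  simp only [e', cross_zero, cross_one, cross_two, PiLp.neg_apply]
  · linear_combination (-s * (u 1 * (u 0 * v 1 - u 1 * v 0) - u 2 * (u 2 * v 0 - u 0 * v 2))) * h2
  · linear_combination (-s * (u 2 * (u 1 * v 2 - u 2 * v 1) - u 0 * (u 0 * v 1 - u 1 * v 0))) * h2
  · linear_combination (-s * (u 0 * (u 2 * v 0 - u 0 * v 2) - u 1 * (u 1 * v 2 - u 2 * v 1))) * h2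

/-- The inverse of a rotation is its adjoint. -/
theorem inner_cayley_left (u v w : E3) :
    inner ℝ (cayley u v) w = inner ℝ v (cayley (-u) w) := by
  have e : ∀ i, cayley (-u) w i = w i + (2 / (1 + inner ℝ u u)) *
      (cross (-u) w i + cross (-u) (cross (-u) w) i) := fun i => by
    rw [cayley_apply, inner_neg_neg]
  rw [inner_E3, inner_E3, e, e, e]
  set s := 2 / (1 + inner ℝ u u) with hs
  simp only [cayley_apply, ← hs, cross_zero, cross_one, cross_two, PiLp.neg_apply]
  ring

theorem cayley_zero_left (v : E3) : cayley 0 v = v := by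
  apply E3_ext <;> simp [cayley_apply]

theorem cayley_zero_right (u : E3) : cayley u 0 = 0 := by
  apply E3_ext <;> simp [cayley_apply]

/-- The Cayley parameter of the rotation that moves `q` to `x` along the great circle. -/
noncomputable def cayleyParam (q x : E3) : E3 := (1 / (1 + inner ℝ q x)) • cross q x

theorem cross_cross_left (a b d : E3) :
    cross (cross a b) d = inner ℝ a d • b - inner ℝ b d • a := by
  apply E3_ext <;> simp only [inner_E3, PiLp.sub_apply, PiLp.smul_apply, smul_eq_mul, cross_zero,
    cross_one, cross_two] <;> ring

theorem cross_smul_left (r : ℝ) (a b : E3) : cross (r • a) b = r • cross a b := by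
  apply E3_ext <;> simp only [PiLp.smul_apply, smul_eq_mul, cross_zero, cross_one, cross_two] <;>
  ring

/-- The defining property of the Cayley parameter, for points that are not antipodal. -/
theorem cayley_cayleyParam {q x : S2} (h : 1 + inner ℝ (q : E3) (x : E3) ≠ 0) :
    cayley (cayleyParam q x) q = x := by
  have hq := inner_self_S2 q
  have hx := inner_self_S2 x
  have hxq : inner ℝ (x : E3) (q : E3) = inner ℝ (q : E3) (x : E3) := real_inner_comm _ _
  set c := inner ℝ (q : E3) (x : E3) with hc
  have hk : 1 / (1 + c) * (1 + c) = 1 := one_div_mul_cancel h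
  have hk0 : 1 / (1 + c) ≠ 0 := one_div_ne_zero h
  have hu : cayleyParam q x = (1 / (1 + c)) • cross q x := rfl
  generalize 1 / (1 + c) = k at hk hk0 hu
  rw [hu]
  have h1 : cross (k • cross (q : E3) x) q = k • ((x : E3) - c • (q : E3)) := by
    rw [cross_smul_left, cross_cross_left, hq, one_smul, hxq]
  have h2 : cross (k • cross (q : E3) x) (k • ((x : E3) - c • (q : E3))) =
      (-(k * (1 - c))) • (q : E3) := by
    rw [cross_smul_left, cross_cross_left, inner_smul_right, inner_smul_right, inner_sub_right,
      inner_sub_right, inner_smul_right, inner_smul_right, hq, hx, hxq]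
    have e : -(k * (1 - c)) = k * -(k * (1 - c * c)) := by
      linear_combination (k * (1 - c)) * hk
    rw [e]
    module
  have h3 : inner ℝ (cross (q : E3) x) (cross (q : E3) x) = 1 - c * c := by
    have e : inner ℝ (cross (q : E3) x) (cross (q : E3) x) = inner ℝ (q : E3) (q : E3) *
        inner ℝ (x : E3) (x : E3) - inner ℝ (q : E3) (x : E3) * inner ℝ (q : E3) (x : E3) := by
      simp only [inner_E3, cross_zero, cross_one, cross_two]
      ring
    rw [e, hq, hx, one_mul]
  have h4 : 1 + inner ℝ (k • cross (q : E3) x) (k • cross (q : E3) x) = 2 * k := by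
    rw [inner_smul_left, inner_smul_right, h3]
    simp only [conj_trivial]
    linear_combination (k * (1 - c) - 1) * hk
  rw [cayley, h1, h2, h4, mul_comm, div_mul_eq_div_div_swap, div_self two_ne_zero]
  have e : (1 / k) * k = 1 := one_div_mul_cancel hk0
  rw [smul_add, smul_smul, smul_smul, mul_neg, ← mul_assoc, e]
  module

/-- The rotation with Cayley parameter `u`, as a linear map. -/
noncomputable def cayleyMap (u : E3) : E3 →L[ℝ] E3 :=
  LinearMap.toContinuousLinearMap
    { toFun := cayley u
      map_add' := fun v w => by
        apply E3_ext <;> simp only [cayley_apply, PiLp.add_apply, cross_zero, cross_one, cross_two] <;>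
        ring
      map_smul' := fun r v => by
        apply E3_ext <;> simp only [cayley_apply, PiLp.smul_apply, smul_eq_mul, cross_zero, cross_one,
          cross_two, RingHom.id_apply] <;>
        ring }

theorem contDiff_cayley {V : Type*} [NormedAddCommGroup V] [NormedSpace ℝ V] {f g : V → E3}
    (hf : ContDiff ℝ ∞ f) (hg : ContDiff ℝ ∞ g) : ContDiff ℝ ∞ fun x => cayley (f x) (g x) := by
  have h1 := contDiff_cross hf hg
  exact hg.add ((contDiff_const.div (contDiff_const.add (hf.inner ℝ hf))
    fun x => (one_add_inner_self_pos (f x)).ne').smul (h1.add (contDiff_cross hf h1)))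

end Rotation

/-! ### Rotations damped outside a ball -/

section LocalTwist

/-- The rotation with Cayley parameter `u` about the origin, damped outside a small ball. -/
noncomputable def twist (e : ℝ) (u v : E3) : E3 :=
  cayley (Real.smoothTransition (2 - 2 * inner ℝ v v / e) • u) v

variable {e : ℝ}

theorem det_comp (A B : E3 →L[ℝ] E3) : (A.comp B).det = A.det * B.det :=
  LinearMap.det_comp _ _

theorem inner_twist_self (u v : E3) : inner ℝ (twist e u v) (twist e u v) = inner ℝ v v :=
  inner_cayley_self _ _

theorem twist_neg_twist (u v : E3) : twist e (-u) (twist e u v) = v := by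
  have h := inner_twist_self (e := e) u v
  unfold twist at h ⊢
  rw [h, smul_neg, cayley_neg_cayley]

theorem twist_zero_left (v : E3) : twist e 0 v = v := by
  rw [twist, smul_zero, cayley_zero_left]

theorem twist_of_le (he : 0 < e) (u : E3) {v : E3} (h : e ≤ inner ℝ v v) : twist e u v = v := by
  rw [twist, Real.smoothTransition.zero_of_nonpos, zero_smul, cayley_zero_left]
  rw [sub_nonpos, le_div_iff₀ he]
  linarith

theorem twist_of_two_mul_le (he : 0 < e) (u : E3) {v : E3} (h : 2 * inner ℝ v v ≤ e) :
    twist e u v = cayley u v := by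
  rw [twist, Real.smoothTransition.one_of_one_le, one_smul]
  rw [le_sub_comm, div_le_iff₀ he]
  linarith

theorem contDiff_twist (e : ℝ) {V : Type*} [NormedAddCommGroup V] [NormedSpace ℝ V] {f g : V → E3}
    (hf : ContDiff ℝ ∞ f) (hg : ContDiff ℝ ∞ g) : ContDiff ℝ ∞ fun x => twist e (f x) (g x) := by
  have h1 : ContDiff ℝ ∞ fun x => 2 - 2 * inner ℝ (g x) (g x) / e :=
    contDiff_const.sub ((contDiff_const.mul (hg.inner ℝ hg)).div_const e)
  exact contDiff_cayley ((Real.smoothTransition.contDiff.comp h1).smul hf) hg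

/-- The damped rotation about `z₀`, in the coordinates given by the linear map `L`. -/
noncomputable def localTwist (z₀ : E3) (L : E3 ≃L[ℝ] E3) (e : ℝ) (u z : E3) : E3 :=
  z₀ + L.symm (twist e u (L (z - z₀)))

/-- The ball that contains the support of the damped rotations. -/
def twistBall (z₀ : E3) (L : E3 ≃L[ℝ] E3) (e : ℝ) : Set E3 :=
  {z | inner ℝ (L (z - z₀)) (L (z - z₀)) ≤ e}

variable {z₀ : E3} {L : E3 ≃L[ℝ] E3}

theorem map_localTwist_sub (u z : E3) :
    L (localTwist z₀ L e u z - z₀) = twist e u (L (z - z₀)) := by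
  rw [localTwist, add_sub_cancel_left, L.apply_symm_apply]

theorem localTwist_neg (u z : E3) : localTwist z₀ L e (-u) (localTwist z₀ L e u z) = z := by
  rw [localTwist, map_localTwist_sub, twist_neg_twist, L.symm_apply_apply, add_sub_cancel]

theorem localTwist_zero (z : E3) : localTwist z₀ L e 0 z = z := by
  rw [localTwist, twist_zero_left, L.symm_apply_apply, add_sub_cancel]

theorem localTwist_mem_iff (u z : E3) :
    localTwist z₀ L e u z ∈ twistBall z₀ L e ↔ z ∈ twistBall z₀ L e := by
  simp only [twistBall, Set.mem_ofPred_eq, map_localTwist_sub, inner_twist_self]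

theorem localTwist_of_not_mem (he : 0 < e) (u : E3) {z : E3} (hz : z ∉ twistBall z₀ L e) :
    localTwist z₀ L e u z = z := by
  rw [localTwist, twist_of_le he u (not_le.1 hz).le, L.symm_apply_apply, add_sub_cancel]

theorem localTwist_self (he : 0 < e) (u : E3) : localTwist z₀ L e u z₀ = z₀ := by
  have h : twist e u 0 = 0 := by
    rw [twist_of_two_mul_le he u (by rw [inner_zero_left]; linarith), cayley_zero_right]
  rw [localTwist, sub_self, map_zero, h, map_zero, add_zero]

theorem contDiff_localTwist (z₀ : E3) (L : E3 ≃L[ℝ] E3) (e : ℝ) :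
    ContDiff ℝ ∞ fun x : E3 × E3 => localTwist z₀ L e x.1 x.2 :=
  contDiff_const.add (L.symm.contDiff.comp (contDiff_twist e contDiff_fst
    (L.contDiff.comp (contDiff_snd.sub contDiff_const))))

theorem hasFDerivAt_localTwist (he : 0 < e) (u : E3) : HasFDerivAt (localTwist z₀ L e u)
    ((L.symm : E3 →L[ℝ] E3).comp ((cayleyMap u).comp (L : E3 →L[ℝ] E3))) z₀ := by
  have h1 : HasFDerivAt (fun z => z₀ + L.symm (cayleyMap u (L (z - z₀))))
      ((L.symm : E3 →L[ℝ] E3).comp ((cayleyMap u).comp (L : E3 →L[ℝ] E3))) z₀ :=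
    (((L.symm : E3 →L[ℝ] E3).comp ((cayleyMap u).comp (L : E3 →L[ℝ] E3))).hasFDerivAt.comp z₀
      ((hasFDerivAt_id z₀).sub_const z₀)).const_add z₀
  refine h1.congr_of_eventuallyEq ?_
  have h2 : Continuous fun z => 2 * inner ℝ (L (z - z₀)) (L (z - z₀)) := by fun_prop
  have h3 : ∀ᶠ z in nhds z₀, 2 * inner ℝ (L (z - z₀)) (L (z - z₀)) < e := by
    refine h2.continuousAt.eventually (gt_mem_nhds ?_)
    simpa using he
  filter_upwards [h3] with z hz
  rw [localTwist, twist_of_two_mul_le he u hz.le]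
  rfl

/-- The determinant of the derivative does not vanish, as the twists are invertible, and it is one for
the trivial twist, to which every twist is joined. -/
theorem det_fderiv_localTwist_pos (u z : E3) : 0 < (fderiv ℝ (localTwist z₀ L e u) z).det := by
  have hF := contDiff_localTwist z₀ L e
  have hd : ∀ u z, HasFDerivAt (localTwist z₀ L e u)
      ((fderiv ℝ (fun x : E3 × E3 => localTwist z₀ L e x.1 x.2) (u, z)).comp
        (ContinuousLinearMap.inr ℝ E3 E3)) z := fun u z =>
    ((hF.differentiable (by simp)) (u, z)).hasFDerivAt.comp z (hasFDerivAt_prodMk_right u z)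
  set g : ℝ → ℝ := fun t => (fderiv ℝ (localTwist z₀ L e (t • u)) z).det with hg
  have hgc : Continuous g := by
    have h1 : g = fun t => ((fderiv ℝ (fun x : E3 × E3 => localTwist z₀ L e x.1 x.2) (t • u, z)).comp
        (ContinuousLinearMap.inr ℝ E3 E3)).det := by
      funext t
      rw [hg]
      simp only [(hd (t • u) z).fderiv]
    rw [h1]
    refine ContinuousLinearMap.continuous_det.comp (Continuous.clm_comp ?_ continuous_const)
    exact (hF.continuous_fderiv (by simp)).comp (by fun_prop)
  have hg0 : ∀ t, g t ≠ 0 := by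
    intro t h0
    have h1 : HasFDerivAt (fun z => localTwist z₀ L e (-(t • u)) (localTwist z₀ L e (t • u) z)) _ z :=
      (hd (-(t • u)) _).comp z (hd (t • u) z)
    simp only [localTwist_neg] at h1
    have h2 := congrArg ContinuousLinearMap.det (h1.unique (hasFDerivAt_id z))
    rw [hg] at h0
    simp only [(hd (t • u) z).fderiv] at h0
    rw [det_comp, h0, mul_zero] at h2
    exact zero_ne_one (h2.trans LinearMap.det_id)
  have hg1 : g 0 = 1 := by
    have h1 : localTwist z₀ L e ((0 : ℝ) • u) = id := by
      funext z
      rw [zero_smul, localTwist_zero, id]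
    simp only [hg, h1, fderiv_id]
    exact LinearMap.det_id
  by_contra! h
  have h1 : g 1 ≤ 0 := by
    simpa [hg] using h
  obtain ⟨t, ht⟩ := mem_range_of_exists_le_of_exists_ge hgc ⟨1, h1⟩ ⟨0, by rw [hg1]; exact zero_le_one⟩
  exact hg0 t ht

theorem isCompact_twistBall (z₀ : E3) (L : E3 ≃L[ℝ] E3) (e : ℝ) :
    IsCompact (twistBall z₀ L e) := by
  have h1 : IsCompact ((fun v => z₀ + L.symm v) '' Metric.closedBall 0 (√e)) :=
    (isCompact_closedBall (0 : E3) (√e)).image (by fun_prop)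
  refine h1.of_isClosed_subset (isClosed_le (by fun_prop) continuous_const) fun z hz => ?_
  refine ⟨L (z - z₀), ?_, by simp⟩
  rw [mem_closedBall_zero_iff, ← Real.sqrt_sq (norm_nonneg _), ← real_inner_self_eq_norm_sq]
  exact Real.sqrt_le_sqrt hz

theorem exists_twistBall_subset (z₀ : E3) (L : E3 ≃L[ℝ] E3) {V : Set E3} (hV : V ∈ nhds z₀) :
    ∃ e : ℝ, 0 < e ∧ twistBall z₀ L e ⊆ V := by
  have hc : Continuous fun v => z₀ + L.symm v := by fun_prop
  obtain ⟨r, hr, hrV⟩ := Metric.nhds_basis_closedBall.mem_iff.1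
    (hc.continuousAt.preimage_mem_nhds (x := 0) (by simpa using hV))
  refine ⟨r ^ 2, by positivity, fun z hz => ?_⟩
  have h1 : L (z - z₀) ∈ Metric.closedBall (0 : E3) r := by
    rw [mem_closedBall_zero_iff]
    have h2 : inner ℝ (L (z - z₀)) (L (z - z₀)) ≤ r ^ 2 := hz
    rw [real_inner_self_eq_norm_sq] at h2
    exact (pow_le_pow_iff_left₀ (norm_nonneg _) hr.le two_ne_zero).1 h2
  have h2 := hrV h1
  simpa using h2

end LocalTwist

/-! ### Pull-back of the contact condition -/

section Wedge

theorem triple_single_eq_det (A : E3 →L[ℝ] E3) : triple (A (EuclideanSpace.single 0 1))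
    (A (EuclideanSpace.single 1 1)) (A (EuclideanSpace.single 2 1)) = A.det := by
  have h := LinearMap.det_toMatrix (EuclideanSpace.basisFun (Fin 3) ℝ).toBasis (A : E3 →ₗ[ℝ] E3)
  rw [ContinuousLinearMap.det, ← h, Matrix.det_fin_three, triple_eq]
  simp only [LinearMap.toMatrix_apply, OrthonormalBasis.coe_toBasis, EuclideanSpace.basisFun_apply,
    OrthonormalBasis.coe_toBasis_repr_apply, EuclideanSpace.basisFun_repr,
    ContinuousLinearMap.coe_coe]
  ring

theorem wedgeDer_congr {a b : E3 → E3 →L[ℝ] ℝ} {z : E3} (h : a =ᶠ[nhds z] b) :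
    wedgeDer a z = wedgeDer b z := by
  simp only [wedgeDer, extDer, h.fderiv_eq, h.self_of_nhds]

/-- The pull-back of `a ∧ da` is multiplied by the Jacobian determinant: the second derivatives
cancel by symmetry. -/
theorem wedgeDer_pullback {a : E3 → E3 →L[ℝ] ℝ} {G : E3 → E3} {z : E3}
    (ha : DifferentiableAt ℝ a (G z)) (hG : ContDiffAt ℝ 2 G z) :
    wedgeDer (fun z => (a (G z)).comp (fderiv ℝ G z)) z = (fderiv ℝ G z).det * wedgeDer a (G z) := by
  have h1 : HasFDerivAt (fun z => a (G z)) ((fderiv ℝ a (G z)).comp (fderiv ℝ G z)) z :=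
    ha.hasFDerivAt.comp z (hG.differentiableAt (by simp)).hasFDerivAt
  have h2 : HasFDerivAt (fderiv ℝ G) (fderiv ℝ (fderiv ℝ G) z) z :=
    ((hG.fderiv_right (m := 1) (by norm_num)).differentiableAt (by simp)).hasFDerivAt
  have h3 : ∀ u v, fderiv ℝ (fderiv ℝ G) z u v = fderiv ℝ (fderiv ℝ G) z v u :=
    hG.isSymmSndFDerivAt (by simp)
  have h4 : ∀ u v, extDer (fun z => (a (G z)).comp (fderiv ℝ G z)) z u v =
      extDer a (G z) (fderiv ℝ G z u) (fderiv ℝ G z v) := by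
    intro u v
    simp only [extDer, (h1.clm_comp h2).fderiv]
    simp [h3 u v]
  set A := fderiv ℝ G z with hA
  rw [← triple_single_eq_det]
  simp only [wedgeDer, h4, ContinuousLinearMap.comp_apply, EuclideanSpace.basisFun_apply]
  have hx : ∀ x : E3, x = x 0 • EuclideanSpace.single 0 1 + x 1 • EuclideanSpace.single 1 1 +
      x 2 • EuclideanSpace.single 2 1 := fun x => by apply E3_ext <;> simp
  generalize A (EuclideanSpace.single 0 1) = r
  generalize A (EuclideanSpace.single 1 1) = s
  generalize A (EuclideanSpace.single 2 1) = t
  rw [triple_eq, extDer, extDer, extDer, extDer, extDer, extDer]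
  generalize fderiv ℝ a (G z) = B
  rw [hx r, hx s, hx t]
  simp only [map_add, map_smul, add_apply, smul_apply,
    smul_eq_mul, PiLp.add_apply, PiLp.smul_apply, PiLp.single_apply]
  simp
  ring

end Wedge

/-! ### One-forms in charts -/

section FormAlong

variable {Y : Type*} [TopologicalSpace Y] [ChartedSpace E3 Y]

/-- The pull-back of a 1-form on `Y` by a map `ℝ³ → Y`. -/
noncomputable def formAlong (α : ∀ y : Y, TangentSpace (𝓡 3) y →L[ℝ] ℝ) (ψ : E3 → Y) (z : E3) :
    E3 →L[ℝ] ℝ :=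
  (α (ψ z)).comp (mfderiv 𝓘(ℝ, E3) (𝓡 3) ψ z)

theorem formAlong_congr (α : ∀ y : Y, TangentSpace (𝓡 3) y →L[ℝ] ℝ) {ψ ψ' : E3 → Y} {z : E3}
    (h : ψ =ᶠ[nhds z] ψ') : formAlong α ψ z = formAlong α ψ' z := by
  have h1 : (mfderiv 𝓘(ℝ, E3) (𝓡 3) ψ z : E3 →L[ℝ] E3) = mfderiv 𝓘(ℝ, E3) (𝓡 3) ψ' z := h.mfderiv_eq
  have h2 : (α (ψ z) : E3 →L[ℝ] ℝ) = α (ψ' z) := by rw [h.self_of_nhds]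
  exact congrArg₂ (fun (a : E3 →L[ℝ] ℝ) (b : E3 →L[ℝ] E3) => a.comp b) h2 h1

/-- The coordinate change between the preferred charts at `x` and `w`. -/
noncomputable def chartChange (x w : Y) (z : E3) : E3 :=
  extChartAt (𝓡 3) w ((extChartAt (𝓡 3) x).symm z)

theorem chartChange_self {p : Y} {z : E3} (hz : z ∈ (extChartAt (𝓡 3) p).target) : chartChange p p z = z :=
  (extChartAt (𝓡 3) p).right_inv hz

/-- The part of the preferred chart at `x` that lies in a subset of `Y`. -/
def chartPart (x : Y) (S : Set Y) : Set E3 :=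
  (extChartAt (𝓡 3) x).target ∩ (extChartAt (𝓡 3) x).symm ⁻¹' S

theorem isOpen_chartPart (x : Y) {S : Set Y} (hS : IsOpen S) : IsOpen (chartPart x S) :=
  (continuousOn_extChartAt_symm x).isOpen_inter_preimage (isOpen_extChartAt_target x) hS

variable [IsManifold (𝓡 3) ∞ Y]

theorem contMDiffAt_extChartAt_symm {w : Y} {z : E3} (hz : z ∈ (extChartAt (𝓡 3) w).target) :
    ContMDiffAt 𝓘(ℝ, E3) (𝓡 3) ∞ (extChartAt (𝓡 3) w).symm z :=
  (contMDiffOn_extChartAt_symm w).contMDiffAt ((isOpen_extChartAt_target w).mem_nhds hz)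

theorem formAlong_symm_comp (α : ∀ y : Y, TangentSpace (𝓡 3) y →L[ℝ] ℝ) (w : Y) {F : E3 → E3}
    {z : E3} (hF : DifferentiableAt ℝ F z) (hz : F z ∈ (extChartAt (𝓡 3) w).target) :
    formAlong α ((extChartAt (𝓡 3) w).symm ∘ F) z = (localForm α w (F z)).comp (fderiv ℝ F z) := by
  have h1 := mfderiv_comp z ((contMDiffAt_extChartAt_symm hz).mdifferentiableAt (by simp))
    hF.mdifferentiableAt
  rw [mfderiv_eq_fderiv] at h1
  rw [formAlong, h1]
  rfl

theorem contDiffOn_chartChange (x w : Y) :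
    ContDiffOn ℝ ∞ (chartChange x w) (chartPart x (extChartAt (𝓡 3) w).source) :=
  contDiffOn_ext_coord_change w x

theorem det_fderiv_chartChange_pos (hY : IsOrientedAtlas Y) {x w : Y} {z : E3}
    (hz : z ∈ chartPart x (extChartAt (𝓡 3) w).source) : 0 < (fderiv ℝ (chartChange x w) z).det := by
  have h1 := hY x w ((extChartAt (𝓡 3) x).symm z)
    (by simpa using (extChartAt (𝓡 3) x).map_target hz.1) (by simpa using hz.2)
  rw [tangentCoordChange_def, ModelWithCorners.Boundaryless.range_eq_univ, fderivWithin_univ,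
    (extChartAt (𝓡 3) x).right_inv hz.1] at h1
  exact h1

end FormAlong

/-! ### Smooth families of maps -/

section SmoothFamily

variable {F : E3 → E3 → E3}

theorem contDiffOn_comp₂ (hF : ContDiff ℝ ∞ fun x : E3 × E3 => F x.1 x.2) {V : Type*}
    [NormedAddCommGroup V] [NormedSpace ℝ V] {f g : V → E3} {s : Set V} (hf : ContDiffOn ℝ ∞ f s)
    (hg : ContDiffOn ℝ ∞ g s) : ContDiffOn ℝ ∞ (fun x => F (f x) (g x)) s :=
  hF.comp_contDiffOn (hf.prodMk hg)

theorem contMDiffAt_comp₂ (hF : ContDiff ℝ ∞ fun x : E3 × E3 => F x.1 x.2) {Y : Type*}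
    [TopologicalSpace Y] [ChartedSpace E3 Y] {f g : E3 × Y → E3} {x : E3 × Y}
    (hf : ContMDiffAt (𝓘(ℝ, E3).prod (𝓡 3)) 𝓘(ℝ, E3) ∞ f x)
    (hg : ContMDiffAt (𝓘(ℝ, E3).prod (𝓡 3)) 𝓘(ℝ, E3) ∞ g x) :
    ContMDiffAt (𝓘(ℝ, E3).prod (𝓡 3)) 𝓘(ℝ, E3) ∞ (fun x => F (f x) (g x)) x :=
  ContMDiffAt.comp (g := fun y : E3 × E3 => F y.1 y.2) x hF.contMDiff.contMDiffAt
    (hf.prodMk_space hg)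

end SmoothFamily

/-! ### Twists of a neighbourhood of a point -/

section ChartTwist

variable {Y : Type*} [TopologicalSpace Y] [ChartedSpace E3 Y]

theorem contDiffAt_localForm (α : ContactForm Y) {x : Y} {z : E3}
    (hz : z ∈ (extChartAt (𝓡 3) x).target) : ContDiffAt ℝ ∞ (localForm α.form x) z :=
  (α.smooth x).contDiffAt ((isOpen_extChartAt_target x).mem_nhds hz)

/-- A linear frame at `p` and a ball around `p`, round in this frame and contained in the preferred
chart; they determine the diffeomorphisms of `Y` that twist a neighbourhood of `p`. -/
structure TwistData (p : Y) where
  /-- The linear frame. -/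
  frame : E3 ≃L[ℝ] E3
  /-- The square of the radius of the ball. -/
  size : ℝ
  size_pos : 0 < size
  ball_subset : twistBall (extChartAt (𝓡 3) p p) frame size ⊆ (extChartAt (𝓡 3) p).target

namespace TwistData

variable {p : Y} (D : TwistData p)

/-- The twist in the preferred chart at `p`. -/
noncomputable def inChart (u z : E3) : E3 := localTwist (extChartAt (𝓡 3) p p) D.frame D.size u z

theorem contDiff_inChart : ContDiff ℝ ∞ fun x : E3 × E3 => D.inChart x.1 x.2 :=
  contDiff_localTwist _ _ _

theorem inChart_mem_target (u : E3) {z : E3} (hz : z ∈ (extChartAt (𝓡 3) p).target) :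
    D.inChart u z ∈ (extChartAt (𝓡 3) p).target := by
  by_cases h : z ∈ twistBall (extChartAt (𝓡 3) p p) D.frame D.size
  · exact D.ball_subset ((localTwist_mem_iff u z).2 h)
  · rwa [inChart, localTwist_of_not_mem D.size_pos u h]

open Classical in
/-- The diffeomorphism of `Y` that twists a neighbourhood of `p` by the rotation with Cayley
parameter `u`. -/
noncomputable def map (u : E3) (y : Y) : Y :=
  if y ∈ (extChartAt (𝓡 3) p).source then
    (extChartAt (𝓡 3) p).symm (D.inChart u (extChartAt (𝓡 3) p y)) else y

theorem map_of_mem (u : E3) {y : Y} (hy : y ∈ (extChartAt (𝓡 3) p).source) :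
    D.map u y = (extChartAt (𝓡 3) p).symm (D.inChart u (extChartAt (𝓡 3) p y)) :=
  if_pos hy

theorem map_neg (u : E3) (y : Y) : D.map (-u) (D.map u y) = y := by
  by_cases hy : y ∈ (extChartAt (𝓡 3) p).source
  · have h1 := D.inChart_mem_target u ((extChartAt (𝓡 3) p).map_source hy)
    rw [D.map_of_mem u hy, D.map_of_mem _ ((extChartAt (𝓡 3) p).map_target h1),
      (extChartAt (𝓡 3) p).right_inv h1, inChart, inChart, localTwist_neg,
      (extChartAt (𝓡 3) p).left_inv hy]
  · simp only [map, hy, if_false]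

theorem map_zero (y : Y) : D.map 0 y = y := by
  by_cases hy : y ∈ (extChartAt (𝓡 3) p).source
  · rw [D.map_of_mem _ hy, inChart, localTwist_zero, (extChartAt (𝓡 3) p).left_inv hy]
  · simp only [map, hy, if_false]

/-- The compact set outside which the twists are the identity. -/
def support : Set Y :=
  (extChartAt (𝓡 3) p).symm '' twistBall (extChartAt (𝓡 3) p p) D.frame D.size

theorem support_subset : D.support ⊆ (extChartAt (𝓡 3) p).source := by
  rintro _ ⟨z, hz, rfl⟩
  exact (extChartAt (𝓡 3) p).map_target (D.ball_subset hz)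

theorem map_of_not_mem (u : E3) {y : Y} (hy : y ∉ D.support) : D.map u y = y := by
  by_cases h : y ∈ (extChartAt (𝓡 3) p).source
  · have h1 : extChartAt (𝓡 3) p y ∉ twistBall (extChartAt (𝓡 3) p p) D.frame D.size := fun h1 =>
      hy ⟨_, h1, (extChartAt (𝓡 3) p).left_inv h⟩
    rw [D.map_of_mem u h, inChart, localTwist_of_not_mem D.size_pos u h1,
      (extChartAt (𝓡 3) p).left_inv h]
  · simp only [map, h, if_false]

theorem isClosed_support [T2Space Y] : IsClosed D.support :=
  ((isCompact_twistBall _ _ _).image_of_continuousOn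
    ((continuousOn_extChartAt_symm p).mono D.ball_subset)).isClosed

/-- The twist, from the preferred chart at `x` to the preferred chart at `p`. -/
noncomputable def chart (x : Y) (u z : E3) : E3 := D.inChart u (chartChange x p z)

theorem chart_mem_target {x : Y} (u : E3) {z : E3}
    (hz : z ∈ chartPart x (extChartAt (𝓡 3) p).source) :
    D.chart x u z ∈ (extChartAt (𝓡 3) p).target :=
  D.inChart_mem_target u ((extChartAt (𝓡 3) p).map_source hz.2)

theorem chartPart_cover {x : Y} {z : E3} (hz : z ∈ (extChartAt (𝓡 3) x).target) :
    z ∈ chartPart x (extChartAt (𝓡 3) p).source ∨ z ∈ chartPart x D.supportᶜ := by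
  by_cases h : (extChartAt (𝓡 3) x).symm z ∈ (extChartAt (𝓡 3) p).source
  · exact Or.inl ⟨hz, h⟩
  · exact Or.inr ⟨hz, fun h' => h (D.support_subset h')⟩

variable [IsManifold (𝓡 3) ∞ Y]

theorem contMDiff_map [T2Space Y] : ContMDiff (𝓘(ℝ, E3).prod (𝓡 3)) (𝓡 3) ∞
    fun x : E3 × Y => D.map x.1 x.2 := by
  intro x
  by_cases hx : x.2 ∈ (extChartAt (𝓡 3) p).source
  · have h1 : ContMDiffAt (𝓘(ℝ, E3).prod (𝓡 3)) 𝓘(ℝ, E3) ∞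
        (fun x : E3 × Y => extChartAt (𝓡 3) p x.2) x :=
      ContMDiffAt.comp x (contMDiffAt_extChartAt' (by simpa using hx)) contMDiffAt_snd
    have h3 : ContMDiffAt (𝓘(ℝ, E3).prod (𝓡 3)) 𝓘(ℝ, E3) ∞
        (fun x : E3 × Y => D.inChart x.1 (extChartAt (𝓡 3) p x.2)) x :=
      contMDiffAt_comp₂ D.contDiff_inChart contMDiffAt_fst h1
    refine (ContMDiffAt.comp x (contMDiffAt_extChartAt_symm
      (D.inChart_mem_target x.1 ((extChartAt (𝓡 3) p).map_source hx))) h3).congr_of_eventuallyEq ?_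
    filter_upwards [((isOpen_extChartAt_source p).preimage continuous_snd).mem_nhds hx] with y hy
    exact D.map_of_mem y.1 hy
  · refine contMDiffAt_snd.congr_of_eventuallyEq ?_
    have h1 : x.2 ∈ D.supportᶜ := fun h => hx (D.support_subset h)
    filter_upwards [(D.isClosed_support.isOpen_compl.preimage continuous_snd).mem_nhds h1] with y hy
    exact D.map_of_not_mem y.1 hy

theorem contMDiff_map_left [T2Space Y] (u : E3) : ContMDiff (𝓡 3) (𝓡 3) ∞ (D.map u) :=
  D.contMDiff_map.comp (contMDiff_const.prodMk contMDiff_id)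

theorem contDiffOn_chart (x : Y) : ContDiffOn ℝ ∞ (fun y : E3 × E3 => D.chart x y.1 y.2)
    (Prod.snd ⁻¹' chartPart x (extChartAt (𝓡 3) p).source) := by
  have h1 : ContDiffOn ℝ ∞ (fun y : E3 × E3 => chartChange x p y.2)
      (Prod.snd ⁻¹' chartPart x (extChartAt (𝓡 3) p).source) :=
    (contDiffOn_chartChange x p).comp contDiffOn_snd fun y hy => hy
  exact contDiffOn_comp₂ D.contDiff_inChart contDiffOn_fst h1

theorem contDiffAt_chart {x : Y} (u : E3) {z : E3}
    (hz : z ∈ chartPart x (extChartAt (𝓡 3) p).source) : ContDiffAt ℝ ∞ (D.chart x u) z := by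
  have h1 := (D.contDiffOn_chart x).contDiffAt (x := (u, z))
    (((isOpen_chartPart x (isOpen_extChartAt_source p)).preimage continuous_snd).mem_nhds hz)
  exact h1.comp z (contDiffAt_const.prodMk contDiffAt_id)

theorem det_fderiv_chart_pos (hY : IsOrientedAtlas Y) {x : Y} (u : E3) {z : E3}
    (hz : z ∈ chartPart x (extChartAt (𝓡 3) p).source) : 0 < (fderiv ℝ (D.chart x u) z).det := by
  have h1 : HasFDerivAt (D.inChart u) (fderiv ℝ (D.inChart u) (chartChange x p z)) (chartChange x p z) :=
    DifferentiableAt.hasFDerivAt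
      (((D.contDiff_inChart.comp (contDiff_const.prodMk contDiff_id)).differentiable
        (by simp)) _)
  have h2 : HasFDerivAt (chartChange x p) (fderiv ℝ (chartChange x p) z) z :=
    (((contDiffOn_chartChange x p).contDiffAt ((isOpen_chartPart x
      (isOpen_extChartAt_source p)).mem_nhds hz)).differentiableAt (by simp)).hasFDerivAt
  have h3 : fderiv ℝ (D.chart x u) z = _ := (h1.comp z h2).fderiv
  rw [h3, det_comp]
  exact mul_pos (det_fderiv_localTwist_pos u _) (det_fderiv_chartChange_pos hY hz)

/-- The pull-back of a 1-form by a twist. -/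
noncomputable def pullForm (u : E3) (α : ∀ y : Y, TangentSpace (𝓡 3) y →L[ℝ] ℝ) (y : Y) :
    TangentSpace (𝓡 3) y →L[ℝ] ℝ :=
  (α (D.map u y)).comp (mfderiv (𝓡 3) (𝓡 3) (D.map u) y)

variable [T2Space Y] (u : E3) (α : ∀ y : Y, TangentSpace (𝓡 3) y →L[ℝ] ℝ)

theorem localForm_pullForm_eq_formAlong {x : Y} {z : E3} (hz : z ∈ (extChartAt (𝓡 3) x).target) :
    localForm (D.pullForm u α) x z = formAlong α (D.map u ∘ (extChartAt (𝓡 3) x).symm) z := by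
  have h1 := mfderiv_comp z ((D.contMDiff_map_left u).mdifferentiableAt (by simp))
    ((contMDiffAt_extChartAt_symm hz).mdifferentiableAt (by simp))
  rw [formAlong, h1]
  rfl

theorem localForm_pullForm {x : Y} {z : E3} (hz : z ∈ chartPart x (extChartAt (𝓡 3) p).source) :
    localForm (D.pullForm u α) x z =
      (localForm α p (D.chart x u z)).comp (fderiv ℝ (D.chart x u) z) := by
  rw [D.localForm_pullForm_eq_formAlong u α hz.1, ← formAlong_symm_comp α p
    ((D.contDiffAt_chart u hz).differentiableAt (by simp)) (D.chart_mem_target u hz)]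
  refine formAlong_congr α ?_
  filter_upwards [(isOpen_chartPart x (isOpen_extChartAt_source p)).mem_nhds hz] with y hy
  exact D.map_of_mem u hy.2

theorem localForm_pullForm_of_not_mem {x : Y} {z : E3} (hz : z ∈ chartPart x D.supportᶜ) :
    localForm (D.pullForm u α) x z = localForm α x z := by
  rw [D.localForm_pullForm_eq_formAlong u α hz.1]
  refine formAlong_congr α ?_
  filter_upwards [(isOpen_chartPart x D.isClosed_support.isOpen_compl).mem_nhds hz] with y hy
  exact D.map_of_not_mem u hy.2

/-- The pull-back of a contact form by a twist. -/
noncomputable def pull (hY : IsOrientedAtlas Y) (α : ContactForm Y) : ContactForm Y where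
  form := D.pullForm u α.form
  smooth x z hz := by
    refine ContDiffAt.contDiffWithinAt ?_
    rcases D.chartPart_cover hz with h | h
    · have h1 := D.contDiffAt_chart u h
      refine ContDiffAt.congr_of_eventuallyEq (f := fun z =>
        (localForm α.form p (D.chart x u z)).comp (fderiv ℝ (D.chart x u) z)) ?_ ?_
      · exact ((contDiffAt_localForm α (D.chart_mem_target u h)).comp z h1).clm_comp
          (h1.fderiv_right (m := ∞) le_rfl)
      · filter_upwards [(isOpen_chartPart x (isOpen_extChartAt_source p)).mem_nhds h] with y hy
        exact D.localForm_pullForm u α.form hy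
    · refine (contDiffAt_localForm α hz).congr_of_eventuallyEq ?_
      filter_upwards [(isOpen_chartPart x D.isClosed_support.isOpen_compl).mem_nhds h] with y hy
      exact D.localForm_pullForm_of_not_mem u α.form hy
  contact x z hz := by
    rcases D.chartPart_cover hz with h | h
    · have e : localForm (D.pullForm u α.form) x =ᶠ[nhds z] fun z =>
          (localForm α.form p (D.chart x u z)).comp (fderiv ℝ (D.chart x u) z) := by
        filter_upwards [(isOpen_chartPart x (isOpen_extChartAt_source p)).mem_nhds h] with y hy
        exact D.localForm_pullForm u α.form hy
      rw [wedgeDer_congr e, wedgeDer_pullback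
        ((contDiffAt_localForm α (D.chart_mem_target u h)).differentiableAt (by simp))
        ((D.contDiffAt_chart u h).of_le (by norm_cast))]
      exact mul_pos (D.det_fderiv_chart_pos hY u h) (α.contact p _ (D.chart_mem_target u h))
    · have e : localForm (D.pullForm u α.form) x =ᶠ[nhds z] localForm α.form x := by
        filter_upwards [(isOpen_chartPart x D.isClosed_support.isOpen_compl).mem_nhds h] with y hy
        exact D.localForm_pullForm_of_not_mem u α.form hy
      rw [wedgeDer_congr e]
      exact α.contact x z hz

end TwistData

end ChartTwist

/-! ### The smooth topology in charts -/

section SmoothTopology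

variable {Y : Type*} [TopologicalSpace Y] [ChartedSpace E3 Y]

/-- Uniform convergence of the derivatives on compact sets makes them jointly continuous in the form
and the point. -/
theorem continuousOn_iteratedFDeriv_localForm (x : Y) (k : ℕ) :
    ContinuousOn (fun y : ContactForm Y × E3 => iteratedFDeriv ℝ k (localForm y.1.form x) y.2)
      (Prod.snd ⁻¹' (extChartAt (𝓡 3) x).target) := by
  rintro ⟨α, z⟩ hz
  refine ContinuousAt.continuousWithinAt ?_
  obtain ⟨K, hK, hKt, hKc⟩ := LocallyCompactSpace.local_compact_nhds z _
    ((isOpen_extChartAt_target (I := 𝓡 3) x).mem_nhds hz)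
  have h1 : Continuous fun α : ContactForm Y =>
      UniformOnFun.ofFun {K : Set E3 | IsCompact K ∧ K ⊆ (extChartAt (𝓡 3) x).target}
        (iteratedFDeriv ℝ k (localForm α.form x)) :=
    continuous_iInf_dom (i := x) (continuous_iInf_dom (i := k) continuous_induced_dom)
  have h2 : TendstoUniformlyOn
      (fun y : ContactForm Y × E3 => iteratedFDeriv ℝ k (localForm y.1.form x))
      (iteratedFDeriv ℝ k (localForm α.form x)) (nhds (α, z)) K :=
    UniformOnFun.tendsto_iff_tendstoUniformlyOn.1
      ((h1.comp continuous_fst).tendsto (α, z)) K ⟨hKc, hKt⟩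
  refine h2.tendsto_comp ?_ ?_
  · exact ((((α.smooth x).contDiffAt ((isOpen_extChartAt_target x).mem_nhds hz)).continuousAt_iteratedFDeriv
      (by exact_mod_cast le_top)).continuousWithinAt)
  · rw [nhdsWithin_eq_nhds.2 hK]
    exact continuous_snd.continuousAt

/-- Conversely, joint continuity gives uniform convergence on compact sets, by the tube lemma. -/
theorem continuous_of_continuousOn_iteratedFDeriv {P : Type*} [TopologicalSpace P]
    {f : P → ContactForm Y}
    (hf : ∀ (x : Y) (k : ℕ), ContinuousOn
      (fun y : P × E3 => iteratedFDeriv ℝ k (localForm (f y.1).form x) y.2)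
      (Prod.snd ⁻¹' (extChartAt (𝓡 3) x).target)) : Continuous f := by
  refine continuous_iInf_rng.2 fun x => continuous_iInf_rng.2 fun k => continuous_induced_rng.2 ?_
  refine continuous_iff_continuousAt.2 fun a => ?_
  refine UniformOnFun.tendsto_iff_tendstoUniformlyOn.2 ?_
  rintro K ⟨hKc, hKt⟩
  refine Metric.tendstoUniformlyOn_iff.2 fun ε hε => ?_
  refine hKc.eventually_forall_of_forall_eventually fun z hz => ?_
  have h1 : ContinuousAt (fun y : P × E3 => iteratedFDeriv ℝ k (localForm (f y.1).form x) y.2) (a, z) :=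
    (hf x k).continuousAt (((isOpen_extChartAt_target x).preimage continuous_snd).mem_nhds (hKt hz))
  have h2 : ContinuousAt (fun y : P × E3 => iteratedFDeriv ℝ k (localForm (f a).form x) y.2) (a, z) :=
    ContinuousAt.comp (f := fun y : P × E3 => (a, y.2)) (x := (a, z))
      (g := fun y : P × E3 => iteratedFDeriv ℝ k (localForm (f y.1).form x) y.2) h1
      (continuous_const.prodMk continuous_snd).continuousAt
  refine (h2.dist h1).eventually (gt_mem_nhds ?_)
  simpa using hε

theorem contDerivs_localForm (k : ℕ) (x : Y) :
    ContDerivs k (fun (y : E3 × ContactForm Y) => localForm y.2.form x)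
      (Prod.snd ⁻¹' (extChartAt (𝓡 3) x).target) := by
  refine contDerivs_of_iteratedFDeriv k (fun y hy => contDiffAt_localForm y.1.2 hy) fun j => ?_
  exact (continuousOn_iteratedFDeriv_localForm x j).comp
    ((continuous_snd.comp continuous_fst).prodMk continuous_snd).continuousOn fun y hy => hy

end SmoothTopology

/-! ### Continuity of the action on contact forms -/

section PullContinuous

variable {Y : Type*} [TopologicalSpace Y] [ChartedSpace E3 Y] [IsManifold (𝓡 3) ∞ Y] [T2Space Y]
  {p : Y} (D : TwistData p) (hY : IsOrientedAtlas Y)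

namespace TwistData

/-- The chart expressions of the pulled-back contact form depend continuously, with all their
derivatives, on the twist and on the contact form. -/
theorem contDerivs_pull (k : ℕ) (x : Y) :
    ContDerivs k (fun (y : E3 × ContactForm Y) => localForm (D.pull y.1 hY y.2).form x)
      (Prod.snd ⁻¹' chartPart x (extChartAt (𝓡 3) p).source) := by
  have ho := isOpen_chartPart x (isOpen_extChartAt_source (I := 𝓡 3) p)
  have ho' := ho.preimage (continuous_snd (X := E3))
  have h1 : ContDerivs k (fun (y : E3 × ContactForm Y) z => D.chart x y.1 z)
      (Prod.snd ⁻¹' chartPart x (extChartAt (𝓡 3) p).source) :=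
    contDerivs_of_contDiffOn k ho' (D.contDiffOn_chart x) continuous_fst fun y hy => hy
  have h2 : ContDerivs k (fun (y : E3 × ContactForm Y) z =>
      (fderiv ℝ (fun y : E3 × E3 => D.chart x y.1 y.2) (y.1, z)).comp
        (ContinuousLinearMap.inr ℝ E3 E3))
      (Prod.snd ⁻¹' chartPart x (extChartAt (𝓡 3) p).source) :=
    contDerivs_of_contDiffOn (F := fun y => (fderiv ℝ (fun y : E3 × E3 => D.chart x y.1 y.2) y).comp
        (ContinuousLinearMap.inr ℝ E3 E3)) k ho'
      (((D.contDiffOn_chart x).fderiv_of_isOpen ho' (m := ∞) le_rfl).clm_comp contDiffOn_const)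
      continuous_fst fun y hy => hy
  have h3 := (contDerivs_localForm k p).comp h1 fun y hy => D.chart_mem_target y.1.1 hy
  refine (ContDerivs.bilinear (ContinuousLinearMap.compL ℝ E3 E3 ℝ) h3 h2).congr
    (ho.preimage continuous_snd) fun y hy => ?_
  have h4 : HasFDerivAt (D.chart x y.1.1) _ y.2 :=
    (((D.contDiffOn_chart x).contDiffAt (x := (y.1.1, y.2)) (ho'.mem_nhds hy)).differentiableAt
      (by simp)).hasFDerivAt.comp y.2 (hasFDerivAt_prodMk_right y.1.1 y.2)
  exact (D.localForm_pullForm y.1.1 y.1.2.form hy).trans (by rw [h4.fderiv]; rfl)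

theorem continuous_pull : Continuous fun y : E3 × ContactForm Y => D.pull y.1 hY y.2 := by
  refine continuous_of_continuousOn_iteratedFDeriv fun x k => ?_
  rintro ⟨⟨u, α⟩, z⟩ hz
  refine ContinuousAt.continuousWithinAt ?_
  rcases D.chartPart_cover hz with h | h
  · have ho := (isOpen_chartPart x (isOpen_extChartAt_source (I := 𝓡 3) p)).preimage
      (continuous_snd (X := E3 × ContactForm Y))
    exact ((D.contDerivs_pull hY k x).continuousOn_iteratedFDeriv ho).continuousAt (ho.mem_nhds h)
  · have ho := (isOpen_chartPart x D.isClosed_support.isOpen_compl).preimage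
      (continuous_snd (X := E3 × ContactForm Y))
    have h1 : ContDerivs k (fun (y : E3 × ContactForm Y) => localForm (D.pull y.1 hY y.2).form x)
        (Prod.snd ⁻¹' chartPart x D.supportᶜ) :=
      ((contDerivs_localForm k x).mono fun y hy => hy.1).congr ho
        fun y hy => D.localForm_pullForm_of_not_mem y.1.1 y.1.2.form hy
    exact (h1.continuousOn_iteratedFDeriv ho).continuousAt (ho.mem_nhds h)

end TwistData

end PullContinuous

/-! ### The action on contact structures -/

section TwistAction

variable {Y : Type*} [TopologicalSpace Y] [ChartedSpace E3 Y] [IsManifold (𝓡 3) ∞ Y] [T2Space Y]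
  {p : Y} (D : TwistData p) (hY : IsOrientedAtlas Y)

namespace TwistData

theorem pullForm_comp_mfderiv (u : E3) (α : ∀ y : Y, TangentSpace (𝓡 3) y →L[ℝ] ℝ) {f g : Y → Y}
    (hf : ContMDiff (𝓡 3) (𝓡 3) ∞ f) (h : ∀ y, D.map u (f y) = g y) (y : Y) :
    (D.pullForm u α (f y)).comp (mfderiv (𝓡 3) (𝓡 3) f y) =
      (α (g y)).comp (mfderiv (𝓡 3) (𝓡 3) g y) := by
  obtain rfl : D.map u ∘ f = g := funext h
  rw [mfderiv_comp y ((D.contMDiff_map_left u).mdifferentiableAt (by simp))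
    (hf.mdifferentiableAt (by simp))]
  rfl

theorem pull_neg_pull (u : E3) (α : ContactForm Y) (y : Y) :
    (D.pull u hY (D.pull (-u) hY α)).form y = α.form y := by
  refine (D.pullForm_comp_mfderiv (-u) α.form (D.contMDiff_map_left u) (D.map_neg u) y).trans ?_
  rw [show mfderiv (𝓡 3) (𝓡 3) (fun y : Y => y) y = _ from mfderiv_id]
  rfl

/-- The action of the twists on contact structures, by push-forward. -/
noncomputable def act (u : E3) : ContactStructure Y → ContactStructure Y :=
  Quotient.map (D.pull (-u) hY) (by
    intro α β h y
    obtain ⟨c, hc, h⟩ := h (D.map (-u) y)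
    refine ⟨c, hc, ?_⟩
    change (β.form _).comp _ = c • (α.form _).comp _
    rw [h]
    rfl)

theorem continuous_act : Continuous fun x : E3 × ContactStructure Y => D.act hY x.1 x.2 := by
  refine isQuotientMap_quotient_mk'.continuous_lift_prod_right ?_
  exact continuous_quotient_mk'.comp ((D.continuous_pull hY).comp
    ((continuous_neg.comp continuous_fst).prodMk continuous_snd))

theorem act_neg_act (u : E3) (ξ : ContactStructure Y) : D.act hY (-u) (D.act hY u ξ) = ξ := by
  induction ξ using Quotient.inductionOn with
  | h α =>
    refine Quotient.sound fun y => ⟨1, one_pos, ?_⟩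
    rw [one_smul, neg_neg]
    exact (D.pull_neg_pull hY u α y).symm

theorem act_zero (ξ : ContactStructure Y) : D.act hY 0 ξ = ξ := by
  induction ξ using Quotient.inductionOn with
  | h α =>
    refine Quotient.sound fun y => ⟨1, one_pos, ?_⟩
    rw [one_smul, neg_zero]
    have h1 := D.pullForm_comp_mfderiv 0 α.form contMDiff_id D.map_zero y
    rw [show mfderiv (𝓡 3) (𝓡 3) (fun y : Y => y) y = _ from mfderiv_id, mfderiv_id] at h1
    exact h1.symm

/-- The twist as a diffeomorphism. -/
noncomputable def diffeo (u : E3) : Y ≃ₘ⟮𝓡 3, 𝓡 3⟯ Y where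
  toFun := D.map u
  invFun := D.map (-u)
  left_inv := D.map_neg u
  right_inv y := by simpa using D.map_neg (-u) y
  contMDiff_toFun := D.contMDiff_map_left u
  contMDiff_invFun := D.contMDiff_map_left (-u)

theorem isIsotopic_act (u : E3) {ξ₀ ξ : ContactStructure Y} (h : IsIsotopic ξ₀ ξ) :
    IsIsotopic ξ₀ (D.act hY u ξ) := by
  obtain ⟨φ, hφ, h0, α₀, α, rfl, rfl, h1⟩ := h
  refine ⟨fun t => (φ t).trans (D.diffeo (t • u)), ?_, fun y => ?_, α₀, D.pull (-u) hY α, rfl, rfl,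
    fun y => ?_⟩
  · have h2 : ContMDiff (𝓘(ℝ, ℝ).prod (𝓡 3)) 𝓘(ℝ, E3) ∞ fun x : ℝ × Y => x.1 • u :=
      ContMDiff.comp (g := fun t : ℝ => t • u)
        (contDiff_id.smul contDiff_const).contMDiff contMDiff_fst
    exact D.contMDiff_map.comp (h2.prodMk hφ)
  · change D.map ((0 : ℝ) • u) (φ 0 y) = y
    rw [zero_smul, D.map_zero, h0]
  · obtain ⟨c, hc, h1⟩ := h1 y
    refine ⟨c, hc, ?_⟩
    rw [← h1]
    refine D.pullForm_comp_mfderiv (-u) α.form ((φ 1).trans (D.diffeo ((1 : ℝ) • u))).contMDiff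
      (fun y => ?_) y
    change D.map (-u) (D.map ((1 : ℝ) • u) (φ 1 y)) = φ 1 y
    rw [one_smul, D.map_neg]

/-- A twist rotates the tangent space at `p`. -/
theorem pull_form_self (u : E3) (α : ContactForm Y) (v : E3) :
    (D.pull u hY α).form p v = α.form p (D.frame.symm (cayley u (D.frame v)) : E3) := by
  have hz := mem_extChartAt_target (I := 𝓡 3) p
  have h1 : HasFDerivAt (D.chart p u) ((D.frame.symm : E3 →L[ℝ] E3).comp
      ((cayleyMap u).comp (D.frame : E3 →L[ℝ] E3))) (extChartAt (𝓡 3) p p) := by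
    refine (hasFDerivAt_localTwist D.size_pos u).congr_of_eventuallyEq ?_
    filter_upwards [(isOpen_extChartAt_target p).mem_nhds hz] with z hz
    rw [chart, chartChange_self hz]
    rfl
  have h2 : D.chart p u (extChartAt (𝓡 3) p p) = extChartAt (𝓡 3) p p := by
    rw [chart, chartChange_self hz, inChart, localTwist_self D.size_pos]
  have h3 : extChartAt (𝓡 3) p p ∈ chartPart p (extChartAt (𝓡 3) p).source :=
    ⟨hz, (extChartAt (𝓡 3) p).map_target hz⟩
  rw [← localForm_self]
  refine (congrArg (fun a : E3 →L[ℝ] ℝ => a v) (D.localForm_pullForm u α.form h3)).trans ?_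
  rw [h1.fderiv, h2]
  exact localForm_self α.form p _

/-- The linear frame of a twist, as a framing of the tangent space at `p`. -/
def framing : TangentSpace (𝓡 3) p ≃L[ℝ] E3 := D.frame

/-- A twist acts on the positive normal vector at `p` by its rotation: contact forms are pulled back by
the inverse twist, and the transpose of the inverse of a rotation is the rotation. -/
theorem evalAt_act (u : E3) (ξ : ContactStructure Y) :
    (evalAt p D.framing (D.act hY u ξ) : E3) = cayley u (evalAt p D.framing ξ) := by
  induction ξ using Quotient.inductionOn with
  | h α =>
    set w := covectorDual D.framing (α.form p) with hw
    have h1 : covectorDual D.framing ((D.pull (-u) hY α).form p) = cayley u w := by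
      refine ext_inner_right ℝ fun v => ?_
      rw [inner_covectorDual, inner_cayley_left, hw, inner_covectorDual]
      refine (D.pull_form_self hY (-u) α (D.framing.symm v)).trans ?_
      exact congrArg (fun v : E3 => α.form p (D.frame.symm (cayley (-u) v) : E3))
        (D.frame.apply_symm_apply v)
    have h2 : ‖cayley u w‖ = ‖w‖ := by
      rw [← sq_eq_sq₀ (norm_nonneg _) (norm_nonneg _), ← real_inner_self_eq_norm_sq,
        ← real_inner_self_eq_norm_sq, inner_cayley_self]
    change ‖covectorDual D.framing ((D.pull (-u) hY α).form p)‖⁻¹ •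
      covectorDual D.framing ((D.pull (-u) hY α).form p) = cayley u (‖w‖⁻¹ • w)
    rw [h1, h2]
    exact ((cayleyMap u).map_smul _ _).symm

end TwistData

end TwistAction

/-! ### Local triviality of the evaluation map -/

section EvaluationFibration

theorem one_add_inner_ne_zero {q x : S2} (h : (x : E3) ≠ -(q : E3)) :
    1 + inner ℝ (q : E3) (x : E3) ≠ 0 := by
  intro h0
  apply h
  have h1 : inner ℝ ((x : E3) + q) ((x : E3) + q) = 0 := by
    rw [real_inner_add_add_self, inner_self_S2, inner_self_S2, real_inner_comm]
    linear_combination 2 * h0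
  exact eq_neg_of_add_eq_zero_left (inner_self_eq_zero.1 h1)

theorem cayleyParam_self (q : S2) : cayleyParam q q = 0 := by
  have h : cross (q : E3) q = 0 := by
    apply E3_ext <;> simp only [cross_zero, cross_one, cross_two, PiLp.zero_apply] <;> ring
  rw [cayleyParam, h, smul_zero]

theorem continuous_cayleyParam {Z : Type*} [TopologicalSpace Z] (q : S2) {f : Z → S2}
    (hf : Continuous f) (h : ∀ z, (f z : E3) ≠ -(q : E3)) :
    Continuous fun z => cayleyParam q (f z) := by
  have h1 : Continuous fun z => (f z : E3) := continuous_subtype_val.comp hf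
  exact (continuous_const.div (continuous_const.add (continuous_const.inner h1))
    fun z => one_add_inner_ne_zero (h z)).smul (continuous_cross continuous_const h1)

variable {Y : Type*} [TopologicalSpace Y] [ChartedSpace E3 Y] [IsManifold (𝓡 3) ∞ Y] [T2Space Y]
  {p : Y} (D : TwistData p) (hY : IsOrientedAtlas Y) (ξ₀ : ContactStructure Y)

/-- The action of the twists on an isotopy class of contact structures. -/
noncomputable def TwistData.actClass (u : E3) (ξ : IsotopyClass ξ₀) : IsotopyClass ξ₀ :=
  ⟨D.act hY u ξ.1, D.isIsotopic_act hY u ξ.2⟩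

theorem TwistData.continuous_actClass {Z : Type*} [TopologicalSpace Z] {u : Z → E3}
    {f : Z → IsotopyClass ξ₀} (hu : Continuous u) (hf : Continuous f) :
    Continuous fun z => D.actClass hY ξ₀ (u z) (f z) := by
  have h1 : Continuous fun z => (f z).1 := continuous_subtype_val.comp hf
  exact Continuous.subtype_mk ((D.continuous_act hY).comp (hu.prodMk h1)) _

theorem TwistData.ev_actClass (u : E3) (ξ : IsotopyClass ξ₀) :
    (ev ξ₀ p D.framing (D.actClass hY ξ₀ u ξ) : E3) = cayley u (ev ξ₀ p D.framing ξ) :=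
  D.evalAt_act hY u ξ.1

theorem TwistData.ev_actClass_neg {q : S2} {ξ : IsotopyClass ξ₀}
    (h : (ev ξ₀ p D.framing ξ : E3) ≠ -(q : E3)) :
    ev ξ₀ p D.framing (D.actClass hY ξ₀ (-cayleyParam q (ev ξ₀ p D.framing ξ)) ξ) = q := by
  apply Subtype.ext
  have h1 := cayley_cayleyParam (one_add_inner_ne_zero h)
  rw [D.ev_actClass hY ξ₀]
  nth_rewrite 2 [← h1]
  exact cayley_neg_cayley _ _

/-- Over a punctured sphere the evaluation map is trivialized by the twists that rotate the centre
of the punctured sphere to its other points. -/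
noncomputable def TwistData.trivialization (q : S2) :
    PuncturedTrivialization (ev ξ₀ p D.framing) q where
  toFun := ⟨fun x => D.actClass hY ξ₀ (cayleyParam q x.1.1) x.2.1,
    D.continuous_actClass hY ξ₀
      (continuous_cayleyParam q (f := fun x : PuncturedSphere q × Fibre (ev ξ₀ p D.framing) q => x.1.1)
        (continuous_subtype_val.comp continuous_fst) fun x => x.1.2)
      (f := fun x : PuncturedSphere q × Fibre (ev ξ₀ p D.framing) q => x.2.1)
      (continuous_subtype_val.comp continuous_snd)⟩
  retract := ⟨fun y => ⟨D.actClass hY ξ₀ (-cayleyParam q (ev ξ₀ p D.framing y.1)) y.1,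
      D.ev_actClass_neg hY ξ₀ y.2⟩,
    Continuous.subtype_mk (D.continuous_actClass hY ξ₀
      (continuous_cayleyParam q ((ev ξ₀ p D.framing).continuous.comp continuous_subtype_val)
        fun y => y.2).neg continuous_subtype_val) fun y => D.ev_actClass_neg hY ξ₀ y.2⟩
  proj_toFun x := by
    apply Subtype.ext
    refine (D.ev_actClass hY ξ₀ _ _).trans ?_
    rw [x.2.2]
    exact cayley_cayleyParam (one_add_inner_ne_zero x.1.2)
  toFun_centre f := by
    apply Subtype.ext
    change D.act hY (cayleyParam q q) f.1.1 = f.1.1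
    rw [cayleyParam_self, D.act_zero]
  retract_toFun x h := by
    have h1 : ev ξ₀ p D.framing (D.actClass hY ξ₀ (cayleyParam q x.1.1) x.2.1) = x.1.1 := by
      apply Subtype.ext
      refine (D.ev_actClass hY ξ₀ _ _).trans ?_
      rw [x.2.2]
      exact cayley_cayleyParam (one_add_inner_ne_zero x.1.2)
    apply Subtype.ext
    apply Subtype.ext
    change D.act hY (-cayleyParam q (ev ξ₀ p D.framing (D.actClass hY ξ₀ (cayleyParam q x.1.1) x.2.1)))
      (D.act hY (cayleyParam q x.1.1) x.2.1.1) = x.2.1.1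
    rw [h1, D.act_neg_act]
  toFun_retract y := by
    apply Subtype.ext
    change D.act hY (cayleyParam q (ev ξ₀ p D.framing y.1))
      (D.act hY (-cayleyParam q (ev ξ₀ p D.framing y.1)) y.1.1) = y.1.1
    have h1 := D.act_neg_act hY (-cayleyParam q (ev ξ₀ p D.framing y.1)) y.1.1
    rwa [neg_neg] at h1

/-- The evaluation map is a trivial bundle over every punctured sphere. -/
theorem nonempty_trivialization (hY : IsOrientedAtlas Y) (ξ₀ : ContactStructure Y)
    (τ : TangentSpace (𝓡 3) p ≃L[ℝ] E3) (q : S2) :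
    Nonempty (PuncturedTrivialization (ev ξ₀ p τ) q) := by
  obtain ⟨e, he, h⟩ := exists_twistBall_subset (extChartAt (𝓡 3) p p) (τ : E3 ≃L[ℝ] E3)
    (extChartAt_target_mem_nhds p)
  exact ⟨TwistData.trivialization ⟨τ, e, he, h⟩ hY ξ₀ q⟩

end EvaluationFibration

/-! ### Change of framing -/

section ChangeOfFraming

variable {Y : Type*} [TopologicalSpace Y] [ChartedSpace E3 Y] [IsManifold (𝓡 3) ∞ Y] {p : Y}

/-- The evaluation maps in two positive framings differ by the map of the sphere induced by a linear
map of positive determinant, hence they are homotopic. -/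
theorem ev_homotopic (ξ₀ : ContactStructure Y) {τ τ' : TangentSpace (𝓡 3) p ≃L[ℝ] E3}
    (hτ : IsPositiveFraming τ) (hτ' : IsPositiveFraming τ') :
    (ev ξ₀ p τ').Homotopic (ev ξ₀ p τ) := by
  set A : E3 →L[ℝ] E3 := (τ : TangentSpace (𝓡 3) p →L[ℝ] E3).comp
    (τ'.symm : E3 →L[ℝ] TangentSpace (𝓡 3) p) with hA
  have h1 : ∀ a : TangentSpace (𝓡 3) p →L[ℝ] ℝ,
      covectorDual τ' a = ContinuousLinearMap.adjoint A (covectorDual τ a) := by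
    intro a
    refine ext_inner_right ℝ fun v => ?_
    rw [ContinuousLinearMap.adjoint_inner_left, inner_covectorDual, inner_covectorDual]
    exact congrArg a (τ.symm_apply_apply (τ'.symm v)).symm
  have h2 : 0 < triple (ContinuousLinearMap.adjoint A (EuclideanSpace.single 0 1))
      (ContinuousLinearMap.adjoint A (EuclideanSpace.single 1 1))
      (ContinuousLinearMap.adjoint A (EuclideanSpace.single 2 1)) := by
    have h3 : 0 < triple (A (EuclideanSpace.single 0 1)) (A (EuclideanSpace.single 1 1))
        (A (EuclideanSpace.single 2 1)) := by
      refine hτ _ _ _ (hτ'.symm_pos ?_)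
      rw [triple_eq]
      simp
    convert h3 using 1
    have h4 : ∀ i j : Fin 3, ContinuousLinearMap.adjoint A (EuclideanSpace.single i 1) j =
        A (EuclideanSpace.single j 1) i := by
      intro i j
      have h5 := ContinuousLinearMap.adjoint_inner_left A (EuclideanSpace.single j (1 : ℝ))
        (EuclideanSpace.single i 1)
      simpa [EuclideanSpace.inner_single_left, EuclideanSpace.inner_single_right] using h5
    rw [triple_eq, triple_eq]
    simp only [h4]
    ring
  obtain ⟨h, hh⟩ := sphereMap_homotopic_id h2
  have h3 : ev ξ₀ p τ' = (sphereMap _ h).comp (ev ξ₀ p τ) := by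
    ext1 ξ
    obtain ⟨ξ, hξ⟩ := ξ
    induction ξ using Quotient.inductionOn with
    | h α =>
      exact (unitVector_congr (h1 (α.form p)) (covectorDual_ne_zero τ' (α.form_ne_zero p))
        (h _ (covectorDual_ne_zero τ (α.form_ne_zero p)))).trans
        (sphereMap_apply_unitVector _ h (covectorDual_ne_zero τ (α.form_ne_zero p))).symm
  rw [h3]
  exact hh.comp (ContinuousMap.Homotopic.refl _)

/-- The class `μ̄(1)` does not depend on the choice of the square root and of the framing. -/
theorem IsMuBarOne.eq_cohomologyMap {ξ₀ : ContactStructure Y} {τ : TangentSpace (𝓡 3) p ≃L[ℝ] E3}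
    (hτ : IsPositiveFraming τ) {κ : Cohomology 2 S2} (hκ : kronecker 2 κ sphereClass = 1)
    {μ : Cohomology 2 (IsotopyClass ξ₀)} (hμ : IsMuBarOne ξ₀ p μ) :
    μ = cohomologyMap 2 (ev ξ₀ p τ) κ := by
  obtain ⟨-, τ', hτ', N, hN⟩ := hμ
  rw [hN.eq_cohomologyMap hκ]
  exact LinearMap.congr_fun (cohomologyMap_eq_of_homotopic (ev_homotopic ξ₀ hτ hτ') 1) κ

end ChangeOfFraming

theorem proposition4p13 {Y : Type*} [TopologicalSpace Y] [ChartedSpace E3 Y]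
    [IsManifold (𝓡 3) ∞ Y] [T2Space Y] [CompactSpace Y] [ConnectedSpace Y]
    (hY : IsOrientedAtlas Y) (ξ₀ : ContactStructure Y) (p : Y)
    (τ : TangentSpace (𝓡 3) p ≃L[ℝ] E3) (hτ : IsPositiveFraming τ) :
    -- the dual class `[S²]^*` and the class `μ̄(1)` exist and are unique
    (∃! κ : Cohomology 2 S2, kronecker 2 κ sphereClass = 1) ∧
    (∃! μ : Cohomology 2 (IsotopyClass ξ₀), IsMuBarOne ξ₀ p μ) ∧
    ∀ κ : Cohomology 2 S2, kronecker 2 κ sphereClass = 1 →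
    ∀ μ : Cohomology 2 (IsotopyClass ξ₀), IsMuBarOne ξ₀ p μ →
      μ = cohomologyMap 2 (ev ξ₀ p τ) κ ∧
      -- `U · T = μ̄(1) ∩ T` is the intersection of `T` with any fibre of `ev_p`
      ∀ (R : Type*) [CommRing R] (n : ℕ) (T : Homology R (n + 2) (IsotopyClass ξ₀)) (q : S2),
        (∃! β : Homology R n (Fibre (ev ξ₀ p τ) q), IsFibreIntersection (ev ξ₀ p τ) q T β) ∧
        ∀ β : Homology R n (Fibre (ev ξ₀ p τ) q), IsFibreIntersection (ev ξ₀ p τ) q T β →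
          cap R n μ T = homologyMap R n (fibreIncl (ev ξ₀ p τ) q) β := by
  obtain ⟨κ₀, hκ₀⟩ := exists_kronecker_eq_one polarSquareRoot
  refine ⟨⟨κ₀, hκ₀, fun κ hκ => eq_of_kronecker_eq (hκ.trans hκ₀.symm)⟩,
    ⟨_, isMuBarOne_cohomologyMap polarSquareRoot ξ₀ hτ hκ₀, fun μ hμ => hμ.eq_cohomologyMap hτ hκ₀⟩,
    fun κ hκ μ hμ => ?_⟩
  obtain rfl := hμ.eq_cohomologyMap hτ hκ
  refine ⟨rfl, fun R _ n T q => ?_⟩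
  obtain ⟨Ψ⟩ := nonempty_trivialization hY ξ₀ τ q
  exact fibreIntersection_eq_cap Ψ hκ T
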